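/- **Setting.** Let $m>0$, let $S=\{x\in\mathbb R^3:|x|\ge m/2\}$ with the flat metric $g_{ij}=\delta_{ij}$ and inner boundary $S_h=\{|x|=m/2\}$, and put $r=|x|$, $\psi_0=1+\frac m{2r}$, $\alpha=1-\frac m{2r}$. Suppose that for all sufficiently small $\varepsilon>0$ there are smooth (up to the boundary) functions $\psi=\psi(\varepsilon)>0$, $H'=H'(\varepsilon)$ and a smooth symmetric traceless tensor $A_{ij}=A_{ij}(\varepsilon)$ on $S$, all invariant under rotations about the $z$-axis, such that $$\partial_iA_{ij}=\tfrac23\psi^6\partial_jH',\qquad \Delta\psi=-\tfrac18A_{ij}A_{ij}\psi^{-7}+\tfrac1{12}H'^2\psi^5\quad\text{on }S,$$ $$\partial_n\psi+\tfrac14h\psi-\tfrac14A_{nn}\psi^{-3}+\tfrac16H'\psi^3=0\quad\text{on }S_h,\qquad n=\tfrac{x}{|x|},\ h=\operatorname{div}n=\tfrac4m$$ (the last condition says that $S_h$ is marginally outer trapped), and which are asymptotically flat: for each $\varepsilon$, $(A_{ij},H')=O(r^{-2})$, $\partial_k(A_{ij},H')=O(r^{-3})$ and $\psi\to1$ as $r\to\infty$.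 Suppose moreover that there are smooth $\psi_1,\psi_2,B_{ij},B$ on $S$ with $$\psi=\psi_0+\varepsilon\psi_1+\varepsilon^2\psi_2+o(\varepsilon^2),\qquad A_{ij}=\varepsilon B_{ij}+o(\varepsilon),\qquad H'=\varepsilon B+o(\varepsilon)\qquad(\varepsilon\to0^+),$$ the first expansion holding uniformly on $S$ together with first derivatives, the other two holding uniformly on $S$ with weight $r^2$, and for first derivatives with weight $r^3$. ($H'$ is not assumed to vanish.) The initial data are $g'_{ij}=\psi^4\delta_{ij}$, $K'^i{}_j=\psi^{-6}A^i{}_j+\frac13H'\delta^i_j$. Let $E$, $p$ be their ADM energy and momentum, $|S_h|$ the area of $S_h$ in the metric $g'$, and $J=\lim_{r\to\infty}\frac1{8\pi}\oint_{|x|=r}(K'_{ij}-H'g'_{ij})(\partial_\varphi)^i n'^j\,dS'$ the angular momentum, where $n'$ and $dS'$ are the unit normal and area element in the metric $g'$. **Notation for the leading terms.** In spherical coordinates $(r,\theta,\varphi)$, with $z=\cos\theta$, put $U=rB_{r\theta}\sin\theta$ and $W=r^3(B_{rr}-\frac23B\psi_0^6)$, and define $Y,X$ by $$U=\psi_0^3(z^2-1)\partial_zY,\quad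 \int_{-1}^1Y\,dz=0,\qquad W=2r\psi_0^2(X-\alpha Y).$$ Let $X_n(r),Y_n(r)$ be the coefficients of $X,Y$ in the expansion in Legendre polynomials $P_n(z)$, and $X_{nh}=X_n(m/2)$. Put $N=\frac12n(n+1)$ and $\beta_n=(N-1)\psi_0+\frac{3m}{r\psi_0}$. The data are called *generic* if at least one of the following fails: 1. $B_{\varphi\theta}=0$ and $B_{\varphi r}=3j\,r^{-2}\sin^2\theta$ for some constant $j$; 2. on $S_h$, $B_{rr}-\frac23B\psi_0^6$ is an affine function of $z$; 3. $Y_n=\frac r{\beta_n}\partial_rX_n-\frac{(N-1)\alpha}{\beta_n^2}X_n$ for all $n\ge2$ and all $r>m/2$. **Theorem.** For all sufficiently small $\varepsilon>0$ the limits defining $E,p,J$ exist and $|S_h|>0$, and there is a constant $D$ with $$E^2-p^2-\frac{|S_h|}{16\pi}-\frac{4\pi J^2}{|S_h|}=D\,\varepsilon^2+o(\varepsilon^2)\qquad(\varepsilon\to0^+),$$ $$D\ \ge\ \sum_{n=2}^\infty\frac{(n-1)(n+2)}{2(n^2+n+1)(2n+1)^3}\,X_{nh}^2 ,$$ the series being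 convergent. If the data are generic, then $D>0$; in particular the sharp Penrose inequality $$E^2-p^2\ \ge\ \frac{|S_h|}{16\pi}+\frac{4\pi}{|S_h|}J^2$$ holds for all sufficiently small $\varepsilon>0$. -/

import Mathlib

open Real Filter Topology Asymptotics MeasureTheory
open scoped ContDiff Matrix

noncomputable section

namespace PenrosePerturbation

/-- Euclidean three-space, carrying the flat preliminary metric in Cartesian coordinates. -/
abbrev E3 : Type := EuclideanSpace ℝ (Fin 3)

/-- Cartesian components of a covariant 2-tensor at a point. -/
abbrev Tensor2 : Type := Matrix (Fin 3) (Fin 3) ℝ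

/-- The initial surface: `ℝ³` minus the open ball of radius `m / 2`. -/
def surface (m : ℝ) : Set E3 := {x | m / 2 ≤ ‖x‖}

/-- Smooth up to the boundary of the surface: near each point of the (closed) set the function is
smooth. -/
def SmoothOnSurface (m : ℝ) (f : E3 → ℝ) : Prop := ∀ x ∈ surface m, ContDiffAt ℝ ∞ f x

/-- Cartesian partial derivative. -/
def partialD (i : Fin 3) (f : E3 → ℝ) (x : E3) : ℝ :=
  fderiv ℝ f x (EuclideanSpace.single i (1 : ℝ))

/-! ### Spherical coordinates -/

/-- The point with spherical coordinates `(r, θ, φ)`. -/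
def sph (r θ φ : ℝ) : E3 := !₂[r * sin θ * cos φ, r * sin θ * sin φ, r * cos θ]

/-- The coordinate vector field `∂_r`. -/
def vecR (θ φ : ℝ) : Fin 3 → ℝ := ![sin θ * cos φ, sin θ * sin φ, cos θ]

/-- The coordinate vector field `∂_θ`. -/
def vecTheta (r θ φ : ℝ) : Fin 3 → ℝ := ![r * cos θ * cos φ, r * cos θ * sin φ, -(r * sin θ)]

/-- The coordinate vector field `∂_φ`. -/
def vecPhi (r θ φ : ℝ) : Fin 3 → ℝ := ![-(r * sin θ * sin φ), r * sin θ * cos φ, 0]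

/-- `T(u, v) = u^i T_{ij} v^j`. -/
def contract (T : Tensor2) (u v : Fin 3 → ℝ) : ℝ := u ⬝ᵥ (T *ᵥ v)

/-- Surface integral over the sphere `‖x‖ = r` with respect to the flat area element. -/
def flatSphereIntegral (r : ℝ) (f : E3 → ℝ) : ℝ :=
  ∫ θ in (0 : ℝ)..π, ∫ φ in (0 : ℝ)..(2 * π), f (sph r θ φ) * (r ^ 2 * sin θ)

/-- Area element, in the parameters `(θ, φ)`, of the metric induced by `g` on the sphere
`‖x‖ = r`. -/
def areaElement (g : E3 → Tensor2) (r θ φ : ℝ) : ℝ :=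
  let G := g (sph r θ φ)
  √(contract G (vecTheta r θ φ) (vecTheta r θ φ) * contract G (vecPhi r θ φ) (vecPhi r θ φ)
    - contract G (vecTheta r θ φ) (vecPhi r θ φ) ^ 2)

/-- Area of the sphere `‖x‖ = r` in the metric `g`. -/
def sphereArea (g : E3 → Tensor2) (r : ℝ) : ℝ :=
  ∫ θ in (0 : ℝ)..π, ∫ φ in (0 : ℝ)..(2 * π), areaElement g r θ φ

/-! ### Physical initial data built from the conformal data -/

/-- The physical metric `g'_{ij} = ψ⁴ δ_{ij}`. -/
def physMetric (ψ : E3 → ℝ) (x : E3) : Tensor2 := (ψ x ^ 4) • (1 : Tensor2)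

/-- The physical extrinsic curvature with lower indices,
`K'_{ij} = g'_{ik} (ψ⁻⁶ A^k_j + ⅓ H' δ^k_j)`. -/
def physCurv (ψ : E3 → ℝ) (A : E3 → Tensor2) (H : E3 → ℝ) (x : E3) : Tensor2 :=
  physMetric ψ x * ((ψ x ^ 6)⁻¹ • A x + (1 / 3 * H x) • (1 : Tensor2))

/-- `K'_{ij} - H' g'_{ij}`. -/
def momentumTensor (ψ : E3 → ℝ) (A : E3 → Tensor2) (H : E3 → ℝ) (x : E3) : Tensor2 :=
  physCurv ψ A H x - H x • physMetric ψ x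

/-- ADM energy: `E = (1/16π) lim ∮ (∂_j g_{ij} - ∂_i g_{jj}) n^i dS`. -/
def IsADMEnergy (g : E3 → Tensor2) (E : ℝ) : Prop :=
  Tendsto (fun r : ℝ => 1 / (16 * π) * flatSphereIntegral r (fun x =>
    ∑ i, ∑ j, (partialD j (fun y => g y i j) x - partialD i (fun y => g y j j) x)
      * (x i / ‖x‖))) atTop (𝓝 E)

/-- ADM linear momentum: `p_i = (1/8π) lim ∮ (K'_{ij} - H' g'_{ij}) n^j dS`. -/
def IsADMMomentum (ψ : E3 → ℝ) (A : E3 → Tensor2) (H : E3 → ℝ) (p : Fin 3 → ℝ) : Prop :=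
  ∀ i, Tendsto (fun r : ℝ => 1 / (8 * π) * flatSphereIntegral r (fun x =>
    ∑ j, momentumTensor ψ A H x i j * (x j / ‖x‖))) atTop (𝓝 (p i))

/-- Angular momentum about the axis: `J = (1/8π) lim ∮ (K'_{ij} - H' g'_{ij}) (∂_φ)^i n'^j dS'`,
where `n' = ψ⁻² ∂_r` is the physical unit normal and `dS'` the physical area element. -/
def IsAngularMomentum (ψ : E3 → ℝ) (A : E3 → Tensor2) (H : E3 → ℝ) (J : ℝ) : Prop :=
  Tendsto (fun r : ℝ => 1 / (8 * π) * ∫ θ in (0 : ℝ)..π, ∫ φ in (0 : ℝ)..(2 * π),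
    contract (momentumTensor ψ A H (sph r θ φ)) (vecPhi r θ φ)
        ((ψ (sph r θ φ) ^ 2)⁻¹ • vecR θ φ)
      * areaElement (physMetric ψ) r θ φ) atTop (𝓝 J)

/-! ### Axially symmetric, asymptotically flat solutions of the conformal constraints -/

/-- Matrix of the rotation by the angle `α` about the third axis. -/
def rotMatrix (α : ℝ) : Tensor2 := !![cos α, -sin α, 0; sin α, cos α, 0; 0, 0, 1]

/-- The rotation by the angle `α` about the third axis. -/
def rot (α : ℝ) (x : E3) : E3 := WithLp.toLp 2 (rotMatrix α *ᵥ (fun i => x i))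

/-- Invariance of a function on the surface under rotations about the third axis. -/
def AxialScalar (m : ℝ) (f : E3 → ℝ) : Prop := ∀ α, ∀ x ∈ surface m, f (rot α x) = f x

/-- Invariance of a 2-tensor field on the surface under rotations about the third axis. -/
def AxialTensor (m : ℝ) (A : E3 → Tensor2) : Prop :=
  ∀ α, ∀ x ∈ surface m, A (rot α x) = rotMatrix α * A x * (rotMatrix α)ᵀ

/-- `f = O(r⁻²)` and `∂f = O(r⁻³)` on the surface. -/
def DecaysQuadratically (m : ℝ) (f : E3 → ℝ) : Prop :=
  ∃ C : ℝ, ∀ x ∈ surface m, |f x| ≤ C / ‖x‖ ^ 2 ∧ ‖fderiv ℝ f x‖ ≤ C / ‖x‖ ^ 3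

/-- `(ψ, A, H')` is an axially symmetric, asymptotically flat solution of the conformal constraint
system with flat preliminary metric on the surface, whose inner boundary is a marginally outer
trapped surface. -/
structure IsSolution (m : ℝ) (ψ : E3 → ℝ) (A : E3 → Tensor2) (H : E3 → ℝ) : Prop where
  smooth_psi : SmoothOnSurface m ψ
  smooth_A : ∀ i j, SmoothOnSurface m (fun x => A x i j)
  smooth_H : SmoothOnSurface m H
  psi_pos : ∀ x ∈ surface m, 0 < ψ x
  symm : ∀ x ∈ surface m, (A x).IsSymm
  traceless : ∀ x ∈ surface m, (A x).trace = 0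
  axial_psi : AxialScalar m ψ
  axial_A : AxialTensor m A
  axial_H : AxialScalar m H
  psi_tendsto : Tendsto ψ (Bornology.cobounded E3) (𝓝 1)
  decay_A : ∀ i j, DecaysQuadratically m (fun x => A x i j)
  decay_H : DecaysQuadratically m H
  /-- `∇_i A^i_j = ⅔ ψ⁶ ∇_j H'`. -/
  momentum : ∀ x ∈ surface m, ∀ j,
    ∑ i, partialD i (fun y => A y i j) x = 2 / 3 * ψ x ^ 6 * partialD j H x
  /-- `Δψ = -⅛ A_{ij} A^{ij} ψ⁻⁷ + (1/12) H'² ψ⁵` (the preliminary metric has `R = 0`). -/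
  hamiltonian : ∀ x ∈ surface m,
    Laplacian.laplacian ψ x
      = -(1 / 8) * (∑ i, ∑ j, A x i j ^ 2) / ψ x ^ 7 + 1 / 12 * H x ^ 2 * ψ x ^ 5
  /-- The boundary condition `∂_n ψ + ¼ h ψ - ¼ A_{nn} ψ⁻³ + ⅙ H' ψ³ = 0`, i.e.
  `H' - K'_{nn} + h' = 0` in the physical metric; here `h = 2 / r = 4 / m` is the mean curvature
  (divergence of the unit normal) of the boundary sphere in the flat metric. -/
  mots : ∀ x : E3, ‖x‖ = m / 2 →
    fderiv ℝ ψ x (‖x‖⁻¹ • x) + 1 / 4 * (4 / m) * ψ x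
      - 1 / 4 * contract (A x) (fun i => x i / ‖x‖) (fun i => x i / ‖x‖) / ψ x ^ 3
      + 1 / 6 * H x * ψ x ^ 3 = 0

/-- The Schwarzschild conformal factor as a function of the radius. -/
def psi0 (m r : ℝ) : ℝ := 1 + m / (2 * r)

/-- Expansions in the small parameter `ε > 0` around the Schwarzschild data:
`ψ = ψ₀ + ε ψ₁ + ε² ψ₂ + o(ε²)` in the uniform `C¹` norm on the surface, and `A = ε B + o(ε)`,
`H' = ε b + o(ε)` in the `C¹` norm with the weights `r²` for the functions and `r³` for their
first derivatives. -/
structure HasExpansion (m : ℝ) (ψ : ℝ → E3 → ℝ) (A : ℝ → E3 → Tensor2) (H : ℝ → E3 → ℝ)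
    (ψ₁ ψ₂ : E3 → ℝ) (B : E3 → Tensor2) (b : E3 → ℝ) : Prop where
  smooth_psi₁ : SmoothOnSurface m ψ₁
  smooth_psi₂ : SmoothOnSurface m ψ₂
  smooth_B : ∀ i j, SmoothOnSurface m (fun x => B x i j)
  smooth_b : SmoothOnSurface m b
  psi_expansion : ∀ δ > 0, ∀ᶠ ε in 𝓝[>] (0 : ℝ), ∀ x ∈ surface m,
    |ψ ε x - psi0 m ‖x‖ - ε * ψ₁ x - ε ^ 2 * ψ₂ x| ≤ δ * ε ^ 2 ∧
    ‖fderiv ℝ (fun y => ψ ε y - psi0 m ‖y‖ - ε * ψ₁ y - ε ^ 2 * ψ₂ y) x‖ ≤ δ * ε ^ 2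
  A_expansion : ∀ δ > 0, ∀ᶠ ε in 𝓝[>] (0 : ℝ), ∀ x ∈ surface m, ∀ i j,
    ‖x‖ ^ 2 * |A ε x i j - ε * B x i j| ≤ δ * ε ∧
    ‖x‖ ^ 3 * ‖fderiv ℝ (fun y => A ε y i j - ε * B y i j) x‖ ≤ δ * ε
  H_expansion : ∀ δ > 0, ∀ᶠ ε in 𝓝[>] (0 : ℝ), ∀ x ∈ surface m,
    ‖x‖ ^ 2 * |H ε x - ε * b x| ≤ δ * ε ∧
    ‖x‖ ^ 3 * ‖fderiv ℝ (fun y => H ε y - ε * b y) x‖ ≤ δ * ε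

/-! ### Legendre moments and generic data

Components of axially symmetric fields as functions of `r` and `z = cos θ`, read off on the
meridian `φ = 0`. -/

def compRR (B : E3 → Tensor2) (r z : ℝ) : ℝ :=
  contract (B (sph r (arccos z) 0)) (vecR (arccos z) 0) (vecR (arccos z) 0)

def compRTheta (B : E3 → Tensor2) (r z : ℝ) : ℝ :=
  contract (B (sph r (arccos z) 0)) (vecR (arccos z) 0) (vecTheta r (arccos z) 0)

def compPhiR (B : E3 → Tensor2) (r z : ℝ) : ℝ :=
  contract (B (sph r (arccos z) 0)) (vecPhi r (arccos z) 0) (vecR (arccos z) 0)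

def compPhiTheta (B : E3 → Tensor2) (r z : ℝ) : ℝ :=
  contract (B (sph r (arccos z) 0)) (vecPhi r (arccos z) 0) (vecTheta r (arccos z) 0)

/-- `B_{rr} - ⅔ ψ₀⁶ b`. -/
def radialPart (m : ℝ) (B : E3 → Tensor2) (b : E3 → ℝ) (r z : ℝ) : ℝ :=
  compRR B r z - 2 / 3 * b (sph r (arccos z) 0) * psi0 m r ^ 6

/-- `U = r B_{rθ} sin θ`. -/
def potU (B : E3 → Tensor2) (r z : ℝ) : ℝ := r * compRTheta B r z * √(1 - z ^ 2)

/-- `W = r³ (B_{rr} - ⅔ ψ₀⁶ b)`. -/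
def potW (m : ℝ) (B : E3 → Tensor2) (b : E3 → ℝ) (r z : ℝ) : ℝ := r ^ 3 * radialPart m B b r z

/-- A primitive in `z` of `Y_{,z} = U / (ψ₀³ (z² - 1))`. -/
def primY (m : ℝ) (B : E3 → Tensor2) (r z : ℝ) : ℝ :=
  ∫ s in (0 : ℝ)..z, potU B r s / (psi0 m r ^ 3 * (s ^ 2 - 1))

/-- The variable `Y`: `U = ψ₀³ (z² - 1) Y_{,z}`, normalized to have zero mean over `[-1, 1]`. -/
def varY (m : ℝ) (B : E3 → Tensor2) (r z : ℝ) : ℝ :=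
  primY m B r z - 1 / 2 * ∫ s in (-1 : ℝ)..1, primY m B r s

/-- `α = 1 - m / (2 r)`. -/
def alphaFn (m r : ℝ) : ℝ := 1 - m / (2 * r)

/-- The variable `X`: `W = 2 r ψ₀² (X - α Y)`. -/
def varX (m : ℝ) (B : E3 → Tensor2) (b : E3 → ℝ) (r z : ℝ) : ℝ :=
  potW m B b r z / (2 * r * psi0 m r ^ 2) + alphaFn m r * varY m B r z

/-- The Legendre polynomial `P_n` (Rodrigues' formula). -/
def legendreP (n : ℕ) (z : ℝ) : ℝ :=
  (1 / (2 ^ n * (n.factorial : ℝ)))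
    * (Polynomial.derivative^[n] ((Polynomial.X ^ 2 - 1 : Polynomial ℝ) ^ n)).eval z

/-- The `n`-th coefficient of the Legendre expansion of a function on `[-1, 1]`. -/
def legendreCoeff (f : ℝ → ℝ) (n : ℕ) : ℝ :=
  (2 * (n : ℝ) + 1) / 2 * ∫ z in (-1 : ℝ)..1, f z * legendreP n z

/-- The moment `X_n(r)`. -/
def momentX (m : ℝ) (B : E3 → Tensor2) (b : E3 → ℝ) (n : ℕ) (r : ℝ) : ℝ :=
  legendreCoeff (varX m B b r) n

/-- The moment `Y_n(r)`. -/
def momentY (m : ℝ) (B : E3 → Tensor2) (n : ℕ) (r : ℝ) : ℝ := legendreCoeff (varY m B r) n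

/-- `N = n (n + 1) / 2`. -/
def capN (n : ℕ) : ℝ := (n : ℝ) * ((n : ℝ) + 1) / 2

/-- `β_n = (N - 1) ψ₀ + 3 m / (r ψ₀)`. -/
def betaFn (m : ℝ) (n : ℕ) (r : ℝ) : ℝ := (capN n - 1) * psi0 m r + 3 * m / (r * psi0 m r)

/-- First condition: `B_{φθ} = 0` and `B_{φr} = 3 j r⁻² sin² θ` for a constant `j`. -/
def PureSpin (m : ℝ) (B : E3 → Tensor2) : Prop :=
  ∃ j : ℝ, ∀ r, m / 2 ≤ r → ∀ z ∈ Set.Icc (-1 : ℝ) 1,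
    compPhiTheta B r z = 0 ∧ compPhiR B r z = 3 * j / r ^ 2 * (1 - z ^ 2)

/-- Second condition: `B_{rr} - ⅔ ψ₀⁶ b` is an affine function of `z` on the inner boundary. -/
def AffineOnHorizon (m : ℝ) (B : E3 → Tensor2) (b : E3 → ℝ) : Prop :=
  ∃ c d : ℝ, ∀ z ∈ Set.Icc (-1 : ℝ) 1, radialPart m B b (m / 2) z = c + d * z

/-- Third condition: `Y_n = (r / β_n) X_{n,r} - ((N - 1) α / β_n²) X_n` for all `n ≥ 2`. -/
def MomentsLocked (m : ℝ) (B : E3 → Tensor2) (b : E3 → ℝ) : Prop :=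
  ∀ n : ℕ, 2 ≤ n → ∀ r, m / 2 < r →
    momentY m B n r = r / betaFn m n r * deriv (momentX m B b n) r
      - (capN n - 1) * alphaFn m r / betaFn m n r ^ 2 * momentX m B b n r

/-- Data with leading terms `(B, b)` are generic if at least one of the three conditions fails. -/
def Generic (m : ℝ) (B : E3 → Tensor2) (b : E3 → ℝ) : Prop :=
  ¬ (PureSpin m B ∧ AffineOnHorizon m B b ∧ MomentsLocked m B b)

/-- `(n - 1) (n + 2) / (2 (n² + n + 1) (2 n + 1)³)`. -/
def excessCoeff (n : ℕ) : ℝ :=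
  ((n : ℝ) - 1) * ((n : ℝ) + 2)
    / (2 * ((n : ℝ) ^ 2 + (n : ℝ) + 1) * (2 * (n : ℝ) + 1) ^ 3)

/-- The term `excessCoeff n * X_{nh}²`, where `X_{nh}` is the value of `X_n` at `r = m / 2`. -/
def excessTerm (m : ℝ) (B : E3 → Tensor2) (b : E3 → ℝ) (n : ℕ) : ℝ :=
  excessCoeff n * momentX m B b n (m / 2) ^ 2

end PenrosePerturbation

end

open PenrosePerturbation

noncomputable section

namespace PenrosePerturbation

/-! ### Averages over the sphere of axially symmetric functions -/

/-! The deficit is expanded to second order in ε; its coefficient `secondVariation` is then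
evaluated Legendre mode by Legendre mode, and the momentum constraint turns each mode of the bulk
energy into boundary values plus a square.

Energy and area. Let u be the spherical mean of ψ. Since r²α' = m/2, the derivative of α r² u' -
(m/2) u is α (r² u')', and α vanishes on the horizon. So the energy is m(u_h - 1) minus twice the
integral of α r² times the mean of Δψ, without any normal derivative on the horizon
(`IsSolution.tendsto_flux`, `IsSolution.isADMEnergy`). By the Hamiltonian constraint that integral
is -ε²/8 times the integral of `energyDensity`, up to o(ε²) (`HasExpansion.tendsto_source`). The
area is πm² times the mean of ψ⁴ on the horizon. Writing ψ = 2 + εq there, the terms linear in the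
mean of q, the only ones through which ψ₂ could enter at order ε², cancel between E² and |S_h|/16π
(`HasExpansion.deficit_isLittleO`).

Horizon. Since Δψ = O(ε²), to first order the n-th moment of ψ - 1 decays like r^(-n-1). Together
with the marginally trapped condition this determines every moment of ψ₁ on the horizon: it is
-x_n/(m(2n+1)), where X_n = (2n+1) x_n (`HasExpansion.legMoment_psi`).

Bulk. In a spherical frame, substituting B_rr = T + ⅔ψ₀⁶b cancels the negative b² term of the energy
density (`IsDecayingData.energyDensity_eq`). The momentum constraint gives two radial equations for
the modes of T and of B_rθ, with the modes of b and of the angular trace-free part as free sources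
(`IsLinearData.hasDerivAt_momT`, `IsLinearData.hasDerivAt_momRT`). The combination X is the one
whose derivative does not contain b (`hasDerivAt_modeX`). In these variables the energy density of a
mode is the derivative of `modePotential` plus the nonnegative `modeSquare`
(`hasDerivAt_modePotential_of_one_lt`), so for n ≥ 2 its integral is x_n²/(m(2N+1)) at the horizon
plus the integral of a square.

Balance. For n = 0 and n = 1 the horizon terms cancel exactly. For n = 1 the potential has a nonzero
limit at infinity, which pays for p². The part of B_rφ fixed by the conserved angular momentum flux
pays for 4πJ²/|S_h|. For n ≥ 2, with 2N + 1 = n² + n + 1, there remains the factor (2n+1)² -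
3(n²+n+1) = (n-1)(n+2), which gives `excessCoeff` (`IsDecayingData.sum_modeExcess_le`). Bessel's
inequality controls the definite terms; the indefinite product T·b is handled by Parseval's identity
and dominated convergence (`IsDecayingData.tendsto_integral_tailDensity`). If the coefficient were
not positive, each nonnegative remainder would vanish, and these vanishings are the three conditions
negated by genericity (`IsDecayingData.secondVariation_pos`).

The delicate analysis is at infinity, where ψ is only known to tend to 1. That the nonlinear part of
the energy flux vanishes there, and that the momentum exists, rests on the Riccati-type argument
`tendsto_flux_zero`. -/

/-- The mean over the unit sphere of a function of the polar angle. -/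
def avg (g : ℝ → ℝ) : ℝ := 1 / 2 * ∫ θ in (0 : ℝ)..π, g θ * sin θ

/-- The mean over the unit sphere of a polynomial in `cos θ`, as a linear functional. -/
def polyAvg : Polynomial ℝ →ₗ[ℝ] ℝ where
  toFun p := avg fun θ => p.eval (cos θ)
  map_add' p q := by
    have h : ∀ p : Polynomial ℝ, IntervalIntegrable (fun θ => p.eval (cos θ) * sin θ) volume 0 π :=
      fun p => ((p.continuous.comp continuous_cos).mul continuous_sin).intervalIntegrable _ _
    simp only [avg, Polynomial.eval_add, add_mul]
    rw [intervalIntegral.integral_add (h p) (h q), mul_add]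
  map_smul' c p := by
    simp only [avg, Polynomial.eval_smul, smul_eq_mul, mul_assoc, RingHom.id_apply]
    rw [intervalIntegral.integral_const_mul]
    ring

theorem polyAvg_apply (p : Polynomial ℝ) : polyAvg p = avg fun θ => p.eval (cos θ) := rfl

theorem polyAvg_derivative (p : Polynomial ℝ) :
    polyAvg (Polynomial.derivative p) = (p.eval 1 - p.eval (-1)) / 2 := by
  have h : ∀ θ ∈ Set.uIcc 0 π, HasDerivAt (fun θ => -p.eval (cos θ))
      ((Polynomial.derivative p).eval (cos θ) * sin θ) θ := by
    intro θ _
    exact ((p.hasDerivAt (cos θ)).comp θ (hasDerivAt_cos θ)).neg.congr_deriv (by ring)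
  rw [polyAvg_apply, avg, intervalIntegral.integral_eq_sub_of_hasDerivAt h]
  · simp; ring
  · exact (((Polynomial.derivative p).continuous.comp continuous_cos).mul
      continuous_sin).intervalIntegrable _ _

/-- Integration by parts in z = cos θ; the boundary terms drop because p vanishes at both poles. -/
theorem polyAvg_mul_derivative {p : Polynomial ℝ} (h1 : p.eval 1 = 0) (h2 : p.eval (-1) = 0)
    (q : Polynomial ℝ) :
    polyAvg (p * Polynomial.derivative q) = -polyAvg (Polynomial.derivative p * q) := by
  have := polyAvg_derivative (p * q)
  rw [Polynomial.derivative_mul, map_add] at this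
  simp only [Polynomial.eval_mul, h1, h2, zero_mul, sub_zero, zero_div] at this
  linarith

/-! ### Legendre polynomials -/

open Polynomial in
/-- The Legendre polynomial `P_n`. -/
def legendrePoly (n : ℕ) : ℝ[X] :=
  C (1 / (2 ^ n * (n.factorial : ℝ))) * derivative^[n] ((X ^ 2 - 1) ^ n)

theorem legendreP_eq (n : ℕ) (z : ℝ) : legendreP n z = (legendrePoly n).eval z := by
  rw [legendreP, legendrePoly, Polynomial.eval_mul, Polynomial.eval_C]

-- With w = (X² - 1)ⁿ one has (X² - 1)w' = 2nXw. Taking n + 1 derivatives by Leibniz' rule leaves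
-- only a few terms, since X² has no third derivative.
open Polynomial in
theorem rodrigues_ode (n : ℕ) :
    (X ^ 2 - 1) * derivative (derivative (derivative^[n] ((X ^ 2 - 1 : ℝ[X]) ^ n)))
      + 2 * X * derivative (derivative^[n] ((X ^ 2 - 1 : ℝ[X]) ^ n))
      = (n : ℝ[X]) * ((n : ℝ[X]) + 1) * derivative^[n] ((X ^ 2 - 1 : ℝ[X]) ^ n) := by
  set w : ℝ[X] := (X ^ 2 - 1) ^ n with hw
  -- X² is written as two successive factors X, so that the rule for iterated derivatives of a
  -- product with X applies directly.
  have h0 : derivative w * X * X - derivative w = (2 * n) • (w * X) := by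
    rcases n with _ | k
    · simp [hw]
    · have h : derivative w = ((k : ℝ[X]) + 1) * (X ^ 2 - 1) ^ k * (2 * X) := by
        rw [hw, derivative_pow_succ, derivative_sub, derivative_X_sq]
        simp [map_ofNat C 2]
      rw [h, hw, pow_succ, nsmul_eq_mul]
      push_cast
      ring
  have h1 := congrArg (derivative^[n + 1]) h0
  have e1 : derivative^[n + 1] (derivative w) = derivative (derivative (derivative^[n] w)) := by
    rw [← Function.iterate_succ_apply, Function.iterate_succ_apply', Function.iterate_succ_apply']
  have e2 : derivative^[n] (derivative w) = derivative (derivative^[n] w) := by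
    rw [← Function.iterate_succ_apply, Function.iterate_succ_apply']
  -- For n = 0 the truncated exponent n - 1 is meaningless, but the factor n removes the term.
  have e3 : n • derivative^[n - 1] (derivative w) = n • derivative^[n] w := by
    rcases n with _ | k
    · simp
    · rw [← Function.iterate_succ_apply]; simp
  have e4 : derivative^[n + 1] w = derivative (derivative^[n] w) := by
    rw [Function.iterate_succ_apply']
  rw [iterate_derivative_sub, iterate_derivative_smul, iterate_derivative_mul_X,
    iterate_derivative_mul_X, iterate_derivative_mul_X, Nat.add_sub_cancel,
    iterate_derivative_mul_X, e1, e2, e3, e4] at h1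
  simp only [nsmul_eq_mul, Nat.cast_add, Nat.cast_one, Nat.cast_mul, Nat.cast_ofNat, Nat.add_sub_cancel] at h1
  linear_combination h1

open Polynomial in
/-- Legendre's equation in divergence form. -/
theorem legendre_ode (n : ℕ) :
    derivative ((1 - X ^ 2) * derivative (legendrePoly n))
      = -(C (2 * capN n) * legendrePoly n) := by
  have h := rodrigues_ode n
  have hc : (C (2 * capN n) : ℝ[X]) = (n : ℝ[X]) * ((n : ℝ[X]) + 1) := by
    rw [capN, show (2 * ((n : ℝ) * (n + 1) / 2)) = (n : ℝ) * (n + 1) by ring]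
    simp
  rw [hc, legendrePoly]
  simp only [derivative_mul, derivative_C, zero_mul, zero_add, derivative_sub, derivative_one,
    derivative_X_pow, Nat.cast_ofNat]
  simp only [map_ofNat]
  linear_combination -(C (1 / (2 ^ n * (n.factorial : ℝ))) : ℝ[X]) * h

-- Differentiate Legendre's equation and multiply by 1 - X². The result is in divergence form for
-- the second derivative, with eigenvalue 2N - 2; it yields the norms of sin²θ Pₙ''.
open Polynomial in
theorem legendre_ode_derivative (n : ℕ) :
    derivative ((1 - X ^ 2) ^ 2 * derivative (derivative (legendrePoly n)))
      = -(C (2 * capN n - 2) * ((1 - X ^ 2) * derivative (legendrePoly n))) := by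
  have h := congrArg derivative (legendre_ode n)
  have d : derivative (1 - X ^ 2 : ℝ[X]) = -(2 * X) := by
    rw [derivative_sub, derivative_X_sq, derivative_one]; simp [map_ofNat C 2]
  rw [sq (1 - X ^ 2 : ℝ[X])]
  simp only [derivative_mul, derivative_neg, derivative_C, zero_mul, zero_add, d, derivative_add,
    derivative_X, derivative_ofNat, map_sub, map_ofNat] at h ⊢
  linear_combination (1 - X ^ 2) * h

-- The nonvanishing coefficient of degree n is what allows a polynomial to be expanded in Legendre
-- polynomials by elimination from the top degree.
open Polynomial in
theorem legendrePoly_coeff (n : ℕ) : (legendrePoly n).coeff n ≠ 0 := by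
  rw [legendrePoly, coeff_C_mul, coeff_iterate_derivative]
  have hm : ((X ^ 2 - 1 : ℝ[X]) ^ n).coeff (n + n) = 1 := by
    have h1 : (X ^ 2 - 1 : ℝ[X]).Monic := by
      simpa using monic_X_pow_sub_C (1 : ℝ) (n := 2) (by norm_num)
    have h2 : (X ^ 2 - 1 : ℝ[X]).natDegree = 2 := by
      simpa using natDegree_X_pow_sub_C (n := 2) (r := (1 : ℝ))
    have h3 := (h1.pow n).coeff_natDegree
    rw [h1.natDegree_pow, h2] at h3
    rw [← two_mul, mul_comm]; exact h3
  rw [hm]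
  have : (n + n).descFactorial n ≠ 0 := by
    rw [Ne, Nat.descFactorial_eq_zero_iff_lt]; omega
  simp only [nsmul_eq_mul, mul_one]
  positivity

open Polynomial in
theorem legendrePoly_natDegree_le (n : ℕ) : (legendrePoly n).natDegree ≤ n := by
  refine (natDegree_C_mul_le _ _).trans ((natDegree_iterate_derivative _ _).trans ?_)
  have h2 : (X ^ 2 - 1 : ℝ[X]).natDegree = 2 := by
    simpa using natDegree_X_pow_sub_C (n := 2) (r := (1 : ℝ))
  have := natDegree_pow_le (p := (X ^ 2 - 1 : ℝ[X])) (n := n)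
  rw [h2] at this
  omega

-- Expand at e: since e² = 1, (X² - 1)ⁿ becomes Xⁿ(X + 2e)ⁿ, whose n-th Taylor coefficient is (2e)ⁿ.
-- The square avoids the sign at e = -1, and only the square is needed for the norm.
open Polynomial in
theorem legendrePoly_eval_sq_of_sq {e : ℝ} (he : e ^ 2 = 1) (n : ℕ) :
    (legendrePoly n).eval e ^ 2 = 1 := by
  have h1 : (derivative^[n] ((X ^ 2 - 1 : ℝ[X]) ^ n)).eval e = n.factorial * (2 * e) ^ n := by
    rw [← factorial_smul_hasseDeriv, LinearMap.smul_apply, eval_smul, nsmul_eq_mul, ← taylor_coeff]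
    have : taylor e ((X ^ 2 - 1 : ℝ[X]) ^ n) = X ^ n * (X + C (2 * e)) ^ n := by
      rw [← mul_pow, taylor_pow]
      congr 1
      simp only [map_sub, taylor_pow, taylor_X, taylor_one, map_mul]
      have : (C e : ℝ[X]) ^ 2 = 1 := by rw [← C_pow, he, C_1]
      simp only [map_ofNat, map_one]
      linear_combination this
    rw [this]
    have := coeff_X_pow_mul ((X + C (2 * e)) ^ n) n 0
    rw [zero_add] at this
    rw [this, coeff_zero_eq_eval_zero]
    simp
  rw [legendrePoly, eval_mul, eval_C, h1, mul_pow 2 e]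
  have : (n.factorial : ℝ) ≠ 0 := by positivity
  field_simp
  rw [← pow_mul, mul_comm, pow_mul, he, one_pow]

open Polynomial in
theorem polyAvg_derivative_mul_derivative (n k : ℕ) :
    polyAvg ((1 - X ^ 2) * derivative (legendrePoly n) * derivative (legendrePoly k))
      = 2 * capN n * polyAvg (legendrePoly n * legendrePoly k) := by
  rw [polyAvg_mul_derivative (by simp) (by simp), legendre_ode, neg_mul, map_neg, neg_neg,
    mul_assoc, ← smul_eq_C_mul, map_smul, smul_eq_mul]

theorem capN_injective {n k : ℕ} (h : capN n = capN k) : n = k := by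
  unfold capN at h
  have h' : (n * (n + 1) : ℕ) = k * (k + 1) := by
    have : (n : ℝ) * (n + 1) = k * (k + 1) := by linarith
    exact_mod_cast this
  nlinarith [lt_trichotomy n k, h'] 

-- The symmetric Dirichlet form of Pₙ and Pₖ can be evaluated with either eigenvalue, and these
-- differ.
open Polynomial in
theorem polyAvg_legendre_of_ne {n k : ℕ} (h : n ≠ k) :
    polyAvg (legendrePoly n * legendrePoly k) = 0 := by
  have h1 := polyAvg_derivative_mul_derivative n k
  have h2 := polyAvg_derivative_mul_derivative k n
  rw [mul_comm (legendrePoly k), mul_right_comm, h1] at h2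
  have : capN n ≠ capN k := fun h' => h (capN_injective h')
  have h3 : (capN n - capN k) * polyAvg (legendrePoly n * legendrePoly k) = 0 := by linarith
  rcases mul_eq_zero.mp h3 with h4 | h4
  · exact absurd (sub_eq_zero.mp h4) this
  · exact h4

open Polynomial in
theorem exists_eq_sum_legendre (K : ℕ) : ∀ p : ℝ[X], p.degree < K →
    ∃ c : ℕ → ℝ, p = ∑ n ∈ Finset.range K, c n • legendrePoly n := by
  induction K with
  | zero =>
    intro p hp
    refine ⟨0, ?_⟩
    simpa [degree_lt_iff_coeff_zero, Polynomial.ext_iff] using hp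
  | succ K ih =>
    intro p hp
    set d := p.coeff K / (legendrePoly K).coeff K
    obtain ⟨c, hc⟩ := ih (p - d • legendrePoly K) (by
      rw [degree_lt_iff_coeff_zero] at hp ⊢
      intro j hj
      rcases hj.eq_or_lt with rfl | hj
      · simp [d, legendrePoly_coeff]
      · rw [coeff_sub, coeff_smul, hp j hj, coeff_eq_zero_of_natDegree_lt
          ((legendrePoly_natDegree_le K).trans_lt hj)]
        simp)
    refine ⟨Function.update c K d, ?_⟩
    rw [Finset.sum_range_succ, Function.update_self, ← sub_eq_iff_eq_add, hc]
    refine Finset.sum_congr rfl fun n hn => ?_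
    rw [Function.update_of_ne (Finset.mem_range.mp hn).ne]

open Polynomial in
theorem polyAvg_legendre_mul_of_degree_lt {n : ℕ} {p : ℝ[X]} (hp : p.degree < n) :
    polyAvg (legendrePoly n * p) = 0 := by
  obtain ⟨c, rfl⟩ := exists_eq_sum_legendre n p hp
  rw [Finset.mul_sum, map_sum]
  refine Finset.sum_eq_zero fun k hk => ?_
  rw [mul_smul_comm, map_smul, polyAvg_legendre_of_ne (Finset.mem_range.mp hk).ne', smul_zero]

-- Integrate (X Pₙ²)'. The endpoints contribute 1, and the integrand is (2n+1)Pₙ² + 2Pₙ(X Pₙ' -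
-- nPₙ), whose last factor has degree below n and is therefore orthogonal to Pₙ.
open Polynomial in
theorem polyAvg_legendre_mul_self (n : ℕ) :
    polyAvg (legendrePoly n * legendrePoly n) = 1 / (2 * n + 1) := by
  set P := legendrePoly n
  have h1 := polyAvg_derivative (X * (P * P))
  rw [eval_mul, eval_mul, eval_mul, eval_mul] at h1
  simp only [derivative_mul, derivative_X, one_mul, eval_X] at h1
  rw [← sq (P.eval 1), ← sq (P.eval (-1)), legendrePoly_eval_sq_of_sq (by norm_num),
    legendrePoly_eval_sq_of_sq (by norm_num),
    show P * P + X * (derivative P * P + P * derivative P)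
      = (2 * (n : ℝ) + 1) • (P * P) + (2 : ℝ) • (P * (X * derivative P - (n : ℝ) • P)) by
        simp only [smul_eq_C_mul, map_add, map_mul, map_natCast, map_one, map_ofNat]; ring,
    map_add, map_smul, map_smul,
    polyAvg_legendre_mul_of_degree_lt (p := X * derivative P - (n : ℝ) • P)] at h1
  · have : (2 * (n : ℝ) + 1) ≠ 0 := by positivity
    rw [eq_div_iff this]
    simp only [smul_eq_mul] at h1
    linarith
  · rw [degree_lt_iff_coeff_zero]
    intro j hj
    rw [coeff_sub, coeff_smul]
    rcases j with _ | j
    · obtain rfl : n = 0 := by omega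
      simp
    · rw [coeff_X_mul, coeff_derivative]
      rcases hj.eq_or_lt with h | h
      · rw [h]; push_cast; simp; ring
      · rw [coeff_eq_zero_of_natDegree_lt ((legendrePoly_natDegree_le n).trans_lt h)]; simp

open Polynomial in
theorem polyAvg_second_derivative_mul (n k : ℕ) :
    polyAvg ((1 - X ^ 2) ^ 2 * derivative (derivative (legendrePoly n))
        * derivative (derivative (legendrePoly k)))
      = (2 * capN n - 2) * (2 * capN n * polyAvg (legendrePoly n * legendrePoly k)) := by
  rw [polyAvg_mul_derivative (by simp) (by simp), legendre_ode_derivative, neg_mul, map_neg,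
    neg_neg, mul_assoc, ← smul_eq_C_mul, map_smul, smul_eq_mul, polyAvg_derivative_mul_derivative]

/-! ### Elementary properties of the mean -/

theorem intervalIntegrable_mul_sin {f : ℝ → ℝ} (hf : Continuous f) :
    IntervalIntegrable (fun θ => f θ * sin θ) volume 0 π :=
  (hf.mul continuous_sin).intervalIntegrable _ _

theorem avg_add {f g : ℝ → ℝ} (hf : Continuous f) (hg : Continuous g) :
    avg (fun θ => f θ + g θ) = avg f + avg g := by
  simp only [avg, add_mul]
  rw [intervalIntegral.integral_add (intervalIntegrable_mul_sin hf) (intervalIntegrable_mul_sin hg)]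
  ring

theorem avg_sub {f g : ℝ → ℝ} (hf : Continuous f) (hg : Continuous g) :
    avg (fun θ => f θ - g θ) = avg f - avg g := by
  simp only [avg, sub_mul]
  rw [intervalIntegral.integral_sub (intervalIntegrable_mul_sin hf) (intervalIntegrable_mul_sin hg)]
  ring

theorem avg_const_mul (c : ℝ) (f : ℝ → ℝ) : avg (fun θ => c * f θ) = c * avg f := by
  simp only [avg, mul_assoc]
  rw [intervalIntegral.integral_const_mul]
  ring

theorem avg_mul_const (c : ℝ) (f : ℝ → ℝ) : avg (fun θ => f θ * c) = avg f * c := by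
  simp only [mul_comm _ c, avg_const_mul]

theorem avg_div_const (c : ℝ) (f : ℝ → ℝ) : avg (fun θ => f θ / c) = avg f / c := by
  simp only [div_eq_mul_inv, avg_mul_const]

theorem avg_neg (f : ℝ → ℝ) : avg (fun θ => -f θ) = -avg f := by
  simpa using avg_const_mul (-1) f

theorem avg_const (c : ℝ) : avg (fun _ => c) = c := by
  rw [avg, intervalIntegral.integral_const_mul, integral_sin]
  simp; ring

theorem avg_sum {ι : Type*} (s : Finset ι) {f : ι → ℝ → ℝ} (hf : ∀ i ∈ s, Continuous (f i)) :
    avg (fun θ => ∑ i ∈ s, f i θ) = ∑ i ∈ s, avg (f i) := by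
  simp only [avg, Finset.sum_mul]
  rw [intervalIntegral.integral_finsetSum fun i hi => intervalIntegrable_mul_sin (hf i hi),
    Finset.mul_sum]

theorem avg_mono {f g : ℝ → ℝ} (hf : Continuous f) (hg : Continuous g)
    (h : ∀ θ ∈ Set.Icc 0 π, f θ ≤ g θ) : avg f ≤ avg g := by
  refine mul_le_mul_of_nonneg_left (intervalIntegral.integral_mono_on pi_pos.le
    (intervalIntegrable_mul_sin hf) (intervalIntegrable_mul_sin hg) fun θ hθ => ?_) (by norm_num)
  exact mul_le_mul_of_nonneg_right (h θ hθ) (sin_nonneg_of_nonneg_of_le_pi hθ.1 hθ.2)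

theorem avg_nonneg {f : ℝ → ℝ} (hf : Continuous f) (h : ∀ θ ∈ Set.Icc 0 π, 0 ≤ f θ) :
    0 ≤ avg f := by
  simpa [avg_const] using avg_mono continuous_const hf h

theorem abs_avg_le {f : ℝ → ℝ} {C : ℝ} (hf : Continuous f)
    (h : ∀ θ ∈ Set.Icc 0 π, |f θ| ≤ C) : |avg f| ≤ C := by
  rw [abs_le]
  have h1 := avg_mono hf continuous_const fun θ hθ => (abs_le.mp (h θ hθ)).2
  have h2 := avg_mono continuous_const hf fun θ hθ => (abs_le.mp (h θ hθ)).1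
  rw [avg_const] at h1 h2
  exact ⟨h2, h1⟩

theorem eq_zero_of_avg_sq_eq_zero {f : ℝ → ℝ} (hf : Continuous f)
    (h : avg (fun θ => f θ ^ 2) = 0) : ∀ θ ∈ Set.Icc 0 π, f θ = 0 := by
  by_contra! hne
  obtain ⟨θ, hθ, hne⟩ := hne
  have hc : Continuous fun θ => f θ ^ 2 * sin θ := (hf.pow 2).mul continuous_sin
  have hnn : ∀ θ ∈ Set.Icc 0 π, 0 ≤ f θ ^ 2 * sin θ := fun θ hθ =>
    mul_nonneg (sq_nonneg _) (sin_nonneg_of_nonneg_of_le_pi hθ.1 hθ.2)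
  -- The weight sin θ vanishes at the poles, so positivity of the integral only settles interior
  -- angles; the poles follow by continuity.
  have h0 : ∀ θ ∈ Set.Ioo 0 π, f θ = 0 := by
    intro t ht
    by_contra hft
    have : 0 < ∫ θ in (0 : ℝ)..π, f θ ^ 2 * sin θ :=
      intervalIntegral.integral_pos pi_pos hc.continuousOn
        (fun x hx => hnn x ⟨hx.1.le, hx.2⟩) ⟨t, ⟨ht.1.le, ht.2.le⟩,
          mul_pos (by positivity) (sin_pos_of_pos_of_lt_pi ht.1 ht.2)⟩
    rw [avg] at h
    linarith
  have hcl : IsClosed {θ | f θ = 0} := isClosed_eq hf continuous_const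
  have : closure (Set.Ioo 0 π) ⊆ {θ | f θ = 0} := hcl.closure_subset_iff.mpr h0
  rw [closure_Ioo pi_pos.ne] at this
  exact hne (this hθ)

theorem avg_eq_integral_arccos {h : ℝ → ℝ} (hh : Continuous h) :
    avg h = 1 / 2 * ∫ z in (-1 : ℝ)..1, h (arccos z) := by
  have hf : Continuous fun z => h (arccos z) := hh.comp continuous_arccos
  have := intervalIntegral.integral_comp_mul_deriv (a := 0) (b := π)
    (f := cos) (f' := fun θ => -sin θ) (g := fun z => h (arccos z))
    (fun θ _ => hasDerivAt_cos θ) (by fun_prop) hf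
  rw [cos_zero, cos_pi] at this
  rw [intervalIntegral.integral_symm, ← this, avg, ← intervalIntegral.integral_neg]
  congr 1
  refine intervalIntegral.integral_congr fun θ hθ => ?_
  rw [Set.uIcc_of_le pi_pos.le] at hθ
  simp only [Function.comp, arccos_cos hθ.1 hθ.2]
  ring

/-! ### Orthogonal expansions -/

/-- The coefficients d are left arbitrary: Bessel's inequality uses the Fourier coefficients,
Parseval's identity those of an approximating polynomial. -/
theorem avg_sq_sub_sum {s : Finset ℕ} {e : ℕ → ℝ → ℝ} {c : ℕ → ℝ} (he : ∀ n, Continuous (e n))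
    (horth : ∀ n k, avg (fun θ => e n θ * e k θ) = if n = k then c n else 0)
    {f : ℝ → ℝ} (hf : Continuous f) (d : ℕ → ℝ) :
    avg (fun θ => (f θ - ∑ n ∈ s, d n * e n θ) ^ 2)
      = avg (fun θ => f θ ^ 2) - 2 * ∑ n ∈ s, d n * avg (fun θ => f θ * e n θ)
        + ∑ n ∈ s, d n ^ 2 * c n := by
  have h1 : ∀ θ, (f θ - ∑ n ∈ s, d n * e n θ) ^ 2 = f θ ^ 2 - 2 * (∑ n ∈ s, d n * (f θ * e n θ))
      + ∑ n ∈ s, ∑ k ∈ s, d n * d k * (e n θ * e k θ) := by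
    intro θ
    have : ∑ n ∈ s, d n * (f θ * e n θ) = f θ * ∑ n ∈ s, d n * e n θ := by
      rw [Finset.mul_sum]; exact Finset.sum_congr rfl fun n _ => by ring
    have h2 : ∑ n ∈ s, ∑ k ∈ s, d n * d k * (e n θ * e k θ)
        = (∑ n ∈ s, d n * e n θ) * ∑ n ∈ s, d n * e n θ := by
      rw [Finset.sum_mul_sum]
      exact Finset.sum_congr rfl fun n _ => Finset.sum_congr rfl fun k _ => by ring
    rw [this, h2]; ring
  simp only [h1]
  rw [avg_add (by fun_prop) (by fun_prop), avg_sub (by fun_prop) (by fun_prop), avg_const_mul,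
    avg_sum _ (fun n _ => by fun_prop), avg_sum _ (fun n _ => by fun_prop)]
  congr 1
  · simp only [avg_const_mul]
  · refine Finset.sum_congr rfl fun n hn => ?_
    rw [avg_sum _ (fun n _ => by fun_prop)]
    simp only [avg_const_mul, horth]
    rw [Finset.sum_eq_single n]
    · simp only [if_true]; ring
    · intro k _ hk; simp [hk.symm]
    · exact fun h => absurd hn h

/-- Bessel's inequality. -/
theorem sum_sq_div_le_avg_sq {s : Finset ℕ} {e : ℕ → ℝ → ℝ} {c : ℕ → ℝ}
    (he : ∀ n, Continuous (e n))
    (horth : ∀ n k, avg (fun θ => e n θ * e k θ) = if n = k then c n else 0)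
    {f : ℝ → ℝ} (hf : Continuous f) :
    ∑ n ∈ s, avg (fun θ => f θ * e n θ) ^ 2 / c n ≤ avg (fun θ => f θ ^ 2) := by
  have h1 := avg_sq_sub_sum (s := s) he horth hf fun n => avg (fun θ => f θ * e n θ) / c n
  have h2 : 0 ≤ avg (fun θ => (f θ - ∑ n ∈ s, avg (fun θ => f θ * e n θ) / c n * e n θ) ^ 2) :=
    avg_nonneg (by fun_prop) fun θ _ => sq_nonneg _
  have h3 : ∑ n ∈ s, avg (fun θ => f θ * e n θ) / c n * avg (fun θ => f θ * e n θ)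
      = ∑ n ∈ s, avg (fun θ => f θ * e n θ) ^ 2 / c n :=
    Finset.sum_congr rfl fun n _ => by ring
  have h4 : ∑ n ∈ s, (avg (fun θ => f θ * e n θ) / c n) ^ 2 * c n
      = ∑ n ∈ s, avg (fun θ => f θ * e n θ) ^ 2 / c n := by
    refine Finset.sum_congr rfl fun n _ => ?_
    -- Some basis functions have norm zero: sin θ Pₙ' for n = 0, and sin²θ Pₙ'' for n = 0 and n = 1.
    -- Division by zero then makes the corresponding term zero.
    rcases eq_or_ne (c n) 0 with h | h
    · simp [h]
    · field_simp
  rw [h3, h4] at h1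
  linarith

/-- The mean of a function of the polar angle against `P_n (cos θ)`. -/
def legMoment (f : ℝ → ℝ) (n : ℕ) : ℝ := avg fun θ => f θ * (legendrePoly n).eval (cos θ)

theorem continuous_eval_cos (p : Polynomial ℝ) : Continuous fun θ => p.eval (cos θ) :=
  p.continuous.comp continuous_cos

theorem avg_legendre_mul (n k : ℕ) :
    avg (fun θ => (legendrePoly n).eval (cos θ) * (legendrePoly k).eval (cos θ))
      = if n = k then 1 / (2 * (n : ℝ) + 1) else 0 := by
  have := polyAvg_apply (legendrePoly n * legendrePoly k)
  simp only [Polynomial.eval_mul] at this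
  rw [← this]
  split_ifs with h
  · rw [← h, polyAvg_legendre_mul_self]
  · exact polyAvg_legendre_of_ne h

theorem sum_legMoment_sq_le {f : ℝ → ℝ} (hf : Continuous f) (s : Finset ℕ) :
    ∑ n ∈ s, (2 * (n : ℝ) + 1) * legMoment f n ^ 2 ≤ avg (fun θ => f θ ^ 2) := by
  refine le_trans (le_of_eq (Finset.sum_congr rfl fun n _ => ?_))
    (sum_sq_div_le_avg_sq (s := s) (fun n => continuous_eval_cos (legendrePoly n))
      avg_legendre_mul hf)
  rw [legMoment, div_div_eq_mul_div, div_one, mul_comm]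

theorem avg_derivative_legendre_mul (n k : ℕ) :
    avg (fun θ => (sin θ * (legendrePoly n).derivative.eval (cos θ))
        * (sin θ * (legendrePoly k).derivative.eval (cos θ)))
      = if n = k then 2 * capN n / (2 * (n : ℝ) + 1) else 0 := by
  have h := polyAvg_derivative_mul_derivative n k
  rw [polyAvg_apply] at h
  have : ∀ θ, (sin θ * (legendrePoly n).derivative.eval (cos θ))
        * (sin θ * (legendrePoly k).derivative.eval (cos θ)) = Polynomial.eval (cos θ)
        ((1 - Polynomial.X ^ 2) * (legendrePoly n).derivative * (legendrePoly k).derivative) := by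
    intro θ
    simp only [Polynomial.eval_mul, Polynomial.eval_sub, Polynomial.eval_one, Polynomial.eval_pow,
      Polynomial.eval_X]
    linear_combination Polynomial.eval (cos θ) (legendrePoly n).derivative
      * Polynomial.eval (cos θ) (legendrePoly k).derivative * sin_sq θ
  simp only [this]
  rw [h]
  split_ifs with hnk
  · rw [← hnk, polyAvg_legendre_mul_self]; ring
  · rw [polyAvg_legendre_of_ne hnk, mul_zero]

theorem avg_second_derivative_legendre_mul (n k : ℕ) :
    avg (fun θ => (sin θ ^ 2 * (legendrePoly n).derivative.derivative.eval (cos θ))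
        * (sin θ ^ 2 * (legendrePoly k).derivative.derivative.eval (cos θ)))
      = if n = k then 4 * capN n * (capN n - 1) / (2 * (n : ℝ) + 1) else 0 := by
  have h := polyAvg_second_derivative_mul n k
  rw [polyAvg_apply] at h
  have : ∀ θ, (sin θ ^ 2 * (legendrePoly n).derivative.derivative.eval (cos θ))
        * (sin θ ^ 2 * (legendrePoly k).derivative.derivative.eval (cos θ))
        = Polynomial.eval (cos θ) ((1 - Polynomial.X ^ 2) ^ 2 * (legendrePoly n).derivative.derivative
          * (legendrePoly k).derivative.derivative) := by
    intro θ
    simp only [Polynomial.eval_mul, Polynomial.eval_sub, Polynomial.eval_one, Polynomial.eval_pow,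
      Polynomial.eval_X]
    rw [sin_sq]
    ring
  simp only [this]
  rw [h]
  split_ifs with hnk
  · rw [← hnk, polyAvg_legendre_mul_self]; ring
  · rw [polyAvg_legendre_of_ne hnk, mul_zero, mul_zero]

theorem sum_derivative_moment_sq_le {f : ℝ → ℝ} (hf : Continuous f) (s : Finset ℕ) :
    ∑ n ∈ s, (2 * (n : ℝ) + 1)
        * (avg (fun θ => f θ * (sin θ * (legendrePoly n).derivative.eval (cos θ))) ^ 2
          / (2 * capN n)) ≤ avg (fun θ => f θ ^ 2) := by
  refine le_trans (le_of_eq (Finset.sum_congr rfl fun n _ => ?_))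
    (sum_sq_div_le_avg_sq (s := s)
      (e := fun n θ => sin θ * (legendrePoly n).derivative.eval (cos θ))
      (fun n => continuous_sin.mul (continuous_eval_cos (legendrePoly n).derivative))
      avg_derivative_legendre_mul hf)
  rw [div_div_eq_mul_div, ← mul_div_assoc, mul_comm]

/-- Bessel's inequality for the harmonics of the trace-free angular components. The terms n = 0, 1
have denominator zero and count as zero, which matches the absence of such components in these
degrees. -/
theorem sum_second_derivative_moment_sq_le {f : ℝ → ℝ} (hf : Continuous f) (s : Finset ℕ) :
    ∑ n ∈ s, (2 * (n : ℝ) + 1)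
        * (avg (fun θ => f θ * (sin θ ^ 2 * (legendrePoly n).derivative.derivative.eval (cos θ))) ^ 2
          / (4 * capN n * (capN n - 1))) ≤ avg (fun θ => f θ ^ 2) := by
  refine le_trans (le_of_eq (Finset.sum_congr rfl fun n _ => ?_))
    (sum_sq_div_le_avg_sq (s := s)
      (e := fun n θ => sin θ ^ 2 * (legendrePoly n).derivative.derivative.eval (cos θ))
      (fun n => (continuous_sin.pow 2).mul
        (continuous_eval_cos (legendrePoly n).derivative.derivative))
      avg_second_derivative_legendre_mul hf)
  rw [div_div_eq_mul_div, ← mul_div_assoc, mul_comm]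

/-- Parseval's identity for Legendre expansions. -/
theorem tendsto_sum_legMoment_sq {f : ℝ → ℝ} (hf : Continuous f) :
    Tendsto (fun K => ∑ n ∈ Finset.range K, (2 * (n : ℝ) + 1) * legMoment f n ^ 2) atTop
      (𝓝 (avg fun θ => f θ ^ 2)) := by
  rw [Metric.tendsto_atTop]
  intro ε hε
  -- The bound 1 ensures that the squared error does not exceed the error, hence stays below ε/2.
  obtain ⟨p, hp⟩ := exists_polynomial_near_of_continuousOn (-1) 1 (fun z => f (arccos z))
    (hf.comp continuous_arccos).continuousOn (min 1 (ε / 2)) (by positivity)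
  refine ⟨p.natDegree + 1, fun K hK => ?_⟩
  have hle := sum_legMoment_sq_le hf (Finset.range K)
  rw [Real.dist_eq, abs_sub_comm, abs_of_nonneg (by linarith)]
  obtain ⟨d, hd⟩ := exists_eq_sum_legendre K p
    ((Polynomial.degree_le_natDegree).trans_lt (by exact_mod_cast hK))
  have h1 := avg_sq_sub_sum (s := Finset.range K)
    (fun n => continuous_eval_cos (legendrePoly n)) avg_legendre_mul hf d
  have h2 : avg (fun θ => (f θ - ∑ n ∈ Finset.range K, d n * (legendrePoly n).eval (cos θ)) ^ 2)
      ≤ ε / 2 := by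
    have : ∀ θ ∈ Set.Icc 0 π, |(f θ - ∑ n ∈ Finset.range K,
        d n * (legendrePoly n).eval (cos θ)) ^ 2| ≤ ε / 2 := by
      intro θ hθ
      have h3 : ∑ n ∈ Finset.range K, d n * (legendrePoly n).eval (cos θ) = p.eval (cos θ) := by
        rw [hd, Polynomial.eval_finsetSum]; simp
      have h4 := hp (cos θ) ⟨neg_one_le_cos θ, cos_le_one θ⟩
      rw [arccos_cos hθ.1 hθ.2, abs_sub_comm] at h4
      rw [h3, abs_pow, sq]
      have h5 := lt_min_iff.mp h4
      nlinarith [abs_nonneg (f θ - p.eval (cos θ))]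
    refine (le_abs_self _).trans (abs_avg_le ?_ this)
    have := fun n => continuous_eval_cos (legendrePoly n)
    fun_prop
  -- The partial Fourier sum is the best approximation: completing the square in each coefficient
  -- shows that no other choice d does better.
  have h6 : ∑ n ∈ Finset.range K, (2 * (n : ℝ) + 1) * legMoment f n ^ 2
      ≥ 2 * ∑ n ∈ Finset.range K, d n * avg (fun θ => f θ * (legendrePoly n).eval (cos θ))
        - ∑ n ∈ Finset.range K, d n ^ 2 * (1 / (2 * (n : ℝ) + 1)) := by
    rw [ge_iff_le, Finset.mul_sum, ← Finset.sum_sub_distrib]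
    refine Finset.sum_le_sum fun n _ => ?_
    change _ * (_ * legMoment f n) - _ ≤ _
    have h7 : (0 : ℝ) < 2 * n + 1 := by positivity
    have : (2 * (n : ℝ) + 1) * legMoment f n ^ 2 - (2 * (d n * legMoment f n)
        - d n ^ 2 * (1 / (2 * (n : ℝ) + 1)))
        = ((2 * (n : ℝ) + 1) * legMoment f n - d n) ^ 2 / (2 * n + 1) := by
      field_simp; ring
    have h8 : 0 ≤ ((2 * (n : ℝ) + 1) * legMoment f n - d n) ^ 2 / (2 * n + 1) := by positivity
    linarith
  linarith

theorem legMoment_add {f g : ℝ → ℝ} (hf : Continuous f) (hg : Continuous g) (n : ℕ) :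
    legMoment (fun θ => f θ + g θ) n = legMoment f n + legMoment g n := by
  have := continuous_eval_cos (legendrePoly n)
  simp only [legMoment, add_mul]
  exact avg_add (by fun_prop) (by fun_prop)

theorem legMoment_sub {f g : ℝ → ℝ} (hf : Continuous f) (hg : Continuous g) (n : ℕ) :
    legMoment (fun θ => f θ - g θ) n = legMoment f n - legMoment g n := by
  have := continuous_eval_cos (legendrePoly n)
  simp only [legMoment, sub_mul]
  exact avg_sub (by fun_prop) (by fun_prop)

theorem legMoment_const_mul (c : ℝ) (f : ℝ → ℝ) (n : ℕ) :
    legMoment (fun θ => c * f θ) n = c * legMoment f n := by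
  simp only [legMoment, mul_assoc, avg_const_mul]

/-- Polarization of Parseval's identity. -/
theorem tendsto_sum_legMoment_mul {f g : ℝ → ℝ} (hf : Continuous f) (hg : Continuous g) :
    Tendsto (fun K => ∑ n ∈ Finset.range K, (2 * (n : ℝ) + 1) * (legMoment f n * legMoment g n))
      atTop (𝓝 (avg fun θ => f θ * g θ)) := by
  have h := ((tendsto_sum_legMoment_sq (hf.add hg)).sub
    (tendsto_sum_legMoment_sq (hf.sub hg))).const_mul (1 / 4)
  rw [← avg_sub (by fun_prop) (by fun_prop), ← avg_const_mul] at h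
  convert h using 2
  · rw [← Finset.sum_sub_distrib, Finset.mul_sum]
    refine Finset.sum_congr rfl fun n _ => ?_
    rw [show legMoment (f + g) n = _ from legMoment_add hf hg n,
      show legMoment (f - g) n = _ from legMoment_sub hf hg n]
    ring
  · congr 1
    funext θ
    simp only [Pi.add_apply, Pi.sub_apply]
    ring

/-- The bound does not depend on K, which is what dominated convergence needs for the tails of the
indefinite product T·b. -/
theorem abs_sum_legMoment_mul_le {f g : ℝ → ℝ} {C D : ℝ} (hf : Continuous f) (hg : Continuous g)
    (hC : ∀ θ, |f θ| ≤ C) (hD : ∀ θ, |g θ| ≤ D) (K : ℕ) :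
    |∑ n ∈ Finset.range K, (2 * (n : ℝ) + 1) * (legMoment f n * legMoment g n)|
      ≤ (C ^ 2 + D ^ 2) / 2 := by
  have hs : ∀ {f : ℝ → ℝ} {C : ℝ}, Continuous f → (∀ θ, |f θ| ≤ C) →
      ∑ n ∈ Finset.range K, (2 * (n : ℝ) + 1) * legMoment f n ^ 2 ≤ C ^ 2 := by
    intro f C hf hC
    refine (sum_legMoment_sq_le hf _).trans ((le_abs_self _).trans
      (abs_avg_le (hf.pow 2) fun θ _ => ?_))
    rw [abs_pow]
    exact pow_le_pow_left₀ (abs_nonneg _) (hC θ) 2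
  have h1 := hs hf hC
  have h2 := hs hg hD
  have h3 : ∀ n : ℕ, |(2 * (n : ℝ) + 1) * (legMoment f n * legMoment g n)|
      ≤ ((2 * (n : ℝ) + 1) * legMoment f n ^ 2 + (2 * (n : ℝ) + 1) * legMoment g n ^ 2) / 2 := by
    intro n
    have h7 : (0 : ℝ) < 2 * n + 1 := by positivity
    rw [abs_mul, abs_of_pos h7]
    have : |legMoment f n * legMoment g n| ≤ (legMoment f n ^ 2 + legMoment g n ^ 2) / 2 := by
      rw [abs_le]
      constructor <;> nlinarith [sq_nonneg (legMoment f n - legMoment g n),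
        sq_nonneg (legMoment f n + legMoment g n)]
    nlinarith
  calc _ ≤ ∑ n ∈ Finset.range K, |(2 * (n : ℝ) + 1) * (legMoment f n * legMoment g n)| :=
        Finset.abs_sum_le_sum_abs _ _
    _ ≤ ∑ n ∈ Finset.range K, ((2 * (n : ℝ) + 1) * legMoment f n ^ 2
          + (2 * (n : ℝ) + 1) * legMoment g n ^ 2) / 2 := Finset.sum_le_sum fun n _ => h3 n
    _ = (∑ n ∈ Finset.range K, (2 * (n : ℝ) + 1) * legMoment f n ^ 2
          + ∑ n ∈ Finset.range K, (2 * (n : ℝ) + 1) * legMoment g n ^ 2) / 2 := by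
        rw [← Finset.sum_div, Finset.sum_add_distrib]
    _ ≤ _ := by linarith

/-- Two normalizations meet here: `legMoment` is a bare mean over the sphere, while the coefficient
of an expansion carries the inverse norm 2n + 1. -/
theorem legendreCoeff_arccos {f : ℝ → ℝ} (hf : Continuous f) (n : ℕ) :
    legendreCoeff (fun z => f (arccos z)) n = (2 * (n : ℝ) + 1) * legMoment f n := by
  have := continuous_eval_cos (legendrePoly n)
  rw [legendreCoeff, legMoment, avg_eq_integral_arccos (by fun_prop), div_mul_eq_mul_div,
    mul_div_assoc, div_eq_inv_mul, ← one_div]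
  congr 2
  refine intervalIntegral.integral_congr fun z hz => ?_
  rw [Set.uIcc_of_le (by norm_num)] at hz
  simp only [legendreP_eq, cos_arccos hz.1 hz.2]

/-! ### Meridian coordinates -/

/-- The radial unit vector on the meridian `φ = 0`. -/
def eR (θ : ℝ) : E3 := !₂[sin θ, 0, cos θ]

/-- The polar unit vector on the meridian `φ = 0`. -/
def eT (θ : ℝ) : E3 := !₂[cos θ, 0, -sin θ]

theorem norm_eR (θ : ℝ) : ‖eR θ‖ = 1 := by
  rw [EuclideanSpace.norm_eq, Fin.sum_univ_three]
  simp [eR, sin_sq_add_cos_sq]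

theorem norm_smul_eR {r : ℝ} (hr : 0 ≤ r) (θ : ℝ) : ‖r • eR θ‖ = r := by
  rw [norm_smul, norm_eR, mul_one, Real.norm_of_nonneg hr]

theorem smul_eR_mem {m r : ℝ} (hm : 0 < m) (hr : m / 2 ≤ r) (θ : ℝ) : r • eR θ ∈ surface m := by
  rw [surface, Set.mem_ofPred_eq, norm_smul_eR (by linarith)]
  exact hr

theorem sph_zero (r θ : ℝ) : sph r θ 0 = r • eR θ := by
  ext i
  fin_cases i <;> simp [sph, eR]

theorem hasDerivAt_eR (θ : ℝ) : HasDerivAt eR (eT θ) θ := by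
  have h : HasDerivAt (fun θ i => eR θ i) (fun i => eT θ i) θ := by
    rw [hasDerivAt_pi]
    intro i
    fin_cases i
    · simpa [eR, eT] using hasDerivAt_sin θ
    · simpa [eR, eT] using hasDerivAt_const θ (0 : ℝ)
    · simpa [eR, eT] using hasDerivAt_cos θ
  exact (PiLp.hasFDerivAt_toLp 2 _).comp_hasDerivAt θ h

theorem continuous_eR : Continuous eR :=
  continuous_iff_continuousAt.mpr fun θ => (hasDerivAt_eR θ).continuousAt

theorem eq_sum_single (v : E3) : v = ∑ i, v i • EuclideanSpace.single i (1 : ℝ) := by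
  ext j
  simp [Fin.sum_univ_three]
  fin_cases j <;> simp

theorem fderiv_apply_eq_sum (f : E3 → ℝ) (x v : E3) :
    fderiv ℝ f x v = ∑ i, v i * partialD i f x := by
  conv_lhs => rw [eq_sum_single v]
  simp [partialD]

theorem abs_partialD_le (i : Fin 3) (f : E3 → ℝ) (x : E3) : |partialD i f x| ≤ ‖fderiv ℝ f x‖ := by
  have := (fderiv ℝ f x).le_opNorm (EuclideanSpace.single i (1 : ℝ))
  simpa [partialD] using this

/-! ### Smooth functions on the surface -/

section Smooth
variable {m : ℝ} {f g : E3 → ℝ}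

theorem SmoothOnSurface.sub (hf : SmoothOnSurface m f) (hg : SmoothOnSurface m g) :
    SmoothOnSurface m fun x => f x - g x := fun x hx => (hf x hx).sub (hg x hx)

theorem SmoothOnSurface.mul (hf : SmoothOnSurface m f) (hg : SmoothOnSurface m g) :
    SmoothOnSurface m fun x => f x * g x := fun x hx => (hf x hx).mul (hg x hx)

theorem SmoothOnSurface.const (c : ℝ) : SmoothOnSurface m fun _ => c :=
  fun _ _ => contDiffAt_const

theorem SmoothOnSurface.const_mul (c : ℝ) (hf : SmoothOnSurface m f) :
    SmoothOnSurface m fun x => c * f x := (SmoothOnSurface.const c).mul hf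

theorem SmoothOnSurface.pow (hf : SmoothOnSurface m f) (n : ℕ) :
    SmoothOnSurface m fun x => f x ^ n := fun x hx => (hf x hx).pow n

theorem SmoothOnSurface.coord (i : Fin 3) : SmoothOnSurface m fun x => x i :=
  fun _ _ => (EuclideanSpace.proj (𝕜 := ℝ) i).contDiff.contDiffAt

theorem SmoothOnSurface.differentiableAt (hf : SmoothOnSurface m f) {x : E3} (hx : x ∈ surface m) :
    DifferentiableAt ℝ f x := (hf x hx).differentiableAt (by simp)

theorem SmoothOnSurface.partialD (hf : SmoothOnSurface m f) (i : Fin 3) :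
    SmoothOnSurface m (partialD i f) := fun x hx =>
  ((hf x hx).fderiv_right (m := ∞) (by simp)).clm_apply contDiffAt_const

theorem SmoothOnSurface.continuousOn (hf : SmoothOnSurface m f) : ContinuousOn f (surface m) :=
  fun x hx => (hf x hx).continuousAt.continuousWithinAt

theorem SmoothOnSurface.continuousOn_mer (hm : 0 < m) (hf : SmoothOnSurface m f) :
    ContinuousOn (fun p : ℝ × ℝ => f (p.1 • eR p.2)) (Set.Ici (m / 2) ×ˢ Set.univ) := by
  refine hf.continuousOn.comp ?_ fun p hp => smul_eR_mem hm hp.1 _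
  exact (continuous_fst.smul (continuous_eR.comp continuous_snd)).continuousOn

theorem SmoothOnSurface.continuous_mer (hm : 0 < m) (hf : SmoothOnSurface m f) {r : ℝ}
    (hr : m / 2 ≤ r) : Continuous fun θ => f (r • eR θ) := by
  rw [← continuousOn_univ]
  exact (hf.continuousOn_mer hm).comp (continuousOn_const.prodMk continuousOn_id)
    fun θ _ => ⟨hr, Set.mem_univ _⟩

theorem SmoothOnSurface.hasDerivAt_radial (hm : 0 < m) (hf : SmoothOnSurface m f) {r : ℝ}
    (hr : m / 2 ≤ r) (θ : ℝ) : HasDerivAt (fun r => f (r • eR θ))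
      (sin θ * PenrosePerturbation.partialD 0 f (r • eR θ)
        + cos θ * PenrosePerturbation.partialD 2 f (r • eR θ)) r := by
  have h1 := (hf.differentiableAt (smul_eR_mem hm hr θ)).hasFDerivAt
  have h2 : HasDerivAt (fun r : ℝ => r • eR θ) (eR θ) r := by
    simpa using (hasDerivAt_id r).smul_const (eR θ)
  refine (h1.comp_hasDerivAt r h2).congr_deriv ?_
  rw [fderiv_apply_eq_sum, Fin.sum_univ_three]
  simp [eR]

theorem SmoothOnSurface.hasDerivAt_polar (hm : 0 < m) (hf : SmoothOnSurface m f) {r : ℝ}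
    (hr : m / 2 ≤ r) (θ : ℝ) : HasDerivAt (fun θ => f (r • eR θ))
      (r * (cos θ * PenrosePerturbation.partialD 0 f (r • eR θ)
        - sin θ * PenrosePerturbation.partialD 2 f (r • eR θ))) θ := by
  have h1 := (hf.differentiableAt (smul_eR_mem hm hr θ)).hasFDerivAt
  have h2 : HasDerivAt (fun θ : ℝ => r • eR θ) (r • eT θ) θ := (hasDerivAt_eR θ).const_smul r
  refine (h1.comp_hasDerivAt θ h2).congr_deriv ?_
  rw [fderiv_apply_eq_sum, Fin.sum_univ_three]
  simp [eT]
  ring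

end Smooth

/-! ### Means depending on the radius -/

theorem continuousOn_avg {a : ℝ} {F : ℝ → ℝ → ℝ}
    (hF : ContinuousOn (fun p : ℝ × ℝ => F p.1 p.2) (Set.Ici a ×ˢ Set.univ)) :
    ContinuousOn (fun r => avg (F r)) (Set.Ici a) := by
  -- Replacing r by max r a extends F continuously to all radii, so that continuity of parametric
  -- integrals applies up to the boundary r = a.
  have h1 : Continuous fun p : ℝ × ℝ => F (max p.1 a) p.2 := by
    rw [← continuousOn_univ]
    exact hF.comp (by fun_prop) (t := Set.Ici a ×ˢ Set.univ)
      (f := fun p : ℝ × ℝ => (max p.1 a, p.2)) fun p _ =>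
        ⟨Set.mem_Ici.mpr (le_max_right _ _), Set.mem_univ _⟩
  have h2 : Continuous fun r => avg (F (max r a)) := by
    refine continuous_const.mul ?_
    exact intervalIntegral.continuous_parametric_intervalIntegral_of_continuous'
      (f := fun r θ => F (max r a) θ * sin θ) (h1.mul (continuous_sin.comp continuous_snd)) _ _
  refine h2.continuousOn.congr fun r hr => ?_
  simp only [max_eq_left (Set.mem_Ici.mp hr)]

theorem hasDerivAt_avg {a : ℝ} {F F' : ℝ → ℝ → ℝ}
    (hF : ContinuousOn (fun p : ℝ × ℝ => F p.1 p.2) (Set.Ici a ×ˢ Set.univ))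
    (hF' : ContinuousOn (fun p : ℝ × ℝ => F' p.1 p.2) (Set.Ici a ×ˢ Set.univ))
    (h : ∀ r, a < r → ∀ θ, HasDerivAt (fun r => F r θ) (F' r θ) r) {r : ℝ} (hr : a < r) :
    HasDerivAt (fun r => avg (F r)) (avg (F' r)) r := by
  have hc : ∀ {F : ℝ → ℝ → ℝ}, ContinuousOn (fun p : ℝ × ℝ => F p.1 p.2) (Set.Ici a ×ˢ Set.univ) →
      ∀ {r}, a ≤ r → Continuous fun θ => F r θ * sin θ := by
    intro F hF r hr
    refine Continuous.mul ?_ continuous_sin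
    rw [← continuousOn_univ]
    exact hF.comp (continuousOn_const.prodMk continuousOn_id) fun θ _ => ⟨hr, Set.mem_univ _⟩
  have hK : IsCompact (Set.Icc a (r + 1) ×ˢ Set.Icc (0 : ℝ) π) := isCompact_Icc.prod isCompact_Icc
  obtain ⟨C, hC⟩ := hK.exists_bound_of_continuousOn
    (hF'.mono (Set.prod_mono Set.Icc_subset_Ici_self (Set.subset_univ _)))
  have hs : Set.Ioo a (r + 1) ∈ 𝓝 r := Ioo_mem_nhds hr (by linarith)
  have := intervalIntegral.hasDerivAt_integral_of_dominated_loc_of_deriv_le (μ := volume)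
    (a := 0) (b := π) (F := fun r θ => F r θ * sin θ) (F' := fun r θ => F' r θ * sin θ)
    (bound := fun _ => C) hs ?_ ?_ ?_ ?_ ?_ ?_
  · exact this.2.const_mul (1 / 2)
  · filter_upwards [hs] with x hx
    exact (hc hF hx.1.le).aestronglyMeasurable
  · exact (hc hF hr.le).intervalIntegrable _ _
  · exact (hc hF' hr.le).aestronglyMeasurable
  · refine Eventually.of_forall fun θ hθ x hx => ?_
    rw [Set.uIoc_of_le pi_pos.le] at hθ
    rw [norm_mul]
    have h1 := hC (x, θ) ⟨⟨hx.1.le, hx.2.le⟩, hθ.1.le, hθ.2⟩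
    have h2 : ‖sin θ‖ ≤ 1 := abs_sin_le_one θ
    calc _ ≤ C * 1 := mul_le_mul h1 h2 (norm_nonneg _) ((norm_nonneg _).trans h1)
      _ = C := mul_one C
  · exact intervalIntegrable_const
  · exact Eventually.of_forall fun θ _ x hx => (h x hx.1 θ).mul_const _

/-- The radial component on the meridian. -/
def radComp (V : Fin 3 → E3 → ℝ) (r θ : ℝ) : ℝ :=
  sin θ * V 0 (r • eR θ) + cos θ * V 2 (r • eR θ)

/-- The polar component on the meridian. -/
def polComp (V : Fin 3 → E3 → ℝ) (r θ : ℝ) : ℝ :=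
  cos θ * V 0 (r • eR θ) - sin θ * V 2 (r • eR θ)

/-- The flux identity for axially symmetric vector fields. -/
theorem hasDerivAt_flux {m : ℝ} (hm : 0 < m) {V : Fin 3 → E3 → ℝ}
    (hV : ∀ i, SmoothOnSurface m (V i))
    (hax : ∀ r, m / 2 < r → ∀ θ, r * sin θ * partialD 1 (V 1) (r • eR θ) = V 0 (r • eR θ))
    {Φ Φ' : ℝ → ℝ} (hΦ : ∀ θ, HasDerivAt Φ (Φ' θ) θ) (hΦ' : Continuous Φ') {r : ℝ}
    (hr : m / 2 < r) :
    HasDerivAt (fun r => r ^ 2 * avg fun θ => Φ θ * radComp V r θ)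
      (r ^ 2 * avg (fun θ => Φ θ * ∑ i, partialD i (V i) (r • eR θ))
        + r * avg (fun θ => Φ' θ * polComp V r θ)) r := by
  have hr0 : 0 < r := by linarith
  have hΦc : Continuous Φ := continuous_iff_continuousAt.mpr fun θ => (hΦ θ).continuousAt
  have c0 := fun i => (hV i).continuousOn_mer hm
  have c1 := fun i j => ((hV i).partialD j).continuousOn_mer hm
  have cs : ContinuousOn (fun p : ℝ × ℝ => sin p.2) (Set.Ici (m / 2) ×ˢ Set.univ) := by fun_prop
  have cc : ContinuousOn (fun p : ℝ × ℝ => cos p.2) (Set.Ici (m / 2) ×ˢ Set.univ) := by fun_prop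
  have d0 := fun i => (hV i).continuous_mer hm hr.le
  have d1 := fun i j => ((hV i).partialD j).continuous_mer hm hr.le
  set R' : ℝ → ℝ → ℝ := fun r θ =>
    sin θ * (sin θ * partialD 0 (V 0) (r • eR θ) + cos θ * partialD 2 (V 0) (r • eR θ))
      + cos θ * (sin θ * partialD 0 (V 2) (r • eR θ) + cos θ * partialD 2 (V 2) (r • eR θ)) with hR'
  have cR : Continuous (R' r) := by
    have := d1 0 0; have := d1 0 2; have := d1 2 0; have := d1 2 2
    simp only [hR']; fun_prop
  have cr : Continuous (radComp V r) := by
    exact (continuous_sin.mul (d0 0)).add (continuous_cos.mul (d0 2))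
  have cp : Continuous (polComp V r) := by
    exact (continuous_cos.mul (d0 0)).sub (continuous_sin.mul (d0 2))
  have cdiv : Continuous fun θ => ∑ i, partialD i (V i) (r • eR θ) :=
    continuous_finsetSum _ fun i _ => d1 i i
  have h1 : HasDerivAt (fun r => avg fun θ => Φ θ * radComp V r θ)
      (avg fun θ => Φ θ * R' r θ) r := by
    refine hasDerivAt_avg (a := m / 2) (F := fun r θ => Φ θ * radComp V r θ)
      (F' := fun r θ => Φ θ * R' r θ) ?_ ?_ ?_ hr
    · exact (hΦc.comp continuous_snd).continuousOn.mul
        ((cs.mul (c0 0)).add (cc.mul (c0 2)))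
    · exact (hΦc.comp continuous_snd).continuousOn.mul
        ((cs.mul ((cs.mul (c1 0 0)).add (cc.mul (c1 0 2)))).add
          (cc.mul ((cs.mul (c1 2 0)).add (cc.mul (c1 2 2)))))
    · intro r hr θ
      exact ((((hV 0).hasDerivAt_radial hm hr.le θ).const_mul _).add
        (((hV 2).hasDerivAt_radial hm hr.le θ).const_mul _)).const_mul _
  have h2 := (hasDerivAt_pow 2 r).mul h1
  refine h2.congr_deriv ?_
  -- the angular part of the divergence
  have hT : ∀ θ, HasDerivAt (fun θ => sin θ * polComp V r θ)
      (r * sin θ * ∑ i, partialD i (V i) (r • eR θ) - r * sin θ * R' r θ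
        - 2 * sin θ * radComp V r θ) θ := by
    intro θ
    have e0 := (hV 0).hasDerivAt_polar hm hr.le θ
    have e2 := (hV 2).hasDerivAt_polar hm hr.le θ
    refine ((hasDerivAt_sin θ).mul (((hasDerivAt_cos θ).mul e0).sub
      ((hasDerivAt_sin θ).mul e2))).congr_deriv ?_
    -- The transverse term ∂_y V_y of the divergence is not seen on the meridian; axial symmetry
    -- expresses it through V_x.
    have hx := hax r hr θ
    simp only [hR', radComp, Fin.sum_univ_three, Pi.mul_apply, Pi.sub_apply]
    have hs : cos θ ^ 2 = 1 - sin θ ^ 2 := cos_sq' θ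
    linear_combination (-1 : ℝ) * hx + (V 0 (r • eR θ)
      + r * sin θ * partialD 0 (V 0) (r • eR θ) + r * sin θ * partialD 2 (V 2) (r • eR θ)) * hs
  -- Integrating the angular part against Φ by parts, the factor sin θ removes the boundary terms at
  -- the poles.
  have hint := intervalIntegral.integral_mul_deriv_eq_deriv_mul (a := 0) (b := π)
    (u := Φ) (u' := Φ') (v := fun θ => sin θ * polComp V r θ)
    (fun θ _ => hΦ θ) (fun θ _ => hT θ) (hΦ'.intervalIntegrable _ _)
    (Continuous.intervalIntegrable (by fun_prop) _ _)
  rw [sin_pi, sin_zero] at hint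
  simp only [zero_mul, mul_zero, sub_zero, zero_sub] at hint
  have e1 : ∫ θ in (0 : ℝ)..π, Φ θ * (r * sin θ * ∑ i, partialD i (V i) (r • eR θ)
      - r * sin θ * R' r θ - 2 * sin θ * radComp V r θ)
      = 2 * avg (fun θ => r * (Φ θ * ∑ i, partialD i (V i) (r • eR θ)) - r * (Φ θ * R' r θ)
        - 2 * (Φ θ * radComp V r θ)) := by
    rw [avg, ← mul_assoc, mul_one_div_cancel two_ne_zero, one_mul]
    congr 1
    funext θ
    ring
  have e2 : ∫ θ in (0 : ℝ)..π, Φ' θ * (sin θ * polComp V r θ)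
      = 2 * avg (fun θ => Φ' θ * polComp V r θ) := by
    rw [avg, ← mul_assoc, mul_one_div_cancel two_ne_zero, one_mul]
    congr 1
    funext θ
    ring
  rw [e1, e2, avg_sub (by fun_prop) (by fun_prop), avg_sub (by fun_prop) (by fun_prop),
    avg_const_mul, avg_const_mul, avg_const_mul] at hint
  simp only [Nat.cast_ofNat, Nat.add_one_sub_one, pow_one]
  linear_combination (-(r / 2)) * hint

/-! ### Infinitesimal rotations -/

section Axial
variable {m : ℝ}

theorem rot_apply (α : ℝ) (x : E3) :
    rot α x = !₂[cos α * x 0 - sin α * x 1, sin α * x 0 + cos α * x 1, x 2] := by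
  ext i
  fin_cases i <;>
    simp [rot, rotMatrix, dotProduct, Fin.sum_univ_three, sub_eq_add_neg]

theorem rot_zero (x : E3) : rot 0 x = x := by
  rw [rot_apply]
  ext i
  fin_cases i <;> simp

theorem rot_mem_surface {x : E3} (hx : x ∈ surface m) (α : ℝ) : rot α x ∈ surface m := by
  have : ‖rot α x‖ = ‖x‖ := by
    rw [EuclideanSpace.norm_eq, EuclideanSpace.norm_eq, rot_apply]
    simp only [Fin.sum_univ_three, Real.norm_eq_abs, sq_abs]
    congr 1
    simp
    linear_combination (x 0 ^ 2 + x 1 ^ 2) * sin_sq_add_cos_sq α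
  change m / 2 ≤ ‖rot α x‖
  rw [this]; exact hx

theorem sph_eq_rot (r θ φ : ℝ) : sph r θ φ = rot φ (r • eR θ) := by
  rw [rot_apply]
  ext i
  fin_cases i <;> simp [sph, eR] <;> ring

theorem hasDerivAt_rot (x : E3) : HasDerivAt (fun α => rot α x) (!₂[-x 1, x 0, 0] : E3) 0 := by
  have h : HasDerivAt (fun α i => rot α x i) (fun i => (!₂[-x 1, x 0, 0] : E3) i) 0 := by
    rw [hasDerivAt_pi]
    intro i
    simp only [rot_apply]
    fin_cases i
    · refine (((hasDerivAt_cos 0).mul_const (x 0)).sub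
        ((hasDerivAt_sin 0).mul_const (x 1))).congr_deriv ?_
      simp
    · refine (((hasDerivAt_sin 0).mul_const (x 0)).add
        ((hasDerivAt_cos 0).mul_const (x 1))).congr_deriv ?_
      simp
    · simpa using hasDerivAt_const (0 : ℝ) (x 2)
  exact (PiLp.hasFDerivAt_toLp 2 _).comp_hasDerivAt 0 h

theorem SmoothOnSurface.hasDerivAt_rot {f : E3 → ℝ} (hf : SmoothOnSurface m f) {x : E3}
    (hx : x ∈ surface m) :
    HasDerivAt (fun α => f (rot α x))
      (x 0 * PenrosePerturbation.partialD 1 f x - x 1 * PenrosePerturbation.partialD 0 f x) 0 := by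
  have h1 := (hf.differentiableAt hx).hasFDerivAt
  rw [← rot_zero x] at h1
  refine (h1.comp_hasDerivAt (0 : ℝ) (PenrosePerturbation.hasDerivAt_rot x)).congr_deriv ?_
  rw [rot_zero, fderiv_apply_eq_sum, Fin.sum_univ_three]
  simp
  ring

theorem SmoothOnSurface.rotation_eq_zero {f : E3 → ℝ} (hf : SmoothOnSurface m f)
    (hax : AxialScalar m f) {x : E3} (hx : x ∈ surface m) :
    x 0 * PenrosePerturbation.partialD 1 f x - x 1 * PenrosePerturbation.partialD 0 f x = 0 := by
  have h1 := hf.hasDerivAt_rot hx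
  have h2 : HasDerivAt (fun α => f (rot α x)) 0 0 := by
    simp only [hax _ x hx]
    exact hasDerivAt_const _ _
  exact h1.unique h2

theorem smul_eR_zero (r θ : ℝ) : (r • eR θ) 0 = r * sin θ := by simp [eR]
theorem smul_eR_one (r θ : ℝ) : (r • eR θ) 1 = 0 := by simp [eR]
theorem smul_eR_two (r θ : ℝ) : (r • eR θ) 2 = r * cos θ := by simp [eR]

theorem SmoothOnSurface.sin_mul_partialD_one (hm : 0 < m) {f : E3 → ℝ} (hf : SmoothOnSurface m f)
    (hax : AxialScalar m f) {r : ℝ} (hr : m / 2 ≤ r) (θ : ℝ) :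
    sin θ * PenrosePerturbation.partialD 1 f (r • eR θ) = 0 := by
  have h := hf.rotation_eq_zero hax (smul_eR_mem hm hr θ)
  rw [smul_eR_zero, smul_eR_one, zero_mul, sub_zero, mul_assoc] at h
  exact (mul_eq_zero.mp h).resolve_left (by linarith)

theorem partialD_mul {f g : E3 → ℝ} {x : E3} (hf : DifferentiableAt ℝ f x)
    (hg : DifferentiableAt ℝ g x) (i : Fin 3) :
    partialD i (fun y => f y * g y) x = partialD i f x * g x + f x * partialD i g x := by
  simp only [partialD]
  rw [fderiv_fun_mul hf hg]
  simp
  ring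

theorem partialD_sub {f g : E3 → ℝ} {x : E3} (hf : DifferentiableAt ℝ f x)
    (hg : DifferentiableAt ℝ g x) (i : Fin 3) :
    partialD i (fun y => f y - g y) x = partialD i f x - partialD i g x := by
  simp only [partialD]
  rw [fderiv_fun_sub hf hg]
  simp

theorem partialD_add {f g : E3 → ℝ} {x : E3} (hf : DifferentiableAt ℝ f x)
    (hg : DifferentiableAt ℝ g x) (i : Fin 3) :
    partialD i (fun y => f y + g y) x = partialD i f x + partialD i g x := by
  simp only [partialD]
  rw [fderiv_fun_add hf hg]
  simp

theorem partialD_coord (i j : Fin 3) (x : E3) :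
    partialD i (fun y => y j) x = if i = j then 1 else 0 := by
  have : HasFDerivAt (fun y : E3 => y j) (EuclideanSpace.proj (𝕜 := ℝ) j) x :=
    (EuclideanSpace.proj (𝕜 := ℝ) j).hasFDerivAt
  rw [partialD, this.fderiv]
  simp [eq_comm]

theorem partialD_const (i : Fin 3) (c : ℝ) (x : E3) : partialD i (fun _ => c) x = 0 := by
  simp [partialD]

theorem partialD_congr {f g : E3 → ℝ} {x : E3} (h : f =ᶠ[𝓝 x] g) (i : Fin 3) :
    partialD i f x = partialD i g x := by
  rw [partialD, partialD, h.fderiv_eq]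

theorem surface_mem_nhds {r : ℝ} (hm : 0 < m) (hr : m / 2 < r) (θ : ℝ) :
    surface m ∈ 𝓝 (r • eR θ) := by
  have h : IsOpen {x : E3 | m / 2 < ‖x‖} := isOpen_lt continuous_const continuous_norm
  refine Filter.mem_of_superset (h.mem_nhds ?_) fun x hx =>
    show m / 2 ≤ ‖x‖ from le_of_lt hx
  change m / 2 < ‖r • eR θ‖
  rwa [norm_smul_eR (by linarith)]

/-- The gradient of an axially symmetric function is an axially symmetric vector field. -/
theorem SmoothOnSurface.gradient_axial (hm : 0 < m) {f : E3 → ℝ} (hf : SmoothOnSurface m f)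
    (hax : AxialScalar m f) {r : ℝ} (hr : m / 2 < r) (θ : ℝ) :
    r * sin θ * PenrosePerturbation.partialD 1 (PenrosePerturbation.partialD 1 f) (r • eR θ)
      = PenrosePerturbation.partialD 0 f (r • eR θ) := by
  have hmem := smul_eR_mem hm hr.le θ
  have h0 : (fun x : E3 => x 0 * PenrosePerturbation.partialD 1 f x
      - x 1 * PenrosePerturbation.partialD 0 f x) =ᶠ[𝓝 (r • eR θ)] fun _ => 0 := by
    filter_upwards [surface_mem_nhds hm hr θ] with x hx using hf.rotation_eq_zero hax hx
  -- Differentiate x ∂_y f - y ∂_x f = 0 in the direction y and set y = 0. The identity must hold on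
  -- a neighbourhood, hence the strict inequality for r.
  have h1 := partialD_congr h0 1
  have dc := fun i => (SmoothOnSurface.coord (m := m) i).differentiableAt hmem
  have dp := fun i => (hf.partialD i).differentiableAt hmem
  have d0 : DifferentiableAt ℝ (fun x : E3 => x 0 * PenrosePerturbation.partialD 1 f x)
    (r • eR θ) := (dc 0).mul (dp 1)
  have d1 : DifferentiableAt ℝ (fun x : E3 => x 1 * PenrosePerturbation.partialD 0 f x)
    (r • eR θ) := (dc 1).mul (dp 0)
  rw [partialD_sub d0 d1, partialD_mul (dc 0) (dp 1),
    partialD_mul (dc 1) (dp 0), partialD_coord, partialD_coord, partialD_const, smul_eR_zero,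
    smul_eR_one] at h1
  simp at h1
  linarith

/-- A smooth symmetric traceless axially symmetric tensor field on the surface. -/
structure IsAxialTT (m : ℝ) (T : E3 → Tensor2) : Prop where
  smooth : ∀ i j, SmoothOnSurface m (fun x => T x i j)
  symm : ∀ x ∈ surface m, (T x).IsSymm
  traceless : ∀ x ∈ surface m, (T x).trace = 0
  axial : AxialTensor m T

variable {T : E3 → Tensor2}

theorem IsAxialTT.trace_eq (hT : IsAxialTT m T) {x : E3} (hx : x ∈ surface m) :
    T x 0 0 + T x 1 1 + T x 2 2 = 0 := by
  have := hT.traceless x hx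
  rwa [Matrix.trace_fin_three] at this

theorem IsAxialTT.symm_apply (hT : IsAxialTT m T) {x : E3} (hx : x ∈ surface m) (i j : Fin 3) :
    T x i j = T x j i := (hT.symm x hx).apply j i

/-- Differentiate the conjugation law at angle zero. The generator is antisymmetric, so the right
side becomes a commutator. -/
theorem IsAxialTT.rotation_eq (hT : IsAxialTT m T) {x : E3} (hx : x ∈ surface m) (i j : Fin 3) :
    x 0 * partialD 1 (fun y => T y i j) x - x 1 * partialD 0 (fun y => T y i j) x
      = ((!![0, -1, 0; 1, 0, 0; 0, 0, 0] : Tensor2) * T x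
          - T x * (!![0, -1, 0; 1, 0, 0; 0, 0, 0] : Tensor2)) i j := by
  have h1 := (hT.smooth i j).hasDerivAt_rot hx
  simp only [hT.axial _ x hx] at h1
  refine h1.unique ?_
  have hR : ∀ k l, HasDerivAt (fun α => rotMatrix α k l)
      ((!![0, -1, 0; 1, 0, 0; 0, 0, 0] : Tensor2) k l) 0 := by
    intro k l
    have hs := hasDerivAt_sin 0
    have hc := hasDerivAt_cos 0
    simp only [cos_zero, sin_zero, neg_zero] at hs hc
    fin_cases k <;> fin_cases l <;> simp [rotMatrix] <;>
      first
      | exact hs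
      | exact hc
      | exact hs.neg
      | exact hasDerivAt_const _ _
  have h0 : rotMatrix 0 = 1 := by
    ext k l; fin_cases k <;> fin_cases l <;> simp [rotMatrix]
  have h2 : HasDerivAt (fun α => ∑ k, (∑ l, rotMatrix α i l * T x l k) * rotMatrix α j k)
      (∑ k, ((∑ l, (!![0, -1, 0; 1, 0, 0; 0, 0, 0] : Tensor2) i l * T x l k) * rotMatrix 0 j k
        + (∑ l, rotMatrix 0 i l * T x l k) * (!![0, -1, 0; 1, 0, 0; 0, 0, 0] : Tensor2) j k)) 0 :=
    HasDerivAt.fun_sum fun k _ =>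
      (HasDerivAt.fun_sum fun l _ => (hR i l).mul_const _).mul (hR j k)
  have hG : (!![0, -1, 0; 1, 0, 0; 0, 0, 0] : Tensor2)ᵀ = -!![0, -1, 0; 1, 0, 0; 0, 0, 0] := by
    ext k l; fin_cases k <;> fin_cases l <;> simp
  simp only [Matrix.mul_apply, Matrix.transpose_apply]
  refine h2.congr_deriv ?_
  trans ((!![0, -1, 0; 1, 0, 0; 0, 0, 0] : Tensor2) * T x * (rotMatrix 0)ᵀ
    + rotMatrix 0 * T x * (!![0, -1, 0; 1, 0, 0; 0, 0, 0] : Tensor2)ᵀ) i j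
  · simp only [Matrix.add_apply, Matrix.mul_apply, Matrix.transpose_apply, Finset.sum_add_distrib]
  · rw [h0, hG, Matrix.transpose_one, mul_one, one_mul, mul_neg, ← sub_eq_add_neg]

theorem IsAxialTT.rotation_meridian (hm : 0 < m) (hT : IsAxialTT m T) {r : ℝ} (hr : m / 2 ≤ r)
    (θ : ℝ) (i j : Fin 3) :
    r * sin θ * partialD 1 (fun y => T y i j) (r • eR θ)
      = ((!![0, -1, 0; 1, 0, 0; 0, 0, 0] : Tensor2) * T (r • eR θ)
          - T (r • eR θ) * (!![0, -1, 0; 1, 0, 0; 0, 0, 0] : Tensor2)) i j := by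
  have := hT.rotation_eq (smul_eR_mem hm hr θ) i j
  rw [smul_eR_zero, smul_eR_one] at this
  linarith

theorem IsAxialTT.rotation_one_two (hm : 0 < m) (hT : IsAxialTT m T) {r : ℝ} (hr : m / 2 ≤ r)
    (θ : ℝ) : r * sin θ * partialD 1 (fun y => T y 1 2) (r • eR θ) = T (r • eR θ) 0 2 := by
  rw [hT.rotation_meridian hm hr, Matrix.sub_apply, Matrix.mul_apply, Matrix.mul_apply]
  simp [Fin.sum_univ_three]

theorem IsAxialTT.rotation_one_one (hm : 0 < m) (hT : IsAxialTT m T) {r : ℝ} (hr : m / 2 ≤ r)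
    (θ : ℝ) : r * sin θ * partialD 1 (fun y => T y 1 1) (r • eR θ) = 2 * T (r • eR θ) 0 1 := by
  rw [hT.rotation_meridian hm hr, Matrix.sub_apply, Matrix.mul_apply, Matrix.mul_apply]
  simp [Fin.sum_univ_three, hT.symm_apply (smul_eR_mem hm hr θ) 1 0]
  ring

theorem IsAxialTT.rotation_one_zero (hm : 0 < m) (hT : IsAxialTT m T) {r : ℝ} (hr : m / 2 ≤ r)
    (θ : ℝ) : r * sin θ * partialD 1 (fun y => T y 1 0) (r • eR θ)
      = T (r • eR θ) 0 0 - T (r • eR θ) 1 1 := by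
  rw [hT.rotation_meridian hm hr, Matrix.sub_apply, Matrix.mul_apply, Matrix.mul_apply]
  simp [Fin.sum_univ_three]

end Axial

/-! ### Frame components of a tensor on the meridian -/

def frRR (T : E3 → Tensor2) (r θ : ℝ) : ℝ :=
  sin θ ^ 2 * T (r • eR θ) 0 0 + 2 * sin θ * cos θ * T (r • eR θ) 0 2
    + cos θ ^ 2 * T (r • eR θ) 2 2

def frRT (T : E3 → Tensor2) (r θ : ℝ) : ℝ :=
  sin θ * cos θ * (T (r • eR θ) 0 0 - T (r • eR θ) 2 2)
    + (cos θ ^ 2 - sin θ ^ 2) * T (r • eR θ) 0 2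

def frTT (T : E3 → Tensor2) (r θ : ℝ) : ℝ :=
  cos θ ^ 2 * T (r • eR θ) 0 0 - 2 * sin θ * cos θ * T (r • eR θ) 0 2
    + sin θ ^ 2 * T (r • eR θ) 2 2

/-- Half the difference of the two angular diagonal components. -/
def frQ (T : E3 → Tensor2) (r θ : ℝ) : ℝ := (frTT T r θ - T (r • eR θ) 1 1) / 2

def frRP (T : E3 → Tensor2) (r θ : ℝ) : ℝ :=
  sin θ * T (r • eR θ) 0 1 + cos θ * T (r • eR θ) 1 2

def frTP (T : E3 → Tensor2) (r θ : ℝ) : ℝ :=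
  cos θ * T (r • eR θ) 0 1 - sin θ * T (r • eR θ) 1 2

section Frame
variable {m : ℝ} {T : E3 → Tensor2}

theorem IsAxialTT.frTT_eq (hm : 0 < m) (hT : IsAxialTT m T) {r : ℝ} (hr : m / 2 ≤ r) (θ : ℝ) :
    frTT T r θ = frQ T r θ - frRR T r θ / 2 := by
  have h := hT.trace_eq (smul_eR_mem hm hr θ)
  simp only [frQ, frTT, frRR]
  linear_combination (1 / 2 : ℝ) * h + (1 / 2 : ℝ) * (T (r • eR θ) 0 0 + T (r • eR θ) 2 2)
    * sin_sq_add_cos_sq θ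

/-- In the orthonormal spherical frame, vanishing trace makes the two angular diagonal entries -½RR
+ Q and -½RR - Q; this is the origin of the coefficient 3/2. -/
theorem IsAxialTT.sum_sq_eq (hm : 0 < m) (hT : IsAxialTT m T) {r : ℝ} (hr : m / 2 ≤ r) (θ : ℝ) :
    ∑ i, ∑ j, T (r • eR θ) i j ^ 2 = 3 / 2 * frRR T r θ ^ 2 + 2 * frRT T r θ ^ 2
      + 2 * frQ T r θ ^ 2 + 2 * frRP T r θ ^ 2 + 2 * frTP T r θ ^ 2 := by
  have hx := smul_eR_mem hm hr θ
  have h := hT.trace_eq hx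
  simp only [Fin.sum_univ_three, hT.symm_apply hx 1 0, hT.symm_apply hx 2 0, hT.symm_apply hx 2 1,
    frQ, frTT, frRR, frRT, frRP, frTP]
  have h1 : T (r • eR θ) 1 1 = -(T (r • eR θ) 0 0 + T (r • eR θ) 2 2) := by linarith
  have hc : cos θ ^ 2 = 1 - sin θ ^ 2 := cos_sq' θ
  rw [h1]
  generalize T (r • eR θ) 0 0 = a
  generalize T (r • eR θ) 2 2 = b
  generalize T (r • eR θ) 0 2 = d
  generalize T (r • eR θ) 0 1 = e
  generalize T (r • eR θ) 1 2 = f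
  generalize sin θ = s at *
  generalize cos θ = c at *
  have h4 : c ^ 4 = (1 - s ^ 2) ^ 2 := by rw [← hc]; ring
  ring_nf
  simp only [h4, show c ^ 3 = c * (1 - s ^ 2) by rw [← hc]; ring, hc]
  ring

end Frame

/-! ### Flux identities for tensors and functions -/

section Flux
variable {m : ℝ} {T : E3 → Tensor2} {f : E3 → ℝ}

theorem SmoothOnSurface.sum {ι : Type*} {s : Finset ι} {F : ι → E3 → ℝ}
    (h : ∀ i ∈ s, SmoothOnSurface m (F i)) : SmoothOnSurface m fun x => ∑ i ∈ s, F i x :=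
  fun x hx => ContDiffAt.sum fun i hi => h i hi x hx

theorem hasDerivAt_eval_cos (p : Polynomial ℝ) (θ : ℝ) :
    HasDerivAt (fun θ => p.eval (cos θ)) (-(sin θ * p.derivative.eval (cos θ))) θ :=
  ((p.hasDerivAt (cos θ)).comp θ (hasDerivAt_cos θ)).congr_deriv (by ring)

theorem IsAxialTT.frRR_continuousOn (hm : 0 < m) (hT : IsAxialTT m T) :
    ContinuousOn (fun p : ℝ × ℝ => frRR T p.1 p.2) (Set.Ici (m / 2) ×ˢ Set.univ) := by
  have h := fun i j => (hT.smooth i j).continuousOn_mer hm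
  have cs : ContinuousOn (fun p : ℝ × ℝ => sin p.2) (Set.Ici (m / 2) ×ˢ Set.univ) := by fun_prop
  have cc : ContinuousOn (fun p : ℝ × ℝ => cos p.2) (Set.Ici (m / 2) ×ˢ Set.univ) := by fun_prop
  exact (((cs.pow 2).mul (h 0 0)).add (((continuousOn_const.mul cs).mul cc).mul (h 0 2))).add
    ((cc.pow 2).mul (h 2 2))

theorem IsAxialTT.frRT_continuousOn (hm : 0 < m) (hT : IsAxialTT m T) :
    ContinuousOn (fun p : ℝ × ℝ => frRT T p.1 p.2) (Set.Ici (m / 2) ×ˢ Set.univ) := by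
  have h := fun i j => (hT.smooth i j).continuousOn_mer hm
  have cs : ContinuousOn (fun p : ℝ × ℝ => sin p.2) (Set.Ici (m / 2) ×ˢ Set.univ) := by fun_prop
  have cc : ContinuousOn (fun p : ℝ × ℝ => cos p.2) (Set.Ici (m / 2) ×ˢ Set.univ) := by fun_prop
  exact ((cs.mul cc).mul ((h 0 0).sub (h 2 2))).add (((cc.pow 2).sub (cs.pow 2)).mul (h 0 2))

theorem IsAxialTT.frTT_continuousOn (hm : 0 < m) (hT : IsAxialTT m T) :
    ContinuousOn (fun p : ℝ × ℝ => frTT T p.1 p.2) (Set.Ici (m / 2) ×ˢ Set.univ) := by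
  have h := fun i j => (hT.smooth i j).continuousOn_mer hm
  have cs : ContinuousOn (fun p : ℝ × ℝ => sin p.2) (Set.Ici (m / 2) ×ˢ Set.univ) := by fun_prop
  have cc : ContinuousOn (fun p : ℝ × ℝ => cos p.2) (Set.Ici (m / 2) ×ˢ Set.univ) := by fun_prop
  exact (((cc.pow 2).mul (h 0 0)).sub (((continuousOn_const.mul cs).mul cc).mul (h 0 2))).add
    ((cs.pow 2).mul (h 2 2))

theorem IsAxialTT.frQ_continuousOn (hm : 0 < m) (hT : IsAxialTT m T) :
    ContinuousOn (fun p : ℝ × ℝ => frQ T p.1 p.2) (Set.Ici (m / 2) ×ˢ Set.univ) :=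
  ((hT.frTT_continuousOn hm).sub ((hT.smooth 1 1).continuousOn_mer hm)).div_const 2

theorem IsAxialTT.frRP_continuousOn (hm : 0 < m) (hT : IsAxialTT m T) :
    ContinuousOn (fun p : ℝ × ℝ => frRP T p.1 p.2) (Set.Ici (m / 2) ×ˢ Set.univ) := by
  have h := fun i j => (hT.smooth i j).continuousOn_mer hm
  have cs : ContinuousOn (fun p : ℝ × ℝ => sin p.2) (Set.Ici (m / 2) ×ˢ Set.univ) := by fun_prop
  have cc : ContinuousOn (fun p : ℝ × ℝ => cos p.2) (Set.Ici (m / 2) ×ˢ Set.univ) := by fun_prop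
  exact (cs.mul (h 0 1)).add (cc.mul (h 1 2))

theorem IsAxialTT.frTP_continuousOn (hm : 0 < m) (hT : IsAxialTT m T) :
    ContinuousOn (fun p : ℝ × ℝ => frTP T p.1 p.2) (Set.Ici (m / 2) ×ˢ Set.univ) := by
  have h := fun i j => (hT.smooth i j).continuousOn_mer hm
  have cs : ContinuousOn (fun p : ℝ × ℝ => sin p.2) (Set.Ici (m / 2) ×ˢ Set.univ) := by fun_prop
  have cc : ContinuousOn (fun p : ℝ × ℝ => cos p.2) (Set.Ici (m / 2) ×ˢ Set.univ) := by fun_prop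
  exact (cc.mul (h 0 1)).sub (cs.mul (h 1 2))

theorem continuous_slice {a : ℝ} {F : ℝ → ℝ → ℝ}
    (hF : ContinuousOn (fun p : ℝ × ℝ => F p.1 p.2) (Set.Ici a ×ˢ Set.univ)) {r : ℝ}
    (hr : a ≤ r) : Continuous (F r) := by
  rw [← continuousOn_univ]
  exact hF.comp (continuousOn_const.prodMk continuousOn_id) fun θ _ => ⟨hr, Set.mem_univ _⟩

/-- The divergence of a tensor field, as in the momentum constraint. -/
def divT (T : E3 → Tensor2) (j : Fin 3) (x : E3) : ℝ := ∑ i, partialD i (fun y => T y i j) x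

/-- Flux identity for the contraction of a tensor with the position vector. -/
theorem IsAxialTT.hasDerivAt_flux_position (hm : 0 < m) (hT : IsAxialTT m T) {Φ Φ' : ℝ → ℝ}
    (hΦ : ∀ θ, HasDerivAt Φ (Φ' θ) θ) (hΦ' : Continuous Φ') {r : ℝ} (hr : m / 2 < r) :
    HasDerivAt (fun r => r ^ 3 * avg fun θ => Φ θ * frRR T r θ)
      (r ^ 3 * avg (fun θ => Φ θ * (sin θ * divT T 0 (r • eR θ) + cos θ * divT T 2 (r • eR θ)))
        + r ^ 2 * avg (fun θ => Φ' θ * frRT T r θ)) r := by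
  set V : Fin 3 → E3 → ℝ := fun i x => ∑ j, T x i j * x j with hVdef
  have hV : ∀ i, SmoothOnSurface m (V i) := fun i =>
    SmoothOnSurface.sum fun j _ => (hT.smooth i j).mul (SmoothOnSurface.coord j)
  have hpd : ∀ i k x, x ∈ surface m → partialD k (V i) x
      = ∑ j, (partialD k (fun y => T y i j) x * x j + T x i j * if k = j then 1 else 0) := by
    intro i k x hx
    have d : ∀ j, DifferentiableAt ℝ (fun y : E3 => T y i j * y j) x := fun j =>
      ((hT.smooth i j).mul (SmoothOnSurface.coord j)).differentiableAt hx
    have e : ∀ j, partialD k (fun y : E3 => T y i j * y j) x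
        = partialD k (fun y => T y i j) x * x j + T x i j * if k = j then 1 else 0 := fun j => by
      rw [partialD_mul ((hT.smooth i j).differentiableAt hx)
        ((SmoothOnSurface.coord (m := m) j).differentiableAt hx), partialD_coord]
    have : V i = fun y => (T y i 0 * y 0 + T y i 1 * y 1) + T y i 2 * y 2 := by
      funext y; simp [hVdef, Fin.sum_univ_three]
    rw [this, partialD_add ((d 0).fun_add (d 1)) (d 2), partialD_add (d 0) (d 1), e, e, e,
      Fin.sum_univ_three]
  have h := hasDerivAt_flux hm hV (fun r hr θ => ?_) hΦ hΦ' hr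
  · have hrad : ∀ r θ, m / 2 ≤ r → radComp V r θ = r * frRR T r θ := by
      intro r θ hr
      have hx := smul_eR_mem hm hr θ
      simp only [radComp, hVdef, Fin.sum_univ_three, smul_eR_zero, smul_eR_one, smul_eR_two, frRR,
        hT.symm_apply hx 2 0]
      ring
    have hpol : ∀ θ, polComp V r θ = r * frRT T r θ := by
      intro θ
      have hx := smul_eR_mem hm hr.le θ
      simp only [polComp, hVdef, Fin.sum_univ_three, smul_eR_zero, smul_eR_one, smul_eR_two, frRT,
        hT.symm_apply hx 2 0]
      ring
    have hdiv : ∀ θ, ∑ i, partialD i (V i) (r • eR θ)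
        = r * (sin θ * divT T 0 (r • eR θ) + cos θ * divT T 2 (r • eR θ)) := by
      intro θ
      have hx := smul_eR_mem hm hr.le θ
      -- The divergence of x ↦ T x is the divergence of T contracted with x plus the trace of T, and
      -- the latter vanishes.
      have ht := hT.trace_eq hx
      simp only [hpd _ _ _ hx, Fin.sum_univ_three, smul_eR_zero, smul_eR_one, smul_eR_two, divT]
      simp
      linear_combination ht
    refine (h.congr_deriv ?_).congr_of_eventuallyEq ?_
    · simp only [hdiv, hpol]
      have e1 : (fun θ => Φ θ * (r * (sin θ * divT T 0 (r • eR θ) + cos θ * divT T 2 (r • eR θ))))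
          = fun θ => r * (Φ θ * (sin θ * divT T 0 (r • eR θ) + cos θ * divT T 2 (r • eR θ))) := by
        funext θ; ring
      have e2 : (fun θ => Φ' θ * (r * frRT T r θ)) = fun θ => r * (Φ' θ * frRT T r θ) := by
        funext θ; ring
      rw [e1, e2, avg_const_mul, avg_const_mul]
      ring
    · filter_upwards [lt_mem_nhds hr] with s hs
      have e3 : (fun θ => Φ θ * radComp V s θ) = fun θ => s * (Φ θ * frRR T s θ) := by
        funext θ; rw [hrad s θ hs.le]; ring
      rw [e3, avg_const_mul]
      ring
  · have hx := smul_eR_mem hm hr.le θ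
    have h2 := hT.rotation_one_two hm hr.le θ
    have h1 := hT.rotation_one_one hm hr.le θ
    have h0 := hT.rotation_one_zero hm hr.le θ
    rw [hpd _ _ _ hx]
    simp only [hVdef, Fin.sum_univ_three, smul_eR_zero, smul_eR_one, smul_eR_two]
    simp
    linear_combination r * cos θ * h2 + r * sin θ * h0

/-- Flux identity for the contraction of a tensor with the axis. -/
theorem IsAxialTT.hasDerivAt_flux_axis (hm : 0 < m) (hT : IsAxialTT m T) {Φ Φ' : ℝ → ℝ}
    (hΦ : ∀ θ, HasDerivAt Φ (Φ' θ) θ) (hΦ' : Continuous Φ') {r : ℝ} (hr : m / 2 < r) :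
    HasDerivAt (fun r => r ^ 2 * avg fun θ => Φ θ * (cos θ * frRR T r θ - sin θ * frRT T r θ))
      (r ^ 2 * avg (fun θ => Φ θ * divT T 2 (r • eR θ))
        + r * avg (fun θ => Φ' θ * (cos θ * frRT T r θ - sin θ * frTT T r θ))) r := by
  have h := hasDerivAt_flux hm (V := fun i x => T x i 2) (fun i => hT.smooth i 2)
    (fun r hr θ => hT.rotation_one_two hm hr.le θ) hΦ hΦ' hr
  have hrad : ∀ r θ, radComp (fun i x => T x i 2) r θ
      = cos θ * frRR T r θ - sin θ * frRT T r θ := by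
    intro r θ
    simp only [radComp, frRR, frRT]
    linear_combination (-(sin θ * T (r • eR θ) 0 2) - cos θ * T (r • eR θ) 2 2)
      * sin_sq_add_cos_sq θ
  have hpol : ∀ θ, polComp (fun i x => T x i 2) r θ
      = cos θ * frRT T r θ - sin θ * frTT T r θ := by
    intro θ
    simp only [polComp, frTT, frRT]
    linear_combination (-(cos θ * T (r • eR θ) 0 2) + sin θ * T (r • eR θ) 2 2)
      * sin_sq_add_cos_sq θ
  simp only [hrad, hpol] at h
  exact h

/-- The flux of angular momentum is conserved. -/
theorem IsAxialTT.hasDerivAt_flux_rotation (hm : 0 < m) (hT : IsAxialTT m T)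
    (hdiv : ∀ r, m / 2 < r → ∀ θ, sin θ * divT T 1 (r • eR θ) = 0) {r : ℝ} (hr : m / 2 < r) :
    HasDerivAt (fun r => r ^ 3 * avg fun θ => sin θ * frRP T r θ) 0 r := by
  set V : Fin 3 → E3 → ℝ := fun i x => T x i 1 * x 0 - T x i 0 * x 1 with hVdef
  have hV : ∀ i, SmoothOnSurface m (V i) := fun i =>
    ((hT.smooth i 1).mul (SmoothOnSurface.coord 0)).sub
      ((hT.smooth i 0).mul (SmoothOnSurface.coord 1))
  have hpd : ∀ i k x, x ∈ surface m → partialD k (V i) x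
      = (partialD k (fun y => T y i 1) x * x 0 + T x i 1 * if k = 0 then 1 else 0)
        - (partialD k (fun y => T y i 0) x * x 1 + T x i 0 * if k = 1 then 1 else 0) := by
    intro i k x hx
    have d : ∀ j l, DifferentiableAt ℝ (fun y : E3 => T y i j * y l) x := fun j l =>
      ((hT.smooth i j).mul (SmoothOnSurface.coord l)).differentiableAt hx
    have e : ∀ j l, partialD k (fun y : E3 => T y i j * y l) x
        = partialD k (fun y => T y i j) x * x l + T x i j * if k = l then 1 else 0 := fun j l => by
      rw [partialD_mul ((hT.smooth i j).differentiableAt hx)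
        ((SmoothOnSurface.coord (m := m) l).differentiableAt hx), partialD_coord]
    rw [hVdef, partialD_sub (d 1 0) (d 0 1), e, e]
  have h := hasDerivAt_flux hm hV (fun r hr θ => ?_) (Φ := fun _ => 1) (Φ' := fun _ => 0)
    (fun θ => hasDerivAt_const _ _) continuous_const hr
  · refine (h.congr_deriv ?_).congr_of_eventuallyEq ?_
    · have : ∀ θ, ∑ i, partialD i (V i) (r • eR θ) = 0 := by
        intro θ
        have hx := smul_eR_mem hm hr.le θ
        have h1 := hdiv r hr θ
        simp only [hpd _ _ _ hx, Fin.sum_univ_three, smul_eR_zero, smul_eR_one, divT] at h1 ⊢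
        simp [hT.symm_apply hx 1 0]
        linear_combination r * h1
      simp only [this, mul_zero, zero_mul, avg_const, add_zero]
    · filter_upwards [lt_mem_nhds hr] with s hs
      have e3 : (fun θ => 1 * radComp V s θ) = fun θ => s * (sin θ * frRP T s θ) := by
        funext θ
        have hx := smul_eR_mem hm hs.le θ
        simp only [radComp, hVdef, smul_eR_zero, smul_eR_one, frRP, hT.symm_apply hx 2 1]
        ring
      rw [e3, avg_const_mul]
      ring
  · have hx := smul_eR_mem hm hr.le θ
    have h1 := hT.rotation_one_one hm hr.le θ
    rw [hpd _ _ _ hx]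
    simp only [hVdef, smul_eR_zero, smul_eR_one]
    simp [hT.symm_apply hx 1 0]
    linear_combination r * sin θ * h1

/-- Flux identity for the gradient of an axially symmetric function. -/
theorem SmoothOnSurface.hasDerivAt_flux_gradient (hm : 0 < m) (hf : SmoothOnSurface m f)
    (hax : AxialScalar m f) {Φ Φ' : ℝ → ℝ}
    (hΦ : ∀ θ, HasDerivAt Φ (Φ' θ) θ) (hΦ' : Continuous Φ') {r : ℝ} (hr : m / 2 < r) :
    HasDerivAt (fun r => r ^ 2 * avg fun θ => Φ θ * radComp (fun i => PenrosePerturbation.partialD i f) r θ)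
      (r ^ 2 * avg (fun θ => Φ θ * ∑ i, PenrosePerturbation.partialD i
          (PenrosePerturbation.partialD i f) (r • eR θ))
        + r * avg (fun θ => Φ' θ * polComp (fun i => PenrosePerturbation.partialD i f) r θ)) r :=
  hasDerivAt_flux hm (fun i => hf.partialD i) (fun _ hr θ => hf.gradient_axial hm hax hr θ)
    hΦ hΦ' hr

theorem SmoothOnSurface.hasDerivAt_avg_mul (hm : 0 < m) (hf : SmoothOnSurface m f) {Φ : ℝ → ℝ}
    (hΦ : Continuous Φ) {r : ℝ} (hr : m / 2 < r) :
    HasDerivAt (fun r => avg fun θ => Φ θ * f (r • eR θ))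
      (avg fun θ => Φ θ * radComp (fun i => PenrosePerturbation.partialD i f) r θ) r := by
  have hs : ContinuousOn (fun p : ℝ × ℝ => sin p.2) (Set.Ici (m / 2) ×ˢ Set.univ) := by fun_prop
  have hc : ContinuousOn (fun p : ℝ × ℝ => cos p.2) (Set.Ici (m / 2) ×ˢ Set.univ) := by fun_prop
  have hΦ2 : ContinuousOn (fun p : ℝ × ℝ => Φ p.2) (Set.Ici (m / 2) ×ˢ Set.univ) :=
    (hΦ.comp continuous_snd).continuousOn
  exact hasDerivAt_avg (F := fun r θ => Φ θ * f (r • eR θ))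
    (F' := fun r θ => Φ θ * radComp (fun i => PenrosePerturbation.partialD i f) r θ)
    (hΦ2.mul (hf.continuousOn_mer hm))
    (hΦ2.mul ((hs.mul ((hf.partialD 0).continuousOn_mer hm)).add
      (hc.mul ((hf.partialD 2).continuousOn_mer hm))))
    (fun r hr θ => (hf.hasDerivAt_radial hm hr.le θ).const_mul _) hr

end Flux

/-! ### Legendre moments of solutions of the linearized momentum constraint -/

/-- The linearized momentum constraint on a Schwarzschild background. -/
structure IsLinearData (m : ℝ) (B : E3 → Tensor2) (b : E3 → ℝ) : Prop extends IsAxialTT m B where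
  smooth_b : SmoothOnSurface m b
  axial_b : AxialScalar m b
  momentum : ∀ x ∈ surface m, ∀ j, divT B j x = 2 / 3 * psi0 m ‖x‖ ^ 6 * partialD j b x

def momRR (B : E3 → Tensor2) (n : ℕ) (r : ℝ) : ℝ := legMoment (frRR B r) n

def momH (b : E3 → ℝ) (n : ℕ) (r : ℝ) : ℝ := legMoment (fun θ => b (r • eR θ)) n

/-- The weight is minus the θ-derivative of Pₙ(cos θ): the vector harmonic adapted to the mixed
component. -/
def momRT (B : E3 → Tensor2) (n : ℕ) (r : ℝ) : ℝ :=
  avg fun θ => frRT B r θ * (sin θ * (legendrePoly n).derivative.eval (cos θ))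

/-- The weight sin²θ Pₙ'' is the trace-free Hessian harmonic, which is trivial for n = 0 and n = 1.
-/
def momQ (B : E3 → Tensor2) (n : ℕ) (r : ℝ) : ℝ :=
  avg fun θ => frQ B r θ * (sin θ ^ 2 * (legendrePoly n).derivative.derivative.eval (cos θ))

/-- Subtracting ⅔ψ₀⁶b absorbs the derivative of b in the momentum constraint, so that only b itself
remains in the radial equation. The same combination appears in the linearized boundary condition.
-/
def momT (m : ℝ) (B : E3 → Tensor2) (b : E3 → ℝ) (n : ℕ) (r : ℝ) : ℝ :=
  momRR B n r - 2 / 3 * psi0 m r ^ 6 * momH b n r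

theorem hasDerivAt_psi0 {m r : ℝ} (hr : r ≠ 0) :
    HasDerivAt (psi0 m) (-(m / (2 * r ^ 2))) r := by
  have h := ((hasDerivAt_const r m).div ((hasDerivAt_id r).const_mul 2)
    (by simpa using hr)).const_add 1
  refine h.congr_deriv ?_
  simp only [id]
  field_simp
  ring

theorem legendre_eval_ode (n : ℕ) (z : ℝ) :
    2 * z * (legendrePoly n).derivative.eval z
      - (1 - z ^ 2) * (legendrePoly n).derivative.derivative.eval z
      = 2 * capN n * (legendrePoly n).eval z := by
  have h := congrArg (Polynomial.eval z) (legendre_ode n)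
  simp only [Polynomial.derivative_mul, Polynomial.derivative_sub, Polynomial.derivative_one,
    Polynomial.derivative_X_sq, Polynomial.eval_add, Polynomial.eval_mul, Polynomial.eval_sub,
    Polynomial.eval_one, Polynomial.eval_pow, Polynomial.eval_X, Polynomial.eval_neg,
    Polynomial.eval_C, Polynomial.eval_zero] at h
  linarith

section Moments
variable {m : ℝ} {B : E3 → Tensor2} {b : E3 → ℝ}

theorem IsLinearData.hasDerivAt_momH (hm : 0 < m) (hB : IsLinearData m B b) (n : ℕ) {r : ℝ}
    (hr : m / 2 < r) : HasDerivAt (momH b n)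
      (avg fun θ => (legendrePoly n).eval (cos θ) * radComp (fun i => partialD i b) r θ) r := by
  have h := hB.smooth_b.hasDerivAt_avg_mul hm (continuous_eval_cos (legendrePoly n)) hr
  simp only [mul_comm (Polynomial.eval _ _) (b _)] at h
  exact h

/-- This is the flux identity for the position field with weight Pₙ. The term in ∂_r b is absorbed
into the derivative of r³ψ₀⁶b, and the remainder comes from (r³ψ₀⁶)' = 3αr²ψ₀⁵. -/
theorem IsLinearData.hasDerivAt_momT (hm : 0 < m) (hB : IsLinearData m B b) (n : ℕ) {r : ℝ}
    (hr : m / 2 < r) : HasDerivAt (fun r => r ^ 3 * momT m B b n r)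
      (-(r ^ 2 * momRT B n r) - 2 * alphaFn m r * r ^ 2 * psi0 m r ^ 5 * momH b n r) r := by
  have hr0 : 0 < r := by linarith
  have h1 := hB.toIsAxialTT.hasDerivAt_flux_position hm (hasDerivAt_eval_cos (legendrePoly n))
    ((continuous_sin.mul (continuous_eval_cos _)).neg) hr
  have h2 := hB.hasDerivAt_momH hm n hr
  have h3 := (((hasDerivAt_pow 3 r).mul ((hasDerivAt_psi0 (m := m) hr0.ne').pow 6)).const_mul
    (2 / 3)).mul h2
  refine ((h1.sub h3).congr_deriv ?_).congr_of_eventuallyEq (Eventually.of_forall fun s => ?_)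
  · have e1 : ∀ θ, (legendrePoly n).eval (cos θ)
        * (sin θ * divT B 0 (r • eR θ) + cos θ * divT B 2 (r • eR θ))
        = 2 / 3 * psi0 m r ^ 6
          * ((legendrePoly n).eval (cos θ) * radComp (fun i => partialD i b) r θ) := by
      intro θ
      rw [hB.momentum _ (smul_eR_mem hm hr.le θ), hB.momentum _ (smul_eR_mem hm hr.le θ),
        norm_smul_eR hr0.le, radComp]
      ring
    have e2 : ∀ θ, -(sin θ * (legendrePoly n).derivative.eval (cos θ)) * frRT B r θ
        = -(frRT B r θ * (sin θ * (legendrePoly n).derivative.eval (cos θ))) := fun θ => by ring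
    simp only [e1, e2, avg_const_mul, avg_neg, Pi.mul_apply, Pi.pow_apply]
    change _ + r ^ 2 * -momRT B n r - _ = _
    simp only [alphaFn, psi0]
    push_cast
    field_simp
    ring
  · simp only [momT, momRR, legMoment, Pi.sub_apply, Pi.mul_apply, Pi.pow_apply,
      mul_comm (Polynomial.eval _ _) (frRR _ _ _)]
    ring

/-- The field ∂_θ is singular on the axis, so the mixed component is reached as a difference of two
regular fluxes: the position field with weight cos θ Pₙ', minus r times the axis field with weight
Pₙ'. The radial components cancel and sin θ Pₙ' times the mixed one is left. The angular derivative
of b is integrated by parts and produces the term in N b. -/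
theorem IsLinearData.hasDerivAt_momRT (hm : 0 < m) (hB : IsLinearData m B b) (n : ℕ) {r : ℝ}
    (hr : m / 2 < r) : HasDerivAt (fun r => r ^ 3 * momRT B n r)
      (-(r ^ 2 * (capN n * momT m B b n r + 2 * capN n * psi0 m r ^ 6 * momH b n r
        + momQ B n r))) r := by
  have hr0 : 0 < r := by linarith
  have hBT := hB.toIsAxialTT
  set P := legendrePoly n with hP
  set p1 : ℝ → ℝ := fun θ => P.derivative.eval (cos θ) with hp1
  set p2 : ℝ → ℝ := fun θ => P.derivative.derivative.eval (cos θ) with hp2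
  have cp0 : Continuous fun θ => P.eval (cos θ) := continuous_eval_cos _
  have cp1 : Continuous p1 := continuous_eval_cos _
  have cp2 : Continuous p2 := continuous_eval_cos _
  have cRR := continuous_slice (hBT.frRR_continuousOn hm) hr.le
  have cRT := continuous_slice (hBT.frRT_continuousOn hm) hr.le
  have cTT := continuous_slice (hBT.frTT_continuousOn hm) hr.le
  have cQ := continuous_slice (hBT.frQ_continuousOn hm) hr.le
  have cb := hB.smooth_b.continuous_mer hm hr.le
  have cb0 := (hB.smooth_b.partialD 0).continuous_mer hm hr.le
  have cb2 := (hB.smooth_b.partialD 2).continuous_mer hm hr.le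
  have d1 : ∀ θ, HasDerivAt p1 (-(sin θ * p2 θ)) θ := hasDerivAt_eval_cos P.derivative
  have hA := hBT.hasDerivAt_flux_position hm (Φ := fun θ => cos θ * p1 θ)
    (fun θ => (hasDerivAt_cos θ).mul (d1 θ)) (by fun_prop) hr
  have hZ := hBT.hasDerivAt_flux_axis hm d1 (by fun_prop) hr
  have hZ' := (hasDerivAt_id r).mul hZ
  refine ((hA.sub hZ').congr_deriv ?_).congr_of_eventuallyEq ?_
  · have hbr : ∀ θ, divT B 0 (r • eR θ) = 2 / 3 * psi0 m r ^ 6 * partialD 0 b (r • eR θ) ∧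
        divT B 2 (r • eR θ) = 2 / 3 * psi0 m r ^ 6 * partialD 2 b (r • eR θ) := by
      intro θ
      rw [hB.momentum _ (smul_eR_mem hm hr.le θ), hB.momentum _ (smul_eR_mem hm hr.le θ),
        norm_smul_eR hr0.le]
      exact ⟨rfl, rfl⟩
    simp only [hbr, id]
    -- integration by parts for the angular derivative of `b`
    have hparts : r * avg (fun θ => sin θ * p1 θ
          * (cos θ * partialD 0 b (r • eR θ) - sin θ * partialD 2 b (r • eR θ)))
        = -(2 * capN n * momH b n r) := by
      have hu : ∀ θ, HasDerivAt (fun θ => sin θ ^ 2 * p1 θ)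
          (sin θ * (b (r • eR θ) * 0 + (2 * cos θ * p1 θ - sin θ ^ 2 * p2 θ))) θ := fun θ =>
        (((hasDerivAt_sin θ).pow 2).mul (d1 θ)).congr_deriv (by
          simp only [Pi.pow_apply, Nat.cast_ofNat]; ring)
      have hint := intervalIntegral.integral_mul_deriv_eq_deriv_mul (a := 0) (b := π)
        (fun θ _ => hu θ) (fun θ _ => hB.smooth_b.hasDerivAt_polar hm hr.le θ)
        ((continuous_sin.mul ((cb.mul continuous_const).add (by fun_prop))).intervalIntegrable _ _)
        ((continuous_const.mul ((continuous_cos.mul cb0).sub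
          (continuous_sin.mul cb2))).intervalIntegrable _ _)
      have e1 : avg (fun θ => sin θ * p1 θ
          * (cos θ * partialD 0 b (r • eR θ) - sin θ * partialD 2 b (r • eR θ)))
          = 1 / 2 * ∫ θ in (0 : ℝ)..π, sin θ ^ 2 * p1 θ
            * (cos θ * partialD 0 b (r • eR θ) - sin θ * partialD 2 b (r • eR θ)) := by
        rw [avg]; congr 2; funext θ; ring
      have e2 : ∫ θ in (0 : ℝ)..π, sin θ * (b (r • eR θ) * 0 + (2 * cos θ * p1 θ
            - sin θ ^ 2 * p2 θ)) * b (r • eR θ) = 2 * (2 * capN n * momH b n r) := by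
        have : ∀ I : ℝ, 2 * (2 * capN n * (1 / 2 * I)) = 2 * capN n * I := fun I => by ring
        rw [momH, legMoment, avg, this, ← intervalIntegral.integral_const_mul]
        congr 1
        funext θ
        have := legendre_eval_ode n (cos θ)
        rw [← sin_sq] at this
        linear_combination sin θ * b (r • eR θ) * this
      rw [e2, sin_pi, sin_zero] at hint
      have e3 : ∫ θ in (0 : ℝ)..π, sin θ ^ 2 * p1 θ
            * (r * (cos θ * partialD 0 b (r • eR θ) - sin θ * partialD 2 b (r • eR θ)))
          = r * ∫ θ in (0 : ℝ)..π, sin θ ^ 2 * p1 θ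
            * (cos θ * partialD 0 b (r • eR θ) - sin θ * partialD 2 b (r • eR θ)) := by
        rw [← intervalIntegral.integral_const_mul]; congr 1; funext θ; ring
      rw [e3] at hint
      rw [e1]
      linear_combination (1 / 2 : ℝ) * hint
    have hb1 : avg (fun θ => cos θ * p1 θ * (sin θ * (2 / 3 * psi0 m r ^ 6 * partialD 0 b (r • eR θ))
          + cos θ * (2 / 3 * psi0 m r ^ 6 * partialD 2 b (r • eR θ))))
        - avg (fun θ => p1 θ * (2 / 3 * psi0 m r ^ 6 * partialD 2 b (r • eR θ)))
        = 2 / 3 * psi0 m r ^ 6 * avg (fun θ => sin θ * p1 θ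
          * (cos θ * partialD 0 b (r • eR θ) - sin θ * partialD 2 b (r • eR θ))) := by
      rw [← avg_sub (by fun_prop) (by fun_prop), ← avg_const_mul]
      congr 1
      funext θ
      linear_combination 2 / 3 * psi0 m r ^ 6 * p1 θ * partialD 2 b (r • eR θ)
        * sin_sq_add_cos_sq θ
    have hang : avg (fun θ => (-sin θ * p1 θ + cos θ * -(sin θ * p2 θ)) * frRT B r θ)
        - avg (fun θ => p1 θ * (cos θ * frRR B r θ - sin θ * frRT B r θ))
        - avg (fun θ => -(sin θ * p2 θ) * (cos θ * frRT B r θ - sin θ * frTT B r θ))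
        = -momQ B n r - capN n * momRR B n r := by
      -- The diagonal polar component is Q - ½RR; its RR part combines with the other radial terms
      -- through Legendre's equation.
      rw [← avg_sub (by fun_prop) (by fun_prop), ← avg_sub (by fun_prop) (by fun_prop), momQ,
        momRR, legMoment, ← avg_neg, ← avg_const_mul, ← avg_sub (by fun_prop) (by fun_prop)]
      congr 1
      funext θ
      have h1 := legendre_eval_ode n (cos θ)
      rw [← sin_sq] at h1
      rw [hBT.frTT_eq hm hr.le]
      linear_combination (-(frRR B r θ / 2)) * h1
    rw [momT]
    linear_combination r ^ 3 * hb1 + r ^ 2 * hang + 2 / 3 * psi0 m r ^ 6 * r ^ 2 * hparts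
  · filter_upwards [lt_mem_nhds hr] with s hs
    have cRR := continuous_slice (hBT.frRR_continuousOn hm) hs.le
    have cRT := continuous_slice (hBT.frRT_continuousOn hm) hs.le
    have e : momRT B n s = avg (fun θ => cos θ * p1 θ * frRR B s θ)
        - avg (fun θ => p1 θ * (cos θ * frRR B s θ - sin θ * frRT B s θ)) := by
      rw [← avg_sub (by fun_prop) (by fun_prop), momRT]
      congr 1
      funext θ
      ring
    simp only [Pi.sub_apply, Pi.mul_apply, id, e]
    ring

end Moments

/-! ### The radial system for a single Legendre mode -/

section Mode
variable {m : ℝ}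

theorem psi0_pos {r : ℝ} (hm : 0 < m) (hr : m / 2 ≤ r) : 0 < psi0 m r := by
  have : 0 < r := by linarith
  unfold psi0; positivity

theorem one_le_psi0 {r : ℝ} (hm : 0 < m) (hr : m / 2 ≤ r) : 1 ≤ psi0 m r := by
  have : 0 < r := by linarith
  have : 0 ≤ m / (2 * r) := by positivity
  unfold psi0; linarith

theorem psi0_le_two {r : ℝ} (hm : 0 < m) (hr : m / 2 ≤ r) : psi0 m r ≤ 2 := by
  have hr0 : 0 < r := by linarith
  have : m / (2 * r) ≤ 1 := by rw [div_le_one (by positivity)]; linarith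
  unfold psi0; linarith

theorem alphaFn_eq (r : ℝ) : alphaFn m r = 2 - psi0 m r := by
  unfold alphaFn psi0; ring

theorem alphaFn_nonneg {r : ℝ} (hm : 0 < m) (hr : m / 2 ≤ r) : 0 ≤ alphaFn m r := by
  rw [alphaFn_eq]; linarith [psi0_le_two hm hr]

theorem alphaFn_pos {r : ℝ} (hm : 0 < m) (hr : m / 2 < r) : 0 < alphaFn m r := by
  have hr0 : 0 < r := by linarith
  have : m / (2 * r) < 1 := by rw [div_lt_one (by positivity)]; linarith
  unfold alphaFn; linarith

theorem alphaFn_le_one {r : ℝ} (hm : 0 < m) (hr : m / 2 ≤ r) : alphaFn m r ≤ 1 := by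
  rw [alphaFn_eq]; linarith [one_le_psi0 hm hr]

theorem eq_mul_psi0_sub_one {r : ℝ} (hr : r ≠ 0) : m = 2 * r * (psi0 m r - 1) := by
  unfold psi0; field_simp; ring

/-- `r ψ₀ β`. -/
def kappaFn (m N r : ℝ) : ℝ := (N - 1) * r * psi0 m r ^ 2 + 3 * m

theorem kappaFn_pos {N r : ℝ} (hm : 0 < m) (hN : 1 ≤ N) (hr : m / 2 ≤ r) : 0 < kappaFn m N r := by
  have h1 : 0 < r := by linarith
  have h2 := psi0_pos hm hr
  have h3 : 0 ≤ N - 1 := by linarith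
  unfold kappaFn; positivity

/-- The mode of `Y` in terms of the mode of the mixed component. -/
def modeY (m N : ℝ) (σ : ℝ → ℝ) (r : ℝ) : ℝ := -(r ^ 3 * σ r) / (2 * N * r * psi0 m r ^ 3)

/-- The mode of `X`. -/
def modeX (m N : ℝ) (t σ : ℝ → ℝ) (r : ℝ) : ℝ :=
  r ^ 3 * t r / (2 * r * psi0 m r ^ 2) + alphaFn m r * modeY m N σ r

theorem hasDerivAt_alphaFn {r : ℝ} (hr : r ≠ 0) :
    HasDerivAt (alphaFn m) (m / (2 * r ^ 2)) r := by
  have h := (hasDerivAt_psi0 (m := m) hr).const_sub 2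
  have e : alphaFn m = fun r => 2 - psi0 m r := funext fun r => alphaFn_eq r
  rw [e]
  simpa using h

variable {N : ℝ} {t σ q b : ℝ → ℝ} {r : ℝ}

/-- The weights in X are chosen so that b disappears: it enters (r³t)'/(2rψ₀²) as -αrψ₀³b and α
times the derivative of Y as +αrψ₀³b. -/
theorem hasDerivAt_modeX (hm : 0 < m) (hN : 0 < N) (hr : m / 2 < r)
    (ht : HasDerivAt (fun r => r ^ 3 * t r)
      (-(r ^ 2 * σ r) - 2 * alphaFn m r * r ^ 2 * psi0 m r ^ 5 * b r) r)
    (hσ : HasDerivAt (fun r => r ^ 3 * σ r)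
      (-(r ^ 2 * (N * t r + 2 * N * psi0 m r ^ 6 * b r + q r))) r) :
    HasDerivAt (modeX m N t σ) (kappaFn m N r * modeY m N σ r / (r ^ 2 * psi0 m r)
      + alphaFn m r * r * q r / (2 * N * psi0 m r ^ 3)) r := by
  have hr0 : 0 < r := by linarith
  have hp := psi0_pos hm hr.le
  have dp := hasDerivAt_psi0 (m := m) hr0.ne'
  have d1 := ((hasDerivAt_id r).const_mul 2).mul (dp.pow 2)
  have d2 := ((hasDerivAt_id r).const_mul (2 * N)).mul (dp.pow 3)
  have hx := (ht.div d1 (by simp only [Pi.mul_apply, Pi.pow_apply, id]; positivity)).add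
    ((hasDerivAt_alphaFn (m := m) hr0.ne').mul
    (hσ.neg.div d2 (by simp only [Pi.mul_apply, Pi.pow_apply, id]; positivity)))
  refine hx.congr_deriv ?_
  simp only [Pi.mul_apply, Pi.pow_apply, Pi.div_apply, Pi.neg_apply, id, modeY, kappaFn, alphaFn_eq]
  have hmr := eq_mul_psi0_sub_one (m := m) hr0.ne'
  generalize psi0 m r = p at *
  subst hmr
  field_simp
  ring

/-- The function whose derivative accounts for the non-square part of the energy of a mode. -/
def modePotential (m N : ℝ) (t σ : ℝ → ℝ) (r : ℝ) : ℝ :=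
  -(1 / 2) * (r ^ 3 * t r) ^ 2 / (psi0 m r ^ 6 * r ^ 3)
    + 2 * N * modeX m N t σ r ^ 2 / kappaFn m N r

theorem hasDerivAt_inv_cube (hm : 0 < m) (hr : m / 2 < r) :
    HasDerivAt (fun r => 1 / (psi0 m r ^ 6 * r ^ 3))
      (-3 * alphaFn m r / (psi0 m r ^ 7 * r ^ 4)) r := by
  have hr0 : 0 < r := by linarith
  have hp := psi0_pos hm hr.le
  have h := (hasDerivAt_const r (1 : ℝ)).div (((hasDerivAt_psi0 (m := m) hr0.ne').pow 6).mul
    (hasDerivAt_pow 3 r)) (by simp only [Pi.mul_apply, Pi.pow_apply]; positivity)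
  refine h.congr_deriv ?_
  simp only [Pi.mul_apply, Pi.pow_apply, alphaFn_eq]
  have hmr := eq_mul_psi0_sub_one (m := m) hr0.ne'
  generalize psi0 m r = p at *
  subst hmr
  push_cast
  field_simp
  ring

/-- Stated before completing the square, so without division by N - 1; it therefore also covers the
dipole N = 1. -/
theorem hasDerivAt_modePotential (hm : 0 < m) (hN : 1 ≤ N) (hr : m / 2 < r)
    (ht : HasDerivAt (fun r => r ^ 3 * t r)
      (-(r ^ 2 * σ r) - 2 * alphaFn m r * r ^ 2 * psi0 m r ^ 5 * b r) r)
    (hσ : HasDerivAt (fun r => r ^ 3 * σ r)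
      (-(r ^ 2 * (N * t r + 2 * N * psi0 m r ^ 6 * b r + q r))) r) :
    HasDerivAt (modePotential m N t σ)
      (r ^ 2 * alphaFn m r * (3 / 2 * t r ^ 2 / psi0 m r ^ 7 + 2 * (t r * b r) / psi0 m r
          + 2 * (σ r ^ 2 / (2 * N)) / psi0 m r ^ 7)
        + 2 * alphaFn m r * r * modeX m N t σ r * q r / (kappaFn m N r * psi0 m r ^ 3)
        - 2 * N * (N - 1) * alphaFn m r * psi0 m r * modeX m N t σ r ^ 2 / kappaFn m N r ^ 2) r := by
  have hr0 : 0 < r := by linarith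
  have hp := psi0_pos hm hr.le
  have hk := kappaFn_pos hm hN hr.le
  have hX := hasDerivAt_modeX hm (by linarith) hr ht hσ
  have hK : HasDerivAt (kappaFn m N) ((N - 1) * psi0 m r * alphaFn m r) r := by
    have h := ((((hasDerivAt_id r).const_mul (N - 1)).mul
      ((hasDerivAt_psi0 (m := m) hr0.ne').pow 2)).add_const (3 * m))
    refine h.congr_deriv ?_
    simp only [Pi.pow_apply, id, alphaFn_eq]
    have hmr := eq_mul_psi0_sub_one (m := m) hr0.ne'
    generalize psi0 m r = p at *
    subst hmr
    push_cast
    field_simp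
    ring
  have h1 := ((ht.pow 2).const_mul (-(1 / 2))).mul (hasDerivAt_inv_cube hm hr)
  have h2 := ((hX.pow 2).const_mul (2 * N)).div hK hk.ne'
  refine ((h1.add h2).congr_deriv ?_).congr_of_eventuallyEq (Eventually.of_forall fun s => ?_)
  · simp only [Pi.pow_apply]
    have hY : -(r ^ 2 * σ r) = 2 * N * psi0 m r ^ 3 * modeY m N σ r := by
      rw [modeY]; field_simp
    have hT : r ^ 2 * t r = 2 * psi0 m r ^ 2 * (modeX m N t σ r - alphaFn m r * modeY m N σ r) := by
      rw [modeX]; field_simp; ring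
    have hN0 : N ≠ 0 := by linarith
    -- After t and σ are expressed through X and Y, the claim is an identity of rational functions
    -- in which ψ₀, α and κ may be treated as independent.
    have eσ : σ r = -(2 * N * psi0 m r ^ 3 * modeY m N σ r) / r ^ 2 := by
      rw [← hY]; field_simp
    have et : t r = 2 * psi0 m r ^ 2 * (modeX m N t σ r - alphaFn m r * modeY m N σ r) / r ^ 2 := by
      rw [← hT]; field_simp
    rw [eσ, et]
    generalize modeX m N t σ r = x
    generalize modeY m N σ r = y
    generalize kappaFn m N r = κ at *
    generalize alphaFn m r = α
    generalize psi0 m r = p at *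
    push_cast
    field_simp
    ring
  · simp only [modePotential, Pi.add_apply, Pi.mul_apply, Pi.div_apply, Pi.pow_apply]
    ring

/-- The square completing the energy of a mode with `N > 1`. -/
def modeSquare (m N : ℝ) (t σ q : ℝ → ℝ) (r : ℝ) : ℝ :=
  alphaFn m r * r ^ 2 / (2 * N * (N - 1) * psi0 m r ^ 7)
    * (q r - 2 * N * (N - 1) * psi0 m r ^ 4 * modeX m N t σ r / (r * kappaFn m N r)) ^ 2

/-- The energy density of a mode. -/
def modeDensity (m N : ℝ) (t σ q b : ℝ → ℝ) (r : ℝ) : ℝ :=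
  r ^ 2 * alphaFn m r * (3 / 2 * t r ^ 2 / psi0 m r ^ 7 + 2 * (t r * b r) / psi0 m r
    + 2 * (σ r ^ 2 / (2 * N) + q r ^ 2 / (4 * N * (N - 1))) / psi0 m r ^ 7)

/-- For N > 1 the density contains q² with a positive coefficient. Together with the cross term Xq
and the term in X² from κ' it forms exactly the perfect square `modeSquare`. -/
theorem hasDerivAt_modePotential_of_one_lt (hm : 0 < m) (hN : 1 < N) (hr : m / 2 < r)
    (ht : HasDerivAt (fun r => r ^ 3 * t r)
      (-(r ^ 2 * σ r) - 2 * alphaFn m r * r ^ 2 * psi0 m r ^ 5 * b r) r)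
    (hσ : HasDerivAt (fun r => r ^ 3 * σ r)
      (-(r ^ 2 * (N * t r + 2 * N * psi0 m r ^ 6 * b r + q r))) r) :
    HasDerivAt (modePotential m N t σ)
      (modeDensity m N t σ q b r - modeSquare m N t σ q r) r := by
  have hr0 : 0 < r := by linarith
  have hp := psi0_pos hm hr.le
  have hk := kappaFn_pos hm hN.le hr.le
  have hN1 : N - 1 ≠ 0 := by linarith
  have hN0 : N ≠ 0 := by linarith
  refine (hasDerivAt_modePotential hm hN.le hr ht hσ).congr_deriv ?_
  rw [modeDensity, modeSquare]
  generalize modeX m N t σ r = x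
  generalize kappaFn m N r = κ at *
  generalize alphaFn m r = α
  generalize psi0 m r = p at *
  field_simp
  ring

/-- With q = 0 and N = 1 every term of the square is absent, including the quotient q²/(N - 1),
which is zero by convention. -/
theorem hasDerivAt_modePotential_one (hm : 0 < m) (hr : m / 2 < r) (hq : q r = 0)
    (ht : HasDerivAt (fun r => r ^ 3 * t r)
      (-(r ^ 2 * σ r) - 2 * alphaFn m r * r ^ 2 * psi0 m r ^ 5 * b r) r)
    (hσ : HasDerivAt (fun r => r ^ 3 * σ r)
      (-(r ^ 2 * (1 * t r + 2 * 1 * psi0 m r ^ 6 * b r + q r))) r) :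
    HasDerivAt (modePotential m 1 t σ) (modeDensity m 1 t σ q b r) r := by
  refine (hasDerivAt_modePotential hm le_rfl hr ht hσ).congr_deriv ?_
  rw [modeDensity, hq]
  simp

/-- There is no mixed component for N = 0, so the first summand of the potential alone has the
density as its derivative. -/
theorem hasDerivAt_modePotential_zero (hm : 0 < m) (hr : m / 2 < r) (hq : q r = 0) (hs : σ r = 0)
    (ht : HasDerivAt (fun r => r ^ 3 * t r)
      (-(r ^ 2 * σ r) - 2 * alphaFn m r * r ^ 2 * psi0 m r ^ 5 * b r) r) :
    HasDerivAt (fun r => -(1 / 2) * (r ^ 3 * t r) ^ 2 * (1 / (psi0 m r ^ 6 * r ^ 3)))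
      (modeDensity m 0 t σ q b r) r := by
  have hr0 : 0 < r := by linarith
  have hp := psi0_pos hm hr.le
  have h1 := ((ht.pow 2).const_mul (-(1 / 2))).mul (hasDerivAt_inv_cube hm hr)
  refine h1.congr_deriv ?_
  rw [modeDensity, hq, hs]
  simp only [Pi.pow_apply]
  generalize alphaFn m r = α
  generalize psi0 m r = p at *
  push_cast
  field_simp
  ring

end Mode

/-! ### Decay in the radius -/

/-- `f = O(r⁻ᵏ)` as `r → ∞`. -/
def Decays (k : ℕ) (f : ℝ → ℝ) : Prop := f =O[atTop] fun r : ℝ => (r ^ k)⁻¹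

section Decay
variable {k l : ℕ} {f g : ℝ → ℝ}

theorem Decays.mul (hf : Decays k f) (hg : Decays l g) : Decays (k + l) fun r => f r * g r := by
  have := IsBigO.mul hf hg
  refine this.congr_right fun r => ?_
  rw [pow_add, mul_inv]

theorem Decays.add (hf : Decays k f) (hg : Decays k g) : Decays k fun r => f r + g r :=
  IsBigO.add hf hg

theorem Decays.sub (hf : Decays k f) (hg : Decays k g) : Decays k fun r => f r - g r :=
  IsBigO.sub hf hg

theorem Decays.const_mul (c : ℝ) (hf : Decays k f) : Decays k fun r => c * f r :=
  IsBigO.const_mul_left hf c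

theorem Decays.sq (hf : Decays k f) : Decays (2 * k) fun r => f r ^ 2 := by
  have := hf.mul hf
  rw [two_mul]
  simpa only [_root_.sq] using this

theorem Decays.of_succ_pow (n : ℕ) (hf : Decays (k + n) f) : Decays k fun r => r ^ n * f r := by
  have h : (fun r : ℝ => r ^ n) =O[atTop] fun r : ℝ => r ^ n := isBigO_refl _ _
  refine (h.mul hf).congr' EventuallyEq.rfl ?_
  filter_upwards [eventually_gt_atTop 0] with r hr
  rw [pow_add]
  field_simp

theorem Decays.mono (hf : Decays k f) (h : l ≤ k) : Decays l f := by
  refine IsBigO.trans hf (IsBigO.of_bound 1 ?_)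
  filter_upwards [eventually_ge_atTop 1] with r hr
  have hr0 : 0 < r := by linarith
  rw [one_mul, Real.norm_of_nonneg (by positivity), Real.norm_of_nonneg (by positivity)]
  exact inv_anti₀ (by positivity) (pow_le_pow_right₀ hr h)

theorem decays_zero_of_tendsto {c : ℝ} (hf : Tendsto f atTop (𝓝 c)) : Decays 0 f := by
  have := hf.isBigO_one ℝ
  simpa [Decays] using this

theorem Decays.tendsto_zero (hf : Decays k f) (hk : 0 < k) : Tendsto f atTop (𝓝 0) :=
  IsBigO.trans_tendsto hf (tendsto_inv_atTop_zero.comp (tendsto_pow_atTop hk.ne'))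

theorem decays_of_bound {a C : ℝ} (h : ∀ r, a ≤ r → |f r| ≤ C / r ^ k) : Decays k f := by
  refine IsBigO.of_bound C ?_
  filter_upwards [eventually_ge_atTop a, eventually_gt_atTop 0] with r hr h0
  have := h r hr
  rw [Real.norm_eq_abs, Real.norm_of_nonneg (by positivity), ← div_eq_mul_inv]
  exact this

theorem Decays.integrableOn {a : ℝ} (hf : Decays 2 f) (hc : ContinuousOn f (Set.Ici a)) :
    IntegrableOn f (Set.Ioi a) := by
  have h1 : LocallyIntegrableOn f (Set.Ici a) := hc.locallyIntegrableOn measurableSet_Ici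
  have hg : IntegrableAtFilter (fun r : ℝ => (r ^ 2)⁻¹) atTop := by
    refine ⟨Set.Ioi 1, Ioi_mem_atTop 1, ?_⟩
    have := integrableOn_Ioi_rpow_of_lt (a := -2) (by norm_num) (zero_lt_one (α := ℝ))
    refine this.congr_fun (fun r hr => ?_) measurableSet_Ioi
    have hr0 : (0 : ℝ) < r := zero_lt_one.trans hr
    simp only
    rw [Real.rpow_neg hr0.le]
    norm_cast
  exact (h1.integrableOn_of_isBigO_atTop hf hg).mono_set Set.Ioi_subset_Ici_self

end Decay

/-! ### Background functions ψ₀, α and κ at infinity and on the horizon. -/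

section Background
variable {m : ℝ}

theorem tendsto_psi0 : Tendsto (psi0 m) atTop (𝓝 1) := by
  have h : Tendsto (fun r : ℝ => m / (2 * r)) atTop (𝓝 0) :=
    tendsto_const_nhds.div_atTop (tendsto_id.const_mul_atTop two_pos)
  have := h.const_add 1
  rw [add_zero] at this
  exact this

theorem tendsto_alphaFn : Tendsto (alphaFn m) atTop (𝓝 1) := by
  have := (tendsto_psi0 (m := m)).const_sub 2
  rw [show alphaFn m = fun r => 2 - psi0 m r from funext alphaFn_eq]
  convert this using 2; norm_num

theorem decays_psi0_pow (n : ℕ) : Decays 0 fun r => psi0 m r ^ n :=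
  decays_zero_of_tendsto (tendsto_psi0.pow n)

theorem decays_inv_psi0_pow (n : ℕ) : Decays 0 fun r => (psi0 m r ^ n)⁻¹ :=
  decays_zero_of_tendsto ((tendsto_psi0.pow n).inv₀ (by simp))

theorem decays_alphaFn : Decays 0 (alphaFn m) := decays_zero_of_tendsto tendsto_alphaFn

theorem continuousOn_psi0 (hm : 0 < m) : ContinuousOn (psi0 m) (Set.Ici (m / 2)) := fun r hr =>
  (hasDerivAt_psi0 (by have : m / 2 ≤ r := hr; linarith : 0 < r).ne').continuousAt.continuousWithinAt

theorem continuousOn_alphaFn (hm : 0 < m) : ContinuousOn (alphaFn m) (Set.Ici (m / 2)) := by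
  rw [show alphaFn m = fun r => 2 - psi0 m r from funext alphaFn_eq]
  exact continuousOn_const.sub (continuousOn_psi0 hm)

theorem continuousOn_kappaFn (hm : 0 < m) (N : ℝ) :
    ContinuousOn (kappaFn m N) (Set.Ici (m / 2)) := by
  have := continuousOn_psi0 hm
  unfold kappaFn; fun_prop

/-- Growth of κ needs N > 1; for N = 1 it is the constant 3m, which is why the dipole keeps a
boundary term at infinity. -/
theorem decays_inv_kappaFn {N : ℝ} (hN : 1 < N) :
    Decays 1 fun r => (kappaFn m N r)⁻¹ := by
  have h1 : Tendsto (fun r => (N - 1) * psi0 m r ^ 2 + 3 * m / r) atTop (𝓝 ((N - 1) * 1 ^ 2 + 0)) :=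
    ((tendsto_psi0.pow 2).const_mul _).add (tendsto_const_nhds.div_atTop tendsto_id)
  have h2 := decays_zero_of_tendsto (h1.inv₀ (by simp; linarith))
  have h3 : Decays 1 fun r : ℝ => r⁻¹ := by
    unfold Decays; simpa using isBigO_refl _ _
  refine (h3.mul h2).congr' ?_ (by simp)
  filter_upwards [eventually_gt_atTop 0] with r hr
  rw [← mul_inv, kappaFn]
  congr 1
  field_simp

theorem psi0_horizon (hm : 0 < m) : psi0 m (m / 2) = 2 := by
  unfold psi0; field_simp; norm_num

theorem alphaFn_horizon (hm : 0 < m) : alphaFn m (m / 2) = 0 := by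
  rw [alphaFn_eq, psi0_horizon hm, sub_self]

end Background

/-! ### Integrals of the mode energies -/

section ModeIntegral
variable {m N : ℝ} {t σ q b : ℝ → ℝ}

theorem continuousOn_modeDensity (hm : 0 < m) (ct : ContinuousOn t (Set.Ici (m / 2)))
    (cσ : ContinuousOn σ (Set.Ici (m / 2))) (cq : ContinuousOn q (Set.Ici (m / 2)))
    (cb : ContinuousOn b (Set.Ici (m / 2))) :
    ContinuousOn (modeDensity m N t σ q b) (Set.Ici (m / 2)) := by
  have h1 := continuousOn_psi0 hm
  have h2 := continuousOn_alphaFn hm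
  have hp : ∀ r ∈ Set.Ici (m / 2), psi0 m r ≠ 0 := fun r hr => (psi0_pos hm hr).ne'
  have hp7 : ∀ r ∈ Set.Ici (m / 2), psi0 m r ^ 7 ≠ 0 := fun r hr => pow_ne_zero _ (hp r hr)
  unfold modeDensity
  fun_prop (disch := assumption)

theorem decays_modeDensity (dt : Decays 2 t) (dσ : Decays 2 σ) (dq : Decays 2 q)
    (db : Decays 2 b) : Decays 2 (modeDensity m N t σ q b) := by
  have e1 := decays_inv_psi0_pow (m := m) 1
  have e7 := decays_inv_psi0_pow (m := m) 7
  have h1 : Decays 4 fun r => 3 / 2 * (t r ^ 2 * (psi0 m r ^ 7)⁻¹) := (dt.sq.mul e7).const_mul _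
  have h2 : Decays 4 fun r => 2 * (t r * b r * (psi0 m r ^ 1)⁻¹) := ((dt.mul db).mul e1).const_mul _
  have h3 : Decays 4 fun r => 2 * ((1 / (2 * N) * σ r ^ 2 + 1 / (4 * N * (N - 1)) * q r ^ 2)
      * (psi0 m r ^ 7)⁻¹) := (((dσ.sq.const_mul _).add (dq.sq.const_mul _)).mul e7).const_mul _
  have h4 := (decays_alphaFn (m := m)).mul ((h1.add h2).add h3)
  refine (Decays.of_succ_pow (k := 2) 2 h4).congr_left fun r => ?_
  rw [modeDensity]
  ring

theorem continuousOn_modeX (hm : 0 < m) (hN : N ≠ 0) (ct : ContinuousOn t (Set.Ici (m / 2)))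
    (cσ : ContinuousOn σ (Set.Ici (m / 2))) :
    ContinuousOn (modeX m N t σ) (Set.Ici (m / 2)) := by
  have h1 := continuousOn_psi0 hm
  have h2 := continuousOn_alphaFn hm
  have hp : ∀ r ∈ Set.Ici (m / 2), psi0 m r ≠ 0 := fun r hr => (psi0_pos hm hr).ne'
  have hr0 : ∀ r ∈ Set.Ici (m / 2), r ≠ 0 := fun r hr =>
    (by have : m / 2 ≤ r := hr; linarith : 0 < r).ne'
  have hp2 : ∀ r ∈ Set.Ici (m / 2), 2 * r * psi0 m r ^ 2 ≠ 0 := fun r hr =>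
    mul_ne_zero (mul_ne_zero two_ne_zero (hr0 r hr)) (pow_ne_zero _ (hp r hr))
  have hp3 : ∀ r ∈ Set.Ici (m / 2), 2 * N * r * psi0 m r ^ 3 ≠ 0 := fun r hr =>
    mul_ne_zero (mul_ne_zero (mul_ne_zero two_ne_zero hN) (hr0 r hr)) (pow_ne_zero _ (hp r hr))
  unfold modeX modeY
  fun_prop (disch := assumption)

theorem decays_modeX (dt : Decays 2 t) (dσ : Decays 2 σ) : Decays 0 (modeX m N t σ) := by
  have h2 := (Decays.of_succ_pow (k := 0) 2 (dt.mul (decays_inv_psi0_pow (m := m) 2))).const_mul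
    (1 / 2)
  have h3 := ((decays_alphaFn (m := m)).mul (Decays.of_succ_pow (k := 0) 2
    (dσ.mul (decays_inv_psi0_pow (m := m) 3)))).const_mul (-(1 / (2 * N)))
  refine (h2.add h3).congr' ?_ EventuallyEq.rfl
  filter_upwards [eventually_gt_atTop 0] with r hr
  rw [modeX, modeY]
  field_simp

theorem continuousOn_modeSquare (hm : 0 < m) (hN : 1 < N) (ct : ContinuousOn t (Set.Ici (m / 2)))
    (cσ : ContinuousOn σ (Set.Ici (m / 2))) (cq : ContinuousOn q (Set.Ici (m / 2))) :
    ContinuousOn (modeSquare m N t σ q) (Set.Ici (m / 2)) := by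
  have h1 := continuousOn_psi0 hm
  have h2 := continuousOn_alphaFn hm
  have h3 := continuousOn_kappaFn hm N
  have h4 := continuousOn_modeX hm (by linarith : N ≠ 0) ct cσ
  have hp : ∀ r ∈ Set.Ici (m / 2), 2 * N * (N - 1) * psi0 m r ^ 7 ≠ 0 := fun r hr => by
    have h5 := psi0_pos hm hr
    have h6 : 0 < N - 1 := by linarith
    have h7 : 0 < N := by linarith
    positivity
  have hk : ∀ r ∈ Set.Ici (m / 2), r * kappaFn m N r ≠ 0 := fun r hr => by
    have h5 := kappaFn_pos hm hN.le hr
    have : 0 < r := by have : m / 2 ≤ r := hr; linarith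
    positivity
  unfold modeSquare
  fun_prop (disch := assumption)

theorem decays_modeSquare (hN : 1 < N) (dt : Decays 2 t) (dσ : Decays 2 σ) (dq : Decays 2 q) :
    Decays 2 (modeSquare m N t σ q) := by
  have hx := decays_modeX (m := m) (N := N) dt dσ
  have h3 : Decays 1 fun r : ℝ => r⁻¹ := by
    unfold Decays; simpa using isBigO_refl _ _
  have h1 : Decays 2 fun r => q r - 2 * N * (N - 1) * (psi0 m r ^ 4 * modeX m N t σ r
      * (r⁻¹ * (kappaFn m N r)⁻¹)) :=
    dq.sub ((((decays_psi0_pow 4).mul hx).mul (h3.mul (decays_inv_kappaFn hN))).const_mul _)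
  have h2 := Decays.of_succ_pow (k := 2) 2
    (((decays_alphaFn (m := m)).mul (decays_inv_psi0_pow (m := m) 7)).mul h1.sq)
  refine (h2.const_mul (1 / (2 * N * (N - 1)))).congr_left fun r => ?_
  rw [modeSquare]
  simp only [div_eq_mul_inv, mul_inv]
  ring

theorem modeSquare_nonneg (hm : 0 < m) (hN : 1 < N) {r : ℝ} (hr : m / 2 ≤ r) :
    0 ≤ modeSquare m N t σ q r := by
  have h1 := psi0_pos hm hr
  have h2 := alphaFn_nonneg hm hr
  have h3 : 0 < N - 1 := by linarith
  have h4 : 0 < N := by linarith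
  unfold modeSquare; positivity

theorem continuousOn_modePotential (hm : 0 < m) (hN : 1 ≤ N)
    (ct : ContinuousOn t (Set.Ici (m / 2))) (cσ : ContinuousOn σ (Set.Ici (m / 2))) :
    ContinuousOn (modePotential m N t σ) (Set.Ici (m / 2)) := by
  have h1 := continuousOn_psi0 hm
  have h3 := continuousOn_kappaFn hm N
  have h4 := continuousOn_modeX hm (by linarith : N ≠ 0) ct cσ
  have hp : ∀ r ∈ Set.Ici (m / 2), psi0 m r ^ 6 * r ^ 3 ≠ 0 := fun r hr => by
    have h5 := psi0_pos hm hr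
    have : 0 < r := by have : m / 2 ≤ r := hr; linarith
    positivity
  have hk : ∀ r ∈ Set.Ici (m / 2), kappaFn m N r ≠ 0 := fun r hr => (kappaFn_pos hm hN hr).ne'
  unfold modePotential
  fun_prop (disch := assumption)

theorem tendsto_cube_mul_sq (dt : Decays 2 t) :
    Tendsto (fun r => -(1 / 2) * (r ^ 3 * t r) ^ 2 / (psi0 m r ^ 6 * r ^ 3)) atTop (𝓝 0) := by
  have h1 := (Decays.of_succ_pow (k := 1) 3 (dt.sq.mul (decays_inv_psi0_pow (m := m) 6))).const_mul
    (-(1 / 2))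
  refine (h1.tendsto_zero one_pos).congr' ?_
  filter_upwards [eventually_gt_atTop 0] with r hr
  field_simp

/-- On the horizon α = 0, ψ₀ = 2 and κ = m(2N + 1), so X is there a multiple of the radial moment
and both summands of the potential are multiples of X². -/
theorem modePotential_horizon (hm : 0 < m) (hN : 1 ≤ N) :
    modePotential m N t σ (m / 2)
      = -(modeX m N t σ (m / 2) ^ 2 * (1 / m - 2 * N / (m * (2 * N + 1)))) := by
  have h1 : (m / 2) ^ 3 * t (m / 2) = 4 * m * modeX m N t σ (m / 2) := by
    rw [modeX, alphaFn_horizon hm, psi0_horizon hm]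
    field_simp
    ring
  rw [modePotential, h1, psi0_horizon hm, kappaFn, psi0_horizon hm]
  have : (N - 1) * (m / 2) * 2 ^ 2 + 3 * m = m * (2 * N + 1) := by ring
  rw [this]
  have : 0 < 2 * N + 1 := by linarith
  field_simp
  ring

/-- The total energy of a mode with `N > 1`. -/
theorem integral_modeDensity (hm : 0 < m) (hN : 1 < N)
    (ct : ContinuousOn t (Set.Ici (m / 2))) (cσ : ContinuousOn σ (Set.Ici (m / 2)))
    (cq : ContinuousOn q (Set.Ici (m / 2))) (cb : ContinuousOn b (Set.Ici (m / 2)))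
    (dt : Decays 2 t) (dσ : Decays 2 σ) (dq : Decays 2 q) (db : Decays 2 b)
    (ht : ∀ r, m / 2 < r → HasDerivAt (fun r => r ^ 3 * t r)
      (-(r ^ 2 * σ r) - 2 * alphaFn m r * r ^ 2 * psi0 m r ^ 5 * b r) r)
    (hσ : ∀ r, m / 2 < r → HasDerivAt (fun r => r ^ 3 * σ r)
      (-(r ^ 2 * (N * t r + 2 * N * psi0 m r ^ 6 * b r + q r))) r) :
    ∫ r in Set.Ioi (m / 2), modeDensity m N t σ q b r
      = modeX m N t σ (m / 2) ^ 2 * (1 / m - 2 * N / (m * (2 * N + 1)))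
        + ∫ r in Set.Ioi (m / 2), modeSquare m N t σ q r := by
  have i1 := (decays_modeDensity (m := m) (N := N) dt dσ dq db).integrableOn
    (continuousOn_modeDensity hm ct cσ cq cb)
  have i2 := (decays_modeSquare (m := m) hN dt dσ dq).integrableOn
    (continuousOn_modeSquare hm hN ct cσ cq)
  have hlim : Tendsto (modePotential m N t σ) atTop (𝓝 0) := by
    have h2 := (((decays_modeX (m := m) (N := N) dt dσ).sq.mul
      (decays_inv_kappaFn (m := m) hN)).const_mul (2 * N)).tendsto_zero one_pos
    have := (tendsto_cube_mul_sq (m := m) dt).add h2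
    rw [add_zero] at this
    refine this.congr fun r => ?_
    rw [modePotential]
    ring
  have h := integral_Ioi_of_hasDerivAt_of_tendsto
    ((continuousOn_modePotential hm hN.le ct cσ) _ Set.self_mem_Ici)
    (fun r hr => hasDerivAt_modePotential_of_one_lt hm hN hr (ht r hr) (hσ r hr)) (i1.sub i2) hlim
  rw [integral_sub i1 i2, modePotential_horizon hm hN.le] at h
  linarith

/-- Since κ = 3m is constant, the potential tends to 2X²/(3m) at infinity, where X tends to half the
limit of r²(t - σ). For the data this limit is the linear momentum. -/
theorem integral_modeDensity_one (hm : 0 < m)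
    (ct : ContinuousOn t (Set.Ici (m / 2))) (cσ : ContinuousOn σ (Set.Ici (m / 2)))
    (cq : ContinuousOn q (Set.Ici (m / 2))) (cb : ContinuousOn b (Set.Ici (m / 2)))
    (dt : Decays 2 t) (dσ : Decays 2 σ) (dq : Decays 2 q) (db : Decays 2 b)
    (ht : ∀ r, m / 2 < r → HasDerivAt (fun r => r ^ 3 * t r)
      (-(r ^ 2 * σ r) - 2 * alphaFn m r * r ^ 2 * psi0 m r ^ 5 * b r) r)
    (hσ : ∀ r, m / 2 < r → HasDerivAt (fun r => r ^ 3 * σ r)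
      (-(r ^ 2 * (1 * t r + 2 * 1 * psi0 m r ^ 6 * b r + q r))) r)
    (hq : ∀ r, q r = 0) {p : ℝ}
    (hp : Tendsto (fun r => 1 / 2 * (r ^ 2 * (t r - σ r))) atTop (𝓝 p)) :
    ∫ r in Set.Ioi (m / 2), modeDensity m 1 t σ q b r
      = 2 * p ^ 2 / (3 * m) + modeX m 1 t σ (m / 2) ^ 2 * (1 / (3 * m)) := by
  have i1 := (decays_modeDensity (m := m) (N := 1) dt dσ dq db).integrableOn
    (continuousOn_modeDensity hm ct cσ cq cb)
  -- r²t and r²σ are bounded and their coefficients tend to those of the flux, so X and the flux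
  -- have the same limit.
  have hX : Tendsto (modeX m 1 t σ) atTop (𝓝 p) := by
    have e1 : Tendsto (fun r => 1 - 1 / psi0 m r ^ 2) atTop (𝓝 0) := by
      have := ((tendsto_psi0 (m := m)).pow 2).inv₀ (by simp)
      have := this.const_sub 1
      simpa using this
    have e2 : Tendsto (fun r => 1 - alphaFn m r / psi0 m r ^ 3) atTop (𝓝 0) := by
      have := (tendsto_alphaFn (m := m)).div ((tendsto_psi0 (m := m)).pow 3) (by simp)
      have := this.const_sub 1
      simpa using this
    have b1 := Decays.of_succ_pow (k := 0) 2 dt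
    have b2 := Decays.of_succ_pow (k := 0) 2 dσ
    simp only [Decays, pow_zero, inv_one] at b1 b2
    have z1 := (isLittleO_one_iff ℝ).mp (by simpa using b1.mul_isLittleO ((isLittleO_one_iff ℝ).mpr e1))
    have z2 := (isLittleO_one_iff ℝ).mp (by simpa using b2.mul_isLittleO ((isLittleO_one_iff ℝ).mpr e2))
    have h := (hp.sub (z1.const_mul (1 / 2))).add (z2.const_mul (1 / 2))
    simp only [mul_zero, sub_zero, add_zero] at h
    refine h.congr' ?_
    filter_upwards [eventually_ge_atTop (m / 2)] with r hr
    have hr0 : 0 < r := by linarith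
    have := psi0_pos hm hr
    rw [modeX, modeY]
    field_simp
    ring
  have hlim : Tendsto (modePotential m 1 t σ) atTop (𝓝 (2 * p ^ 2 / (3 * m))) := by
    have h2 := ((hX.pow 2).const_mul 2).div_const (3 * m)
    have := (tendsto_cube_mul_sq (m := m) dt).add h2
    rw [zero_add] at this
    refine this.congr fun r => ?_
    rw [modePotential, kappaFn]
    ring
  have h := integral_Ioi_of_hasDerivAt_of_tendsto
    ((continuousOn_modePotential hm le_rfl ct cσ) _ Set.self_mem_Ici)
    (fun r hr => hasDerivAt_modePotential_one hm hr (hq r) (ht r hr) (hσ r hr)) i1 hlim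
  rw [modePotential_horizon hm le_rfl] at h
  rw [h]
  field_simp
  ring

/-- For N = 0 the quotient defining `modeY` is zero by convention, so X is just the rescaled radial
moment. -/
theorem integral_modeDensity_zero (hm : 0 < m)
    (ct : ContinuousOn t (Set.Ici (m / 2))) (cσ : ContinuousOn σ (Set.Ici (m / 2)))
    (cq : ContinuousOn q (Set.Ici (m / 2))) (cb : ContinuousOn b (Set.Ici (m / 2)))
    (dt : Decays 2 t) (dσ : Decays 2 σ) (dq : Decays 2 q) (db : Decays 2 b)
    (ht : ∀ r, m / 2 < r → HasDerivAt (fun r => r ^ 3 * t r)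
      (-(r ^ 2 * σ r) - 2 * alphaFn m r * r ^ 2 * psi0 m r ^ 5 * b r) r)
    (hσ : ∀ r, σ r = 0) (hq : ∀ r, q r = 0) :
    ∫ r in Set.Ioi (m / 2), modeDensity m 0 t σ q b r
      = modeX m 0 t σ (m / 2) ^ 2 * (1 / m) := by
  have i1 := (decays_modeDensity (m := m) (N := 0) dt dσ dq db).integrableOn
    (continuousOn_modeDensity hm ct cσ cq cb)
  have hc : ContinuousWithinAt (fun r => -(1 / 2) * (r ^ 3 * t r) ^ 2 * (1 / (psi0 m r ^ 6 * r ^ 3)))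
      (Set.Ici (m / 2)) (m / 2) := by
    have h1 := continuousOn_psi0 hm (m / 2) Set.self_mem_Ici
    have h2 := ct (m / 2) Set.self_mem_Ici
    have h3 : psi0 m (m / 2) ^ 6 * (m / 2) ^ 3 ≠ 0 := by
      rw [psi0_horizon hm]; positivity
    fun_prop (disch := assumption)
  have h := integral_Ioi_of_hasDerivAt_of_tendsto hc
    (fun r hr => hasDerivAt_modePotential_zero hm hr (hq r) (hσ r) (ht r hr)) i1
    ((tendsto_cube_mul_sq (m := m) dt).congr fun r => by ring)
  have h1 : (m / 2) ^ 3 * t (m / 2) = 4 * m * modeX m 0 t σ (m / 2) := by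
    rw [modeX, alphaFn_horizon hm, psi0_horizon hm]
    field_simp
    ring
  rw [h, h1, psi0_horizon hm]
  field_simp
  ring

end ModeIntegral

/-! ### The quadratic energy of the leading terms -/

/-- Solutions of the linearized momentum constraint decaying quadratically. -/
structure IsDecayingData (m C : ℝ) (B : E3 → Tensor2) (b : E3 → ℝ) : Prop
    extends IsLinearData m B b where
  decay_B : ∀ x ∈ surface m, ∀ i j, |B x i j| ≤ C / ‖x‖ ^ 2
  decay_b : ∀ x ∈ surface m, |b x| ≤ C / ‖x‖ ^ 2

/-- The radial part as a function of the polar angle. -/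
def frT (m : ℝ) (B : E3 → Tensor2) (b : E3 → ℝ) (r θ : ℝ) : ℝ :=
  frRR B r θ - 2 / 3 * psi0 m r ^ 6 * b (r • eR θ)

/-- The radial density of the quadratic energy. -/
def energyDensity (m : ℝ) (B : E3 → Tensor2) (b : E3 → ℝ) (r : ℝ) : ℝ :=
  r ^ 2 * alphaFn m r * avg fun θ => (∑ i, ∑ j, B (r • eR θ) i j ^ 2) / psi0 m r ^ 7
    - 2 / 3 * b (r • eR θ) ^ 2 * psi0 m r ^ 5

/-- The part of the energy density due to deviation from a pure spin. -/
def spinDensity (m J : ℝ) (B : E3 → Tensor2) (r : ℝ) : ℝ :=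
  2 * r ^ 2 * alphaFn m r / psi0 m r ^ 7
    * avg fun θ => (frRP B r θ - 3 * J / r ^ 3 * sin θ) ^ 2 + frTP B r θ ^ 2

/-- The contribution of high modes to the indefinite part of the energy density. -/
def tailDensity (m : ℝ) (B : E3 → Tensor2) (b : E3 → ℝ) (K : ℕ) (r : ℝ) : ℝ :=
  2 * r ^ 2 * alphaFn m r / psi0 m r * (avg (fun θ => frT m B b r θ * b (r • eR θ))
    - ∑ n ∈ Finset.range K, (2 * (n : ℝ) + 1) * (momT m B b n r * momH b n r))

section Energy
variable {m C : ℝ} {B : E3 → Tensor2} {b : E3 → ℝ}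

theorem abs_sin_mul_cos_le (θ : ℝ) : |sin θ * cos θ| ≤ 1 := by
  rw [abs_mul]
  exact mul_le_one₀ (abs_sin_le_one θ) (abs_nonneg _) (abs_cos_le_one θ)

theorem abs_lin_comb_le {u v w x y z D : ℝ} (hu : |u| ≤ 1) (hv : |v| ≤ 2) (hw : |w| ≤ 1)
    (hx : |x| ≤ D) (hy : |y| ≤ D) (hz : |z| ≤ D) : |u * x + v * y + w * z| ≤ 4 * D := by
  have h1 : |u * x| ≤ 1 * D := by
    rw [abs_mul]; exact mul_le_mul hu hx (abs_nonneg _) (by norm_num)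
  have h2 : |v * y| ≤ 2 * D := by
    rw [abs_mul]; exact mul_le_mul hv hy (abs_nonneg _) (by norm_num)
  have h3 : |w * z| ≤ 1 * D := by
    rw [abs_mul]; exact mul_le_mul hw hz (abs_nonneg _) (by norm_num)
  calc _ ≤ |u * x| + |v * y| + |w * z| := abs_add_three _ _ _
    _ ≤ 4 * D := by linarith

theorem IsDecayingData.bound (hm : 0 < m) (hB : IsDecayingData m C B b) {r : ℝ} (hr : m / 2 ≤ r)
    (θ : ℝ) (i j : Fin 3) : |B (r • eR θ) i j| ≤ C / r ^ 2 := by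
  have := hB.decay_B _ (smul_eR_mem hm hr θ) i j
  rwa [norm_smul_eR (by linarith)] at this

theorem IsDecayingData.bound_b (hm : 0 < m) (hB : IsDecayingData m C B b) {r : ℝ} (hr : m / 2 ≤ r)
    (θ : ℝ) : |b (r • eR θ)| ≤ C / r ^ 2 := by
  have := hB.decay_b _ (smul_eR_mem hm hr θ)
  rwa [norm_smul_eR (by linarith)] at this

theorem abs_sin_sq_le (θ : ℝ) : |sin θ ^ 2| ≤ 1 := by
  rw [abs_of_nonneg (sq_nonneg _)]; exact sin_sq_le_one θ

theorem abs_cos_sq_le (θ : ℝ) : |cos θ ^ 2| ≤ 1 := by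
  rw [abs_of_nonneg (sq_nonneg _)]; exact cos_sq_le_one θ

theorem abs_two_sin_cos_le (θ : ℝ) : |2 * sin θ * cos θ| ≤ 2 := by
  rw [mul_assoc, abs_mul, abs_two]
  linarith [abs_sin_mul_cos_le θ]

theorem IsDecayingData.bound_RR (hm : 0 < m) (hB : IsDecayingData m C B b) {r : ℝ}
    (hr : m / 2 ≤ r) (θ : ℝ) : |frRR B r θ| ≤ 4 * C / r ^ 2 := by
  have h := hB.bound hm hr θ
  rw [mul_div_assoc]
  exact abs_lin_comb_le (abs_sin_sq_le θ) (abs_two_sin_cos_le θ) (abs_cos_sq_le θ)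
    (h 0 0) (h 0 2) (h 2 2)

theorem IsDecayingData.bound_TT (hm : 0 < m) (hB : IsDecayingData m C B b) {r : ℝ}
    (hr : m / 2 ≤ r) (θ : ℝ) : |frTT B r θ| ≤ 4 * C / r ^ 2 := by
  have h := hB.bound hm hr θ
  rw [mul_div_assoc, frTT, sub_eq_add_neg, ← neg_mul]
  exact abs_lin_comb_le (abs_cos_sq_le θ) (by rw [abs_neg]; exact abs_two_sin_cos_le θ)
    (abs_sin_sq_le θ) (h 0 0) (h 0 2) (h 2 2)

theorem IsDecayingData.bound_RT (hm : 0 < m) (hB : IsDecayingData m C B b) {r : ℝ}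
    (hr : m / 2 ≤ r) (θ : ℝ) : |frRT B r θ| ≤ 4 * C / r ^ 2 := by
  have h := hB.bound hm hr θ
  have e : frRT B r θ = sin θ * cos θ * B (r • eR θ) 0 0
      + (cos θ ^ 2 - sin θ ^ 2) * B (r • eR θ) 0 2 + -(sin θ * cos θ) * B (r • eR θ) 2 2 := by
    rw [frRT]; ring
  rw [mul_div_assoc, e]
  refine abs_lin_comb_le (abs_sin_mul_cos_le θ) ?_ (by rw [abs_neg]; exact abs_sin_mul_cos_le θ)
    (h 0 0) (h 0 2) (h 2 2)
  refine (abs_sub _ _).trans ?_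
  linarith [abs_sin_sq_le θ, abs_cos_sq_le θ]

theorem IsDecayingData.bound_Q (hm : 0 < m) (hB : IsDecayingData m C B b) {r : ℝ}
    (hr : m / 2 ≤ r) (θ : ℝ) : |frQ B r θ| ≤ 4 * C / r ^ 2 := by
  have h := hB.bound hm hr θ 1 1
  have h2 := hB.bound_TT hm hr θ
  have h3 := abs_sub (frTT B r θ) (B (r • eR θ) 1 1)
  have h4 := abs_nonneg (B (r • eR θ) 1 1)
  rw [frQ, abs_div, abs_two]
  rw [mul_div_assoc] at *
  linarith

/-- The constant 50 rounds up 4 + ⅔·2⁶, using ψ₀ ≤ 2. -/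
theorem IsDecayingData.bound_T (hm : 0 < m) (hB : IsDecayingData m C B b) {r : ℝ}
    (hr : m / 2 ≤ r) (θ : ℝ) : |frT m B b r θ| ≤ 50 * C / r ^ 2 := by
  have h := hB.bound_b hm hr θ
  have h2 := hB.bound_RR hm hr θ
  have h3 := abs_sub (frRR B r θ) (2 / 3 * psi0 m r ^ 6 * b (r • eR θ))
  have h5 : psi0 m r ^ 6 ≤ 2 ^ 6 := pow_le_pow_left₀ (psi0_pos hm hr).le (psi0_le_two hm hr) 6
  have h6 : |2 / 3 * psi0 m r ^ 6 * b (r • eR θ)| ≤ 2 / 3 * 2 ^ 6 * (C / r ^ 2) := by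
    rw [abs_mul, abs_of_nonneg (by have := psi0_pos hm hr; positivity)]
    gcongr
  have h4 : 0 ≤ C / r ^ 2 := (abs_nonneg _).trans h
  rw [frT]
  rw [mul_div_assoc] at *
  linarith

theorem IsDecayingData.continuousOn_frT (hm : 0 < m) (hB : IsDecayingData m C B b) :
    ContinuousOn (fun p : ℝ × ℝ => frT m B b p.1 p.2) (Set.Ici (m / 2) ×ˢ Set.univ) := by
  have h1 := hB.frRR_continuousOn hm
  have h2 := hB.smooth_b.continuousOn_mer hm
  have h3 : ContinuousOn (fun p : ℝ × ℝ => psi0 m p.1) (Set.Ici (m / 2) ×ˢ Set.univ) :=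
    (continuousOn_psi0 hm).comp continuousOn_fst fun p hp => hp.1
  exact h1.sub ((continuousOn_const.mul (h3.pow 6)).mul h2)

theorem continuousOn_avg_mul {F : ℝ → ℝ → ℝ} {a : ℝ}
    (hF : ContinuousOn (fun p : ℝ × ℝ => F p.1 p.2) (Set.Ici a ×ˢ Set.univ)) {g : ℝ → ℝ}
    (hg : Continuous g) : ContinuousOn (fun r => avg fun θ => F r θ * g θ) (Set.Ici a) :=
  continuousOn_avg (F := fun r θ => F r θ * g θ)
    (hF.mul (hg.comp continuous_snd).continuousOn)

theorem decays_avg_mul {F : ℝ → ℝ → ℝ} {a D : ℝ} {k : ℕ}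
    (hF : ContinuousOn (fun p : ℝ × ℝ => F p.1 p.2) (Set.Ici a ×ˢ Set.univ))
    (hb : ∀ r, a ≤ r → ∀ θ, |F r θ| ≤ D / r ^ k) {g : ℝ → ℝ}
    (hg : Continuous g) : Decays k fun r => avg fun θ => F r θ * g θ := by
  obtain ⟨M, hM⟩ := isCompact_Icc.exists_bound_of_continuousOn (hg.continuousOn (s := Set.Icc 0 π))
  refine decays_of_bound (a := a) (C := D * M) fun r hr => ?_
  refine abs_avg_le ((continuous_slice hF hr).mul hg) fun θ hθ => ?_
  rw [abs_mul, mul_div_right_comm]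
  exact mul_le_mul (hb r hr θ) (hM θ hθ) (abs_nonneg _) ((abs_nonneg _).trans (hb r hr θ))

theorem decays_avg {F : ℝ → ℝ → ℝ} {a D : ℝ} {k : ℕ}
    (hF : ContinuousOn (fun p : ℝ × ℝ => F p.1 p.2) (Set.Ici a ×ˢ Set.univ))
    (hb : ∀ r, a ≤ r → ∀ θ, |F r θ| ≤ D / r ^ k) : Decays k fun r => avg (F r) :=
  decays_of_bound (a := a) (C := D) fun r hr =>
    abs_avg_le (continuous_slice hF hr) fun θ _ => hb r hr θ

theorem IsDecayingData.momT_eq (hm : 0 < m) (hB : IsDecayingData m C B b) (n : ℕ) {r : ℝ}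
    (hr : m / 2 ≤ r) : momT m B b n r = legMoment (frT m B b r) n := by
  have h1 := continuous_slice (hB.frRR_continuousOn hm) hr
  have h2 := hB.smooth_b.continuous_mer hm hr
  have := legMoment_sub h1 (h2.const_mul (2 / 3 * psi0 m r ^ 6)) n
  rw [legMoment_const_mul] at this
  exact this.symm

theorem IsDecayingData.continuousOn_momT (hm : 0 < m) (hB : IsDecayingData m C B b) (n : ℕ) :
    ContinuousOn (momT m B b n) (Set.Ici (m / 2)) := by
  refine (continuousOn_avg_mul (hB.continuousOn_frT hm)
    (continuous_eval_cos (legendrePoly n))).congr fun r hr => hB.momT_eq hm n hr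

theorem IsDecayingData.continuousOn_momH (hm : 0 < m) (hB : IsDecayingData m C B b) (n : ℕ) :
    ContinuousOn (momH b n) (Set.Ici (m / 2)) :=
  continuousOn_avg_mul (F := fun r θ => b (r • eR θ)) (hB.smooth_b.continuousOn_mer hm)
    (continuous_eval_cos (legendrePoly n))

theorem IsDecayingData.continuousOn_momRT (hm : 0 < m) (hB : IsDecayingData m C B b) (n : ℕ) :
    ContinuousOn (momRT B n) (Set.Ici (m / 2)) :=
  continuousOn_avg_mul (hB.frRT_continuousOn hm) (continuous_sin.mul (continuous_eval_cos _))

theorem IsDecayingData.continuousOn_momQ (hm : 0 < m) (hB : IsDecayingData m C B b) (n : ℕ) :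
    ContinuousOn (momQ B n) (Set.Ici (m / 2)) :=
  continuousOn_avg_mul (hB.frQ_continuousOn hm) ((continuous_sin.pow 2).mul (continuous_eval_cos _))

theorem IsDecayingData.decays_momT (hm : 0 < m) (hB : IsDecayingData m C B b) (n : ℕ) :
    Decays 2 (momT m B b n) := by
  refine (decays_avg_mul (hB.continuousOn_frT hm) (fun r hr θ => hB.bound_T hm hr θ)
    (continuous_eval_cos (legendrePoly n))).congr' ?_ EventuallyEq.rfl
  filter_upwards [eventually_ge_atTop (m / 2)] with r hr
  exact (hB.momT_eq hm n hr).symm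

theorem IsDecayingData.decays_momH (hm : 0 < m) (hB : IsDecayingData m C B b) (n : ℕ) :
    Decays 2 (momH b n) :=
  decays_avg_mul (F := fun r θ => b (r • eR θ)) (hB.smooth_b.continuousOn_mer hm)
    (fun _ hr θ => hB.bound_b hm hr θ) (continuous_eval_cos (legendrePoly n))

theorem IsDecayingData.decays_momRT (hm : 0 < m) (hB : IsDecayingData m C B b) (n : ℕ) :
    Decays 2 (momRT B n) :=
  decays_avg_mul (hB.frRT_continuousOn hm) (fun _ hr θ => hB.bound_RT hm hr θ)
    (continuous_sin.mul (continuous_eval_cos _))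

theorem IsDecayingData.decays_momQ (hm : 0 < m) (hB : IsDecayingData m C B b) (n : ℕ) :
    Decays 2 (momQ B n) :=
  decays_avg_mul (hB.frQ_continuousOn hm) (fun _ hr θ => hB.bound_Q hm hr θ)
    ((continuous_sin.pow 2).mul (continuous_eval_cos _))

theorem capN_zero : capN 0 = 0 := by simp [capN]
theorem capN_one : capN 1 = 1 := by norm_num [capN]

theorem one_lt_capN {n : ℕ} (hn : 2 ≤ n) : 1 < capN n := by
  have : (2 : ℝ) ≤ n := by exact_mod_cast hn
  unfold capN
  nlinarith

theorem legendrePoly_zero_derivative : (legendrePoly 0).derivative = 0 :=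
  Polynomial.derivative_of_natDegree_zero (Nat.le_zero.mp (legendrePoly_natDegree_le 0))

theorem legendrePoly_one_second_derivative : (legendrePoly 1).derivative.derivative = 0 := by
  refine Polynomial.derivative_of_natDegree_zero ?_
  have h1 := Polynomial.natDegree_derivative_le (legendrePoly 1)
  have h2 := legendrePoly_natDegree_le 1
  omega

theorem momRT_zero (B : E3 → Tensor2) (r : ℝ) : momRT B 0 r = 0 := by
  simp [momRT, legendrePoly_zero_derivative, avg_const]

theorem momQ_zero (B : E3 → Tensor2) (r : ℝ) : momQ B 0 r = 0 := by
  simp [momQ, legendrePoly_zero_derivative, avg_const]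

theorem momQ_one (B : E3 → Tensor2) (r : ℝ) : momQ B 1 r = 0 := by
  simp [momQ, legendrePoly_one_second_derivative, avg_const]

/-- The mode `X_n` of the data, up to the factor `2 n + 1`. -/
def dataX (m : ℝ) (B : E3 → Tensor2) (b : E3 → ℝ) (n : ℕ) : ℝ → ℝ :=
  modeX m (capN n) (momT m B b n) (momRT B n)

/-- The energy density of the `n`-th mode of the data. -/
def dataDensity (m : ℝ) (B : E3 → Tensor2) (b : E3 → ℝ) (n : ℕ) : ℝ → ℝ :=
  modeDensity m (capN n) (momT m B b n) (momRT B n) (momQ B n) (momH b n)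

/-- The square in the energy density of the `n`-th mode of the data. -/
def dataSquare (m : ℝ) (B : E3 → Tensor2) (b : E3 → ℝ) (n : ℕ) : ℝ → ℝ :=
  modeSquare m (capN n) (momT m B b n) (momRT B n) (momQ B n)

theorem IsDecayingData.integrableOn_dataDensity (hm : 0 < m) (hB : IsDecayingData m C B b)
    (n : ℕ) : IntegrableOn (dataDensity m B b n) (Set.Ioi (m / 2)) :=
  (decays_modeDensity (hB.decays_momT hm n) (hB.decays_momRT hm n) (hB.decays_momQ hm n)
    (hB.decays_momH hm n)).integrableOn (continuousOn_modeDensity hm (hB.continuousOn_momT hm n)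
    (hB.continuousOn_momRT hm n) (hB.continuousOn_momQ hm n) (hB.continuousOn_momH hm n))

theorem IsDecayingData.integral_dataDensity (hm : 0 < m) (hB : IsDecayingData m C B b)
    {n : ℕ} (hn : 2 ≤ n) : ∫ r in Set.Ioi (m / 2), dataDensity m B b n r
      = dataX m B b n (m / 2) ^ 2 * (1 / m - 2 * capN n / (m * (2 * capN n + 1)))
        + ∫ r in Set.Ioi (m / 2), dataSquare m B b n r :=
  integral_modeDensity hm (one_lt_capN hn) (hB.continuousOn_momT hm n)
    (hB.continuousOn_momRT hm n) (hB.continuousOn_momQ hm n) (hB.continuousOn_momH hm n)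
    (hB.decays_momT hm n) (hB.decays_momRT hm n) (hB.decays_momQ hm n) (hB.decays_momH hm n)
    (fun _ hr => hB.hasDerivAt_momT hm n hr) fun _ hr => hB.hasDerivAt_momRT hm n hr

theorem IsDecayingData.integral_dataDensity_one (hm : 0 < m) (hB : IsDecayingData m C B b) {p : ℝ}
    (hp : Tendsto (fun r => 1 / 2 * (r ^ 2 * (momT m B b 1 r - momRT B 1 r))) atTop (𝓝 p)) :
    ∫ r in Set.Ioi (m / 2), dataDensity m B b 1 r
      = 2 * p ^ 2 / (3 * m) + dataX m B b 1 (m / 2) ^ 2 * (1 / (3 * m)) := by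
  have h := fun r (hr : m / 2 < r) => hB.hasDerivAt_momRT hm 1 hr
  rw [dataDensity, dataX, capN_one]
  rw [capN_one] at h
  exact integral_modeDensity_one hm (hB.continuousOn_momT hm 1)
    (hB.continuousOn_momRT hm 1) (hB.continuousOn_momQ hm 1) (hB.continuousOn_momH hm 1)
    (hB.decays_momT hm 1) (hB.decays_momRT hm 1) (hB.decays_momQ hm 1) (hB.decays_momH hm 1)
    (fun _ hr => hB.hasDerivAt_momT hm 1 hr) h (momQ_one B) hp

theorem IsDecayingData.integral_dataDensity_zero (hm : 0 < m) (hB : IsDecayingData m C B b) :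
    ∫ r in Set.Ioi (m / 2), dataDensity m B b 0 r = dataX m B b 0 (m / 2) ^ 2 * (1 / m) := by
  rw [dataDensity, dataX, capN_zero]
  exact integral_modeDensity_zero hm (hB.continuousOn_momT hm 0)
    (hB.continuousOn_momRT hm 0) (hB.continuousOn_momQ hm 0) (hB.continuousOn_momH hm 0)
    (hB.decays_momT hm 0) (hB.decays_momRT hm 0) (hB.decays_momQ hm 0) (hB.decays_momH hm 0)
    (fun _ hr => hB.hasDerivAt_momT hm 0 hr) (momRT_zero B) (momQ_zero B)

end Energy

/-! ### Splitting the energy density into modes, spin and tail. -/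

section EnergyBound
variable {m C J : ℝ} {B : E3 → Tensor2} {b : E3 → ℝ}

theorem avg_sin_sq : avg (fun θ => sin θ ^ 2) = 2 / 3 := by
  have h := polyAvg_derivative (Polynomial.X - Polynomial.C (1 / 3) * Polynomial.X ^ 3)
  rw [polyAvg_apply] at h
  have e : ∀ θ, (Polynomial.derivative
      (Polynomial.X - Polynomial.C (1 / 3 : ℝ) * Polynomial.X ^ 3)).eval (cos θ) = sin θ ^ 2 := by
    intro θ
    simp [sin_sq]
    ring
  simp only [e] at h
  rw [h]
  simp
  norm_num

theorem avg_lin_comb {f₁ f₂ f₃ f₄ f₅ f₆ f₇ : ℝ → ℝ} (h₁ : Continuous f₁) (h₂ : Continuous f₂)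
    (h₃ : Continuous f₃) (h₄ : Continuous f₄) (h₅ : Continuous f₅) (h₆ : Continuous f₆)
    (h₇ : Continuous f₇) (c₁ c₂ c₃ c₄ c₅ c₆ c₇ : ℝ) :
    avg (fun θ => c₁ * f₁ θ + c₂ * f₂ θ + c₃ * f₃ θ + c₄ * f₄ θ + c₅ * f₅ θ + c₆ * f₆ θ
      - c₇ * f₇ θ) = c₁ * avg f₁ + c₂ * avg f₂ + c₃ * avg f₃ + c₄ * avg f₄ + c₅ * avg f₅
      + c₆ * avg f₆ - c₇ * avg f₇ := by
  rw [avg_sub (by fun_prop) (by fun_prop), avg_add (by fun_prop) (by fun_prop),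
    avg_add (by fun_prop) (by fun_prop), avg_add (by fun_prop) (by fun_prop),
    avg_add (by fun_prop) (by fun_prop), avg_add (by fun_prop) (by fun_prop)]
  simp only [avg_const_mul]

/-- Substituting RR = T + ⅔ψ₀⁶b into (3/2)RR²/ψ₀⁷ produces +⅔ψ₀⁵b², which cancels the negative term
and leaves only the product T·b. The conserved flux fixes the component of RP along sin θ to be
3J/r³; splitting it off leaves squares and an explicit multiple of J². -/
theorem IsDecayingData.energyDensity_eq (hm : 0 < m) (hB : IsDecayingData m C B b) {r : ℝ}
    (hr : m / 2 ≤ r) (hJ : r ^ 3 * avg (fun θ => sin θ * frRP B r θ) = 2 * J) :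
    energyDensity m B b r = r ^ 2 * alphaFn m r * (3 / 2 * avg (fun θ => frT m B b r θ ^ 2)
        / psi0 m r ^ 7 + 2 * avg (fun θ => frT m B b r θ * b (r • eR θ)) / psi0 m r
        + 2 * (avg (fun θ => frRT B r θ ^ 2) + avg (fun θ => frQ B r θ ^ 2)) / psi0 m r ^ 7)
      + spinDensity m J B r + 12 * J ^ 2 * (alphaFn m r / (psi0 m r ^ 7 * r ^ 4)) := by
  have hr0 : 0 < r := by linarith
  have hp := psi0_pos hm hr
  have cT := continuous_slice (hB.continuousOn_frT hm) hr
  have cRT := continuous_slice (hB.frRT_continuousOn hm) hr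
  have cQ := continuous_slice (hB.frQ_continuousOn hm) hr
  have cRP := continuous_slice (hB.frRP_continuousOn hm) hr
  have cTP := continuous_slice (hB.frTP_continuousOn hm) hr
  have cb := hB.smooth_b.continuous_mer hm hr
  have h1 : ∀ θ, (∑ i, ∑ j, B (r • eR θ) i j ^ 2) / psi0 m r ^ 7
      - 2 / 3 * b (r • eR θ) ^ 2 * psi0 m r ^ 5
      = 3 / 2 / psi0 m r ^ 7 * frT m B b r θ ^ 2
        + 2 / psi0 m r * (frT m B b r θ * b (r • eR θ))
        + 2 / psi0 m r ^ 7 * frRT B r θ ^ 2 + 2 / psi0 m r ^ 7 * frQ B r θ ^ 2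
        + 2 / psi0 m r ^ 7 * ((frRP B r θ - 3 * J / r ^ 3 * sin θ) ^ 2 + frTP B r θ ^ 2)
        + 12 * J / (r ^ 3 * psi0 m r ^ 7) * (sin θ * frRP B r θ)
        - 18 * J ^ 2 / (r ^ 6 * psi0 m r ^ 7) * sin θ ^ 2 := by
    intro θ
    rw [hB.toIsAxialTT.sum_sq_eq hm hr, frT]
    field_simp
    ring
  rw [energyDensity, funext h1]
  rw [avg_lin_comb (f₁ := fun θ => frT m B b r θ ^ 2) (f₂ := fun θ => frT m B b r θ * b (r • eR θ))
    (f₃ := fun θ => frRT B r θ ^ 2) (f₄ := fun θ => frQ B r θ ^ 2)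
    (f₅ := fun θ => (frRP B r θ - 3 * J / r ^ 3 * sin θ) ^ 2 + frTP B r θ ^ 2)
    (f₆ := fun θ => sin θ * frRP B r θ) (f₇ := fun θ => sin θ ^ 2) (cT.pow 2) (cT.mul cb)
    (cRT.pow 2) (cQ.pow 2) (by fun_prop) (by fun_prop) (by fun_prop)]
  have hJ' : avg (fun θ => sin θ * frRP B r θ) = 2 * J / r ^ 3 := by
    rw [← hJ]; field_simp
  rw [hJ', avg_sin_sq, spinDensity]
  field_simp
  ring

/-- Pointwise lower bound of the energy density by finitely many modes. -/
theorem IsDecayingData.sum_dataDensity_le (hm : 0 < m) (hB : IsDecayingData m C B b) {r : ℝ}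
    (hr : m / 2 ≤ r) (hJ : r ^ 3 * avg (fun θ => sin θ * frRP B r θ) = 2 * J) (K : ℕ) :
    ∑ n ∈ Finset.range K, (2 * (n : ℝ) + 1) * dataDensity m B b n r + tailDensity m B b K r
      + spinDensity m J B r + 12 * J ^ 2 * (alphaFn m r / (psi0 m r ^ 7 * r ^ 4))
      ≤ energyDensity m B b r := by
  have hr0 : 0 < r := by linarith
  have hp := psi0_pos hm hr
  have hα := alphaFn_nonneg hm hr
  rw [hB.energyDensity_eq hm hr hJ]
  -- Bessel's inequality may be applied only to the three definite squares. The product T·b has no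
  -- sign, and its discrepancy is kept as `tailDensity`.
  have b1 := sum_legMoment_sq_le (continuous_slice (hB.continuousOn_frT hm) hr) (Finset.range K)
  have b2 := sum_derivative_moment_sq_le (continuous_slice (hB.frRT_continuousOn hm) hr)
    (Finset.range K)
  have b3 := sum_second_derivative_moment_sq_le (continuous_slice (hB.frQ_continuousOn hm) hr)
    (Finset.range K)
  have e : ∑ n ∈ Finset.range K, (2 * (n : ℝ) + 1) * dataDensity m B b n r
      = r ^ 2 * alphaFn m r * (3 / 2 * (∑ n ∈ Finset.range K, (2 * (n : ℝ) + 1)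
            * legMoment (frT m B b r) n ^ 2) / psi0 m r ^ 7
        + 2 * (∑ n ∈ Finset.range K, (2 * (n : ℝ) + 1) * (momT m B b n r * momH b n r)) / psi0 m r
        + 2 * ((∑ n ∈ Finset.range K, (2 * (n : ℝ) + 1) * (momRT B n r ^ 2 / (2 * capN n)))
          + ∑ n ∈ Finset.range K, (2 * (n : ℝ) + 1)
            * (momQ B n r ^ 2 / (4 * capN n * (capN n - 1)))) / psi0 m r ^ 7) := by
    simp only [Finset.mul_sum, Finset.sum_div, ← Finset.sum_add_distrib]
    refine Finset.sum_congr rfl fun n _ => ?_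
    rw [dataDensity, modeDensity, ← hB.momT_eq hm n hr]
    ring
  rw [e, tailDensity]
  have h7 : 0 < psi0 m r ^ 7 := by positivity
  have key : r ^ 2 * alphaFn m r * (3 / 2 * (∑ n ∈ Finset.range K, (2 * (n : ℝ) + 1)
            * legMoment (frT m B b r) n ^ 2) / psi0 m r ^ 7
        + 2 * ((∑ n ∈ Finset.range K, (2 * (n : ℝ) + 1) * (momRT B n r ^ 2 / (2 * capN n)))
          + ∑ n ∈ Finset.range K, (2 * (n : ℝ) + 1)
            * (momQ B n r ^ 2 / (4 * capN n * (capN n - 1)))) / psi0 m r ^ 7)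
      ≤ r ^ 2 * alphaFn m r * (3 / 2 * avg (fun θ => frT m B b r θ ^ 2) / psi0 m r ^ 7
        + 2 * (avg (fun θ => frRT B r θ ^ 2) + avg (fun θ => frQ B r θ ^ 2)) / psi0 m r ^ 7) := by
    refine mul_le_mul_of_nonneg_left ?_ (by positivity)
    simp only [momRT, momQ]
    gcongr
  have e2 : ∀ x y : ℝ, 2 * r ^ 2 * alphaFn m r / psi0 m r * (x - y)
      = r ^ 2 * alphaFn m r * (2 * x / psi0 m r) - r ^ 2 * alphaFn m r * (2 * y / psi0 m r) :=
    fun x y => by ring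
  rw [e2]
  linarith

theorem continuousOn_psi0_fst (hm : 0 < m) :
    ContinuousOn (fun p : ℝ × ℝ => psi0 m p.1) (Set.Ici (m / 2) ×ˢ Set.univ) :=
  (continuousOn_psi0 hm).comp continuousOn_fst fun _ hp => hp.1

theorem IsDecayingData.continuousOn_energyDensity (hm : 0 < m) (hB : IsDecayingData m C B b) :
    ContinuousOn (energyDensity m B b) (Set.Ici (m / 2)) := by
  have h1 := continuousOn_psi0_fst hm
  have h2 : ContinuousOn (fun p : ℝ × ℝ => ∑ i, ∑ j, B (p.1 • eR p.2) i j ^ 2)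
      (Set.Ici (m / 2) ×ˢ Set.univ) :=
    continuousOn_finsetSum _ fun i _ => continuousOn_finsetSum _ fun j _ =>
      ((hB.smooth i j).continuousOn_mer hm).pow 2
  have h3 := hB.smooth_b.continuousOn_mer hm
  have h4 := continuousOn_alphaFn hm
  refine ((continuousOn_id.pow 2).mul h4).mul (continuousOn_avg (F := fun r θ =>
    (∑ i, ∑ j, B (r • eR θ) i j ^ 2) / psi0 m r ^ 7 - 2 / 3 * b (r • eR θ) ^ 2 * psi0 m r ^ 5) ?_)
  exact (h2.div (h1.pow 7) fun p hp => pow_ne_zero _ (psi0_pos hm hp.1).ne').sub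
    ((continuousOn_const.mul (h3.pow 2)).mul (h1.pow 5))

theorem IsDecayingData.decays_energyDensity (hm : 0 < m) (hB : IsDecayingData m C B b) :
    Decays 2 (energyDensity m B b) := by
  refine decays_of_bound (a := m / 2) (C := (9 + 2 / 3 * 2 ^ 5) * C ^ 2) fun r hr => ?_
  have hr0 : 0 < r := by linarith
  have hp1 := one_le_psi0 hm hr
  have hp2 := psi0_le_two hm hr
  have hp := psi0_pos hm hr
  have hα := alphaFn_nonneg hm hr
  have hα1 := alphaFn_le_one hm hr
  have hsq : ∀ x : ℝ, |x| ≤ C / r ^ 2 → x ^ 2 ≤ C ^ 2 / r ^ 4 := by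
    intro x hx
    rw [← sq_abs]
    calc |x| ^ 2 ≤ (C / r ^ 2) ^ 2 := pow_le_pow_left₀ (abs_nonneg _) hx 2
      _ = C ^ 2 / r ^ 4 := by rw [div_pow, ← pow_mul]
  have hb : ∀ θ, |(∑ i, ∑ j, B (r • eR θ) i j ^ 2) / psi0 m r ^ 7
      - 2 / 3 * b (r • eR θ) ^ 2 * psi0 m r ^ 5| ≤ (9 + 2 / 3 * 2 ^ 5) * C ^ 2 / r ^ 4 := by
    intro θ
    have h1 : (∑ i, ∑ j, B (r • eR θ) i j ^ 2) ≤ 9 * (C ^ 2 / r ^ 4) := by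
      have : ∀ i j, B (r • eR θ) i j ^ 2 ≤ C ^ 2 / r ^ 4 := fun i j => hsq _ (hB.bound hm hr θ i j)
      simp only [Fin.sum_univ_three]
      linarith [this 0 0, this 0 1, this 0 2, this 1 0, this 1 1, this 1 2, this 2 0, this 2 1,
        this 2 2]
    have h0 : 0 ≤ ∑ i, ∑ j, B (r • eR θ) i j ^ 2 :=
      Finset.sum_nonneg fun i _ => Finset.sum_nonneg fun j _ => sq_nonneg _
    have h2 : (∑ i, ∑ j, B (r • eR θ) i j ^ 2) / psi0 m r ^ 7 ≤ 9 * (C ^ 2 / r ^ 4) :=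
      (div_le_self h0 (one_le_pow₀ hp1)).trans h1
    have h3 : 2 / 3 * b (r • eR θ) ^ 2 * psi0 m r ^ 5 ≤ 2 / 3 * (C ^ 2 / r ^ 4) * 2 ^ 5 := by
      have := hsq _ (hB.bound_b hm hr θ)
      gcongr
    have h4 : 0 ≤ (∑ i, ∑ j, B (r • eR θ) i j ^ 2) / psi0 m r ^ 7 := by positivity
    have h5 : 0 ≤ 2 / 3 * b (r • eR θ) ^ 2 * psi0 m r ^ 5 := by positivity
    have h6 : (9 + 2 / 3 * 2 ^ 5) * C ^ 2 / r ^ 4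
        = 9 * (C ^ 2 / r ^ 4) + 2 / 3 * (C ^ 2 / r ^ 4) * 2 ^ 5 := by ring
    rw [abs_le, h6]
    constructor <;> linarith
  have hc : Continuous fun θ => (∑ i, ∑ j, B (r • eR θ) i j ^ 2) / psi0 m r ^ 7
      - 2 / 3 * b (r • eR θ) ^ 2 * psi0 m r ^ 5 := by
    have h1 := fun i j => (hB.smooth i j).continuous_mer hm hr
    have h2 := hB.smooth_b.continuous_mer hm hr
    exact ((continuous_finsetSum _ fun i _ => continuous_finsetSum _ fun j _ =>
      (h1 i j).pow 2).div_const _).sub ((continuous_const.mul (h2.pow 2)).mul_const _)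
  rw [energyDensity, abs_mul, abs_of_nonneg (by positivity : 0 ≤ r ^ 2 * alphaFn m r)]
  calc _ ≤ r ^ 2 * 1 * ((9 + 2 / 3 * 2 ^ 5) * C ^ 2 / r ^ 4) :=
        mul_le_mul (by gcongr) (abs_avg_le hc fun θ _ => hb θ) (abs_nonneg _) (by positivity)
    _ = _ := by field_simp

theorem IsDecayingData.integrableOn_energyDensity (hm : 0 < m) (hB : IsDecayingData m C B b) :
    IntegrableOn (energyDensity m B b) (Set.Ioi (m / 2)) :=
  (hB.decays_energyDensity hm).integrableOn (hB.continuousOn_energyDensity hm)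

theorem IsDecayingData.continuousOn_spinDensity (hm : 0 < m) (hB : IsDecayingData m C B b) :
    ContinuousOn (spinDensity m J B) (Set.Ici (m / 2)) := by
  have h1 := continuousOn_psi0 hm
  have h4 := continuousOn_alphaFn hm
  have h7 : ∀ r ∈ Set.Ici (m / 2), psi0 m r ^ 7 ≠ 0 := fun r hr =>
    pow_ne_zero _ (psi0_pos hm hr).ne'
  refine ContinuousOn.mul (by fun_prop (disch := assumption)) (continuousOn_avg (F := fun r θ =>
    (frRP B r θ - 3 * J / r ^ 3 * sin θ) ^ 2 + frTP B r θ ^ 2) ?_)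
  have h5 : ContinuousOn (fun p : ℝ × ℝ => 3 * J / p.1 ^ 3 * sin p.2)
      (Set.Ici (m / 2) ×ˢ Set.univ) := by
    have : ∀ p ∈ Set.Ici (m / 2) ×ˢ (Set.univ : Set ℝ), p.1 ^ 3 ≠ 0 := fun p hp => by
      have h : m / 2 ≤ p.1 := hp.1
      have : 0 < p.1 := by linarith
      positivity
    fun_prop (disch := assumption)
  exact (((hB.frRP_continuousOn hm).sub h5).pow 2).add ((hB.frTP_continuousOn hm).pow 2)

theorem spinDensity_nonneg (hm : 0 < m) {r : ℝ} (hr : m / 2 ≤ r) (hB : IsDecayingData m C B b) :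
    0 ≤ spinDensity m J B r := by
  have hp := psi0_pos hm hr
  have hα := alphaFn_nonneg hm hr
  have cRP := continuous_slice (hB.frRP_continuousOn hm) hr
  have cTP := continuous_slice (hB.frTP_continuousOn hm) hr
  have : 0 ≤ avg (fun θ => (frRP B r θ - 3 * J / r ^ 3 * sin θ) ^ 2 + frTP B r θ ^ 2) :=
    avg_nonneg (by fun_prop) fun θ _ => by positivity
  unfold spinDensity; positivity

theorem IsDecayingData.decays_spinDensity (hm : 0 < m) (hB : IsDecayingData m C B b) :
    Decays 2 (spinDensity m J B) := by
  have e : ∀ r, m / 2 ≤ r → spinDensity m J B r = r ^ 2 * (alphaFn m r * ((psi0 m r ^ 7)⁻¹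
      * (2 * (avg (fun θ => frRP B r θ ^ 2 + frTP B r θ ^ 2)
        - 6 * J * (r⁻¹ ^ 3 * avg (fun θ => frRP B r θ * sin θ))
        + 6 * J ^ 2 * r⁻¹ ^ 6)))) := by
    intro r hr
    have cRP := continuous_slice (hB.frRP_continuousOn hm) hr
    have cTP := continuous_slice (hB.frTP_continuousOn hm) hr
    have h1 : ∀ θ, (frRP B r θ - 3 * J / r ^ 3 * sin θ) ^ 2 + frTP B r θ ^ 2
        = (frRP B r θ ^ 2 + frTP B r θ ^ 2) - 6 * J * r⁻¹ ^ 3 * (frRP B r θ * sin θ)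
          + 9 * J ^ 2 * r⁻¹ ^ 6 * sin θ ^ 2 := fun θ => by field_simp; ring
    rw [spinDensity]
    simp only [h1]
    rw [avg_add (by fun_prop) (by fun_prop), avg_sub (by fun_prop) (by fun_prop), avg_const_mul,
      avg_const_mul, avg_sin_sq]
    ring
  have hinv : ∀ k : ℕ, Decays k fun r : ℝ => r⁻¹ ^ k := fun k => by
    unfold Decays; simpa using isBigO_refl _ _
  have bRP : ∀ r, m / 2 ≤ r → ∀ θ, |frRP B r θ| ≤ 2 * C / r ^ 2 := fun r hr θ => by
    have h := hB.bound hm hr θ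
    refine (abs_add_le _ _).trans ?_
    rw [abs_mul, abs_mul]
    have h1 := mul_le_mul (abs_sin_le_one θ) (h 0 1) (abs_nonneg _) zero_le_one
    have h2 := mul_le_mul (abs_cos_le_one θ) (h 1 2) (abs_nonneg _) zero_le_one
    rw [mul_div_assoc]; linarith
  have bTP : ∀ r, m / 2 ≤ r → ∀ θ, |frTP B r θ| ≤ 2 * C / r ^ 2 := fun r hr θ => by
    have h := hB.bound hm hr θ
    refine (abs_sub _ _).trans ?_
    rw [abs_mul, abs_mul]
    have h1 := mul_le_mul (abs_cos_le_one θ) (h 0 1) (abs_nonneg _) zero_le_one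
    have h2 := mul_le_mul (abs_sin_le_one θ) (h 1 2) (abs_nonneg _) zero_le_one
    rw [mul_div_assoc]; linarith
  have hA : Decays 4 fun r => avg fun θ => frRP B r θ ^ 2 + frTP B r θ ^ 2 := by
    refine decays_avg (F := fun r θ => frRP B r θ ^ 2 + frTP B r θ ^ 2) (a := m / 2)
      (D := 8 * C ^ 2) (((hB.frRP_continuousOn hm).pow 2).add ((hB.frTP_continuousOn hm).pow 2))
      fun r hr θ => ?_
    have h1 := pow_le_pow_left₀ (abs_nonneg _) (bRP r hr θ) 2
    have h2 := pow_le_pow_left₀ (abs_nonneg _) (bTP r hr θ) 2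
    rw [sq_abs] at h1 h2
    rw [abs_of_nonneg (by positivity)]
    calc _ ≤ (2 * C / r ^ 2) ^ 2 + (2 * C / r ^ 2) ^ 2 := add_le_add h1 h2
      _ = 8 * C ^ 2 / r ^ 4 := by rw [div_pow, ← pow_mul]; ring
  have hS : Decays 2 fun r => avg fun θ => frRP B r θ * sin θ :=
    decays_avg_mul (hB.frRP_continuousOn hm) bRP continuous_sin
  have h1 : Decays 4 fun r => 2 * (avg (fun θ => frRP B r θ ^ 2 + frTP B r θ ^ 2)
        - 6 * J * (r⁻¹ ^ 3 * avg (fun θ => frRP B r θ * sin θ)) + 6 * J ^ 2 * r⁻¹ ^ 6) :=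
    ((hA.sub ((((hinv 3).mul hS).mono (by norm_num)).const_mul _)).add
      (((hinv 6).mono (by norm_num)).const_mul _)).const_mul _
  have h2 := (decays_alphaFn (m := m)).mul ((decays_inv_psi0_pow (m := m) 7).mul h1)
  refine (Decays.of_succ_pow (k := 2) 2 (h2.mono (by norm_num))).congr' ?_ EventuallyEq.rfl
  filter_upwards [eventually_ge_atTop (m / 2)] with r hr
  exact (e r hr).symm

theorem IsDecayingData.integrableOn_spinDensity (hm : 0 < m) (hB : IsDecayingData m C B b) :
    IntegrableOn (spinDensity m J B) (Set.Ioi (m / 2)) :=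
  (hB.decays_spinDensity hm).integrableOn (hB.continuousOn_spinDensity hm)

/-- The integrand is the derivative of -1/(3ψ₀⁶r³), which vanishes at infinity and equals -1/(24m³)
on the horizon. -/
theorem integral_alpha_psi (hm : 0 < m) :
    IntegrableOn (fun r => alphaFn m r / (psi0 m r ^ 7 * r ^ 4)) (Set.Ioi (m / 2)) ∧
    ∫ r in Set.Ioi (m / 2), alphaFn m r / (psi0 m r ^ 7 * r ^ 4) = 1 / (24 * m ^ 3) := by
  have h1 := continuousOn_psi0 hm
  have h4 := continuousOn_alphaFn hm
  have hr0 : ∀ r ∈ Set.Ici (m / 2), 0 < r := fun r hr => by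
    have : m / 2 ≤ r := hr
    linarith
  have h7 : ∀ r ∈ Set.Ici (m / 2), psi0 m r ^ 7 * r ^ 4 ≠ 0 := fun r hr => by
    have := psi0_pos hm hr; have := hr0 r hr; positivity
  have hinv : Decays 4 fun r : ℝ => (r ^ 4)⁻¹ := isBigO_refl _ _
  have hd : Decays 2 fun r => alphaFn m r / (psi0 m r ^ 7 * r ^ 4) := by
    have := ((decays_alphaFn (m := m)).mul ((decays_inv_psi0_pow (m := m) 7).mul hinv)).mono
      (l := 2) (by norm_num)
    simpa only [div_eq_mul_inv, mul_inv] using this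
  have hi := hd.integrableOn (a := m / 2) (by fun_prop (disch := assumption))
  refine ⟨hi, ?_⟩
  have hlim : Tendsto (fun r => -(1 / 3) * (1 / (psi0 m r ^ 6 * r ^ 3))) atTop (𝓝 0) := by
    have hinv3 : Decays 3 fun r : ℝ => (r ^ 3)⁻¹ := isBigO_refl _ _
    have := (((decays_inv_psi0_pow (m := m) 6).mul hinv3).const_mul (-(1 / 3))).tendsto_zero
      (by norm_num)
    simpa only [one_div, mul_inv] using this
  have hc : ContinuousWithinAt (fun r => -(1 / 3) * (1 / (psi0 m r ^ 6 * r ^ 3)))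
      (Set.Ici (m / 2)) (m / 2) := by
    have h2 := h1 (m / 2) Set.self_mem_Ici
    have h3 : psi0 m (m / 2) ^ 6 * (m / 2) ^ 3 ≠ 0 := by
      rw [psi0_horizon hm]; positivity
    fun_prop (disch := assumption)
  rw [integral_Ioi_of_hasDerivAt_of_tendsto hc (fun r hr =>
    ((hasDerivAt_inv_cube hm hr).const_mul (-(1 / 3))).congr_deriv (by ring)) hi hlim,
    psi0_horizon hm]
  field_simp
  norm_num

/-- The integrable majorant is independent of K because the partial sums of T·b are controlled by
Bessel's inequality. -/
theorem IsDecayingData.abs_tailDensity_le (hm : 0 < m) (hB : IsDecayingData m C B b) (K : ℕ)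
    {r : ℝ} (hr : m / 2 ≤ r) :
    |tailDensity m B b K r| ≤ 2 * (50 * C * C + ((50 * C) ^ 2 + C ^ 2) / 2) * (r ^ 2)⁻¹ := by
  have hr0 : 0 < r := by linarith
  have hp := psi0_pos hm hr
  have hp1 := one_le_psi0 hm hr
  have hα := alphaFn_nonneg hm hr
  have hα1 := alphaFn_le_one hm hr
  have cT := continuous_slice (hB.continuousOn_frT hm) hr
  have cb := hB.smooth_b.continuous_mer hm hr
  have h1 : |avg fun θ => frT m B b r θ * b (r • eR θ)| ≤ 50 * C / r ^ 2 * (C / r ^ 2) := by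
    refine abs_avg_le (cT.mul cb) fun θ _ => ?_
    rw [abs_mul]
    exact mul_le_mul (hB.bound_T hm hr θ) (hB.bound_b hm hr θ) (abs_nonneg _)
      ((abs_nonneg _).trans (hB.bound_T hm hr θ))
  have h2 := abs_sum_legMoment_mul_le cT cb (fun θ => hB.bound_T hm hr θ)
    (fun θ => hB.bound_b hm hr θ) K
  have h3 : ∀ n, momT m B b n r * momH b n r
      = legMoment (frT m B b r) n * legMoment (fun θ => b (r • eR θ)) n := fun n => by
    rw [hB.momT_eq hm n hr]; rfl
  simp only [← h3] at h2
  rw [tailDensity, abs_mul, abs_of_nonneg (by positivity)]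
  have h4 := (abs_sub _ _).trans (add_le_add h1 h2)
  calc _ ≤ 2 * r ^ 2 * 1 / 1 * _ := mul_le_mul (by gcongr) h4 (abs_nonneg _) (by positivity)
    _ = _ := by field_simp

theorem IsDecayingData.continuousOn_tailDensity (hm : 0 < m) (hB : IsDecayingData m C B b)
    (K : ℕ) : ContinuousOn (tailDensity m B b K) (Set.Ici (m / 2)) := by
  have h1 := continuousOn_psi0 hm
  have h4 := continuousOn_alphaFn hm
  have h7 : ∀ r ∈ Set.Ici (m / 2), psi0 m r ≠ 0 := fun r hr => (psi0_pos hm hr).ne'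
  refine ContinuousOn.mul (by fun_prop (disch := assumption)) (ContinuousOn.sub ?_ ?_)
  · exact continuousOn_avg (F := fun r θ => frT m B b r θ * b (r • eR θ))
      ((hB.continuousOn_frT hm).mul (hB.smooth_b.continuousOn_mer hm))
  · exact continuousOn_finsetSum _ fun n _ => continuousOn_const.mul
      ((hB.continuousOn_momT hm n).mul (hB.continuousOn_momH hm n))

theorem integrableOn_inv_sq {a : ℝ} (ha : 0 < a) :
    IntegrableOn (fun r : ℝ => (r ^ 2)⁻¹) (Set.Ioi a) := by
  refine Decays.integrableOn (isBigO_refl _ _) fun r hr => ?_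
  have h : a ≤ r := hr
  have : r ^ 2 ≠ 0 := by have : 0 < r := by linarith
                         positivity
  exact ((continuousAt_id.pow 2).inv₀ this).continuousWithinAt

theorem IsDecayingData.integrableOn_tailDensity (hm : 0 < m) (hB : IsDecayingData m C B b)
    (K : ℕ) : IntegrableOn (tailDensity m B b K) (Set.Ioi (m / 2)) := by
  refine Decays.integrableOn ?_ (hB.continuousOn_tailDensity hm K)
  refine decays_of_bound (a := m / 2)
    (C := 2 * (50 * C * C + ((50 * C) ^ 2 + C ^ 2) / 2)) fun r hr => ?_
  simpa only [div_eq_mul_inv] using hB.abs_tailDensity_le hm K hr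

/-- At each radius the tail tends to zero by Parseval's identity, and the convergence is dominated
by a multiple of r⁻². -/
theorem IsDecayingData.tendsto_integral_tailDensity (hm : 0 < m) (hB : IsDecayingData m C B b) :
    Tendsto (fun K => ∫ r in Set.Ioi (m / 2), tailDensity m B b K r) atTop (𝓝 0) := by
  have h0 : ∫ r in Set.Ioi (m / 2), (0 : ℝ) = 0 := by simp
  rw [← h0]
  refine tendsto_integral_of_dominated_convergence
    (fun r => 2 * (50 * C * C + ((50 * C) ^ 2 + C ^ 2) / 2) * (r ^ 2)⁻¹)
    (fun K => (hB.integrableOn_tailDensity hm K).aestronglyMeasurable)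
    ((integrableOn_inv_sq (by positivity)).const_mul _) (fun K => ?_) ?_
  · filter_upwards [ae_restrict_mem measurableSet_Ioi] with r hr
    exact hB.abs_tailDensity_le hm K (le_of_lt hr)
  · filter_upwards [ae_restrict_mem measurableSet_Ioi] with r hr
    have hr' : m / 2 ≤ r := le_of_lt hr
    have h := (tendsto_sum_legMoment_mul (continuous_slice (hB.continuousOn_frT hm) hr')
      (hB.smooth_b.continuous_mer hm hr')).const_sub
        (avg fun θ => frT m B b r θ * b (r • eR θ))
    have h2 := h.const_mul (2 * r ^ 2 * alphaFn m r / psi0 m r)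
    rw [sub_self, mul_zero] at h2
    refine h2.congr fun K => ?_
    rw [tailDensity]
    congr 2
    exact Finset.sum_congr rfl fun n _ => by rw [hB.momT_eq hm n hr']; rfl

/-- Lower bound of the energy by finitely many modes. -/
theorem IsDecayingData.sum_integral_le (hm : 0 < m) (hB : IsDecayingData m C B b)
    (hJ : ∀ r, m / 2 ≤ r → r ^ 3 * avg (fun θ => sin θ * frRP B r θ) = 2 * J) (K : ℕ) :
    (∑ n ∈ Finset.range K, (2 * (n : ℝ) + 1) * ∫ r in Set.Ioi (m / 2), dataDensity m B b n r)
      + ((∫ r in Set.Ioi (m / 2), tailDensity m B b K r)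
      + (∫ r in Set.Ioi (m / 2), spinDensity m J B r) + J ^ 2 / (2 * m ^ 3))
      ≤ ∫ r in Set.Ioi (m / 2), energyDensity m B b r := by
  have i1 : IntegrableOn (fun r => ∑ n ∈ Finset.range K, (2 * (n : ℝ) + 1) * dataDensity m B b n r)
      (Set.Ioi (m / 2)) :=
    integrable_finsetSum _ fun n _ => (hB.integrableOn_dataDensity hm n).const_mul _
  have i2 := hB.integrableOn_tailDensity hm K
  have i3 := hB.integrableOn_spinDensity (J := J) hm
  obtain ⟨i4, e4⟩ := integral_alpha_psi hm
  have h := setIntegral_mono_on (((i1.add i2).add i3).add (i4.const_mul (12 * J ^ 2)))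
    (hB.integrableOn_energyDensity hm) measurableSet_Ioi fun r hr =>
      hB.sum_dataDensity_le hm (le_of_lt hr) (hJ r (le_of_lt hr)) K
  have e := integral_add ((i1.add i2).add i3) (i4.const_mul (12 * J ^ 2))
  have e' := integral_add (i1.add i2) i3
  have e'' := integral_add i1 i2
  simp only [Pi.add_apply] at h e e' e''
  rw [e, e', e'', integral_finsetSum _ fun n _ => (hB.integrableOn_dataDensity hm n).const_mul _,
    integral_const_mul, e4] at h
  simp only [integral_const_mul] at h
  have e5 : 12 * J ^ 2 * (1 / (24 * m ^ 3)) = J ^ 2 / (2 * m ^ 3) := by field_simp; ring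
  linarith

end EnergyBound

/-- The second-order coefficient of `E² - p² - |S_h|/16π - 4πJ²/|S_h|`, where `h` is the restriction
of the first-order conformal factor to the horizon. -/
def secondVariation (m p J : ℝ) (h : ℝ → ℝ) (B : E3 → Tensor2) (b : E3 → ℝ) : ℝ :=
  m ^ 2 * (avg h ^ 2 - 3 / 2 * avg (fun θ => h θ ^ 2))
    + m / 2 * (∫ r in Set.Ioi (m / 2), energyDensity m B b r) - p ^ 2 - J ^ 2 / (4 * m ^ 2)

/-- The contribution of the `n`-th mode to the second variation. -/
def modeExcess (m : ℝ) (B : E3 → Tensor2) (b : E3 → ℝ) (n : ℕ) : ℝ :=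
  excessCoeff n * ((2 * (n : ℝ) + 1) * dataX m B b n (m / 2)) ^ 2
    + m / 2 * ((2 * (n : ℝ) + 1) * ∫ r in Set.Ioi (m / 2), dataSquare m B b n r)

theorem excessCoeff_pos {n : ℕ} (hn : 2 ≤ n) : 0 < excessCoeff n := by
  have : (2 : ℝ) ≤ n := by exact_mod_cast hn
  have : (0 : ℝ) < n - 1 := by linarith
  unfold excessCoeff
  positivity

/-! ### The lower bound of the second variation by mode excesses. -/

section Bulk
variable {m C p J : ℝ} {h : ℝ → ℝ} {B : E3 → Tensor2} {b : E3 → ℝ}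

theorem dataSquare_nonneg (hm : 0 < m) {n : ℕ} (hn : 2 ≤ n) {r : ℝ} (hr : m / 2 ≤ r) :
    0 ≤ dataSquare m B b n r :=
  modeSquare_nonneg hm (one_lt_capN hn) hr

theorem integral_dataSquare_nonneg (hm : 0 < m) {n : ℕ} (hn : 2 ≤ n) :
    0 ≤ ∫ r in Set.Ioi (m / 2), dataSquare m B b n r :=
  setIntegral_nonneg measurableSet_Ioi fun _ hr => dataSquare_nonneg hm hn (le_of_lt hr)

theorem le_modeExcess (hm : 0 < m) {n : ℕ} (hn : 2 ≤ n) :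
    excessCoeff n * ((2 * (n : ℝ) + 1) * dataX m B b n (m / 2)) ^ 2 ≤ modeExcess m B b n := by
  have := integral_dataSquare_nonneg (B := B) (b := b) hm hn
  unfold modeExcess
  have : 0 ≤ m / 2 * ((2 * (n : ℝ) + 1) * ∫ r in Set.Ioi (m / 2), dataSquare m B b n r) := by
    positivity
  linarith

theorem modeExcess_nonneg (hm : 0 < m) {n : ℕ} (hn : 2 ≤ n) : 0 ≤ modeExcess m B b n :=
  le_trans (by have := excessCoeff_pos hn; positivity) (le_modeExcess hm hn)

/-- With the prescribed moments of h, modes 0 and 1 and the p² and J² terms cancel identically. In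
mode n ≥ 2 the bulk gives (2n+1)x²/(2(n²+n+1)) and the horizon takes away 3x²/(2(2n+1)); the
difference is the coefficient in `modeExcess`. The truncation leaves a Parseval remainder and a
tail, both of which vanish in the limit. -/
theorem IsDecayingData.sum_modeExcess_le (hm : 0 < m) (hB : IsDecayingData m C B b)
    (hJ : ∀ r, m / 2 ≤ r → r ^ 3 * avg (fun θ => sin θ * frRP B r θ) = 2 * J)
    (hp : Tendsto (fun r => 1 / 2 * (r ^ 2 * (momT m B b 1 r - momRT B 1 r))) atTop (𝓝 p))
    (hh : ∀ n, legMoment h n = -dataX m B b n (m / 2) / (m * (2 * (n : ℝ) + 1))) (k : ℕ) :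
    ∑ i ∈ Finset.range k, modeExcess m B b (i + 2)
      + m / 2 * (∫ r in Set.Ioi (m / 2), spinDensity m J B r)
      + m / 2 * (∫ r in Set.Ioi (m / 2), tailDensity m B b (k + 2) r)
      - 3 / 2 * m ^ 2 * (avg (fun θ => h θ ^ 2)
        - ∑ n ∈ Finset.range (k + 2), (2 * (n : ℝ) + 1) * legMoment h n ^ 2)
      ≤ secondVariation m p J h B b := by
  have key := mul_le_mul_of_nonneg_left (hB.sum_integral_le hm hJ (k + 2)) (by positivity : 0 ≤ m / 2)
  have h0 := hh 0
  have havg : legMoment h 0 = avg h := by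
    have : (legendrePoly 0) = 1 := by simp [legendrePoly]
    simp [legMoment, this]
  -- Split off modes 0 and 1, so that the remaining sum runs over n = i + 2.
  simp only [Finset.sum_range_succ' _ (k + 1), Finset.sum_range_succ' _ k] at key ⊢
  have e : ∀ i : ℕ, modeExcess m B b (i + 2) = m / 2 * ((2 * ((i + 2 : ℕ) : ℝ) + 1)
        * ∫ r in Set.Ioi (m / 2), dataDensity m B b (i + 2) r)
      - 3 / 2 * m ^ 2 * ((2 * ((i + 2 : ℕ) : ℝ) + 1) * legMoment h (i + 2) ^ 2) := by
    intro i
    rw [hB.integral_dataDensity hm (by omega), hh, modeExcess, excessCoeff, capN]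
    generalize dataX m B b (i + 2) (m / 2) = X
    generalize ∫ r in Set.Ioi (m / 2), dataSquare m B b (i + 2) r = I
    push_cast
    have : (i : ℝ) + 2 ≠ 0 := by positivity
    have : 2 * ((i : ℝ) + 2) + 1 ≠ 0 := by positivity
    have : ((i : ℝ) + 2) ^ 2 + (i + 2) + 1 ≠ 0 := by positivity
    have : 2 * (((i : ℝ) + 2) * (i + 2 + 1) / 2) + 1 = ((i : ℝ) + 2) ^ 2 + (i + 2) + 1 := by ring
    rw [this]
    field_simp
    ring
  simp only [e, Finset.sum_sub_distrib, ← Finset.mul_sum]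
  simp only [zero_add, hB.integral_dataDensity_one hm hp, hB.integral_dataDensity_zero hm] at key
  have e1 := hh 1
  rw [secondVariation, ← havg]
  simp only [zero_add, h0, e1] at *
  have f1 : m / 2 * ((2 * ((1 : ℕ) : ℝ) + 1) * (2 * p ^ 2 / (3 * m)
      + dataX m B b 1 (m / 2) ^ 2 * (1 / (3 * m)))) = p ^ 2 + dataX m B b 1 (m / 2) ^ 2 / 2 := by
    push_cast; field_simp; ring
  have f0 : m / 2 * ((2 * ((0 : ℕ) : ℝ) + 1) * (dataX m B b 0 (m / 2) ^ 2 * (1 / m)))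
      = dataX m B b 0 (m / 2) ^ 2 / 2 := by
    push_cast; field_simp; ring
  have fJ : m / 2 * (J ^ 2 / (2 * m ^ 3)) = J ^ 2 / (4 * m ^ 2) := by field_simp; ring
  have g1 : m ^ 2 * ((2 * ((1 : ℕ) : ℝ) + 1) * (-dataX m B b 1 (m / 2)
      / (m * (2 * ((1 : ℕ) : ℝ) + 1))) ^ 2) = dataX m B b 1 (m / 2) ^ 2 / 3 := by
    push_cast; field_simp; ring
  have g0 : m ^ 2 * ((2 * ((0 : ℕ) : ℝ) + 1) * (-dataX m B b 0 (m / 2)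
      / (m * (2 * ((0 : ℕ) : ℝ) + 1))) ^ 2) = dataX m B b 0 (m / 2) ^ 2 := by
    push_cast; field_simp; ring
  have g0' : m ^ 2 * (-dataX m B b 0 (m / 2)
      / (m * (2 * ((0 : ℕ) : ℝ) + 1))) ^ 2 = dataX m B b 0 (m / 2) ^ 2 := by
    push_cast; field_simp; ring
  clear h0 e1 havg e
  linarith

/-- The excesses are nonnegative, so bounded partial sums give summability. The error terms of the
truncated estimate are removed by letting the truncation grow. -/
theorem IsDecayingData.tsum_modeExcess_le (hm : 0 < m) (hB : IsDecayingData m C B b)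
    (hcont : Continuous h)
    (hJ : ∀ r, m / 2 ≤ r → r ^ 3 * avg (fun θ => sin θ * frRP B r θ) = 2 * J)
    (hp : Tendsto (fun r => 1 / 2 * (r ^ 2 * (momT m B b 1 r - momRT B 1 r))) atTop (𝓝 p))
    (hh : ∀ n, legMoment h n = -dataX m B b n (m / 2) / (m * (2 * (n : ℝ) + 1))) :
    Summable (fun i => modeExcess m B b (i + 2)) ∧
      ∑' i, modeExcess m B b (i + 2) + m / 2 * (∫ r in Set.Ioi (m / 2), spinDensity m J B r)
        ≤ secondVariation m p J h B b := by
  have hnn : ∀ i, 0 ≤ modeExcess m B b (i + 2) := fun i => modeExcess_nonneg hm (by omega)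
  have t1 := (tendsto_add_atTop_iff_nat 2).mpr (hB.tendsto_integral_tailDensity hm)
  have t2 := (tendsto_add_atTop_iff_nat 2).mpr (tendsto_sum_legMoment_sq hcont)
  have t3 := ((t1.const_mul (m / 2)).sub ((t2.const_sub (avg fun θ => h θ ^ 2)).const_mul
    (3 / 2 * m ^ 2))).const_sub (secondVariation m p J h B b
      - m / 2 * ∫ r in Set.Ioi (m / 2), spinDensity m J B r)
  simp only [mul_zero, sub_self, sub_zero] at t3
  have hle : ∀ k, ∑ i ∈ Finset.range k, modeExcess m B b (i + 2) ≤ secondVariation m p J h B b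
      - m / 2 * ∫ r in Set.Ioi (m / 2), spinDensity m J B r := by
    intro k
    refine ge_of_tendsto t3 ?_
    -- The truncation l tends to infinity while the partial sum up to k stays fixed; for l ≥ k it
    -- only increases by nonnegative terms.
    filter_upwards [eventually_ge_atTop k] with l hl
    have h1 : ∑ i ∈ Finset.range k, modeExcess m B b (i + 2)
        ≤ ∑ i ∈ Finset.range l, modeExcess m B b (i + 2) :=
      Finset.sum_le_sum_of_subset_of_nonneg (Finset.range_mono hl) fun i _ _ => hnn i
    have h2 := hB.sum_modeExcess_le hm hJ hp hh l
    linarith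
  have hs := summable_of_sum_range_le hnn hle
  exact ⟨hs, by linarith [hs.tsum_le_of_sum_range_le hle]⟩

end Bulk

/-! ### The moments `X_n`, `Y_n` and the genericity conditions -/

section Moments
variable {m C : ℝ} {B : E3 → Tensor2} {b : E3 → ℝ}

theorem IsAxialTT.compRR_eq (hm : 0 < m) (hB : IsAxialTT m B) {r : ℝ} (hr : m / 2 ≤ r) (z : ℝ) :
    compRR B r z = frRR B r (arccos z) := by
  have h := hB.symm_apply (smul_eR_mem hm hr (arccos z)) 2 0
  simp only [compRR, sph_zero, contract, vecR, frRR, Matrix.mulVec, dotProduct, Fin.sum_univ_three]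
  simp [h]
  ring

theorem IsAxialTT.compRTheta_eq (hm : 0 < m) (hB : IsAxialTT m B) {r : ℝ} (hr : m / 2 ≤ r)
    (z : ℝ) : compRTheta B r z = r * frRT B r (arccos z) := by
  have h := hB.symm_apply (smul_eR_mem hm hr (arccos z)) 2 0
  simp only [compRTheta, sph_zero, contract, vecR, vecTheta, frRT, Matrix.mulVec, dotProduct,
    Fin.sum_univ_three]
  simp [h]
  ring

theorem IsAxialTT.compPhiR_eq (hm : 0 < m) (hB : IsAxialTT m B) {r : ℝ} (hr : m / 2 ≤ r)
    (z : ℝ) : compPhiR B r z = r * (sin (arccos z) * frRP B r (arccos z)) := by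
  have h := hB.symm_apply (smul_eR_mem hm hr (arccos z)) 1 0
  simp only [compPhiR, sph_zero, contract, vecR, vecPhi, frRP, Matrix.mulVec, dotProduct,
    Fin.sum_univ_three]
  simp [h]
  ring

theorem IsAxialTT.compPhiTheta_eq (hm : 0 < m) (hB : IsAxialTT m B) {r : ℝ} (hr : m / 2 ≤ r)
    (z : ℝ) : compPhiTheta B r z = r ^ 2 * (sin (arccos z) * frTP B r (arccos z)) := by
  have h := hB.symm_apply (smul_eR_mem hm hr (arccos z)) 1 0
  simp only [compPhiTheta, sph_zero, contract, vecTheta, vecPhi, frTP, Matrix.mulVec, dotProduct,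
    Fin.sum_univ_three]
  simp [h]
  ring

theorem IsAxialTT.radialPart_eq (hm : 0 < m) (hB : IsAxialTT m B) {r : ℝ} (hr : m / 2 ≤ r)
    (z : ℝ) : radialPart m B b r z = frT m B b r (arccos z) := by
  rw [radialPart, hB.compRR_eq hm hr, sph_zero, frT]
  ring

/-- The mixed component divided by `sin θ`. -/
def mixedQuotient (B : E3 → Tensor2) (r θ : ℝ) : ℝ :=
  cos θ * (B (r • eR θ) 0 0 - B (r • eR θ) 2 2)
    + (cos θ ^ 2 - sin θ ^ 2) * (r * partialD 1 (fun y => B y 1 2) (r • eR θ))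

/-- By the infinitesimal rotation law T_xz equals r sin θ ∂_y T_yz on the meridian, so the mixed
component is divisible by sin θ with a quotient that is continuous up to the poles. -/
theorem IsAxialTT.frRT_eq_sin_mul (hm : 0 < m) (hB : IsAxialTT m B) {r : ℝ} (hr : m / 2 ≤ r)
    (θ : ℝ) : frRT B r θ = sin θ * mixedQuotient B r θ := by
  have h := hB.rotation_one_two hm hr θ
  rw [frRT, mixedQuotient, ← h]
  ring

theorem IsAxialTT.continuous_mixedQuotient (hm : 0 < m) (hB : IsAxialTT m B) {r : ℝ}
    (hr : m / 2 ≤ r) : Continuous (mixedQuotient B r) := by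
  have h0 := (hB.smooth 0 0).continuous_mer hm hr
  have h2 := (hB.smooth 2 2).continuous_mer hm hr
  have h1 := ((hB.smooth 1 2).partialD 1).continuous_mer hm hr
  exact (continuous_cos.mul (h0.sub h2)).add (((continuous_cos.pow 2).sub
    (continuous_sin.pow 2)).mul (continuous_const.mul h1))

/-- The integrand defining the primitive is a quotient with denominator zero at s = ±1. Away from
these two points it is a multiple of the regular quotient, and a null set does not affect the
integral. -/
theorem IsAxialTT.primY_eq (hm : 0 < m) (hB : IsAxialTT m B) {r : ℝ} (hr : m / 2 ≤ r) {z : ℝ}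
    (hz : z ∈ Set.Icc (-1 : ℝ) 1) : primY m B r z
      = -(r ^ 2 / psi0 m r ^ 3) * ∫ s in (0 : ℝ)..z, mixedQuotient B r (arccos s) := by
  have hp := psi0_pos hm hr
  rw [primY, ← intervalIntegral.integral_const_mul]
  refine intervalIntegral.integral_congr_ae ?_
  have h1 : ∀ᵐ s : ℝ, s ∉ ({-1, 1} : Set ℝ) :=
    (Set.toFinite ({-1, 1} : Set ℝ)).measure_zero volume |> compl_mem_ae_iff.mpr
  filter_upwards [h1] with s hs hsz
  have hs' : s ∈ Set.Icc (-1 : ℝ) 1 :=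
    Set.uIcc_subset_Icc (by norm_num) hz (Set.uIoc_subset_uIcc hsz)
  simp only [Set.mem_insert_iff, Set.mem_singleton_iff, not_or] at hs
  have hs1 : s ^ 2 - 1 ≠ 0 := by
    intro h
    rcases mul_eq_zero.mp (show (s - 1) * (s + 1) = 0 by linarith) with h | h
    · exact hs.2 (by linarith)
    · exact hs.1 (by linarith)
  have hsin : sin (arccos s) ^ 2 = 1 - s ^ 2 := by
    rw [sin_sq, cos_arccos hs'.1 hs'.2]
  rw [potU, hB.compRTheta_eq hm hr, hB.frRT_eq_sin_mul hm hr, ← sin_arccos]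
  have : r * (r * (sin (arccos s) * mixedQuotient B r (arccos s))) * sin (arccos s)
      = -(r ^ 2 * mixedQuotient B r (arccos s) * (s ^ 2 - 1)) := by
    linear_combination r ^ 2 * mixedQuotient B r (arccos s) * hsin
  rw [this]
  field_simp

theorem integral_legendre_eq_zero {n : ℕ} (hn : 1 ≤ n) :
    ∫ z in (-1 : ℝ)..1, (legendrePoly n).eval z = 0 := by
  have h := avg_legendre_mul n 0
  have h1 : legendrePoly 0 = 1 := by simp [legendrePoly]
  rw [if_neg (by omega), h1] at h
  simp only [Polynomial.eval_one, mul_one] at h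
  rw [avg_eq_integral_arccos (continuous_eval_cos _)] at h
  have h2 : ∫ z in (-1 : ℝ)..1, (legendrePoly n).eval (cos (arccos z))
      = ∫ z in (-1 : ℝ)..1, (legendrePoly n).eval z := by
    refine intervalIntegral.integral_congr fun z hz => ?_
    rw [Set.uIcc_of_le (by norm_num)] at hz
    simp only [cos_arccos hz.1 hz.2]
  rw [h2] at h
  linarith

/-- Integrate by parts against (z² - 1)Pₙ', whose derivative is 2N Pₙ and which vanishes at z = ±1.
For n ≥ 1 the constant normalizing the mean of Y is invisible, and N ≠ 0 allows the division. -/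
theorem IsAxialTT.momentY_eq (hm : 0 < m) (hB : IsAxialTT m B) {n : ℕ} (hn : 1 ≤ n) {r : ℝ}
    (hr : m / 2 ≤ r) :
    momentY m B n r = (2 * (n : ℝ) + 1) * modeY m (capN n) (momRT B n) r := by
  have hr0 : 0 < r := by linarith
  have hp := psi0_pos hm hr
  have hN : 0 < capN n := by
    have : (0 : ℝ) < n := by exact_mod_cast hn
    unfold capN; positivity
  set g : ℝ → ℝ := fun s => mixedQuotient B r (arccos s) with hg
  have cg : Continuous g := (hB.continuous_mixedQuotient hm hr).comp continuous_arccos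
  set G : ℝ → ℝ := fun z => ∫ s in (0 : ℝ)..z, g s with hG
  have dG : ∀ z, HasDerivAt G (g z) z := fun z => (cg.integral_hasStrictDerivAt 0 z).hasDerivAt
  have cG : Continuous G := continuous_iff_continuousAt.mpr fun z => (dG z).continuousAt
  set c := 1 / 2 * ∫ s in (-1 : ℝ)..1, primY m B r s with hc
  have hP : Continuous fun z => (legendrePoly n).eval z := (legendrePoly n).continuous
  have hP1 : Continuous fun z => (legendrePoly n).derivative.eval z := Polynomial.continuous _
  have h1 : ∫ z in (-1 : ℝ)..1, varY m B r z * legendreP n z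
      = -(r ^ 2 / psi0 m r ^ 3) * (∫ z in (-1 : ℝ)..1, G z * (legendrePoly n).eval z) := by
    have h2 : ∫ z in (-1 : ℝ)..1, varY m B r z * legendreP n z
        = ∫ z in (-1 : ℝ)..1, (-(r ^ 2 / psi0 m r ^ 3) * (G z * (legendrePoly n).eval z)
          - c * (legendrePoly n).eval z) := by
      refine intervalIntegral.integral_congr fun z hz => ?_
      rw [Set.uIcc_of_le (by norm_num)] at hz
      simp only [varY, hB.primY_eq hm hr hz, legendreP_eq]
      change (-(r ^ 2 / psi0 m r ^ 3) * G z - c) * _ = _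
      ring
    have c1 : Continuous fun z => -(r ^ 2 / psi0 m r ^ 3) * (G z * (legendrePoly n).eval z) :=
      (cG.mul hP).const_mul _
    rw [h2, intervalIntegral.integral_sub (c1.intervalIntegrable _ _)
      ((hP.const_mul _).intervalIntegrable _ _), intervalIntegral.integral_const_mul, intervalIntegral.integral_const_mul,
      integral_legendre_eq_zero hn]
    ring
  have hV : ∀ z, HasDerivAt (fun z => (z ^ 2 - 1) * (legendrePoly n).derivative.eval z)
      (2 * capN n * (legendrePoly n).eval z) z := by
    intro z
    refine (((hasDerivAt_pow 2 z).sub_const 1).mul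
      ((legendrePoly n).derivative.hasDerivAt z)).congr_deriv ?_
    rw [← legendre_eval_ode]
    push_cast
    ring
  have hint := intervalIntegral.integral_mul_deriv_eq_deriv_mul (a := -1) (b := 1)
    (fun z _ => dG z) (fun z _ => hV z) (cg.intervalIntegrable _ _)
    ((hP.const_mul _).intervalIntegrable _ _)
  have h3 : ∫ z in (-1 : ℝ)..1, G z * (2 * capN n * (legendrePoly n).eval z)
      = 2 * capN n * ∫ z in (-1 : ℝ)..1, G z * (legendrePoly n).eval z := by
    rw [← intervalIntegral.integral_const_mul]; congr 1; funext z; ring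
  have h4 : momRT B n r
      = 1 / 2 * ∫ z in (-1 : ℝ)..1, -(g z * ((z ^ 2 - 1) * (legendrePoly n).derivative.eval z)) := by
    have cRT := continuous_slice (hB.frRT_continuousOn hm) hr
    have c1 : Continuous fun θ =>
        frRT B r θ * (sin θ * (legendrePoly n).derivative.eval (cos θ)) :=
      cRT.mul (continuous_sin.mul (continuous_eval_cos _))
    rw [momRT, avg_eq_integral_arccos c1]
    congr 1
    refine intervalIntegral.integral_congr fun z hz => ?_
    rw [Set.uIcc_of_le (by norm_num)] at hz
    have hsin : sin (arccos z) ^ 2 = 1 - z ^ 2 := by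
      rw [sin_sq, cos_arccos hz.1 hz.2]
    simp only [hB.frRT_eq_sin_mul hm hr, cos_arccos hz.1 hz.2, hg]
    linear_combination mixedQuotient B r (arccos z) * (legendrePoly n).derivative.eval z * hsin
  rw [intervalIntegral.integral_neg] at h4
  rw [h3] at hint
  have h5 : ∫ z in (-1 : ℝ)..1, G z * (legendrePoly n).eval z = momRT B n r / capN n := by
    rw [eq_div_iff hN.ne']
    norm_num at hint
    linarith
  rw [momentY, legendreCoeff, h1, h5, modeY]
  field_simp

theorem IsDecayingData.momentX_eq (hm : 0 < m) (hB : IsDecayingData m C B b) {n : ℕ} (hn : 1 ≤ n)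
    {r : ℝ} (hr : m / 2 ≤ r) :
    momentX m B b n r = (2 * (n : ℝ) + 1) * dataX m B b n r := by
  have hBT := hB.toIsAxialTT
  have hr0 : 0 < r := by linarith
  have hp := psi0_pos hm hr
  have cT := continuous_slice (hB.continuousOn_frT hm) hr
  have cg : Continuous fun s => mixedQuotient B r (arccos s) :=
    (hBT.continuous_mixedQuotient hm hr).comp continuous_arccos
  have cG : Continuous fun z : ℝ => ∫ s in (0 : ℝ)..z, mixedQuotient B r (arccos s) :=
    continuous_iff_continuousAt.mpr fun z =>
      (cg.integral_hasStrictDerivAt 0 z).hasDerivAt.continuousAt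
  have cL : Continuous (legendreP n) := by
    rw [show legendreP n = fun z => (legendrePoly n).eval z from funext (legendreP_eq n)]
    exact (legendrePoly n).continuous
  have cY : ContinuousOn (varY m B r) (Set.Icc (-1) 1) :=
    (((cG.const_mul (-(r ^ 2 / psi0 m r ^ 3))).sub (continuous_const
      (y := 1 / 2 * ∫ s in (-1 : ℝ)..1, primY m B r s))).continuousOn).congr
      fun z hz => by rw [varY, hBT.primY_eq hm hr hz]; rfl
  have iY : IntervalIntegrable (fun z => varY m B r z * legendreP n z) volume (-1) 1 := by
    refine ContinuousOn.intervalIntegrable ?_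
    rw [Set.uIcc_of_le (by norm_num)]
    exact cY.mul cL.continuousOn
  have iT : IntervalIntegrable (fun z => frT m B b r (arccos z) * legendreP n z) volume (-1) 1 :=
    ((cT.comp continuous_arccos).mul cL).intervalIntegrable _ _
  have h1 : momentX m B b n r
      = r ^ 3 / (2 * r * psi0 m r ^ 2) * legendreCoeff (fun z => frT m B b r (arccos z)) n
        + alphaFn m r * momentY m B n r := by
    simp only [momentX, momentY, legendreCoeff, varX, potW, hBT.radialPart_eq hm hr]
    have e : ∀ z, (r ^ 3 * frT m B b r (arccos z) / (2 * r * psi0 m r ^ 2)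
        + alphaFn m r * varY m B r z) * legendreP n z
        = r ^ 3 / (2 * r * psi0 m r ^ 2) * (frT m B b r (arccos z) * legendreP n z)
          + alphaFn m r * (varY m B r z * legendreP n z) := fun z => by ring
    simp only [e]
    rw [intervalIntegral.integral_add (iT.const_mul _) (iY.const_mul _),
      intervalIntegral.integral_const_mul, intervalIntegral.integral_const_mul]
    ring
  rw [h1, legendreCoeff_arccos cT, hBT.momentY_eq hm hn hr, dataX, modeX, hB.momT_eq hm n hr]
  ring

theorem eqOn_zero_of_setIntegral_eq_zero {f : ℝ → ℝ} {a : ℝ} (hc : ContinuousOn f (Set.Ici a))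
    (hi : IntegrableOn f (Set.Ioi a)) (h0 : ∀ r, a ≤ r → 0 ≤ f r)
    (h : ∫ r in Set.Ioi a, f r = 0) : ∀ r, a < r → f r = 0 := by
  have h1 := (setIntegral_eq_zero_iff_of_nonneg_ae (by
    filter_upwards [ae_restrict_mem measurableSet_Ioi] with r hr using h0 r (le_of_lt hr)) hi).mp h
  exact Measure.eqOn_open_of_ae_eq h1 isOpen_Ioi (hc.mono Set.Ioi_subset_Ici_self)
    continuousOn_const

theorem continuousOn_slice_left {a : ℝ} {F : ℝ → ℝ → ℝ}
    (hF : ContinuousOn (fun p : ℝ × ℝ => F p.1 p.2) (Set.Ici a ×ˢ Set.univ)) (θ : ℝ) :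
    ContinuousOn (fun r => F r θ) (Set.Ici a) :=
  hF.comp (f := fun r : ℝ => (r, θ)) (continuousOn_id.prodMk continuousOn_const)
    fun _ hr => ⟨hr, trivial⟩

/-- A vanishing integral of the continuous nonnegative spin density makes it vanish at every radius
outside the horizon; there α > 0, so both squares vanish. -/
theorem IsDecayingData.pureSpin (hm : 0 < m) (hB : IsDecayingData m C B b) {J : ℝ}
    (h : ∫ r in Set.Ioi (m / 2), spinDensity m J B r = 0) : PureSpin m B := by
  have hBT := hB.toIsAxialTT
  have h1 := eqOn_zero_of_setIntegral_eq_zero (hB.continuousOn_spinDensity (J := J) hm)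
    (hB.integrableOn_spinDensity hm) (fun r hr => spinDensity_nonneg hm hr hB) h
  have h2 : ∀ r, m / 2 < r → ∀ θ ∈ Set.Icc 0 π,
      frRP B r θ - 3 * J / r ^ 3 * sin θ = 0 ∧ frTP B r θ = 0 := by
    intro r hr
    have hr0 : 0 < r := by linarith
    have hp := psi0_pos hm hr.le
    have hα := alphaFn_pos hm hr
    have cRP := continuous_slice (hB.frRP_continuousOn hm) hr.le
    have cTP := continuous_slice (hB.frTP_continuousOn hm) hr.le
    have hc : Continuous fun θ => frRP B r θ - 3 * J / r ^ 3 * sin θ := by fun_prop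
    have h3 := h1 r hr
    rw [spinDensity, mul_eq_zero, or_iff_right (by positivity)] at h3
    rw [avg_add (f := fun θ => (frRP B r θ - 3 * J / r ^ 3 * sin θ) ^ 2)
      (g := fun θ => frTP B r θ ^ 2) (hc.pow 2) (cTP.pow 2)] at h3
    have h4 : 0 ≤ avg fun θ => (frRP B r θ - 3 * J / r ^ 3 * sin θ) ^ 2 :=
      avg_nonneg (hc.pow 2) fun θ _ => sq_nonneg _
    have h5 : 0 ≤ avg fun θ => frTP B r θ ^ 2 := avg_nonneg (cTP.pow 2) fun θ _ => sq_nonneg _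
    exact fun θ hθ => ⟨eq_zero_of_avg_sq_eq_zero hc (by linarith) θ hθ,
      eq_zero_of_avg_sq_eq_zero cTP (by linarith) θ hθ⟩
  -- On the horizon the weight α is zero and the density says nothing; continuity in r carries the
  -- equations over.
  have h3 : ∀ r, m / 2 ≤ r → ∀ θ ∈ Set.Icc 0 π,
      frRP B r θ - 3 * J / r ^ 3 * sin θ = 0 ∧ frTP B r θ = 0 := by
    intro r hr θ hθ
    have hsub : Set.Ici (m / 2) ⊆ closure (Set.Ioi (m / 2)) := by rw [closure_Ioi]
    have c1 := continuousOn_slice_left (hB.frRP_continuousOn hm) θ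
    have c2 := continuousOn_slice_left (hB.frTP_continuousOn hm) θ
    have c3 : ContinuousOn (fun r => frRP B r θ - 3 * J / r ^ 3 * sin θ) (Set.Ici (m / 2)) := by
      refine c1.sub ?_
      have : ∀ r ∈ Set.Ici (m / 2), r ^ 3 ≠ 0 := fun r hr => by
        have h : m / 2 ≤ r := hr
        have : 0 < r := by linarith
        positivity
      fun_prop (disch := assumption)
    have e1 : Set.EqOn (fun r => frRP B r θ - 3 * J / r ^ 3 * sin θ) (fun _ => 0)
        (Set.Ici (m / 2)) := Set.EqOn.of_subset_closure (s := Set.Ioi (m / 2))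
          (fun r hr => (h2 r hr θ hθ).1) c3 continuousOn_const Set.Ioi_subset_Ici_self hsub
    have e2 : Set.EqOn (fun r => frTP B r θ) (fun _ => 0)
        (Set.Ici (m / 2)) := Set.EqOn.of_subset_closure (s := Set.Ioi (m / 2))
          (fun r hr => (h2 r hr θ hθ).2) c2 continuousOn_const Set.Ioi_subset_Ici_self hsub
    exact ⟨e1 hr, e2 hr⟩
  refine ⟨J, fun r hr z hz => ?_⟩
  have hr0 : 0 < r := by linarith
  obtain ⟨h4, h5⟩ := h3 r hr (arccos z) ⟨arccos_nonneg z, arccos_le_pi z⟩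
  have hsin : sin (arccos z) ^ 2 = 1 - z ^ 2 := by rw [sin_sq, cos_arccos hz.1 hz.2]
  rw [hBT.compPhiTheta_eq hm hr, hBT.compPhiR_eq hm hr, h5, ← hsin, sub_eq_zero.mp h4]
  refine ⟨by ring, ?_⟩
  field_simp

/-- On the horizon `dataX` is a nonzero multiple of the radial moment. Only the moments n = 0, 1
survive, and Parseval's identity shows that the function equals its projection onto affine functions
of z. -/
theorem IsDecayingData.affineOnHorizon (hm : 0 < m) (hB : IsDecayingData m C B b)
    (h : ∀ n, 2 ≤ n → dataX m B b n (m / 2) = 0) : AffineOnHorizon m B b := by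
  have cT := continuous_slice (hB.continuousOn_frT hm) le_rfl
  have h1 : ∀ n, 2 ≤ n → legMoment (frT m B b (m / 2)) n = 0 := by
    intro n hn
    have h2 := h n hn
    rw [dataX, modeX, alphaFn_horizon hm, psi0_horizon hm, hB.momT_eq hm n le_rfl, zero_mul,
      add_zero, div_eq_zero_iff, mul_eq_zero] at h2
    rcases h2 with (h2 | h2) | h2
    · exact absurd h2 (by positivity)
    · exact h2
    · exact absurd h2 (by positivity)
  set c := legMoment (frT m B b (m / 2)) 0
  -- The factor 3 = 2·1 + 1 is the inverse square norm of P₁.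
  set d := 3 * legMoment (frT m B b (m / 2)) 1
  have cP := fun n => continuous_eval_cos (legendrePoly n)
  have cg : Continuous fun θ => frT m B b (m / 2) θ - (c * (legendrePoly 0).eval (cos θ)
      + d * (legendrePoly 1).eval (cos θ)) := cT.sub (((cP 0).const_mul c).add ((cP 1).const_mul d))
  have h2 : ∀ n, legMoment (fun θ => frT m B b (m / 2) θ - (c * (legendrePoly 0).eval (cos θ)
      + d * (legendrePoly 1).eval (cos θ))) n = 0 := by
    intro n
    have ca : Continuous fun θ => c * (legendrePoly 0).eval (cos θ)
      + d * (legendrePoly 1).eval (cos θ) := ((cP 0).const_mul c).add ((cP 1).const_mul d)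
    rw [legMoment_sub cT ca, legMoment_add ((cP 0).const_mul c) ((cP 1).const_mul d), legMoment_const_mul,
      legMoment_const_mul, legMoment, legMoment, legMoment, avg_legendre_mul, avg_legendre_mul]
    match n with
    | 0 => simp [c, legMoment]
    | 1 => simp [d, legMoment]; norm_num; ring
    | n + 2 =>
      rw [if_neg (by omega), if_neg (by omega)]
      have := h1 (n + 2) (by omega)
      rw [legMoment] at this
      simp [this]
  have h3 := tendsto_sum_legMoment_sq cg
  simp only [h2] at h3
  norm_num at h3
  have h4 := eq_zero_of_avg_sq_eq_zero cg h3.symm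
  obtain ⟨u, v, huv⟩ := Polynomial.exists_eq_X_add_C_of_natDegree_le_one
    (legendrePoly_natDegree_le 1)
  have hP0 : legendrePoly 0 = 1 := by simp [legendrePoly]
  refine ⟨c + d * v, d * u, fun z hz => ?_⟩
  have h5 := h4 (arccos z) ⟨arccos_nonneg z, arccos_le_pi z⟩
  rw [huv, hP0, cos_arccos hz.1 hz.2] at h5
  rw [hB.toIsAxialTT.radialPart_eq hm le_rfl]
  simp at h5
  linear_combination h5

theorem IsDecayingData.integrableOn_dataSquare (hm : 0 < m) (hB : IsDecayingData m C B b) {n : ℕ}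
    (hn : 2 ≤ n) : IntegrableOn (dataSquare m B b n) (Set.Ioi (m / 2)) :=
  (decays_modeSquare (one_lt_capN hn) (hB.decays_momT hm n) (hB.decays_momRT hm n)
    (hB.decays_momQ hm n)).integrableOn (continuousOn_modeSquare hm (one_lt_capN hn)
    (hB.continuousOn_momT hm n) (hB.continuousOn_momRT hm n) (hB.continuousOn_momQ hm n))

/-- A vanishing square determines q as a multiple of X. Inserted into the equation for X' it
eliminates q, and solving for Y gives the stated relation, with β = κ/(rψ₀). -/
theorem IsDecayingData.momentsLocked (hm : 0 < m) (hB : IsDecayingData m C B b)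
    (h : ∀ n, 2 ≤ n → ∫ r in Set.Ioi (m / 2), dataSquare m B b n r = 0) :
    MomentsLocked m B b := by
  intro n hn r hr
  have hr0 : 0 < r := by linarith
  have hN := one_lt_capN hn
  have hN0 : 0 < capN n := by linarith
  have hN1 : 0 < capN n - 1 := by linarith
  have hp := psi0_pos hm hr.le
  have hα := alphaFn_pos hm hr
  have hκ := kappaFn_pos hm hN.le hr.le
  have h1 := eqOn_zero_of_setIntegral_eq_zero (continuousOn_modeSquare hm (one_lt_capN hn)
    (hB.continuousOn_momT hm n) (hB.continuousOn_momRT hm n) (hB.continuousOn_momQ hm n))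
    (hB.integrableOn_dataSquare hm hn) (fun r hr => dataSquare_nonneg hm hn hr) (h n hn) r hr
  rw [modeSquare, mul_eq_zero, or_iff_right (by positivity), sq_eq_zero_iff, sub_eq_zero] at h1
  have h2 := hasDerivAt_modeX hm hN0 hr (hB.hasDerivAt_momT hm n hr) (hB.hasDerivAt_momRT hm n hr)
  have h3 : HasDerivAt (momentX m B b n) _ r := (h2.const_mul (2 * (n : ℝ) + 1)).congr_of_eventuallyEq (by
    filter_upwards [lt_mem_nhds hr] with s hs
    exact hB.momentX_eq hm (by omega) hs.le)
  have h4 : betaFn m n r = kappaFn m (capN n) r / (r * psi0 m r) := by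
    rw [betaFn, kappaFn]; field_simp
  rw [h3.deriv, hB.toIsAxialTT.momentY_eq hm (by omega) hr.le, hB.momentX_eq hm (by omega) hr.le,
    h4, h1, dataX]
  field_simp
  ring

/-- If D ≤ 0, the mode excesses and the spin integral, all nonnegative, must vanish separately; this
gives all three of the conditions that genericity excludes together. -/
theorem IsDecayingData.secondVariation_pos (hm : 0 < m) (hB : IsDecayingData m C B b) {D J : ℝ}
    (hs : Summable fun i => modeExcess m B b (i + 2))
    (hD : ∑' i, modeExcess m B b (i + 2) + m / 2 * (∫ r in Set.Ioi (m / 2), spinDensity m J B r)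
      ≤ D) (hg : Generic m B b) : 0 < D := by
  have hnn : ∀ i, 0 ≤ modeExcess m B b (i + 2) := fun i => modeExcess_nonneg hm (by omega)
  have hspin : 0 ≤ ∫ r in Set.Ioi (m / 2), spinDensity m J B r :=
    setIntegral_nonneg measurableSet_Ioi fun r hr => spinDensity_nonneg hm (le_of_lt hr) hB
  have hsum : 0 ≤ ∑' i, modeExcess m B b (i + 2) := tsum_nonneg hnn
  have hspin' : 0 ≤ m / 2 * ∫ r in Set.Ioi (m / 2), spinDensity m J B r := by positivity
  by_contra hD0
  refine hg ⟨hB.pureSpin hm (J := J) ?_, ?_⟩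
  · have : m / 2 * (∫ r in Set.Ioi (m / 2), spinDensity m J B r) = 0 := by linarith
    exact (mul_eq_zero.mp this).resolve_left (by positivity)
  have h0 : ∑' i, modeExcess m B b (i + 2) = 0 := by linarith
  have h1 : ∀ n, 2 ≤ n → modeExcess m B b n = 0 := by
    intro n hn
    have h2 := hs.le_tsum (n - 2) fun j _ => hnn j
    rw [h0, Nat.sub_add_cancel hn] at h2
    exact le_antisymm h2 (modeExcess_nonneg hm hn)
  have h2 : ∀ n, 2 ≤ n → dataX m B b n (m / 2) = 0 ∧
      ∫ r in Set.Ioi (m / 2), dataSquare m B b n r = 0 := by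
    intro n hn
    have h3 := h1 n hn
    have h4 := integral_dataSquare_nonneg (B := B) (b := b) hm hn
    have h5 := excessCoeff_pos hn
    have h6 : 0 ≤ m / 2 * ((2 * (n : ℝ) + 1) * ∫ r in Set.Ioi (m / 2), dataSquare m B b n r) := by
      positivity
    have h7 : 0 ≤ excessCoeff n * ((2 * (n : ℝ) + 1) * dataX m B b n (m / 2)) ^ 2 := by positivity
    rw [modeExcess] at h3
    have h8 : excessCoeff n * ((2 * (n : ℝ) + 1) * dataX m B b n (m / 2)) ^ 2 = 0 := by linarith
    have h9 : m / 2 * ((2 * (n : ℝ) + 1) * ∫ r in Set.Ioi (m / 2), dataSquare m B b n r) = 0 := by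
      linarith
    have hn1 : (2 * (n : ℝ) + 1) ≠ 0 := by positivity
    exact ⟨by simpa [h5.ne', hn1] using h8, by simpa [hm.ne', hn1] using h9⟩
  exact ⟨hB.affineOnHorizon hm fun n hn => (h2 n hn).1, hB.momentsLocked hm fun n hn => (h2 n hn).2⟩

theorem IsDecayingData.excessTerm_eq (hm : 0 < m) (hB : IsDecayingData m C B b) {n : ℕ}
    (hn : 2 ≤ n) : excessTerm m B b n
      = excessCoeff n * ((2 * (n : ℝ) + 1) * dataX m B b n (m / 2)) ^ 2 := by
  rw [excessTerm, hB.momentX_eq hm (by omega) le_rfl]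

theorem IsDecayingData.tsum_excessTerm_le (hm : 0 < m) (hB : IsDecayingData m C B b) {D J : ℝ}
    (hs : Summable fun i => modeExcess m B b (i + 2))
    (hD : ∑' i, modeExcess m B b (i + 2) + m / 2 * (∫ r in Set.Ioi (m / 2), spinDensity m J B r)
      ≤ D) : Summable (fun n => excessTerm m B b (n + 2)) ∧
        ∑' n, excessTerm m B b (n + 2) ≤ D := by
  have hle : ∀ i, excessTerm m B b (i + 2) ≤ modeExcess m B b (i + 2) := fun i => by
    rw [hB.excessTerm_eq hm (by omega)]
    exact le_modeExcess hm (by omega)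
  have hnn : ∀ i, 0 ≤ excessTerm m B b (i + 2) := fun i => by
    have := excessCoeff_pos (n := i + 2) (by omega)
    rw [excessTerm]; positivity
  have hs' := hs.of_nonneg_of_le hnn hle
  have hspin : 0 ≤ ∫ r in Set.Ioi (m / 2), spinDensity m J B r :=
    setIntegral_nonneg measurableSet_Ioi fun r hr => spinDensity_nonneg hm (le_of_lt hr) hB
  have hspin' : 0 ≤ m / 2 * ∫ r in Set.Ioi (m / 2), spinDensity m J B r := by positivity
  exact ⟨hs', by linarith [hs'.tsum_le_tsum hle hs]⟩

end Moments

/-! ### Asymptotics of solutions of ordinary differential inequalities -/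

theorem monotoneOn_Ioi_of_hasDerivAt {f f' : ℝ → ℝ} {R : ℝ}
    (h : ∀ r, R < r → HasDerivAt f (f' r) r) (h0 : ∀ r, R < r → 0 ≤ f' r) :
    MonotoneOn f (Set.Ioi R) :=
  monotoneOn_of_hasDerivWithinAt_nonneg (convex_Ioi R)
    (fun r hr => (h r hr).continuousAt.continuousWithinAt)
    (fun r hr => by rw [interior_Ioi] at hr; exact (h r hr).hasDerivWithinAt)
    fun r hr => by rw [interior_Ioi] at hr; exact h0 r hr

theorem hasDerivAt_div_id (c : ℝ) {r : ℝ} (hr : r ≠ 0) :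
    HasDerivAt (fun r => c / r) (-(c / r ^ 2)) r := by
  refine ((hasDerivAt_const r c).div (hasDerivAt_id r) hr).congr_deriv ?_
  simp only [id]
  field_simp
  ring

theorem tendsto_const_div_id (c : ℝ) : Tendsto (fun r : ℝ => c / r) atTop (𝓝 0) :=
  tendsto_const_nhds.div_atTop tendsto_id

/-- A function tending to zero whose derivative is at least `-L / r²` is at most `L / r`. -/
theorem le_div_of_tendsto_zero {v v' : ℝ → ℝ} {R L : ℝ} (hR : 0 < R)
    (dv : ∀ r, R < r → HasDerivAt v (v' r) r) (h : ∀ r, R < r → -(L / r ^ 2) ≤ v' r)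
    (hv : Tendsto v atTop (𝓝 0)) {r : ℝ} (hr : R < r) : v r ≤ L / r := by
  have hmono := monotoneOn_Ioi_of_hasDerivAt (f := fun r => v r - L / r)
    (fun r hr => (dv r hr).sub (hasDerivAt_div_id L (hR.trans hr).ne'))
    fun r hr => by linarith [h r hr]
  have hlim : Tendsto (fun r => v r - L / r) atTop (𝓝 0) := by
    simpa using hv.sub (tendsto_const_div_id L)
  have : v r - L / r ≤ 0 := by
    refine ge_of_tendsto hlim ?_
    filter_upwards [eventually_ge_atTop r] with s hs
    exact hmono hr (hr.trans_le hs) hs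
  linarith

/-- A flux whose potential tends to zero and which satisfies a Riccati-type inequality vanishes at
infinity. -/
theorem tendsto_flux_zero {G g v : ℝ → ℝ} {R C C₁ c : ℝ} (hR : 0 < R) (hC : 0 ≤ C) (hC₁ : 0 < C₁)
    (hc : 0 < c) (dG : ∀ r, R < r → HasDerivAt G (g r) r)
    (dv : ∀ r, R < r → HasDerivAt v (G r / r ^ 2) r) (hv0 : ∀ r, R < r → 0 ≤ v r)
    (hv : Tendsto v atTop (𝓝 0))
    (hg : ∀ r, R < r → ∀ l : ℝ, c * (2 * l * G r - l ^ 2 * C₁ * r ^ 2 * v r) - C / r ^ 2 ≤ g r) :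
    Tendsto G atTop (𝓝 0) := by
  -- The choice l = 0 of the free parameter already makes G monotone up to the correction C/r.
  have hmono : MonotoneOn (fun r => G r - C / r) (Set.Ioi R) :=
    monotoneOn_Ioi_of_hasDerivAt
      (fun r hr => (dG r hr).sub (hasDerivAt_div_id C (hR.trans hr).ne'))
      fun r hr => by have := hg r hr 0; simp at this; linarith
  have upper : ∀ δ > 0, ∀ᶠ r in atTop, G r < δ := by
    intro δ hδ
    filter_upwards [eventually_gt_atTop (max R (2 * C / δ))] with r₁ hr₁
    have hr1 : R < r₁ := (le_max_left _ _).trans_lt hr₁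
    have hr2 : 2 * C / δ < r₁ := (le_max_right _ _).trans_lt hr₁
    have hr0 : 0 < r₁ := hR.trans hr1
    by_contra! hG
    have h1 : C / r₁ ≤ δ / 2 := by
      rw [div_lt_iff₀ hδ] at hr2
      rw [div_le_iff₀ hr0]; linarith
    have h2 : ∀ r, r₁ < r → δ / 2 ≤ G r := by
      intro r hr
      have := hmono hr1 (hr1.trans hr) hr.le
      simp only at this
      have h3 : 0 ≤ C / r := div_nonneg hC (hr0.trans hr).le
      linarith
    -- If G stays above δ/2, then v increases to its limit zero at a definite rate and would have to
    -- be negative.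
    have h4 : v (r₁ + 1) ≤ -(δ / 2) / (r₁ + 1) := by
      refine le_div_of_tendsto_zero hr0 (fun r hr => dv r (hr1.trans hr)) (fun r hr => ?_) hv
        (by linarith)
      have h5 := h2 r hr
      have h6 : 0 < r ^ 2 := pow_pos (hr0.trans hr) 2
      rw [neg_div, neg_neg]
      gcongr
    have h5 : 0 < δ / 2 / (r₁ + 1) := by positivity
    have h6 := hv0 (r₁ + 1) (by linarith)
    rw [neg_div] at h4
    linarith
  have lower : ∀ δ > 0, ∀ᶠ r in atTop, -δ < G r := by
    intro δ hδ
    by_contra hne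
    have h1 : ∀ r, R < r → G r - C / r ≤ -δ := by
      intro r hr
      by_contra! h
      refine hne ?_
      filter_upwards [eventually_ge_atTop r] with s hs
      have := hmono hr (hr.trans_le hs) hs
      simp only at this
      have h3 : 0 ≤ C / s := div_nonneg hC (hR.trans (hr.trans_le hs)).le
      linarith
    set r₀ := max (R + 1) (2 * C / δ + 1) with hr₀
    have hr0R : R < r₀ := by linarith [le_max_left (R + 1) (2 * C / δ + 1)]
    have hr0C : 2 * C / δ < r₀ := by linarith [le_max_right (R + 1) (2 * C / δ + 1)]
    have hr0 : 0 < r₀ := hR.trans hr0R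
    have h2 : ∀ r, r₀ < r → G r ≤ -(δ / 2) := by
      intro r hr
      have h3 := h1 r (hr0R.trans hr)
      have h4 : C / r ≤ δ / 2 := by
        have h5 := hr0C.trans hr
        rw [div_lt_iff₀ hδ] at h5
        rw [div_le_iff₀ (hr0.trans hr)]; linarith
      linarith
    set L := C / r₀ - G r₀ with hL
    have hLpos : 0 < L := by linarith [h1 r₀ hr0R]
    have h3 : ∀ r, r₀ < r → -L ≤ G r := by
      intro r hr
      have := hmono hr0R (hr0R.trans hr) hr.le
      simp only at this
      have h4 : 0 ≤ C / r := div_nonneg hC (hr0.trans hr).le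
      linarith
    have h4 : ∀ r, r₀ < r → v r ≤ L / r := fun r hr => by
      refine le_div_of_tendsto_zero hr0 (fun r hr => dv r (hr0R.trans hr)) (fun r hr => ?_) hv hr
      have h6 : 0 < r ^ 2 := pow_pos (hr0.trans hr) 2
      rw [← neg_div]
      have := h3 r hr
      gcongr
    -- With l = -μ/r the lower bound for G' becomes c(μδ - μ²C₁L)/r up to C/r²; this μ maximizes it,
    -- with maximum κ/r.
    set μ := δ / (2 * C₁ * L) with hμ
    have hμpos : 0 < μ := by positivity
    set κ := c * (δ ^ 2 / (4 * C₁ * L)) with hκ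
    have hκpos : 0 < κ := by positivity
    have h5 : ∀ r, r₀ < r → κ / r - C / r ^ 2 ≤ g r := by
      intro r hr
      have hrpos := hr0.trans hr
      refine le_trans ?_ (hg r (hr0R.trans hr) (-(μ / r)))
      have e1 : κ / r = c * ((2 * (μ / r) * (δ / 2)) - (μ / r) ^ 2 * C₁ * r ^ 2 * (L / r)) := by
        rw [hκ, hμ]; field_simp; ring
      rw [e1]
      have e2 : 2 * (μ / r) * (δ / 2) ≤ 2 * -(μ / r) * G r := by
        have := h2 r hr
        have h7 : 0 < μ / r := by positivity
        nlinarith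
      have e3 : (μ / r) ^ 2 * C₁ * r ^ 2 * v r ≤ (μ / r) ^ 2 * C₁ * r ^ 2 * (L / r) := by
        have := h4 r hr
        gcongr
      rw [neg_sq]
      gcongr
    -- Hence G grows at least like κ log r, although it is bounded above by 0.
    have hmono2 := monotoneOn_Ioi_of_hasDerivAt (R := r₀) (f := fun r => G r - C / r - κ * log r)
      (fun r hr => ((dG r (hr0R.trans hr)).sub (hasDerivAt_div_id C (hr0.trans hr).ne')).sub
        ((hasDerivAt_log (hr0.trans hr).ne').const_mul κ))
      fun r hr => by
        have := h5 r hr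
        rw [← div_eq_mul_inv]
        linarith
    have hlog : Tendsto (fun r => κ * log r) atTop atTop :=
      tendsto_log_atTop.const_mul_atTop hκpos
    obtain ⟨r, hr1, hr2⟩ := ((hlog.eventually_gt_atTop
      (-(G (r₀ + 1) - C / (r₀ + 1) - κ * log (r₀ + 1)))).and (eventually_ge_atTop (r₀ + 1))).exists
    have h6 := hmono2 (show r₀ < r₀ + 1 by linarith) (show r₀ < r by linarith) hr2
    simp only at h6
    have h7 := h1 r (by linarith)
    linarith
  rw [Metric.tendsto_nhds]
  intro δ hδ
  filter_upwards [upper δ hδ, lower δ hδ] with r h1 h2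
  rw [dist_zero_right, norm_eq_abs, abs_lt]
  exact ⟨h2, h1⟩

/-- If `(r^(n+1) u)' = r^(2 n) w` with `u → 0`, then `w` is not bounded below by a positive
constant. -/
theorem nonpos_of_le_of_tendsto_zero {u w : ℝ → ℝ} {R c : ℝ} {n : ℕ} (hR : 0 < R)
    (h : ∀ r, R < r → HasDerivAt (fun r => r ^ (n + 1) * u r) (r ^ (2 * n) * w r) r)
    (hu : Tendsto u atTop (𝓝 0)) (hw : ∀ r, R < r → c ≤ w r) : c ≤ 0 := by
  by_contra! hc
  have hmono := monotoneOn_Ioi_of_hasDerivAt (R := R)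
    (f := fun r => r ^ (n + 1) * u r - c / (2 * n + 1) * r ^ (2 * n + 1))
    (fun r hr => (h r hr).sub ((hasDerivAt_pow (2 * n + 1) r).const_mul _))
    fun r hr => by
      have h1 := hw r hr
      have h2 : 0 < r ^ (2 * n) := pow_pos (hR.trans hr) _
      have h3 : c / (2 * n + 1) * (((2 * n + 1 : ℕ) : ℝ) * r ^ (2 * n + 1 - 1)) = r ^ (2 * n) * c := by
        push_cast
        field_simp
      rw [h3]
      nlinarith
  -- Integrating over [r, 2r] forces r^(n+1)u to increase by a multiple of r^(2n+1), while u → 0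
  -- makes this increment o(r^(n+1)).
  have hlim : Tendsto (fun r => 2 ^ (n + 1) * u (2 * r) - u r) atTop (𝓝 0) := by
    simpa using ((hu.comp (tendsto_id.const_mul_atTop (by norm_num : (0 : ℝ) < 2))).const_mul
      (2 ^ (n + 1))).sub hu
  obtain ⟨r, h1, h2⟩ := ((hlim.eventually_lt_const
    (show (0 : ℝ) < c / (2 * n + 1) by positivity)).and
      (eventually_gt_atTop (max R 1))).exists
  have hrR : R < r := (le_max_left _ _).trans_lt h2
  have hr1 : 1 < r := (le_max_right _ _).trans_lt h2
  have hr0 := hR.trans hrR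
  have h3 := hmono hrR (show R < 2 * r by linarith) (by linarith)
  simp only at h3
  have hp : 0 < r ^ (n + 1) := by positivity
  have e1 : (2 * r) ^ (n + 1) * u (2 * r) = r ^ (n + 1) * (2 ^ (n + 1) * u (2 * r)) := by
    rw [mul_pow]; ring
  have h4 : c / (2 * n + 1) * r ^ (n + 1)
      ≤ c / (2 * n + 1) * ((2 * r) ^ (2 * n + 1) - r ^ (2 * n + 1)) := by
    refine mul_le_mul_of_nonneg_left ?_ (by positivity)
    have h5 : r ^ (n + 1) ≤ r ^ (2 * n + 1) := pow_le_pow_right₀ hr1.le (by omega)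
    have h6 : (2 : ℝ) ≤ 2 ^ (2 * n + 1) := by
      calc (2 : ℝ) = 2 ^ 1 := by norm_num
        _ ≤ 2 ^ (2 * n + 1) := pow_le_pow_right₀ (by norm_num) (by omega)
    have h7 : 0 < r ^ (2 * n + 1) := by positivity
    rw [mul_pow]
    nlinarith
  have h8 : r ^ (n + 1) * (2 ^ (n + 1) * u (2 * r) - u r) < r ^ (n + 1) * (c / (2 * n + 1)) :=
    mul_lt_mul_of_pos_left h1 hp
  rw [e1] at h3
  nlinarith

theorem exists_tendsto_of_deriv_integrable {f f' : ℝ → ℝ} {a : ℝ}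
    (h : ∀ r, a < r → HasDerivAt f (f' r) r) (hi : IntegrableOn f' (Set.Ioi a)) :
    ∃ l, Tendsto f atTop (𝓝 l) :=
  ⟨_, tendsto_limUnder_of_hasDerivAt_of_integrableOn_Ioi h hi⟩

/-! ### Surface integrals over coordinate spheres -/

theorem flatSphereIntegral_of_axial {r : ℝ} {f : E3 → ℝ}
    (h : ∀ θ φ, f (sph r θ φ) = f (r • eR θ)) :
    flatSphereIntegral r f = 4 * π * r ^ 2 * avg fun θ => f (r • eR θ) := by
  simp only [flatSphereIntegral, h, intervalIntegral.integral_const, smul_eq_mul, avg]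
  have : ∀ θ, (2 * π - 0) * (f (r • eR θ) * (r ^ 2 * sin θ))
      = 2 * π * r ^ 2 * (f (r • eR θ) * sin θ) := fun θ => by ring
  simp only [this, intervalIntegral.integral_const_mul]
  ring

theorem integral_cos_period : ∫ φ in (0 : ℝ)..(2 * π), cos φ = 0 := by
  rw [integral_cos]; simp

theorem integral_sin_period : ∫ φ in (0 : ℝ)..(2 * π), sin φ = 0 := by
  rw [integral_sin]; simp

theorem flatSphereIntegral_eq_zero {r : ℝ} {f : E3 → ℝ} {u v : ℝ → ℝ}
    (h : ∀ θ φ, f (sph r θ φ) = cos φ * u θ + sin φ * v θ) : flatSphereIntegral r f = 0 := by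
  have : ∀ θ φ, (cos φ * u θ + sin φ * v θ) * (r ^ 2 * sin θ)
      = u θ * (r ^ 2 * sin θ) * cos φ + v θ * (r ^ 2 * sin θ) * sin φ := fun θ φ => by ring
  simp only [flatSphereIntegral, h, this]
  have h2 : ∀ θ, ∫ φ in (0 : ℝ)..(2 * π), (u θ * (r ^ 2 * sin θ) * cos φ
      + v θ * (r ^ 2 * sin θ) * sin φ) = 0 := by
    intro θ
    rw [intervalIntegral.integral_add (Continuous.intervalIntegrable (by fun_prop) _ _)
      (Continuous.intervalIntegrable (by fun_prop) _ _), intervalIntegral.integral_const_mul, intervalIntegral.integral_const_mul,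
      integral_cos_period, integral_sin_period]
    ring
  simp only [h2, intervalIntegral.integral_zero]

theorem rotMatrix_transpose_mul (φ : ℝ) : (rotMatrix φ)ᵀ * rotMatrix φ = 1 := by
  have h := sin_sq_add_cos_sq φ
  ext i j
  fin_cases i <;> fin_cases j <;>
    simp [rotMatrix, Matrix.mul_apply, Fin.sum_univ_three] <;> linarith

theorem rot_smul (φ c : ℝ) (x : E3) : rot φ (c • x) = c • rot φ x := by
  ext i
  fin_cases i <;> simp [rot_apply] <;> ring

theorem norm_rot (φ : ℝ) (x : E3) : ‖rot φ x‖ = ‖x‖ := by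
  rw [EuclideanSpace.norm_eq, EuclideanSpace.norm_eq, rot_apply]
  simp only [Fin.sum_univ_three, Real.norm_eq_abs, sq_abs]
  congr 1
  simp
  linear_combination (x 0 ^ 2 + x 1 ^ 2) * sin_sq_add_cos_sq φ

theorem contract_rot (φ : ℝ) (T : Tensor2) (u v : Fin 3 → ℝ) :
    contract (rotMatrix φ * T * (rotMatrix φ)ᵀ) (rotMatrix φ *ᵥ u) (rotMatrix φ *ᵥ v)
      = contract T u v := by
  have h : (rotMatrix φ * T * (rotMatrix φ)ᵀ) *ᵥ (rotMatrix φ *ᵥ v)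
      = rotMatrix φ *ᵥ (T *ᵥ v) := by
    rw [Matrix.mulVec_mulVec, mul_assoc, rotMatrix_transpose_mul, mul_one, Matrix.mulVec_mulVec]
  rw [contract, h, Matrix.dotProduct_mulVec, ← Matrix.vecMul_transpose, Matrix.vecMul_vecMul,
    rotMatrix_transpose_mul, Matrix.vecMul_one, contract]

theorem vecPhi_eq_rot (r θ φ : ℝ) : vecPhi r θ φ = rotMatrix φ *ᵥ vecPhi r θ 0 := by
  ext i
  fin_cases i <;>
    simp [vecPhi, rotMatrix, Matrix.mulVec, dotProduct, Fin.sum_univ_three] <;> ring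

theorem vecR_eq_rot (θ φ : ℝ) : vecR θ φ = rotMatrix φ *ᵥ vecR θ 0 := by
  ext i
  fin_cases i <;>
    simp [vecR, rotMatrix, Matrix.mulVec, dotProduct, Fin.sum_univ_three] <;> ring

theorem eR_zero (θ : ℝ) : eR θ 0 = sin θ := by simp [eR]
theorem eR_one (θ : ℝ) : eR θ 1 = 0 := by simp [eR]
theorem eR_two (θ : ℝ) : eR θ 2 = cos θ := by simp [eR]

/-! ### Flux integrals of a solution reduced to means on the meridian. -/

section Solution
variable {m : ℝ} {ψ : E3 → ℝ} {A : E3 → Tensor2} {H : E3 → ℝ}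

/-- The radial derivative is taken along the ray t ↦ t x, which rotations commute with, so the
rotation itself never has to be differentiated. Strict inequality keeps the ray inside the surface
for t near 1. -/
theorem AxialScalar.fderiv_radial {f : E3 → ℝ} (hax : AxialScalar m f) (hf : SmoothOnSurface m f)
    {x : E3} (hx : m / 2 < ‖x‖) (φ : ℝ) :
    fderiv ℝ f (rot φ x) (rot φ x) = fderiv ℝ f x x := by
  have key : ∀ y : E3, y ∈ surface m → HasDerivAt (fun t : ℝ => f (t • y)) (fderiv ℝ f y y) 1 := by
    intro y hy
    have h1 := (hf.differentiableAt hy).hasFDerivAt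
    rw [← one_smul ℝ y] at h1
    have h2 : HasDerivAt (fun t : ℝ => t • y) y 1 := by
      simpa using (hasDerivAt_id (1 : ℝ)).smul_const y
    have := h1.comp_hasDerivAt (1 : ℝ) h2
    rwa [one_smul] at this
  have hxs : x ∈ surface m := le_of_lt hx
  refine (key _ (rot_mem_surface hxs φ)).unique ((key x hxs).congr_of_eventuallyEq ?_)
  have hopen : IsOpen {t : ℝ | m / 2 < ‖t • x‖} :=
    isOpen_lt continuous_const (continuous_id.smul continuous_const).norm
  filter_upwards [hopen.mem_nhds (show m / 2 < ‖(1 : ℝ) • x‖ by rwa [one_smul])] with t ht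
  rw [← rot_smul, hax φ _ (le_of_lt ht)]

theorem physMetric_apply (x : E3) (i j : Fin 3) :
    physMetric ψ x i j = ψ x ^ 4 * (1 : Tensor2) i j := by
  simp [physMetric]

theorem partialD_physMetric {x : E3} (hψ : DifferentiableAt ℝ ψ x) (k i j : Fin 3) :
    partialD k (fun y => physMetric ψ y i j) x
      = 4 * ψ x ^ 3 * partialD k ψ x * (1 : Tensor2) i j := by
  simp only [physMetric_apply]
  have h : HasFDerivAt (fun y => ψ y ^ 4 * (1 : Tensor2) i j)
      ((1 : Tensor2) i j • ((4 : ℕ) * ψ x ^ 3) • fderiv ℝ ψ x) x := by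
    simpa using (hψ.hasFDerivAt.pow 4).mul_const ((1 : Tensor2) i j)
  rw [partialD, h.fderiv, partialD]
  simp
  ring

theorem momentumTensor_apply {x : E3} (hx : ψ x ≠ 0) (i j : Fin 3) :
    momentumTensor ψ A H x i j
      = A x i j / ψ x ^ 2 - 2 / 3 * H x * ψ x ^ 4 * (1 : Tensor2) i j := by
  simp only [momentumTensor, physCurv, physMetric, Matrix.sub_apply, Matrix.smul_mul,
    Matrix.one_mul, Matrix.smul_apply, Matrix.add_apply, smul_eq_mul]
  field_simp
  ring

theorem contract_one (c : ℝ) (u v : Fin 3 → ℝ) : contract (c • (1 : Tensor2)) u v = c * (u ⬝ᵥ v) := by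
  simp [contract, Matrix.smul_mulVec]

theorem areaElement_physMetric {r θ : ℝ} (hθ : θ ∈ Set.Icc 0 π) (φ : ℝ) :
    areaElement (physMetric ψ) r θ φ = ψ (sph r θ φ) ^ 4 * (r ^ 2 * sin θ) := by
  have h1 : vecTheta r θ φ ⬝ᵥ vecTheta r θ φ = r ^ 2 := by
    simp [vecTheta, dotProduct, Fin.sum_univ_three]
    linear_combination (r ^ 2 * cos θ ^ 2) * sin_sq_add_cos_sq φ + r ^ 2 * sin_sq_add_cos_sq θ
  have h2 : vecPhi r θ φ ⬝ᵥ vecPhi r θ φ = (r * sin θ) ^ 2 := by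
    simp [vecPhi, dotProduct, Fin.sum_univ_three]
    linear_combination (r ^ 2 * sin θ ^ 2) * sin_sq_add_cos_sq φ
  have h3 : vecTheta r θ φ ⬝ᵥ vecPhi r θ φ = 0 := by
    simp [vecTheta, vecPhi, dotProduct, Fin.sum_univ_three]
    ring
  have hs := sin_nonneg_of_nonneg_of_le_pi hθ.1 hθ.2
  simp only [areaElement, physMetric, contract_one, h1, h2, h3]
  rw [show ψ (sph r θ φ) ^ 4 * r ^ 2 * (ψ (sph r θ φ) ^ 4 * (r * sin θ) ^ 2)
      - (ψ (sph r θ φ) ^ 4 * 0) ^ 2 = (ψ (sph r θ φ) ^ 4 * (r ^ 2 * sin θ)) ^ 2 by ring]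
  exact sqrt_sq (by positivity)

theorem IsSolution.isAxialTT (hS : IsSolution m ψ A H) : IsAxialTT m A :=
  ⟨hS.smooth_A, hS.symm, hS.traceless, hS.axial_A⟩

theorem IsSolution.psi_sph (hm : 0 < m) (hS : IsSolution m ψ A H) {r : ℝ} (hr : m / 2 ≤ r)
    (θ φ : ℝ) : ψ (sph r θ φ) = ψ (r • eR θ) := by
  rw [sph_eq_rot, hS.axial_psi _ _ (smul_eR_mem hm hr θ)]

theorem IsSolution.H_sph (hm : 0 < m) (hS : IsSolution m ψ A H) {r : ℝ} (hr : m / 2 ≤ r)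
    (θ φ : ℝ) : H (sph r θ φ) = H (r • eR θ) := by
  rw [sph_eq_rot, hS.axial_H _ _ (smul_eR_mem hm hr θ)]

/-- The energy flux through a sphere. -/
theorem IsSolution.energy_integral (hm : 0 < m) (hS : IsSolution m ψ A H) {r : ℝ} (hr : m / 2 < r) :
    1 / (16 * π) * flatSphereIntegral r (fun x =>
      ∑ i, ∑ j, (partialD j (fun y => physMetric ψ y i j) x
        - partialD i (fun y => physMetric ψ y j j) x) * (x i / ‖x‖))
      = -2 * (r ^ 2 * avg fun θ => ψ (r • eR θ) ^ 3 * radComp (fun i => partialD i ψ) r θ) := by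
  have hr0 : 0 < r := by linarith
  have h1 : ∀ x ∈ surface m, ∑ i, ∑ j, (partialD j (fun y => physMetric ψ y i j) x
        - partialD i (fun y => physMetric ψ y j j) x) * (x i / ‖x‖)
      = -8 * (ψ x ^ 3 * fderiv ℝ ψ x x) / ‖x‖ := by
    intro x hx
    have hd := hS.smooth_psi.differentiableAt hx
    simp only [partialD_physMetric hd, Fin.sum_univ_three, fderiv_apply_eq_sum ψ x x]
    simp
    ring
  have hmem := fun θ => smul_eR_mem hm hr.le θ
  have h2 : ∀ θ, fderiv ℝ ψ (r • eR θ) (r • eR θ) = r * radComp (fun i => partialD i ψ) r θ := by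
    intro θ
    rw [fderiv_apply_eq_sum, Fin.sum_univ_three, smul_eR_zero, smul_eR_one, smul_eR_two, radComp]
    ring
  rw [flatSphereIntegral_of_axial]
  · have h3 : ∀ θ, -8 * (ψ (r • eR θ) ^ 3 * (r * radComp (fun i => partialD i ψ) r θ)) / r
        = -8 * (ψ (r • eR θ) ^ 3 * radComp (fun i => partialD i ψ) r θ) := by
      intro θ; field_simp
    rw [funext fun θ => (h1 _ (hmem θ)).trans (by rw [h2, norm_smul_eR hr0.le, h3]),
      avg_const_mul]
    generalize avg _ = a
    field_simp
    ring
  · intro θ φ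
    have hx : m / 2 < ‖r • eR θ‖ := by rwa [norm_smul_eR hr0.le]
    rw [sph_eq_rot, h1 _ (rot_mem_surface (hmem θ) φ), h1 _ (hmem θ), norm_rot,
      hS.axial_psi.fderiv_radial hS.smooth_psi hx, hS.axial_psi _ _ (hmem θ)]

/-- The flux vector at angle φ is the rotated flux vector of the meridian. Its horizontal components
are therefore combinations of cos φ and sin φ and integrate to zero, and only the axial one
survives. -/
theorem IsSolution.momentum_apply (hm : 0 < m) (hS : IsSolution m ψ A H) {r : ℝ} (hr : m / 2 ≤ r)
    (θ φ : ℝ) (i : Fin 3) :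
    ∑ j, momentumTensor ψ A H (sph r θ φ) i j * (sph r θ φ j / ‖sph r θ φ‖)
      = (rotMatrix φ *ᵥ fun k => ∑ j, momentumTensor ψ A H (r • eR θ) k j * eR θ j) i := by
  have hr0 : 0 < r := by linarith
  have hmem := smul_eR_mem hm hr θ
  have hM : momentumTensor ψ A H (rot φ (r • eR θ))
      = rotMatrix φ * momentumTensor ψ A H (r • eR θ) * (rotMatrix φ)ᵀ := by
    have h1 : rotMatrix φ * (rotMatrix φ)ᵀ = 1 :=
      mul_eq_one_comm.mp (rotMatrix_transpose_mul φ)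
    simp only [momentumTensor, physCurv, physMetric, hS.axial_psi _ _ hmem, hS.axial_H _ _ hmem,
      hS.axial_A _ _ hmem, Matrix.mul_add, Matrix.mul_sub, Matrix.add_mul, Matrix.sub_mul,
      Matrix.smul_mul, Matrix.mul_smul, Matrix.one_mul, Matrix.mul_one, h1]
  have hv : (fun j => sph r θ φ j / ‖sph r θ φ‖) = rotMatrix φ *ᵥ fun j => eR θ j := by
    rw [sph_eq_rot, norm_rot, norm_smul_eR hr0.le, rot_smul]
    funext j
    simp only [PiLp.smul_apply, smul_eq_mul]
    rw [mul_div_cancel_left₀ _ hr0.ne']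
    rfl
  change ((momentumTensor ψ A H (sph r θ φ)) *ᵥ (fun j => sph r θ φ j / ‖sph r θ φ‖)) i
    = (rotMatrix φ *ᵥ (momentumTensor ψ A H (r • eR θ) *ᵥ fun j => eR θ j)) i
  rw [hv, sph_eq_rot, hM, Matrix.mulVec_mulVec, mul_assoc, rotMatrix_transpose_mul, mul_one,
    Matrix.mulVec_mulVec]

theorem IsSolution.momentum_integral_zero (hm : 0 < m) (hS : IsSolution m ψ A H) {r : ℝ}
    (hr : m / 2 ≤ r) : flatSphereIntegral r (fun x =>
      ∑ j, momentumTensor ψ A H x 0 j * (x j / ‖x‖)) = 0 := by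
  refine flatSphereIntegral_eq_zero
    (u := fun θ => ∑ j, momentumTensor ψ A H (r • eR θ) 0 j * eR θ j)
    (v := fun θ => -∑ j, momentumTensor ψ A H (r • eR θ) 1 j * eR θ j) fun θ φ => ?_
  rw [hS.momentum_apply hm hr]
  simp [rotMatrix, Matrix.mulVec, dotProduct, Fin.sum_univ_three]
  ring

theorem IsSolution.momentum_integral_one (hm : 0 < m) (hS : IsSolution m ψ A H) {r : ℝ}
    (hr : m / 2 ≤ r) : flatSphereIntegral r (fun x =>
      ∑ j, momentumTensor ψ A H x 1 j * (x j / ‖x‖)) = 0 := by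
  refine flatSphereIntegral_eq_zero
    (u := fun θ => ∑ j, momentumTensor ψ A H (r • eR θ) 1 j * eR θ j)
    (v := fun θ => ∑ j, momentumTensor ψ A H (r • eR θ) 0 j * eR θ j) fun θ φ => ?_
  rw [hS.momentum_apply hm hr]
  simp [rotMatrix, Matrix.mulVec, dotProduct, Fin.sum_univ_three]
  ring

theorem IsSolution.momentum_integral_two (hm : 0 < m) (hS : IsSolution m ψ A H) {r : ℝ}
    (hr : m / 2 ≤ r) : 1 / (8 * π) * flatSphereIntegral r (fun x =>
      ∑ j, momentumTensor ψ A H x 2 j * (x j / ‖x‖))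
      = 1 / 2 * (r ^ 2 * avg fun θ => (cos θ * frRR A r θ - sin θ * frRT A r θ) / ψ (r • eR θ) ^ 2
        - 2 / 3 * H (r • eR θ) * ψ (r • eR θ) ^ 4 * cos θ) := by
  have h1 : ∀ θ φ, ∑ j, momentumTensor ψ A H (sph r θ φ) 2 j * (sph r θ φ j / ‖sph r θ φ‖)
      = (cos θ * frRR A r θ - sin θ * frRT A r θ) / ψ (r • eR θ) ^ 2
        - 2 / 3 * H (r • eR θ) * ψ (r • eR θ) ^ 4 * cos θ := by
    intro θ φ
    have hmem := smul_eR_mem hm hr θ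
    have hψ := (hS.psi_pos _ hmem).ne'
    have hs := hS.isAxialTT.symm_apply hmem 2 0
    have e : (rotMatrix φ *ᵥ fun k => ∑ j, momentumTensor ψ A H (r • eR θ) k j * eR θ j) 2
        = ∑ j, momentumTensor ψ A H (r • eR θ) 2 j * eR θ j := by
      simp [rotMatrix, Matrix.mulVec, dotProduct, Fin.sum_univ_three]
    rw [hS.momentum_apply hm hr, e]
    simp only [Fin.sum_univ_three, momentumTensor_apply hψ, frRR, frRT, eR_zero, eR_one, eR_two]
    simp [hs]
    field_simp
    have h2 := sin_sq_add_cos_sq θ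
    linear_combination (-3 * sin θ * A (r • eR θ) 0 2 - 3 * cos θ * A (r • eR θ) 2 2) * h2
  have h2 : ∀ θ, ∑ j, momentumTensor ψ A H (r • eR θ) 2 j * ((r • eR θ) j / ‖r • eR θ‖)
      = (cos θ * frRR A r θ - sin θ * frRT A r θ) / ψ (r • eR θ) ^ 2
        - 2 / 3 * H (r • eR θ) * ψ (r • eR θ) ^ 4 * cos θ := fun θ => by
    rw [← h1 θ 0, sph_zero]
  rw [flatSphereIntegral_of_axial fun θ φ => (h1 θ φ).trans (h2 θ).symm, funext h2]
  generalize avg _ = a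
  field_simp
  ring

/-- The conformal weights ψ⁻², ψ⁻² and ψ⁴ of the tensor, the normal and the area element cancel, and
the H' term drops because ∂_φ is orthogonal to ∂_r. The flux is that of A in the flat metric at
every radius. -/
theorem IsSolution.angularMomentum_integral (hm : 0 < m) (hS : IsSolution m ψ A H) {r : ℝ}
    (hr : m / 2 ≤ r) : 1 / (8 * π) * (∫ θ in (0 : ℝ)..π, ∫ φ in (0 : ℝ)..(2 * π),
      contract (momentumTensor ψ A H (sph r θ φ)) (vecPhi r θ φ)
        ((ψ (sph r θ φ) ^ 2)⁻¹ • vecR θ φ) * areaElement (physMetric ψ) r θ φ)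
      = 1 / 2 * (r ^ 3 * avg fun θ => sin θ * frRP A r θ) := by
  have hr0 : 0 < r := by linarith
  have h1 : ∀ θ ∈ Set.Icc 0 π, ∀ φ, contract (momentumTensor ψ A H (sph r θ φ)) (vecPhi r θ φ)
      ((ψ (sph r θ φ) ^ 2)⁻¹ • vecR θ φ) * areaElement (physMetric ψ) r θ φ
      = r ^ 3 * (sin θ * frRP A r θ) * sin θ := by
    intro θ hθ φ
    have hmem := smul_eR_mem hm hr θ
    have hψ := (hS.psi_pos _ hmem).ne'
    have hs := hS.isAxialTT.symm_apply hmem 1 0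
    have hM : momentumTensor ψ A H (sph r θ φ)
        = (ψ (r • eR θ) ^ 2)⁻¹ • A (sph r θ φ)
          + (-(2 / 3 * H (r • eR θ) * ψ (r • eR θ) ^ 4)) • (1 : Tensor2) := by
      ext i j
      rw [momentumTensor_apply (by rw [hS.psi_sph hm hr]; exact hψ), hS.psi_sph hm hr,
        hS.H_sph hm hr]
      simp only [Matrix.add_apply, Matrix.smul_apply, smul_eq_mul]
      ring
    have horth : vecPhi r θ φ ⬝ᵥ vecR θ φ = 0 := by
      simp [vecPhi, vecR, dotProduct, Fin.sum_univ_three]; ring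
    have hA : contract (A (sph r θ φ)) (vecPhi r θ φ) (vecR θ φ)
        = r * (sin θ * frRP A r θ) := by
      rw [sph_eq_rot, hS.axial_A _ _ hmem, vecPhi_eq_rot, vecR_eq_rot, contract_rot]
      simp only [contract, vecR, vecPhi, frRP, Matrix.mulVec, dotProduct, Fin.sum_univ_three]
      simp [hs]
      ring
    have hlin : contract (momentumTensor ψ A H (sph r θ φ)) (vecPhi r θ φ)
        ((ψ (sph r θ φ) ^ 2)⁻¹ • vecR θ φ) = (ψ (r • eR θ) ^ 2)⁻¹ * ((ψ (r • eR θ) ^ 2)⁻¹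
          * contract (A (sph r θ φ)) (vecPhi r θ φ) (vecR θ φ)
          + -(2 / 3 * H (r • eR θ) * ψ (r • eR θ) ^ 4) * (vecPhi r θ φ ⬝ᵥ vecR θ φ)) := by
      rw [hM, hS.psi_sph hm hr]
      simp only [contract, Matrix.mulVec_smul, Matrix.add_mulVec, Matrix.smul_mulVec,
        Matrix.one_mulVec, dotProduct_smul, dotProduct_add, smul_eq_mul]
    rw [hlin, horth, hA, areaElement_physMetric hθ, hS.psi_sph hm hr]
    field_simp
    ring
  have h2 : ∫ θ in (0 : ℝ)..π, ∫ φ in (0 : ℝ)..(2 * π),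
      contract (momentumTensor ψ A H (sph r θ φ)) (vecPhi r θ φ)
        ((ψ (sph r θ φ) ^ 2)⁻¹ • vecR θ φ) * areaElement (physMetric ψ) r θ φ
      = ∫ θ in (0 : ℝ)..π, 2 * π * r ^ 3 * (sin θ * frRP A r θ * sin θ) := by
    refine intervalIntegral.integral_congr fun θ hθ => ?_
    rw [Set.uIcc_of_le pi_pos.le] at hθ
    simp only [h1 θ hθ, intervalIntegral.integral_const, smul_eq_mul]
    ring
  rw [h2, intervalIntegral.integral_const_mul, avg]
  field_simp
  norm_num

theorem IsSolution.sphereArea_eq (hm : 0 < m) (hS : IsSolution m ψ A H) {r : ℝ} (hr : m / 2 ≤ r) :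
    sphereArea (physMetric ψ) r = 4 * π * r ^ 2 * avg fun θ => ψ (r • eR θ) ^ 4 := by
  have hr0 : 0 < r := by linarith
  have h2 : sphereArea (physMetric ψ) r
      = ∫ θ in (0 : ℝ)..π, 2 * π * r ^ 2 * (ψ (r • eR θ) ^ 4 * sin θ) := by
    refine intervalIntegral.integral_congr fun θ hθ => ?_
    rw [Set.uIcc_of_le pi_pos.le] at hθ
    simp only [areaElement_physMetric hθ, hS.psi_sph hm hr,
      intervalIntegral.integral_const, smul_eq_mul]
    ring
  rw [h2, intervalIntegral.integral_const_mul, avg]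
  ring

end Solution

/-! ### Asymptotics of the means of a solution -/

section Means
variable {m : ℝ}

theorem SmoothOnSurface.laplacian_eq {f : E3 → ℝ} (hf : SmoothOnSurface m f) {x : E3}
    (hx : x ∈ surface m) : Laplacian.laplacian f x
      = ∑ i, PenrosePerturbation.partialD i (PenrosePerturbation.partialD i f) x := by
  rw [InnerProductSpace.laplacian_eq_iteratedFDeriv_orthonormalBasis f
    (EuclideanSpace.basisFun (Fin 3) ℝ)]
  refine Finset.sum_congr rfl fun i _ => ?_
  rw [iteratedFDeriv_two_apply]
  have hd : DifferentiableAt ℝ (fderiv ℝ f) x :=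
    ((hf x hx).fderiv_right (m := ∞) (by simp)).differentiableAt (by simp)
  have h := (hd.hasFDerivAt.clm_apply
    (hasFDerivAt_const (EuclideanSpace.single i (1 : ℝ)) x)).fderiv
  change _ = fderiv ℝ (fun y => fderiv ℝ f y (EuclideanSpace.single i (1 : ℝ))) x _
  rw [h]
  simp

theorem SmoothOnSurface.radComp_continuousOn (hm : 0 < m) {f : E3 → ℝ}
    (hf : SmoothOnSurface m f) : ContinuousOn
      (fun p : ℝ × ℝ => radComp (fun i => PenrosePerturbation.partialD i f) p.1 p.2)
      (Set.Ici (m / 2) ×ˢ Set.univ) := by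
  have cs : ContinuousOn (fun p : ℝ × ℝ => sin p.2) (Set.Ici (m / 2) ×ˢ Set.univ) := by fun_prop
  have cc : ContinuousOn (fun p : ℝ × ℝ => cos p.2) (Set.Ici (m / 2) ×ˢ Set.univ) := by fun_prop
  exact (cs.mul ((hf.partialD 0).continuousOn_mer hm)).add
    (cc.mul ((hf.partialD 2).continuousOn_mer hm))

theorem SmoothOnSurface.laplacian_continuousOn (hm : 0 < m) {f : E3 → ℝ}
    (hf : SmoothOnSurface m f) : ContinuousOn
      (fun p : ℝ × ℝ => ∑ i, PenrosePerturbation.partialD i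
        (PenrosePerturbation.partialD i f) (p.1 • eR p.2))
      (Set.Ici (m / 2) ×ˢ Set.univ) :=
  continuousOn_finsetSum _ fun i _ => ((hf.partialD i).partialD i).continuousOn_mer hm

theorem sq_radComp_le (V : Fin 3 → E3 → ℝ) (r θ : ℝ) :
    radComp V r θ ^ 2 ≤ ∑ i, V i (r • eR θ) ^ 2 := by
  rw [radComp, Fin.sum_univ_three]
  have h := sin_sq_add_cos_sq θ
  nlinarith [sq_nonneg (cos θ * V 0 (r • eR θ) - sin θ * V 2 (r • eR θ)),
    sq_nonneg (V 1 (r • eR θ))]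

/-- Averages of uniformly small functions tend to zero. -/
theorem tendsto_avg_zero {F : ℝ → ℝ → ℝ} {a : ℝ} (hc : ∀ r, a ≤ r → Continuous (F r))
    (h : ∀ δ > 0, ∀ᶠ r in atTop, ∀ θ, |F r θ| ≤ δ) :
    Tendsto (fun r => avg (F r)) atTop (𝓝 0) := by
  rw [Metric.tendsto_nhds]
  intro δ hδ
  filter_upwards [h (δ / 2) (by positivity), eventually_ge_atTop a] with r h1 h2
  rw [dist_zero_right, norm_eq_abs]
  have := abs_avg_le (hc r h2) fun θ _ => h1 θ
  linarith

/-- Conservation of the flux of angular momentum up to the boundary. -/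
theorem IsAxialTT.rotation_flux_const {T : E3 → Tensor2} (hm : 0 < m) (hT : IsAxialTT m T)
    (hdiv : ∀ r, m / 2 < r → ∀ θ, sin θ * divT T 1 (r • eR θ) = 0) {r : ℝ} (hr : m / 2 ≤ r) :
    r ^ 3 * avg (fun θ => sin θ * frRP T r θ)
      = (m / 2) ^ 3 * avg (fun θ => sin θ * frRP T (m / 2) θ) := by
  have hc : ContinuousOn (fun r => r ^ 3 * avg fun θ => sin θ * frRP T r θ) (Set.Ici (m / 2)) :=
    (continuousOn_id.pow 3).mul (continuousOn_avg (F := fun r θ => sin θ * frRP T r θ)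
      ((continuous_sin.comp continuous_snd).continuousOn.mul (hT.frRP_continuousOn hm)))
  have hd : ∀ r ∈ interior (Set.Ici (m / 2)),
      HasDerivWithinAt (fun r => r ^ 3 * avg fun θ => sin θ * frRP T r θ) 0
        (interior (Set.Ici (m / 2))) r := fun r hr => by
    rw [interior_Ici] at hr
    exact (hT.hasDerivAt_flux_rotation hm hdiv hr).hasDerivWithinAt
  have h1 := monotoneOn_of_hasDerivWithinAt_nonneg (convex_Ici _) hc hd fun _ _ => le_rfl
  have h2 := antitoneOn_of_hasDerivWithinAt_nonpos (convex_Ici _) hc hd fun _ _ => le_rfl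
  exact le_antisymm (h2 Set.self_mem_Ici hr hr) (h1 Set.self_mem_Ici hr hr)

end Means

/-! ### The ADM energy of a solution. -/

section Solution
variable {m : ℝ} {ψ : E3 → ℝ} {A : E3 → Tensor2} {H : E3 → ℝ}

theorem IsSolution.eventually_psi (hS : IsSolution m ψ A H) {δ : ℝ} (hδ : 0 < δ) :
    ∃ R, m / 2 < R ∧ 0 < R ∧ ∀ r, R < r → ∀ θ, |ψ (r • eR θ) - 1| ≤ δ := by
  have h := (Metric.tendsto_nhds.mp hS.psi_tendsto) δ hδ
  obtain ⟨R, -, hR⟩ := (hasBasis_cobounded_norm (E := E3)).mem_iff.mp h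
  refine ⟨max R (max (m / 2) 0 + 1), ?_, ?_, fun r hr θ => ?_⟩
  · exact lt_of_lt_of_le (by linarith [le_max_left (m / 2) 0]) (le_max_right _ _)
  · exact lt_of_lt_of_le (by linarith [le_max_right (m / 2) 0]) (le_max_right _ _)
  · have h1 : R ≤ r := (le_max_left _ _).trans hr.le
    have h2 : 0 ≤ r := by
      have := (le_max_right R (max (m / 2) 0 + 1)).trans hr.le
      linarith [le_max_right (m / 2) 0]
    have h3 : r • eR θ ∈ {x : E3 | R ≤ ‖x‖} := by
      change R ≤ ‖r • eR θ‖
      rwa [norm_smul_eR h2]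
    have := hR h3
    simp only [Set.mem_ofPred_eq, dist_eq] at this
    exact this.le

theorem IsSolution.exists_bound (hm : 0 < m) (hS : IsSolution m ψ A H) : ∃ C, 0 < C ∧
    ∀ r, m / 2 ≤ r → ∀ θ, (∀ i j, |A (r • eR θ) i j| ≤ C / r ^ 2) ∧ |H (r • eR θ)| ≤ C / r ^ 2 ∧
      ∀ i, |partialD i H (r • eR θ)| ≤ C / r ^ 3 := by
  choose CA hCA using hS.decay_A
  obtain ⟨CH, hCH⟩ := hS.decay_H
  refine ⟨1 + |CH| + ∑ i, ∑ j, |CA i j|, by positivity, fun r hr θ => ?_⟩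
  have hr0 : 0 < r := by linarith
  have hsum : 0 ≤ ∑ i, ∑ j, |CA i j| := by positivity
  have hmem := smul_eR_mem hm hr θ
  have h1 := hCH _ hmem
  have hle : CH ≤ 1 + |CH| + ∑ i, ∑ j, |CA i j| := by linarith [le_abs_self CH]
  rw [norm_smul_eR hr0.le] at h1
  refine ⟨fun i j => ?_, h1.1.trans (by gcongr), fun i =>
    ((abs_partialD_le i H _).trans h1.2).trans (by gcongr)⟩
  have h2 := (hCA i j _ hmem).1
  rw [norm_smul_eR hr0.le] at h2
  refine h2.trans ?_
  have h3 : |CA i j| ≤ ∑ i, ∑ j, |CA i j| :=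
    (Finset.single_le_sum (f := fun j => |CA i j|) (fun _ _ => abs_nonneg _)
      (Finset.mem_univ j)).trans (Finset.single_le_sum (f := fun i => ∑ j, |CA i j|)
        (fun _ _ => Finset.sum_nonneg fun _ _ => abs_nonneg _) (Finset.mem_univ i))
  have h4 : CA i j ≤ 1 + |CH| + ∑ i, ∑ j, |CA i j| := by
    linarith [le_abs_self (CA i j), abs_nonneg CH]
  gcongr

theorem IsSolution.laplacian_apply (hm : 0 < m) (hS : IsSolution m ψ A H) {r : ℝ}
    (hr : m / 2 ≤ r) (θ : ℝ) : ∑ i, partialD i (partialD i ψ) (r • eR θ)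
      = -(1 / 8) * (∑ i, ∑ j, A (r • eR θ) i j ^ 2) / ψ (r • eR θ) ^ 7
        + 1 / 12 * H (r • eR θ) ^ 2 * ψ (r • eR θ) ^ 5 := by
  have hmem := smul_eR_mem hm hr θ
  rw [← hS.smooth_psi.laplacian_eq hmem, hS.hamiltonian _ hmem]

theorem sq_le_of_abs_le_div {x C r : ℝ} (h : |x| ≤ C / r ^ 2) : x ^ 2 ≤ C ^ 2 / r ^ 4 := by
  rw [← sq_abs]
  calc |x| ^ 2 ≤ (C / r ^ 2) ^ 2 := pow_le_pow_left₀ (abs_nonneg _) h 2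
    _ = C ^ 2 / r ^ 4 := by rw [div_pow, ← pow_mul]

/-- The constant 150 exceeds 9·2⁷/8 + (3/2)⁵/12, which comes from 1/2 ≤ ψ ≤ 3/2. -/
theorem IsSolution.laplacian_bound (hm : 0 < m) (hS : IsSolution m ψ A H) : ∃ C R, 0 < C ∧
    m / 2 < R ∧ 0 < R ∧ (∀ r, R < r → ∀ θ, |ψ (r • eR θ) - 1| ≤ 1 / 2) ∧
      ∀ r, R < r → ∀ θ, |∑ i, partialD i (partialD i ψ) (r • eR θ)| ≤ C / r ^ 4 := by
  obtain ⟨C, hC, hb⟩ := hS.exists_bound hm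
  obtain ⟨R, hR, hR0, hψ⟩ := hS.eventually_psi (δ := 1 / 2) (by norm_num)
  refine ⟨150 * C ^ 2, R, by positivity, hR, hR0, hψ, fun r hr θ => ?_⟩
  have hr0 : 0 < r := hR0.trans hr
  obtain ⟨bA, bH, -⟩ := hb r (hR.trans hr).le θ
  rw [hS.laplacian_apply hm (hR.trans hr).le]
  have h1 := abs_le.mp (hψ r hr θ)
  set p := ψ (r • eR θ)
  have hp : 1 / 2 ≤ p := by linarith
  have hp2 : p ≤ 3 / 2 := by linarith
  have hp0 : 0 < p := by linarith
  have hsum : ∑ i, ∑ j, A (r • eR θ) i j ^ 2 ≤ 9 * (C ^ 2 / r ^ 4) := by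
    have : ∀ i j, A (r • eR θ) i j ^ 2 ≤ C ^ 2 / r ^ 4 := fun i j => sq_le_of_abs_le_div (bA i j)
    simp only [Fin.sum_univ_three]
    linarith [this 0 0, this 0 1, this 0 2, this 1 0, this 1 1, this 1 2, this 2 0, this 2 1,
      this 2 2]
  have hsum0 : 0 ≤ ∑ i, ∑ j, A (r • eR θ) i j ^ 2 :=
    Finset.sum_nonneg fun i _ => Finset.sum_nonneg fun j _ => sq_nonneg _
  have h7 : (1 / 2 : ℝ) ^ 7 ≤ p ^ 7 := pow_le_pow_left₀ (by norm_num) hp 7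
  have h5 : p ^ 5 ≤ (3 / 2 : ℝ) ^ 5 := pow_le_pow_left₀ hp0.le hp2 5
  have e1 : (∑ i, ∑ j, A (r • eR θ) i j ^ 2) / p ^ 7 ≤ 9 * (C ^ 2 / r ^ 4) / (1 / 2) ^ 7 :=
    div_le_div₀ (by positivity) hsum (by norm_num) h7
  have e2 : H (r • eR θ) ^ 2 * p ^ 5 ≤ C ^ 2 / r ^ 4 * (3 / 2) ^ 5 :=
    mul_le_mul (sq_le_of_abs_le_div bH) h5 (by positivity) (by positivity)
  have e3 : 0 ≤ (∑ i, ∑ j, A (r • eR θ) i j ^ 2) / p ^ 7 := by positivity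
  have e4 : 0 ≤ H (r • eR θ) ^ 2 * p ^ 5 := by positivity
  have e5 : 0 ≤ C ^ 2 / r ^ 4 := by positivity
  rw [mul_div_assoc, mul_assoc, mul_div_assoc, abs_le]
  norm_num at e1 e2
  constructor <;> linarith

/-- The flux of the gradient. -/
theorem IsSolution.hasDerivAt_flux (hm : 0 < m) (hS : IsSolution m ψ A H) {r : ℝ}
    (hr : m / 2 < r) : HasDerivAt (fun r => r ^ 2 * avg fun θ => radComp (fun i => partialD i ψ) r θ)
      (r ^ 2 * avg fun θ => ∑ i, partialD i (partialD i ψ) (r • eR θ)) r := by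
  have h := hS.smooth_psi.hasDerivAt_flux_gradient hm hS.axial_psi (Φ := fun _ => 1)
    (Φ' := fun _ => 0) (fun θ => hasDerivAt_const _ _) continuous_const hr
  simpa only [one_mul, zero_mul, avg_const, mul_zero, add_zero] using h

theorem IsSolution.hasDerivAt_avg_psi (hm : 0 < m) (hS : IsSolution m ψ A H) {r : ℝ}
    (hr : m / 2 < r) : HasDerivAt (fun r => avg fun θ => ψ (r • eR θ))
      (avg fun θ => radComp (fun i => partialD i ψ) r θ) r := by
  have h := hS.smooth_psi.hasDerivAt_avg_mul hm (Φ := fun _ => 1) continuous_const hr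
  simpa only [one_mul] using h

theorem IsSolution.tendsto_avg_psi (hm : 0 < m) (hS : IsSolution m ψ A H) :
    Tendsto (fun r : ℝ => avg fun θ => ψ (r • eR θ)) atTop (𝓝 1) := by
  have h : Tendsto (fun r : ℝ => avg fun θ => ψ (r • eR θ) - 1) atTop (𝓝 0) := by
    refine tendsto_avg_zero (F := fun r θ => ψ (r • eR θ) - 1) (a := m / 2)
      (fun r hr => (hS.smooth_psi.continuous_mer hm hr).sub continuous_const) fun δ hδ => ?_
    obtain ⟨R, -, -, h⟩ := hS.eventually_psi hδ
    filter_upwards [eventually_gt_atTop R] with r hr using h r hr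
  have h2 := h.add_const 1
  rw [zero_add] at h2
  refine h2.congr' ?_
  filter_upwards [eventually_ge_atTop (m / 2)] with r hr
  rw [avg_sub (hS.smooth_psi.continuous_mer hm hr) continuous_const, avg_const, sub_add_cancel]

theorem IsSolution.integrableOn_source (hm : 0 < m) (hS : IsSolution m ψ A H) :
    IntegrableOn (fun r => alphaFn m r * (r ^ 2 * avg fun θ =>
      ∑ i, partialD i (partialD i ψ) (r • eR θ))) (Set.Ioi (m / 2)) := by
  obtain ⟨C, R, hC, hR, hR0, -, hb⟩ := hS.laplacian_bound hm
  have hcont := hS.smooth_psi.laplacian_continuousOn hm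
  refine Decays.integrableOn ?_ ((continuousOn_alphaFn hm).mul ((continuousOn_id.pow 2).mul
    (continuousOn_avg (F := fun r θ => ∑ i, partialD i (partialD i ψ) (r • eR θ)) hcont)))
  have h1 : Decays 4 fun r => avg fun θ => ∑ i, partialD i (partialD i ψ) (r • eR θ) := by
    refine decays_of_bound (a := R + 1) (C := C) fun r hr => ?_
    exact abs_avg_le (continuous_slice (F := fun r θ => ∑ i, partialD i (partialD i ψ) (r • eR θ))
      hcont (by linarith)) fun θ _ => hb r (by linarith) θ
  simpa using (decays_alphaFn (m := m)).mul (h1.of_succ_pow (k := 2) 2)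

/-- With u the mean of ψ, α r² u' - (m/2)u has derivative α(r²u')'. Its horizon value involves only
u because α vanishes there, and dividing by α → 1 recovers the flux at infinity. -/
theorem IsSolution.tendsto_flux (hm : 0 < m) (hS : IsSolution m ψ A H) :
    Tendsto (fun r => r ^ 2 * avg fun θ => radComp (fun i => partialD i ψ) r θ) atTop
      (𝓝 ((∫ r in Set.Ioi (m / 2), alphaFn m r * (r ^ 2 * avg fun θ =>
        ∑ i, partialD i (partialD i ψ) (r • eR θ)))
          - m / 2 * (avg (fun θ => ψ ((m / 2) • eR θ)) - 1))) := by
  have hr0 : ∀ r, m / 2 < r → 0 < r := fun r hr => by linarith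
  have hd : ∀ r, m / 2 < r → HasDerivAt (fun r => alphaFn m r
      * (r ^ 2 * avg fun θ => radComp (fun i => partialD i ψ) r θ)
      - m / 2 * avg fun θ => ψ (r • eR θ))
      (alphaFn m r * (r ^ 2 * avg fun θ => ∑ i, partialD i (partialD i ψ) (r • eR θ))) r := by
    intro r hr
    have := hr0 r hr
    refine (((hasDerivAt_alphaFn (m := m) this.ne').mul (hS.hasDerivAt_flux hm hr)).sub
      ((hS.hasDerivAt_avg_psi hm hr).const_mul (m / 2))).congr_deriv ?_
    generalize avg _ = u
    field_simp
    ring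
  have hc1 := continuousOn_avg (F := fun r θ => radComp (fun i => partialD i ψ) r θ)
    (hS.smooth_psi.radComp_continuousOn hm)
  have hc2 := continuousOn_avg (F := fun r θ => ψ (r • eR θ))
    (hS.smooth_psi.continuousOn_mer hm)
  have hc : ContinuousOn (fun r => alphaFn m r
      * (r ^ 2 * avg fun θ => radComp (fun i => partialD i ψ) r θ)
      - m / 2 * avg fun θ => ψ (r • eR θ)) (Set.Ici (m / 2)) :=
    ((continuousOn_alphaFn hm).mul ((continuousOn_id.pow 2).mul hc1)).sub
      (continuousOn_const.mul hc2)
  obtain ⟨l, hl⟩ := exists_tendsto_of_deriv_integrable hd (hS.integrableOn_source hm)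
  have hint := integral_Ioi_of_hasDerivAt_of_tendsto (hc _ Set.self_mem_Ici)
    (fun r hr => hd r hr) (hS.integrableOn_source hm) hl
  rw [alphaFn_horizon hm] at hint
  have hα := tendsto_alphaFn (m := m)
  have h1 := (hl.add ((hS.tendsto_avg_psi hm).const_mul (m / 2))).div hα one_ne_zero
  rw [div_one] at h1
  have e : (∫ r in Set.Ioi (m / 2), alphaFn m r * (r ^ 2 * avg fun θ =>
        ∑ i, partialD i (partialD i ψ) (r • eR θ)))
          - m / 2 * (avg (fun θ => ψ ((m / 2) • eR θ)) - 1) = l + m / 2 * 1 := by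
    rw [hint]; ring
  rw [e]
  refine h1.congr' ?_
  filter_upwards [eventually_gt_atTop (m / 2)] with r hr
  have := alphaFn_pos hm hr
  simp only [Pi.div_apply]
  field_simp
  ring

/-- The quartic is the primitive of s³ - 1 with a double zero at s = 1. Both s³ - 1 and s⁶ - 1
vanish there to first order, so their squares are dominated by it on [1/2, 3/2]. -/
theorem quartic_bounds {s : ℝ} (h1 : 1 / 2 ≤ s) (h2 : s ≤ 3 / 2) :
    0 ≤ s ^ 4 / 4 - s + 3 / 4 ∧ (s ^ 3 - 1) ^ 2 ≤ 31 * (s ^ 4 / 4 - s + 3 / 4) ∧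
      (s ^ 6 - 1) ^ 2 ≤ 700 * (s ^ 4 / 4 - s + 3 / 4) ∧ |s ^ 3 - 1| ≤ 3 := by
  have hs : 0 ≤ s := by linarith
  have e : s ^ 4 / 4 - s + 3 / 4 = (s - 1) ^ 2 * ((s ^ 2 + 2 * s + 3) / 4) := by ring
  have h3 : (s - 1) ^ 2 * (3 / 4) ≤ s ^ 4 / 4 - s + 3 / 4 := by
    rw [e]
    refine mul_le_mul_of_nonneg_left ?_ (sq_nonneg _)
    nlinarith
  have hpow : ∀ k : ℕ, s ^ k ≤ (3 / 2) ^ k := fun k => pow_le_pow_left₀ hs h2 k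
  have h4 : s ^ 2 + s + 1 ≤ 19 / 4 := by have := hpow 2; norm_num at this; linarith
  have h5 : 0 ≤ s ^ 2 + s + 1 := by positivity
  have h6 : s ^ 5 + s ^ 4 + s ^ 3 + s ^ 2 + s + 1 ≤ 21 := by
    have a := hpow 2; have b := hpow 3; have c := hpow 4; have d := hpow 5
    norm_num at a b c d; linarith
  have h7 : 0 ≤ s ^ 5 + s ^ 4 + s ^ 3 + s ^ 2 + s + 1 := by positivity
  refine ⟨le_trans (by positivity) h3, ?_, ?_, ?_⟩
  · have e2 : (s ^ 3 - 1) ^ 2 = (s - 1) ^ 2 * (s ^ 2 + s + 1) ^ 2 := by ring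
    have h8 := mul_le_mul_of_nonneg_left (pow_le_pow_left₀ h5 h4 2) (sq_nonneg (s - 1))
    rw [e2]
    nlinarith [sq_nonneg (s - 1)]
  · have e2 : (s ^ 6 - 1) ^ 2
        = (s - 1) ^ 2 * (s ^ 5 + s ^ 4 + s ^ 3 + s ^ 2 + s + 1) ^ 2 := by ring
    have h8 := mul_le_mul_of_nonneg_left (pow_le_pow_left₀ h7 h6 2) (sq_nonneg (s - 1))
    rw [e2]
    nlinarith [sq_nonneg (s - 1)]
  · have := hpow 3
    norm_num at this
    rw [abs_le]
    have : 0 ≤ s ^ 3 := by positivity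
    constructor <;> linarith

/-- The nonlinear part of the energy flux. -/
def nonlinearFlux (ψ : E3 → ℝ) (r : ℝ) : ℝ :=
  r ^ 2 * avg fun θ => (ψ (r • eR θ) ^ 3 - 1) * radComp (fun i => partialD i ψ) r θ

/-- A mean measuring the deviation of the conformal factor from one. -/
def deviation (ψ : E3 → ℝ) (r : ℝ) : ℝ :=
  avg fun θ => ψ (r • eR θ) ^ 4 / 4 - ψ (r • eR θ) + 3 / 4

theorem IsSolution.hasDerivAt_deviation (hm : 0 < m) (hS : IsSolution m ψ A H) {r : ℝ}
    (hr : m / 2 < r) : HasDerivAt (deviation ψ) (nonlinearFlux ψ r / r ^ 2) r := by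
  have hr0 : 0 < r := by linarith
  have cψ := hS.smooth_psi.continuousOn_mer hm
  have cρ := hS.smooth_psi.radComp_continuousOn hm
  have h := hasDerivAt_avg (F := fun r θ => ψ (r • eR θ) ^ 4 / 4 - ψ (r • eR θ) + 3 / 4)
    (F' := fun r θ => (ψ (r • eR θ) ^ 3 - 1) * radComp (fun i => partialD i ψ) r θ)
    (a := m / 2) ((((cψ.pow 4).div_const 4).sub cψ).add continuousOn_const)
    (((cψ.pow 3).sub continuousOn_const).mul cρ) (fun r hr θ => ?_) hr
  · refine h.congr_deriv ?_
    rw [nonlinearFlux]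
    field_simp
  · have hd := hS.smooth_psi.hasDerivAt_radial hm hr.le θ
    refine ((((hd.pow 4).div_const 4).sub hd).add_const (3 / 4)).congr_deriv ?_
    simp only [radComp]
    push_cast
    ring

/-- This is the divergence theorem for the axially symmetric field (ψ³ - 1)∇ψ. -/
theorem IsSolution.hasDerivAt_nonlinearFlux (hm : 0 < m) (hS : IsSolution m ψ A H) {r : ℝ}
    (hr : m / 2 < r) : HasDerivAt (nonlinearFlux ψ) (r ^ 2 * avg fun θ =>
      3 * ψ (r • eR θ) ^ 2 * (∑ i, partialD i ψ (r • eR θ) ^ 2)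
        + (ψ (r • eR θ) ^ 3 - 1) * ∑ i, partialD i (partialD i ψ) (r • eR θ)) r := by
  have hs := hS.smooth_psi
  have hk : SmoothOnSurface m fun x => ψ x ^ 3 - 1 := (hs.pow 3).sub (SmoothOnSurface.const 1)
  have hpd : ∀ i k x, x ∈ surface m → partialD k (fun x => (ψ x ^ 3 - 1) * partialD i ψ x) x
      = 3 * ψ x ^ 2 * partialD k ψ x * partialD i ψ x
        + (ψ x ^ 3 - 1) * partialD k (partialD i ψ) x := by
    intro i k x hx
    rw [partialD_mul (hk.differentiableAt hx) ((hs.partialD i).differentiableAt hx)]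
    have h1 : HasFDerivAt (fun x => ψ x ^ 3 - 1) (((3 : ℕ) * ψ x ^ 2) • fderiv ℝ ψ x) x := by
      simpa using ((hs.differentiableAt hx).hasFDerivAt.pow 3).sub_const 1
    rw [partialD, h1.fderiv]
    simp [partialD]
  have h := PenrosePerturbation.hasDerivAt_flux hm
    (V := fun i x => (ψ x ^ 3 - 1) * partialD i ψ x) (fun i => hk.mul (hs.partialD i))
    (fun r hr θ => ?_) (Φ := fun _ => 1) (Φ' := fun _ => 0) (fun θ => hasDerivAt_const _ _)
    continuous_const hr
  · refine (h.congr_deriv ?_).congr_of_eventuallyEq (Eventually.of_forall fun s => ?_)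
    · simp only [zero_mul, avg_const, mul_zero, add_zero, one_mul]
      congr 2
      funext θ
      simp only [hpd _ _ _ (smul_eR_mem hm hr.le θ), Fin.sum_univ_three]
      ring
    · simp only [nonlinearFlux, radComp, one_mul]
      congr 2
      funext θ
      ring
  · have h1 := hs.sin_mul_partialD_one hm hS.axial_psi hr.le θ
    have h2 := hs.gradient_axial hm hS.axial_psi hr θ
    rw [hpd _ _ _ (smul_eR_mem hm hr.le θ)]
    linear_combination 3 * r * ψ (r • eR θ) ^ 2 * partialD 1 ψ (r • eR θ) * h1
      + (ψ (r • eR θ) ^ 3 - 1) * h2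

theorem IsSolution.continuous_deviation (hm : 0 < m) (hS : IsSolution m ψ A H) {r : ℝ}
    (hr : m / 2 ≤ r) : Continuous fun θ => ψ (r • eR θ) ^ 4 / 4 - ψ (r • eR θ) + 3 / 4 := by
  have h := hS.smooth_psi.continuous_mer hm hr
  exact (((h.pow 4).div_const 4).sub h).add continuous_const

theorem IsSolution.tendsto_deviation (hm : 0 < m) (hS : IsSolution m ψ A H) :
    Tendsto (deviation ψ) atTop (𝓝 0) := by
  refine tendsto_avg_zero (F := fun r θ => ψ (r • eR θ) ^ 4 / 4 - ψ (r • eR θ) + 3 / 4)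
    (a := m / 2) (fun r hr => hS.continuous_deviation hm hr) fun δ hδ => ?_
  have hcont : ContinuousAt (fun s : ℝ => s ^ 4 / 4 - s + 3 / 4) 1 := by fun_prop
  obtain ⟨η, hη, h1⟩ := Metric.continuousAt_iff.mp hcont δ hδ
  obtain ⟨R, -, -, h⟩ := hS.eventually_psi (δ := η / 2) (by positivity)
  filter_upwards [eventually_gt_atTop R] with r hr θ
  have h2 := h1 (x := ψ (r • eR θ)) (by rw [dist_eq]; linarith [h r hr θ])
  rw [dist_eq] at h2
  norm_num at h2
  exact h2.le

/-- No decay of ∇ψ is assumed, so smallness of ψ³ - 1 alone is not enough. The derivative of the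
flux contains the positive term 3ψ²|∇ψ|², which by Cauchy–Schwarz dominates the square of the flux
divided by the deviation; this is the hypothesis of `tendsto_flux_zero`. -/
theorem IsSolution.tendsto_nonlinearFlux (hm : 0 < m) (hS : IsSolution m ψ A H) :
    Tendsto (nonlinearFlux ψ) atTop (𝓝 0) := by
  obtain ⟨C, R, hC, hR, hR0, hψ, hb⟩ := hS.laplacian_bound hm
  have hq : ∀ r, R < r → ∀ θ, _ := fun r hr θ =>
    quartic_bounds (s := ψ (r • eR θ)) (by linarith [(abs_le.mp (hψ r hr θ)).1])
      (by linarith [(abs_le.mp (hψ r hr θ)).2])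
  refine tendsto_flux_zero hR0 (C := 3 * C) (C₁ := 31) (c := 3 / 4) (by positivity) (by norm_num)
    (by norm_num) (fun r hr => hS.hasDerivAt_nonlinearFlux hm (hR.trans hr))
    (fun r hr => hS.hasDerivAt_deviation hm (hR.trans hr)) (fun r hr => ?_)
    (hS.tendsto_deviation hm) fun r hr l => ?_
  · exact avg_nonneg (hS.continuous_deviation hm (hR.trans hr).le) fun θ _ => (hq r hr θ).1
  · have hr' : m / 2 ≤ r := (hR.trans hr).le
    have hr0 : 0 < r := hR0.trans hr
    have cψ := hS.smooth_psi.continuous_mer hm hr'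
    have cρ := continuous_slice (hS.smooth_psi.radComp_continuousOn hm) hr'
    have cΔ := continuous_slice (F := fun r θ => ∑ i, partialD i (partialD i ψ) (r • eR θ))
      (hS.smooth_psi.laplacian_continuousOn hm) hr'
    have cd : Continuous fun θ => ∑ i, partialD i ψ (r • eR θ) ^ 2 :=
      continuous_finsetSum _ fun i _ => ((hS.smooth_psi.partialD i).continuous_mer hm hr').pow 2
    have ck := hS.continuous_deviation hm hr'
    have c1 : Continuous fun θ => (ψ (r • eR θ) ^ 3 - 1) * radComp (fun i => partialD i ψ) r θ :=
      ((cψ.pow 3).sub continuous_const).mul cρ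
    have hpt : ∀ θ, 3 / 2 * l * ((ψ (r • eR θ) ^ 3 - 1) * radComp (fun i => partialD i ψ) r θ)
        - 3 / 4 * l ^ 2 * 31 * (ψ (r • eR θ) ^ 4 / 4 - ψ (r • eR θ) + 3 / 4) - 3 * C / r ^ 4
        ≤ 3 * ψ (r • eR θ) ^ 2 * (∑ i, partialD i ψ (r • eR θ) ^ 2)
        + (ψ (r • eR θ) ^ 3 - 1) * ∑ i, partialD i (partialD i ψ) (r • eR θ) := by
      intro θ
      obtain ⟨q1, q2, -, q4⟩ := hq r hr θ
      have hρ := sq_radComp_le (fun i => partialD i ψ) r θ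
      have h1 := hb r hr θ
      have h2 := abs_le.mp (hψ r hr θ)
      generalize ψ (r • eR θ) = s at *
      generalize radComp (fun i => partialD i ψ) r θ = ρ at *
      generalize ∑ i, partialD i ψ (r • eR θ) ^ 2 = G at *
      generalize ∑ i, partialD i (partialD i ψ) (r • eR θ) = L at *
      have hG : 0 ≤ G := (sq_nonneg ρ).trans hρ
      have h3 : 3 / 4 * ρ ^ 2 ≤ 3 * s ^ 2 * G := by
        have : (3 : ℝ) / 4 ≤ 3 * s ^ 2 := by nlinarith
        calc 3 / 4 * ρ ^ 2 ≤ 3 / 4 * G := by linarith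
          _ ≤ 3 * s ^ 2 * G := mul_le_mul_of_nonneg_right this hG
      have h4 : |(s ^ 3 - 1) * L| ≤ 3 * (C / r ^ 4) := by
        rw [abs_mul]; exact mul_le_mul q4 h1 (abs_nonneg _) (by norm_num)
      have h5 := (abs_le.mp h4).1
      -- Cauchy–Schwarz in linearized form: the free parameter l lets the inequality be averaged
      -- termwise.
      have h6 : 2 * l * ((s ^ 3 - 1) * ρ) - l ^ 2 * (s ^ 3 - 1) ^ 2 ≤ ρ ^ 2 := by
        nlinarith [sq_nonneg (ρ - l * (s ^ 3 - 1))]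
      have h7 := mul_le_mul_of_nonneg_left q2 (sq_nonneg l)
      rw [mul_div_assoc]
      linarith
    have hc2 : Continuous fun θ => 3 / 2 * l
        * ((ψ (r • eR θ) ^ 3 - 1) * radComp (fun i => partialD i ψ) r θ)
        - 3 / 4 * l ^ 2 * 31 * (ψ (r • eR θ) ^ 4 / 4 - ψ (r • eR θ) + 3 / 4) :=
      (c1.const_mul _).sub (ck.const_mul _)
    have h8 := avg_mono (hc2.sub (continuous_const (y := 3 * C / r ^ 4)))
      (g := fun θ => 3 * ψ (r • eR θ) ^ 2 * (∑ i, partialD i ψ (r • eR θ) ^ 2)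
        + (ψ (r • eR θ) ^ 3 - 1) * ∑ i, partialD i (partialD i ψ) (r • eR θ))
      ((((continuous_const.mul (cψ.pow 2)).mul cd).add
        (((cψ.pow 3).sub continuous_const).mul cΔ))) fun θ _ => hpt θ
    have h9 : avg ((fun θ => 3 / 2 * l
        * ((ψ (r • eR θ) ^ 3 - 1) * radComp (fun i => partialD i ψ) r θ)
        - 3 / 4 * l ^ 2 * 31 * (ψ (r • eR θ) ^ 4 / 4 - ψ (r • eR θ) + 3 / 4))
          - fun _ => 3 * C / r ^ 4)
        = 3 / 2 * l * (nonlinearFlux ψ r / r ^ 2) - 3 / 4 * l ^ 2 * 31 * deviation ψ r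
          - 3 * C / r ^ 4 := by
      have h10 := avg_sub hc2 (continuous_const (y := 3 * C / r ^ 4))
      rw [avg_sub (c1.const_mul _) (ck.const_mul _), avg_const_mul, avg_const_mul, avg_const] at h10
      have h11 : nonlinearFlux ψ r / r ^ 2
          = avg fun θ => (ψ (r • eR θ) ^ 3 - 1) * radComp (fun i => partialD i ψ) r θ := by
        rw [nonlinearFlux]; field_simp
      rw [h11]
      exact h10
    rw [h9] at h8
    refine le_trans (le_of_eq ?_) (mul_le_mul_of_nonneg_left h8 (sq_nonneg r))
    field_simp
    ring

/-- Writing ψ³ = 1 + (ψ³ - 1) splits the energy flux into a linear part with known limit and a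
nonlinear part tending to zero. -/
theorem IsSolution.isADMEnergy (hm : 0 < m) (hS : IsSolution m ψ A H) :
    IsADMEnergy (physMetric ψ) (m * (avg (fun θ => ψ ((m / 2) • eR θ)) - 1)
      - 2 * ∫ r in Set.Ioi (m / 2), alphaFn m r * (r ^ 2 * avg fun θ =>
        ∑ i, partialD i (partialD i ψ) (r • eR θ))) := by
  have h := ((hS.tendsto_flux hm).add (hS.tendsto_nonlinearFlux hm)).const_mul (-2)
  refine (h.congr' ?_).trans_eq ?_
  · filter_upwards [eventually_gt_atTop (m / 2)] with r hr
    have cψ := hS.smooth_psi.continuous_mer hm hr.le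
    have cρ := continuous_slice (hS.smooth_psi.radComp_continuousOn hm) hr.le
    rw [hS.energy_integral hm hr, nonlinearFlux, ← mul_add]
    congr 2
    rw [← avg_add (f := fun θ => radComp (fun i => partialD i ψ) r θ)
      (g := fun θ => (ψ (r • eR θ) ^ 3 - 1) * radComp (fun i => partialD i ψ) r θ) cρ
      (((cψ.pow 3).sub continuous_const).mul cρ)]
    congr 1
    funext θ
    ring
  · congr 1
    ring

end Solution

/-! ### Linear and angular momentum of a solution -/

section Momentum
variable {m : ℝ} {T : E3 → Tensor2} {h : E3 → ℝ}

/-- The flux through a sphere whose limit is twice the momentum along the axis. -/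
def axisFlux (T : E3 → Tensor2) (h : E3 → ℝ) (r : ℝ) : ℝ :=
  r ^ 2 * avg fun θ => cos θ * frRR T r θ - sin θ * frRT T r θ - 2 / 3 * h (r • eR θ) * cos θ

theorem IsAxialTT.continuousOn_axisFlux_integrand (hm : 0 < m) (hT : IsAxialTT m T)
    (hh : SmoothOnSurface m h) : ContinuousOn (fun p : ℝ × ℝ => cos p.2 * frRR T p.1 p.2
      - sin p.2 * frRT T p.1 p.2 - 2 / 3 * h (p.1 • eR p.2) * cos p.2)
      (Set.Ici (m / 2) ×ˢ Set.univ) := by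
  have cs : ContinuousOn (fun p : ℝ × ℝ => sin p.2) (Set.Ici (m / 2) ×ˢ Set.univ) := by fun_prop
  have cc : ContinuousOn (fun p : ℝ × ℝ => cos p.2) (Set.Ici (m / 2) ×ˢ Set.univ) := by fun_prop
  exact ((cc.mul (hT.frRR_continuousOn hm)).sub (cs.mul (hT.frRT_continuousOn hm))).sub
    ((continuousOn_const.mul (hh.continuousOn_mer hm)).mul cc)

/-- The flux field is the z-column of T with ⅔h subtracted from its last entry. The subtraction
moves the leading part of the source of the momentum constraint to the other side, so that only its
factor ψ⁶ - 1 remains. -/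
theorem IsAxialTT.hasDerivAt_axisFlux (hm : 0 < m) (hT : IsAxialTT m T)
    (hh : SmoothOnSurface m h) {r : ℝ} (hr : m / 2 < r) :
    HasDerivAt (axisFlux T h) (r ^ 2 * avg fun θ =>
      divT T 2 (r • eR θ) - 2 / 3 * partialD 2 h (r • eR θ)) r := by
  have hV : ∀ i, SmoothOnSurface m ((![fun x => T x 0 2, fun x => T x 1 2,
      fun x => T x 2 2 - 2 / 3 * h x] : Fin 3 → E3 → ℝ) i) := by
    intro i
    fin_cases i
    · exact hT.smooth 0 2
    · exact hT.smooth 1 2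
    · exact (hT.smooth 2 2).sub (hh.const_mul (2 / 3))
  have h1 := hasDerivAt_flux hm hV (fun r hr θ => hT.rotation_one_two hm hr.le θ)
    (Φ := fun _ => 1) (Φ' := fun _ => 0) (fun θ => hasDerivAt_const _ _) continuous_const hr
  refine (h1.congr_deriv ?_).congr_of_eventuallyEq (Eventually.of_forall fun s => ?_)
  · simp only [zero_mul, avg_const, mul_zero, add_zero, one_mul]
    congr 2
    funext θ
    have hx := smul_eR_mem hm hr.le θ
    have e : partialD 2 (fun x => T x 2 2 - 2 / 3 * h x) (r • eR θ)
        = partialD 2 (fun x => T x 2 2) (r • eR θ) - 2 / 3 * partialD 2 h (r • eR θ) := by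
      rw [partialD_sub ((hT.smooth 2 2).differentiableAt hx)
        ((hh.const_mul (2 / 3)).differentiableAt hx),
        partialD_mul (differentiableAt_const _) (hh.differentiableAt hx), partialD_const]
      ring
    simp only [Fin.sum_univ_three, divT, Matrix.cons_val, e]
    ring
  · simp only [axisFlux, one_mul]
    congr 2
    funext θ
    simp only [radComp, frRR, frRT, Matrix.cons_val]
    linear_combination (sin θ * T (s • eR θ) 0 2 + cos θ * T (s • eR θ) 2 2)
      * sin_sq_add_cos_sq θ

theorem integrableOn_Ioi_of_abs_le_rpow {f : ℝ → ℝ} {a C s : ℝ} (hs : s < -1)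
    (hc : ContinuousOn f (Set.Ici a)) (h : ∀ᶠ r in atTop, |f r| ≤ C * r ^ s) :
    IntegrableOn f (Set.Ioi a) := by
  have h1 : LocallyIntegrableOn f (Set.Ici a) := hc.locallyIntegrableOn measurableSet_Ici
  have hg : IntegrableAtFilter (fun r : ℝ => r ^ s) atTop :=
    ⟨Set.Ioi 1, Ioi_mem_atTop 1, integrableOn_Ioi_rpow_of_lt hs zero_lt_one⟩
  have hO : f =O[atTop] fun r : ℝ => r ^ s := by
    refine IsBigO.of_bound C ?_
    filter_upwards [h, eventually_gt_atTop 0] with r hr hr0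
    rwa [norm_eq_abs, norm_eq_abs, abs_of_pos (rpow_pos_of_pos hr0 s)]
  exact (h1.integrableOn_of_isBigO_atTop hO hg).mono_set Set.Ioi_subset_Ici_self

/-- Arithmetic–geometric mean with weight √r, which balances a mean square of order 1/r. -/
theorem abs_le_half_sqrt {x r : ℝ} (hr : 0 < r) :
    |x| ≤ 1 / 2 * (x ^ 2 * √r + 1 / √r) := by
  have hs : 0 < √r := sqrt_pos.mpr hr
  have h1 : 0 ≤ (|x| * √r - 1) ^ 2 / √r := by positivity
  have h2 : (|x| * √r - 1) ^ 2 / √r = x ^ 2 * √r + 1 / √r - 2 * |x| := by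
    rw [← sq_abs x]
    field_simp
    ring
  linarith

variable {ψ : E3 → ℝ} {A : E3 → Tensor2} {H : E3 → ℝ}

/-- The nonlinear flux is eventually below 1 in absolute value, so the deviation has derivative at
least -1/r² and tends to zero. -/
theorem IsSolution.deviation_le (hm : 0 < m) (hS : IsSolution m ψ A H) :
    ∀ᶠ r in atTop, deviation ψ r ≤ 1 / r := by
  have h1 := (Metric.tendsto_nhds.mp (hS.tendsto_nonlinearFlux hm)) 1 one_pos
  obtain ⟨R, hR⟩ := eventually_atTop.mp h1
  filter_upwards [eventually_gt_atTop (max R (m / 2))] with r hr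
  have hmax : m / 2 ≤ max R (m / 2) := le_max_right _ _
  refine le_div_of_tendsto_zero (R := max R (m / 2)) (by linarith)
    (fun s hs => hS.hasDerivAt_deviation hm (by linarith)) (fun s hs => ?_)
    (hS.tendsto_deviation hm) hr
  have h2 := hR s ((le_max_left _ _).trans hs.le)
  rw [dist_zero_right, norm_eq_abs] at h2
  have hs0 : 0 < s := by linarith
  rw [← neg_div]
  gcongr
  linarith [(abs_lt.mp h2).1]

/-- The flux whose limit is twice the momentum converges. -/
theorem IsSolution.exists_tendsto_axisFlux (hm : 0 < m) (hS : IsSolution m ψ A H) :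
    ∃ P, Tendsto (axisFlux A H) atTop (𝓝 P) := by
  have hT := hS.isAxialTT
  have hd : ∀ r, m / 2 < r → HasDerivAt (axisFlux A H) (2 / 3 * (r ^ 2 * avg fun θ =>
      (ψ (r • eR θ) ^ 6 - 1) * partialD 2 H (r • eR θ))) r := by
    intro r hr
    refine (hT.hasDerivAt_axisFlux hm hS.smooth_H hr).congr_deriv ?_
    rw [mul_left_comm, ← avg_const_mul (2 / 3)]
    congr 2
    funext θ
    rw [divT, hS.momentum _ (smul_eR_mem hm hr.le θ) 2]
    ring
  have hcont : ContinuousOn (fun p : ℝ × ℝ => (ψ (p.1 • eR p.2) ^ 6 - 1)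
      * partialD 2 H (p.1 • eR p.2)) (Set.Ici (m / 2) ×ˢ Set.univ) :=
    (((hS.smooth_psi.continuousOn_mer hm).pow 6).sub continuousOn_const).mul
      ((hS.smooth_H.partialD 2).continuousOn_mer hm)
  obtain ⟨C, hC, hb⟩ := hS.exists_bound hm
  obtain ⟨R, hR, hR0, hψ⟩ := hS.eventually_psi (δ := 1 / 2) (by norm_num)
  -- The mean of |ψ⁶ - 1| is O(r^(-1/2)) by the bound on the deviation, and ∂H' = O(r⁻³), so the
  -- derivative of the flux is O(r^(-3/2)) and integrable.
  refine exists_tendsto_of_deriv_integrable hd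
    (integrableOn_Ioi_of_abs_le_rpow (C := C * 701) (s := -(3 / 2)) (by norm_num)
      (continuousOn_const.mul ((continuousOn_id.pow 2).mul (continuousOn_avg
        (F := fun r θ => (ψ (r • eR θ) ^ 6 - 1) * partialD 2 H (r • eR θ)) hcont))) ?_)
  filter_upwards [hS.deviation_le hm, eventually_gt_atTop R] with r hdev hr
  have hr' : m / 2 ≤ r := (hR.trans hr).le
  have hr0 : 0 < r := hR0.trans hr
  have hs : 0 < √r := sqrt_pos.mpr hr0
  have ck := hS.continuous_deviation hm hr'
  have cf := continuous_slice (F := fun r θ => (ψ (r • eR θ) ^ 6 - 1) * partialD 2 H (r • eR θ))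
    hcont hr'
  have hpt : ∀ θ, |(ψ (r • eR θ) ^ 6 - 1) * partialD 2 H (r • eR θ)|
      ≤ C / r ^ 3 * (1 / 2) * (700 * √r * (ψ (r • eR θ) ^ 4 / 4 - ψ (r • eR θ) + 3 / 4)
        + 1 / √r) := by
    intro θ
    obtain ⟨-, -, q3, -⟩ := quartic_bounds (s := ψ (r • eR θ))
      (by linarith [(abs_le.mp (hψ r hr θ)).1]) (by linarith [(abs_le.mp (hψ r hr θ)).2])
    rw [abs_mul, mul_comm, mul_assoc]
    refine mul_le_mul ((hb r hr' θ).2.2 2) ?_ (abs_nonneg _) (by positivity)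
    refine (abs_le_half_sqrt hr0).trans ?_
    have := mul_le_mul_of_nonneg_right q3 hs.le
    linarith
  have h1 : |avg fun θ => (ψ (r • eR θ) ^ 6 - 1) * partialD 2 H (r • eR θ)|
      ≤ C / r ^ 3 * (1 / 2) * (700 * √r * deviation ψ r + 1 / √r) := by
    have c1 : Continuous fun θ => C / r ^ 3 * (1 / 2) * (700 * √r
        * (ψ (r • eR θ) ^ 4 / 4 - ψ (r • eR θ) + 3 / 4) + 1 / √r) :=
      continuous_const.mul ((continuous_const.mul ck).add continuous_const)
    have e : avg (fun θ => C / r ^ 3 * (1 / 2) * (700 * √r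
        * (ψ (r • eR θ) ^ 4 / 4 - ψ (r • eR θ) + 3 / 4) + 1 / √r))
        = C / r ^ 3 * (1 / 2) * (700 * √r * deviation ψ r + 1 / √r) := by
      have c2 : Continuous fun θ => 700 * √r * (ψ (r • eR θ) ^ 4 / 4 - ψ (r • eR θ) + 3 / 4) :=
        continuous_const.mul ck
      rw [avg_const_mul, avg_add c2 continuous_const, avg_const_mul, avg_const, deviation]
    rw [← e, abs_le, ← avg_neg]
    exact ⟨avg_mono c1.neg cf fun θ _ => (abs_le.mp (hpt θ)).1,
      avg_mono cf c1 fun θ _ => (abs_le.mp (hpt θ)).2⟩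
  have h2 : 700 * √r * deviation ψ r + 1 / √r ≤ 701 * (1 / √r) := by
    have : √r * deviation ψ r ≤ √r * (1 / r) := mul_le_mul_of_nonneg_left hdev hs.le
    have e : √r * (1 / r) = 1 / √r := by
      nth_rewrite 2 [← mul_self_sqrt hr0.le]
      field_simp
    rw [e] at this
    linarith
  have h3 : r ^ (-(3 / 2) : ℝ) = 1 / (r * √r) := by
    rw [rpow_neg hr0.le, show (3 / 2 : ℝ) = 1 + 1 / 2 by norm_num, rpow_add hr0, rpow_one,
      ← sqrt_eq_rpow, one_div]
  rw [abs_mul, abs_mul, abs_of_pos (by norm_num : (0 : ℝ) < 2 / 3),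
    abs_of_pos (by positivity : 0 < r ^ 2)]
  calc 2 / 3 * (r ^ 2 * _) ≤ 2 / 3 * (r ^ 2 * (C / r ^ 3 * (1 / 2) * (701 * (1 / √r)))) := by
        gcongr
        exact h1.trans (mul_le_mul_of_nonneg_left h2 (by positivity))
    _ = 1 / 3 * (C * 701 * r ^ (-(3 / 2) : ℝ)) := by
        rw [h3]
        field_simp
    _ ≤ C * 701 * r ^ (-(3 / 2) : ℝ) := by
        have : 0 ≤ C * 701 * r ^ (-(3 / 2) : ℝ) := by positivity
        linarith

/-- r²A and r²H' are bounded and ψ → 1, so dropping the powers of ψ does not change the limit. Half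
of the axis flux remains, since the mean carries 4π against the 8π of the definition. -/
theorem IsSolution.isADMMomentum (hm : 0 < m) (hS : IsSolution m ψ A H) {P : ℝ}
    (hP : Tendsto (axisFlux A H) atTop (𝓝 P)) : IsADMMomentum ψ A H ![0, 0, P / 2] := by
  have hT := hS.isAxialTT
  intro i
  fin_cases i
  · refine tendsto_const_nhds.congr' ?_
    filter_upwards [eventually_ge_atTop (m / 2)] with r hr
    rw [Fin.mk_zero, hS.momentum_integral_zero hm hr]
    simp
  · refine tendsto_const_nhds.congr' ?_
    filter_upwards [eventually_ge_atTop (m / 2)] with r hr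
    rw [Fin.mk_one, hS.momentum_integral_one hm hr]
    simp
  · obtain ⟨C, hC, hb⟩ := hS.exists_bound hm
    have hcA : ∀ r, m / 2 ≤ r → Continuous fun θ => cos θ * frRR A r θ - sin θ * frRT A r θ :=
      fun r hr => (continuous_cos.mul (continuous_slice (hT.frRR_continuousOn hm) hr)).sub
        (continuous_sin.mul (continuous_slice (hT.frRT_continuousOn hm) hr))
    have hcH : ∀ r, m / 2 ≤ r → Continuous fun θ => 2 / 3 * H (r • eR θ) * cos θ := fun r hr =>
      (continuous_const.mul (hS.smooth_H.continuous_mer hm hr)).mul continuous_cos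
    have hcψ : ∀ r, m / 2 ≤ r → Continuous fun θ => ψ (r • eR θ) := fun r hr =>
      hS.smooth_psi.continuous_mer hm hr
    have hpos : ∀ r, m / 2 ≤ r → ∀ θ, ψ (r • eR θ) ^ 2 ≠ 0 := fun r hr θ =>
      pow_ne_zero 2 (hS.psi_pos _ (smul_eR_mem hm hr θ)).ne'
    have hc1 : ∀ r, m / 2 ≤ r → Continuous fun θ =>
        (cos θ * frRR A r θ - sin θ * frRT A r θ) / ψ (r • eR θ) ^ 2
          - 2 / 3 * H (r • eR θ) * ψ (r • eR θ) ^ 4 * cos θ := fun r hr =>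
      ((hcA r hr).div ((hcψ r hr).pow 2) (hpos r hr)).sub
        (((continuous_const.mul (hS.smooth_H.continuous_mer hm hr)).mul
          ((hcψ r hr).pow 4)).mul continuous_cos)
    have hc2 : ∀ r, m / 2 ≤ r → Continuous fun θ =>
        cos θ * frRR A r θ - sin θ * frRT A r θ - 2 / 3 * H (r • eR θ) * cos θ := fun r hr =>
      (hcA r hr).sub (hcH r hr)
    have h0 : Tendsto (fun r => avg fun θ => r ^ 2 * (((cos θ * frRR A r θ - sin θ * frRT A r θ)
        / ψ (r • eR θ) ^ 2 - 2 / 3 * H (r • eR θ) * ψ (r • eR θ) ^ 4 * cos θ)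
        - (cos θ * frRR A r θ - sin θ * frRT A r θ - 2 / 3 * H (r • eR θ) * cos θ)))
        atTop (𝓝 0) := by
      refine tendsto_avg_zero (F := fun r θ => r ^ 2 * (((cos θ * frRR A r θ - sin θ * frRT A r θ)
        / ψ (r • eR θ) ^ 2 - 2 / 3 * H (r • eR θ) * ψ (r • eR θ) ^ 4 * cos θ)
        - (cos θ * frRR A r θ - sin θ * frRT A r θ - 2 / 3 * H (r • eR θ) * cos θ)))
        (a := m / 2) (fun r hr => continuous_const.mul ((hc1 r hr).sub (hc2 r hr)))
        fun δ hδ => ?_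
      have hk1 : ContinuousAt (fun s : ℝ => (s ^ 2)⁻¹) 1 := by
        exact (continuousAt_id.pow 2).inv₀ (by norm_num)
      have hk2 : ContinuousAt (fun s : ℝ => s ^ 4) 1 := by fun_prop
      obtain ⟨η₁, hη₁, h1⟩ := Metric.continuousAt_iff.mp hk1 (δ / (9 * C)) (by positivity)
      obtain ⟨η₂, hη₂, h2⟩ := Metric.continuousAt_iff.mp hk2 (δ / (9 * C)) (by positivity)
      obtain ⟨R, hR, hR0, hψ⟩ := hS.eventually_psi (δ := min η₁ η₂ / 2) (by positivity)
      filter_upwards [eventually_gt_atTop R] with r hr θ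
      have hr0 : 0 < r := hR0.trans hr
      have hclose : dist (ψ (r • eR θ)) 1 < min η₁ η₂ := by
        rw [dist_eq]
        have : 0 < min η₁ η₂ := by positivity
        linarith [hψ r hr θ]
      have e1 := h1 (hclose.trans_le (min_le_left _ _))
      have e2 := h2 (hclose.trans_le (min_le_right _ _))
      rw [dist_eq] at e1 e2
      norm_num at e1 e2
      obtain ⟨bA, bH, -⟩ := hb r (hR.trans hr).le θ
      have hbd : |cos θ * frRR A r θ - sin θ * frRT A r θ| ≤ 2 * (C / r ^ 2) := by
        have e : cos θ * frRR A r θ - sin θ * frRT A r θ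
            = sin θ * A (r • eR θ) 0 2 + cos θ * A (r • eR θ) 2 2 := by
          simp only [frRR, frRT]
          linear_combination (sin θ * A (r • eR θ) 0 2 + cos θ * A (r • eR θ) 2 2)
            * sin_sq_add_cos_sq θ
        rw [e]
        refine (abs_add_le _ _).trans ?_
        rw [abs_mul, abs_mul]
        have a1 := mul_le_mul (abs_sin_le_one θ) (bA 0 2) (abs_nonneg _) zero_le_one
        have a2 := mul_le_mul (abs_cos_le_one θ) (bA 2 2) (abs_nonneg _) zero_le_one
        linarith
      have hbh : |2 / 3 * H (r • eR θ) * cos θ| ≤ 2 / 3 * (C / r ^ 2) := by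
        rw [abs_mul, abs_mul, abs_of_pos (by norm_num : (0 : ℝ) < 2 / 3)]
        have a1 := mul_le_mul bH (abs_cos_le_one θ) (abs_nonneg _) (by positivity)
        linarith
      have e : r ^ 2 * (((cos θ * frRR A r θ - sin θ * frRT A r θ)
          / ψ (r • eR θ) ^ 2 - 2 / 3 * H (r • eR θ) * ψ (r • eR θ) ^ 4 * cos θ)
          - (cos θ * frRR A r θ - sin θ * frRT A r θ - 2 / 3 * H (r • eR θ) * cos θ))
          = r ^ 2 * ((cos θ * frRR A r θ - sin θ * frRT A r θ) * ((ψ (r • eR θ) ^ 2)⁻¹ - 1)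
            - (2 / 3 * H (r • eR θ) * cos θ) * (ψ (r • eR θ) ^ 4 - 1)) := by
        ring
      rw [e, abs_mul, abs_of_pos (by positivity : 0 < r ^ 2)]
      have f1 : |(cos θ * frRR A r θ - sin θ * frRT A r θ) * ((ψ (r • eR θ) ^ 2)⁻¹ - 1)|
          ≤ 2 * (C / r ^ 2) * (δ / (9 * C)) := by
        rw [abs_mul]
        exact mul_le_mul hbd e1.le (abs_nonneg _) (by positivity)
      have f2 : |(2 / 3 * H (r • eR θ) * cos θ) * (ψ (r • eR θ) ^ 4 - 1)|
          ≤ 2 / 3 * (C / r ^ 2) * (δ / (9 * C)) := by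
        rw [abs_mul]
        exact mul_le_mul hbh e2.le (abs_nonneg _) (by positivity)
      calc r ^ 2 * |_| ≤ r ^ 2 * (2 * (C / r ^ 2) * (δ / (9 * C))
            + 2 / 3 * (C / r ^ 2) * (δ / (9 * C))) := by
            refine mul_le_mul_of_nonneg_left ((abs_sub _ _).trans (add_le_add f1 f2)) ?_
            positivity
        _ = 8 / 27 * δ := by field_simp; norm_num
        _ ≤ δ := by linarith
    have h1 := (h0.add hP).const_mul (1 / 2)
    refine (h1.congr' ?_).trans_eq ?_
    · filter_upwards [eventually_ge_atTop (m / 2)] with r hr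
      change _ = 1 / (8 * π) * flatSphereIntegral r (fun x =>
        ∑ j, momentumTensor ψ A H x 2 j * (x j / ‖x‖))
      rw [hS.momentum_integral_two hm hr, axisFlux, avg_const_mul,
        avg_sub (hc1 r hr) (hc2 r hr)]
      ring
    · congr 1
      change 1 / 2 * (0 + P) = P / 2
      ring

/-- The flux of ∂_φ is conserved: the source ψ⁶∂H' has no φ-component by axial symmetry. It may thus
be read off on the horizon, and no limit needs estimating. -/
theorem IsSolution.isAngularMomentum (hm : 0 < m) (hS : IsSolution m ψ A H) :
    IsAngularMomentum ψ A H
      (1 / 2 * ((m / 2) ^ 3 * avg fun θ => sin θ * frRP A (m / 2) θ)) := by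
  refine tendsto_const_nhds.congr' ?_
  filter_upwards [eventually_ge_atTop (m / 2)] with r hr
  rw [hS.angularMomentum_integral hm hr]
  rw [hS.isAxialTT.rotation_flux_const hm (fun r hr θ => ?_) hr]
  rw [divT, hS.momentum _ (smul_eR_mem hm hr.le θ)]
  have := hS.smooth_H.sin_mul_partialD_one hm hS.axial_H hr.le θ
  linear_combination 2 / 3 * ψ (r • eR θ) ^ 6 * this

end Momentum

/-! ### Leading terms of the expansion -/

section Expansion

theorem tendsto_div_of_abs_sub_le {f : ℝ → ℝ} {g c : ℝ} (hc : 0 < c)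
    (h : ∀ δ > 0, ∀ᶠ ε in 𝓝[>] (0 : ℝ), c * |f ε - ε * g| ≤ δ * ε) :
    Tendsto (fun ε => f ε / ε) (𝓝[>] 0) (𝓝 g) := by
  rw [Metric.tendsto_nhds]
  intro δ hδ
  filter_upwards [h (c * (δ / 2)) (by positivity), self_mem_nhdsWithin] with ε h1 h2
  have hε : 0 < ε := h2
  have h3 : |f ε - ε * g| ≤ δ / 2 * ε := by
    rw [mul_assoc] at h1
    exact le_of_mul_le_mul_left h1 hc
  have e : f ε / ε - g = (f ε - ε * g) / ε := by field_simp
  rw [dist_eq, e, abs_div, abs_of_pos hε, div_lt_iff₀ hε]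
  nlinarith

variable {m : ℝ} {ψ : ℝ → E3 → ℝ} {A : ℝ → E3 → Tensor2} {H : ℝ → E3 → ℝ}
  {ψ₁ ψ₂ : E3 → ℝ} {B : E3 → Tensor2} {b : E3 → ℝ}

theorem norm_pos_of_mem (hm : 0 < m) {x : E3} (hx : x ∈ surface m) : 0 < ‖x‖ := by
  have : m / 2 ≤ ‖x‖ := hx
  linarith

theorem IsSolution.exists_psi_bound {ψ : E3 → ℝ} {A : E3 → Tensor2} {H : E3 → ℝ}
    (hS : IsSolution m ψ A H) : ∃ M, ∀ x ∈ surface m, |ψ x| ≤ M := by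
  have h := (Metric.tendsto_nhds.mp hS.psi_tendsto) 1 one_pos
  obtain ⟨R, -, hR⟩ := (hasBasis_cobounded_norm (E := E3)).mem_iff.mp h
  have hK : IsCompact (Metric.closedBall (0 : E3) R ∩ surface m) :=
    (isCompact_closedBall 0 R).inter_right (isClosed_le continuous_const continuous_norm)
  obtain ⟨M, hM⟩ := hK.exists_bound_of_continuousOn
    (hS.smooth_psi.continuousOn.mono Set.inter_subset_right)
  refine ⟨max M 2, fun x hx => ?_⟩
  by_cases hxR : R ≤ ‖x‖
  · have h1 := hR (show x ∈ {x : E3 | R ≤ ‖x‖} from hxR)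
    simp only [Set.mem_ofPred_eq, dist_eq] at h1
    have h2 := abs_lt.mp h1
    exact (abs_le.mpr ⟨by linarith, by linarith⟩ : |ψ x| ≤ 2).trans (le_max_right _ _)
  · refine (hM x ⟨?_, hx⟩).trans (le_max_left _ _)
    rw [mem_closedBall_zero_iff]
    linarith

theorem HasExpansion.partialD_H (hexp : HasExpansion m ψ A H ψ₁ ψ₂ B b)
    {ε : ℝ} (hS : IsSolution m (ψ ε) (A ε) (H ε)) {x : E3} (hx : x ∈ surface m) (i : Fin 3) :
    partialD i (fun y => H ε y - ε * b y) x = partialD i (H ε) x - ε * partialD i b x := by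
  rw [partialD_sub (hS.smooth_H.differentiableAt hx)
    ((hexp.smooth_b.const_mul ε).differentiableAt hx),
    partialD_mul (differentiableAt_const _) (hexp.smooth_b.differentiableAt hx), partialD_const]
  ring

theorem HasExpansion.partialD_A (hexp : HasExpansion m ψ A H ψ₁ ψ₂ B b)
    {ε : ℝ} (hS : IsSolution m (ψ ε) (A ε) (H ε)) {x : E3} (hx : x ∈ surface m) (i j k : Fin 3) :
    partialD i (fun y => A ε y j k - ε * B y j k) x
      = partialD i (fun y => A ε y j k) x - ε * partialD i (fun y => B y j k) x := by
  rw [partialD_sub ((hS.smooth_A j k).differentiableAt hx)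
    (((hexp.smooth_B j k).const_mul ε).differentiableAt hx),
    partialD_mul (differentiableAt_const _) ((hexp.smooth_B j k).differentiableAt hx),
    partialD_const]
  ring

theorem psi0_norm_mem (hm : 0 < m) {x : E3} (hx : x ∈ surface m) :
    1 ≤ psi0 m ‖x‖ ∧ psi0 m ‖x‖ ≤ 2 := ⟨one_le_psi0 hm hx, psi0_le_two hm hx⟩

/-- For each small ε the function ψ is bounded, hence so is ψ₁ + εψ₂; two distinct values of ε then
bound ψ₁ and ψ₂ separately. -/
theorem HasExpansion.exists_bound_psi (hm : 0 < m)
    (hsol : ∀ᶠ ε in 𝓝[>] (0 : ℝ), IsSolution m (ψ ε) (A ε) (H ε))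
    (hexp : HasExpansion m ψ A H ψ₁ ψ₂ B b) :
    ∃ C, 0 < C ∧ ∀ x ∈ surface m, |ψ₁ x| ≤ C ∧ |ψ₂ x| ≤ C := by
  have key : ∀ᶠ ε in 𝓝[>] (0 : ℝ), 0 < ε ∧ ∃ M, ∀ x ∈ surface m, |ψ₁ x + ε * ψ₂ x| ≤ M := by
    filter_upwards [hsol, hexp.psi_expansion 1 one_pos, self_mem_nhdsWithin] with ε hS he hε
    have hε0 : 0 < ε := hε
    obtain ⟨M, hM⟩ := hS.exists_psi_bound
    refine ⟨hε0, (M + 2 + ε ^ 2) / ε, fun x hx => ?_⟩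
    rw [le_div_iff₀ hε0, ← abs_of_pos hε0, ← abs_mul, abs_of_pos hε0]
    have h1 := abs_le.mp (hM x hx)
    have h2 := abs_le.mp (he x hx).1
    have h3 := psi0_norm_mem hm hx
    rw [abs_le]
    constructor <;> nlinarith
  obtain ⟨ε₁, hε₁, M₁, h₁⟩ := key.exists
  obtain ⟨ε₂, ⟨hε₂, M₂, h₂⟩, hlt⟩ := (key.and (Ioo_mem_nhdsGT hε₁)).exists
  have hd : 0 < ε₁ - ε₂ := by linarith [hlt.2]
  have hb2 : ∀ x ∈ surface m, |ψ₂ x| ≤ (M₁ + M₂) / (ε₁ - ε₂) := fun x hx => by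
    have a1 := abs_le.mp (h₁ x hx)
    have a2 := abs_le.mp (h₂ x hx)
    rw [le_div_iff₀ hd]
    nth_rewrite 1 [← abs_of_pos hd]
    rw [← abs_mul, abs_le]
    constructor <;> nlinarith
  refine ⟨1 + |M₁ + ε₁ * ((M₁ + M₂) / (ε₁ - ε₂))| + |(M₁ + M₂) / (ε₁ - ε₂)|, by positivity,
    fun x hx => ⟨?_, ?_⟩⟩
  · have a1 := abs_le.mp (h₁ x hx)
    have a2 := abs_le.mp (hb2 x hx)
    have a3 : |ε₁ * ψ₂ x| ≤ ε₁ * ((M₁ + M₂) / (ε₁ - ε₂)) := by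
      rw [abs_mul, abs_of_pos hε₁]
      exact mul_le_mul_of_nonneg_left (hb2 x hx) hε₁.le
    have a4 := abs_le.mp a3
    have a5 := le_abs_self (M₁ + ε₁ * ((M₁ + M₂) / (ε₁ - ε₂)))
    have a6 := abs_nonneg ((M₁ + M₂) / (ε₁ - ε₂))
    rw [abs_le]
    constructor <;> linarith
  · have := hb2 x hx
    have a5 := le_abs_self ((M₁ + M₂) / (ε₁ - ε₂))
    have a6 := abs_nonneg (M₁ + ε₁ * ((M₁ + M₂) / (ε₁ - ε₂)))
    linarith

theorem abs_le_of_weighted {u v ε δ c k : ℝ} (hε : 0 < ε) (hk : 0 < k)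
    (h1 : k * |u - ε * v| ≤ δ * ε) (h2 : |u| ≤ c / k) : |v| ≤ (c / ε + δ) / k := by
  have h3 : k * |u| ≤ c := by
    rw [le_div_iff₀ hk] at h2
    linarith
  have h4 : |ε * v| ≤ |u| + |u - ε * v| := by
    have := abs_sub u (u - ε * v)
    rwa [sub_sub_cancel] at this
  rw [abs_mul, abs_of_pos hε] at h4
  rw [le_div_iff₀ hk]
  have h5 : ε * (|v| * k) ≤ c + δ * ε := by nlinarith
  have h6 : c / ε + δ = (c + δ * ε) / ε := by field_simp
  rw [h6, le_div_iff₀ hε]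
  linarith

/-- A single ε suffices: the weighted expansion error is uniformly bounded, so B and b inherit the
decay of A(ε) and H'(ε). The constant may depend on that ε. -/
theorem HasExpansion.exists_bound (hm : 0 < m)
    (hsol : ∀ᶠ ε in 𝓝[>] (0 : ℝ), IsSolution m (ψ ε) (A ε) (H ε))
    (hexp : HasExpansion m ψ A H ψ₁ ψ₂ B b) :
    ∃ C, 0 < C ∧ ∀ x ∈ surface m, (∀ i j, |B x i j| ≤ C / ‖x‖ ^ 2) ∧ |b x| ≤ C / ‖x‖ ^ 2 ∧
      ∀ i, |partialD i b x| ≤ C / ‖x‖ ^ 3 := by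
  obtain ⟨ε, hS, hA, hH, hε⟩ := (hsol.and ((hexp.A_expansion 1 one_pos).and
    ((hexp.H_expansion 1 one_pos).and self_mem_nhdsWithin))).exists
  have hε0 : 0 < ε := hε
  choose CA hCA using hS.decay_A
  obtain ⟨CH, hCH⟩ := hS.decay_H
  have hpos : 0 ≤ ∑ i, ∑ j, |CA i j| := by positivity
  refine ⟨(|CH| + ∑ i, ∑ j, |CA i j|) / ε + 1, by positivity, fun x hx => ?_⟩
  have hx0 := norm_pos_of_mem hm hx
  have hle : CH ≤ |CH| + ∑ i, ∑ j, |CA i j| := by linarith [le_abs_self CH]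
  have hleA : ∀ i j, CA i j ≤ |CH| + ∑ i, ∑ j, |CA i j| := fun i j => by
    have h3 : |CA i j| ≤ ∑ i, ∑ j, |CA i j| :=
      (Finset.single_le_sum (f := fun j => |CA i j|) (fun _ _ => abs_nonneg _)
        (Finset.mem_univ j)).trans (Finset.single_le_sum (f := fun i => ∑ j, |CA i j|)
          (fun _ _ => Finset.sum_nonneg fun _ _ => abs_nonneg _) (Finset.mem_univ i))
    linarith [le_abs_self (CA i j), abs_nonneg CH]
  refine ⟨fun i j => abs_le_of_weighted hε0 (by positivity) (hA x hx i j).1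
    ((hCA i j x hx).1.trans (by have := hleA i j; gcongr)),
    abs_le_of_weighted hε0 (by positivity) (hH x hx).1 ((hCH x hx).1.trans (by gcongr)),
    fun i => ?_⟩
  refine abs_le_of_weighted hε0 (by positivity) (u := partialD i (H ε) x) ?_
    ((abs_partialD_le i _ x).trans ((hCH x hx).2.trans (by gcongr)))
  rw [← hexp.partialD_H hS hx]
  exact (mul_le_mul_of_nonneg_left (abs_partialD_le i _ x) (by positivity)).trans (hH x hx).2

/-- Uniform bounds for the data. -/
theorem HasExpansion.eventually_bound (hm : 0 < m)
    (hsol : ∀ᶠ ε in 𝓝[>] (0 : ℝ), IsSolution m (ψ ε) (A ε) (H ε))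
    (hexp : HasExpansion m ψ A H ψ₁ ψ₂ B b) :
    ∃ K, 0 < K ∧ ∀ᶠ ε in 𝓝[>] (0 : ℝ), ∀ x ∈ surface m,
      |ψ ε x - psi0 m ‖x‖| ≤ K * ε ∧ (1 / 2 ≤ ψ ε x ∧ ψ ε x ≤ 3) ∧
      (∀ i j, |A ε x i j| ≤ K * ε / ‖x‖ ^ 2) ∧ |H ε x| ≤ K * ε / ‖x‖ ^ 2 := by
  obtain ⟨C, hC, hb⟩ := hexp.exists_bound_psi hm hsol
  obtain ⟨D, hD, hB⟩ := hexp.exists_bound hm hsol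
  refine ⟨2 * C + 1 + D, by positivity, ?_⟩
  have hsmall : ∀ᶠ ε in 𝓝[>] (0 : ℝ), ε < min 1 (1 / (2 * (2 * C + 1))) :=
    eventually_nhdsWithin_of_eventually_nhds (eventually_lt_nhds (by positivity))
  filter_upwards [hexp.psi_expansion 1 one_pos, hexp.A_expansion 1 one_pos,
    hexp.H_expansion 1 one_pos, self_mem_nhdsWithin, hsmall] with ε hψ hA hH hε hlt x hx
  have hε0 : 0 < ε := hε
  have hε1 : ε < 1 := hlt.trans_le (min_le_left _ _)
  have hε2 : (2 * C + 1) * ε ≤ 1 / 2 := by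
    have := hlt.trans_le (min_le_right _ _)
    rw [lt_div_iff₀ (by positivity)] at this
    linarith
  have hx0 := norm_pos_of_mem hm hx
  have hsq : ε ^ 2 ≤ ε := by nlinarith
  have h1 : |ψ ε x - psi0 m ‖x‖| ≤ (2 * C + 1) * ε := by
    have a1 := abs_le.mp (hψ x hx).1
    have a2 := abs_le.mp (hb x hx).1
    have a3 := abs_le.mp (hb x hx).2
    have a4 : |ε * ψ₁ x| ≤ ε * C := by
      rw [abs_mul, abs_of_pos hε0]
      exact mul_le_mul_of_nonneg_left (hb x hx).1 hε0.le
    have a5 : |ε ^ 2 * ψ₂ x| ≤ ε * C := by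
      rw [abs_mul, abs_of_nonneg (sq_nonneg ε)]
      exact mul_le_mul hsq (hb x hx).2 (abs_nonneg _) hε0.le
    have a6 := abs_le.mp a4
    have a7 := abs_le.mp a5
    rw [abs_le]
    constructor <;> linarith
  have h2 := abs_le.mp h1
  have h3 := psi0_norm_mem hm hx
  have hgen : ∀ u v : ℝ, ‖x‖ ^ 2 * |u - ε * v| ≤ 1 * ε → |v| ≤ D / ‖x‖ ^ 2 →
      |u| ≤ (2 * C + 1 + D) * ε / ‖x‖ ^ 2 := by
    intro u v huv hv
    have hx2 : 0 < ‖x‖ ^ 2 := by positivity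
    rw [le_div_iff₀ hx2] at hv ⊢
    have a1 : |u| ≤ |u - ε * v| + ε * |v| := by
      have := abs_add_le (u - ε * v) (ε * v)
      rwa [sub_add_cancel, abs_mul ε, abs_of_pos hε0] at this
    have a2 : |u| * ‖x‖ ^ 2 ≤ (|u - ε * v| + ε * |v|) * ‖x‖ ^ 2 :=
      mul_le_mul_of_nonneg_right a1 hx2.le
    have a3 : ε * (|v| * ‖x‖ ^ 2) ≤ ε * D := mul_le_mul_of_nonneg_left hv hε0.le
    have a4 : 0 ≤ C * ε := by positivity
    linarith
  exact ⟨h1.trans (by nlinarith), ⟨by linarith, by linarith⟩,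
    fun i j => hgen _ _ (hA x hx i j).1 ((hB x hx).1 i j), hgen _ _ (hH x hx).1 (hB x hx).2.1⟩

theorem HasExpansion.tendsto_psi_div (hexp : HasExpansion m ψ A H ψ₁ ψ₂ B b) {x : E3}
    (hx : x ∈ surface m) :
    Tendsto (fun ε => (ψ ε x - psi0 m ‖x‖) / ε) (𝓝[>] 0) (𝓝 (ψ₁ x)) := by
  refine tendsto_div_of_abs_sub_le one_pos fun δ hδ => ?_
  have hsmall : ∀ᶠ ε in 𝓝[>] (0 : ℝ), ε < δ / (1 + |ψ₂ x|) :=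
    eventually_nhdsWithin_of_eventually_nhds (eventually_lt_nhds (by positivity))
  filter_upwards [hexp.psi_expansion 1 one_pos, self_mem_nhdsWithin, hsmall] with ε h1 h2 h3
  have hε0 : 0 < ε := h2
  rw [lt_div_iff₀ (by positivity)] at h3
  have a1 := (h1 x hx).1
  have a2 := abs_add_le (ψ ε x - psi0 m ‖x‖ - ε * ψ₁ x - ε ^ 2 * ψ₂ x) (ε ^ 2 * ψ₂ x)
  rw [sub_add_cancel, abs_mul (ε ^ 2), abs_of_nonneg (sq_nonneg ε)] at a2
  nlinarith

theorem HasExpansion.tendsto_psi (hexp : HasExpansion m ψ A H ψ₁ ψ₂ B b) {x : E3}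
    (hx : x ∈ surface m) : Tendsto (fun ε => ψ ε x) (𝓝[>] 0) (𝓝 (psi0 m ‖x‖)) := by
  have h0 : Tendsto (fun ε : ℝ => ε) (𝓝[>] 0) (𝓝 0) := tendsto_id.mono_left nhdsWithin_le_nhds
  have h := ((hexp.tendsto_psi_div hx).mul h0).add_const (psi0 m ‖x‖)
  rw [mul_zero, zero_add] at h
  refine h.congr' ?_
  filter_upwards [self_mem_nhdsWithin] with ε hε
  have hε0 : 0 < ε := hε
  field_simp
  ring

theorem HasExpansion.tendsto_A_div (hm : 0 < m) (hexp : HasExpansion m ψ A H ψ₁ ψ₂ B b) {x : E3}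
    (hx : x ∈ surface m) (i j : Fin 3) :
    Tendsto (fun ε => A ε x i j / ε) (𝓝[>] 0) (𝓝 (B x i j)) :=
  tendsto_div_of_abs_sub_le (pow_pos (norm_pos_of_mem hm hx) 2) fun δ hδ =>
    (hexp.A_expansion δ hδ).mono fun _ h => (h x hx i j).1

theorem HasExpansion.tendsto_H_div (hm : 0 < m) (hexp : HasExpansion m ψ A H ψ₁ ψ₂ B b) {x : E3}
    (hx : x ∈ surface m) : Tendsto (fun ε => H ε x / ε) (𝓝[>] 0) (𝓝 (b x)) :=
  tendsto_div_of_abs_sub_le (pow_pos (norm_pos_of_mem hm hx) 2) fun δ hδ =>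
    (hexp.H_expansion δ hδ).mono fun _ h => (h x hx).1

theorem HasExpansion.tendsto_partialD_A_div (hm : 0 < m)
    (hsol : ∀ᶠ ε in 𝓝[>] (0 : ℝ), IsSolution m (ψ ε) (A ε) (H ε))
    (hexp : HasExpansion m ψ A H ψ₁ ψ₂ B b) {x : E3} (hx : x ∈ surface m) (i j k : Fin 3) :
    Tendsto (fun ε => partialD i (fun y => A ε y j k) x / ε) (𝓝[>] 0)
      (𝓝 (partialD i (fun y => B y j k) x)) := by
  have hx0 := norm_pos_of_mem hm hx
  refine tendsto_div_of_abs_sub_le (pow_pos hx0 3) fun δ hδ => ?_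
  filter_upwards [hsol, hexp.A_expansion δ hδ] with ε hS h
  rw [← hexp.partialD_A hS hx]
  exact (mul_le_mul_of_nonneg_left (abs_partialD_le i _ x) (by positivity)).trans (h x hx j k).2

theorem HasExpansion.tendsto_partialD_H_div (hm : 0 < m)
    (hsol : ∀ᶠ ε in 𝓝[>] (0 : ℝ), IsSolution m (ψ ε) (A ε) (H ε))
    (hexp : HasExpansion m ψ A H ψ₁ ψ₂ B b) {x : E3} (hx : x ∈ surface m) (i : Fin 3) :
    Tendsto (fun ε => partialD i (H ε) x / ε) (𝓝[>] 0) (𝓝 (partialD i b x)) := by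
  have hx0 := norm_pos_of_mem hm hx
  refine tendsto_div_of_abs_sub_le (pow_pos hx0 3) fun δ hδ => ?_
  filter_upwards [hsol, hexp.H_expansion δ hδ] with ε hS h
  rw [← hexp.partialD_H hS hx]
  exact (mul_le_mul_of_nonneg_left (abs_partialD_le i _ x) (by positivity)).trans (h x hx).2

theorem HasExpansion.tendsto_smul_A (hm : 0 < m) (hexp : HasExpansion m ψ A H ψ₁ ψ₂ B b) {x : E3}
    (hx : x ∈ surface m) : Tendsto (fun ε => ε⁻¹ • A ε x) (𝓝[>] 0) (𝓝 (B x)) := by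
  refine tendsto_pi_nhds.mpr fun i => tendsto_pi_nhds.mpr fun j => ?_
  refine (hexp.tendsto_A_div hm hx i j).congr fun ε => ?_
  rw [Matrix.smul_apply, smul_eq_mul, div_eq_inv_mul]

/-- The leading terms satisfy the linearized constraints. -/
theorem HasExpansion.exists_isDecayingData (hm : 0 < m)
    (hsol : ∀ᶠ ε in 𝓝[>] (0 : ℝ), IsSolution m (ψ ε) (A ε) (H ε))
    (hexp : HasExpansion m ψ A H ψ₁ ψ₂ B b) : ∃ C, IsDecayingData m C B b := by
  obtain ⟨C, -, hb⟩ := hexp.exists_bound hm hsol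
  refine ⟨C, ?_⟩
  refine
    { smooth := hexp.smooth_B
      symm := fun x hx => ?_
      traceless := fun x hx => ?_
      axial := fun α x hx => ?_
      smooth_b := hexp.smooth_b
      axial_b := fun α x hx => ?_
      momentum := fun x hx j => ?_
      decay_B := fun x hx => (hb x hx).1
      decay_b := fun x hx => (hb x hx).2.1 }
  · have h1 := hexp.tendsto_smul_A hm hx
    have h2 := ((continuous_id.matrix_transpose (R := ℝ) (m := Fin 3) (n := Fin 3)).tendsto
      (B x)).comp h1
    refine tendsto_nhds_unique h2 (h1.congr' ?_)
    filter_upwards [hsol] with ε hS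
    have := hS.symm x hx
    simp only [Function.comp_apply, id_eq, Matrix.transpose_smul]
    rw [this]
  · have h1 := hexp.tendsto_smul_A hm hx
    have h2 := ((continuous_id.matrix_trace (R := ℝ) (n := Fin 3)).tendsto (B x)).comp h1
    refine tendsto_nhds_unique h2 (tendsto_const_nhds.congr' ?_)
    filter_upwards [hsol] with ε hS
    simp only [Function.comp_apply, id_eq, Matrix.trace_smul, hS.traceless x hx, smul_zero]
  · have h1 := hexp.tendsto_smul_A hm hx
    have h2 := (((continuous_const (y := rotMatrix α)).matrix_mul continuous_id).matrix_mul
      (continuous_const (y := (rotMatrix α)ᵀ))).tendsto (B x)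
    have h3 := hexp.tendsto_smul_A hm (rot_mem_surface hx α)
    refine tendsto_nhds_unique h3 ((h2.comp h1).congr' ?_)
    filter_upwards [hsol] with ε hS
    simp only [Function.comp_apply, id_eq, hS.axial_A α x hx, Matrix.mul_smul, Matrix.smul_mul]
  · refine tendsto_nhds_unique (hexp.tendsto_H_div hm (rot_mem_surface hx α))
      ((hexp.tendsto_H_div hm hx).congr' ?_)
    filter_upwards [hsol] with ε hS
    rw [hS.axial_H α x hx]
  · have h1 : Tendsto (fun ε => ∑ i, partialD i (fun y => A ε y i j) x / ε) (𝓝[>] 0)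
        (𝓝 (divT B j x)) :=
      tendsto_finsetSum _ fun i _ => hexp.tendsto_partialD_A_div hm hsol hx i i j
    have h2 := (((hexp.tendsto_psi hx).pow 6).const_mul (2 / 3)).mul
      (hexp.tendsto_partialD_H_div hm hsol hx j)
    refine tendsto_nhds_unique h1 (h2.congr' ?_)
    filter_upwards [hsol] with ε hS
    rw [← Finset.sum_div, hS.momentum x hx j, mul_div_assoc]

end Expansion

/-! ### Limits of the global quantities -/

section Limits

theorem tendsto_avg_of_bound {F : ℝ → ℝ → ℝ} {G : ℝ → ℝ} {l : Filter ℝ} [l.IsCountablyGenerated]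
    {M : ℝ} (hc : ∀ᶠ ε in l, Continuous (F ε)) (hb : ∀ᶠ ε in l, ∀ θ, |F ε θ| ≤ M)
    (hl : ∀ θ, Tendsto (fun ε => F ε θ) l (𝓝 (G θ))) :
    Tendsto (fun ε => avg (F ε)) l (𝓝 (avg G)) := by
  refine Tendsto.const_mul _ (intervalIntegral.tendsto_integral_filter_of_dominated_convergence
    (fun _ => M) ?_ ?_ intervalIntegrable_const ?_)
  · filter_upwards [hc] with ε h
    exact (h.mul continuous_sin).aestronglyMeasurable
  · filter_upwards [hb] with ε h
    refine Eventually.of_forall fun θ _ => ?_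
    rw [norm_mul, norm_eq_abs, norm_eq_abs]
    calc |F ε θ| * |sin θ| ≤ |F ε θ| * 1 :=
          mul_le_mul_of_nonneg_left (abs_sin_le_one θ) (abs_nonneg _)
      _ ≤ M := by rw [mul_one]; exact h θ
  · exact Eventually.of_forall fun θ _ => (hl θ).mul_const _

variable {m : ℝ} {ψ : ℝ → E3 → ℝ} {A : ℝ → E3 → Tensor2} {H : ℝ → E3 → ℝ}
  {ψ₁ ψ₂ : E3 → ℝ} {B : E3 → Tensor2} {b : E3 → ℝ} {C : ℝ}

theorem HasExpansion.tendsto_frRR_div (hm : 0 < m) (hexp : HasExpansion m ψ A H ψ₁ ψ₂ B b) {r : ℝ}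
    (hr : m / 2 ≤ r) (θ : ℝ) :
    Tendsto (fun ε => frRR (A ε) r θ / ε) (𝓝[>] 0) (𝓝 (frRR B r θ)) := by
  have h := fun i j => hexp.tendsto_A_div hm (smul_eR_mem hm hr θ) i j
  refine ((((h 0 0).const_mul (sin θ ^ 2)).add ((h 0 2).const_mul (2 * sin θ * cos θ))).add
    ((h 2 2).const_mul (cos θ ^ 2))).congr fun ε => ?_
  rw [frRR]
  ring

theorem HasExpansion.tendsto_frRP_div (hm : 0 < m) (hexp : HasExpansion m ψ A H ψ₁ ψ₂ B b) {r : ℝ}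
    (hr : m / 2 ≤ r) (θ : ℝ) :
    Tendsto (fun ε => frRP (A ε) r θ / ε) (𝓝[>] 0) (𝓝 (frRP B r θ)) := by
  have h := fun i j => hexp.tendsto_A_div hm (smul_eR_mem hm hr θ) i j
  refine (((h 0 1).const_mul (sin θ)).add ((h 1 2).const_mul (cos θ))).congr fun ε => ?_
  rw [frRP]
  ring

theorem HasExpansion.tendsto_angularMomentum (hm : 0 < m)
    (hsol : ∀ᶠ ε in 𝓝[>] (0 : ℝ), IsSolution m (ψ ε) (A ε) (H ε))
    (hexp : HasExpansion m ψ A H ψ₁ ψ₂ B b) :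
    Tendsto (fun ε => 1 / 2 * ((m / 2) ^ 3 * avg fun θ => sin θ * frRP (A ε) (m / 2) θ) / ε)
      (𝓝[>] 0) (𝓝 (1 / 2 * ((m / 2) ^ 3 * avg fun θ => sin θ * frRP B (m / 2) θ))) := by
  obtain ⟨K, hK, hbd⟩ := hexp.eventually_bound hm hsol
  have h : Tendsto (fun ε => avg fun θ => sin θ * (frRP (A ε) (m / 2) θ / ε)) (𝓝[>] 0)
      (𝓝 (avg fun θ => sin θ * frRP B (m / 2) θ)) := by
    refine tendsto_avg_of_bound (M := 2 * (K / (m / 2) ^ 2)) ?_ ?_ fun θ =>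
      (hexp.tendsto_frRP_div hm le_rfl θ).const_mul _
    · filter_upwards [hsol] with ε hS
      exact continuous_sin.mul
        ((continuous_slice (hS.isAxialTT.frRP_continuousOn hm) le_rfl).div_const ε)
    · filter_upwards [hbd, self_mem_nhdsWithin] with ε hε hpos θ
      have hε0 : 0 < ε := hpos
      have hmem := smul_eR_mem hm le_rfl θ
      have h1 := (hε _ hmem).2.2.1
      rw [norm_smul_eR (by positivity)] at h1
      have h2 : |frRP (A ε) (m / 2) θ| ≤ 2 * (K * ε / (m / 2) ^ 2) := by
        rw [frRP]
        refine (abs_add_le _ _).trans ?_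
        rw [abs_mul, abs_mul]
        have a1 := mul_le_mul (abs_sin_le_one θ) (h1 0 1) (abs_nonneg _) zero_le_one
        have a2 := mul_le_mul (abs_cos_le_one θ) (h1 1 2) (abs_nonneg _) zero_le_one
        linarith
      rw [abs_mul, abs_div, abs_of_pos hε0]
      have h3 : |frRP (A ε) (m / 2) θ| / ε ≤ 2 * (K / (m / 2) ^ 2) := by
        rw [div_le_iff₀ hε0]
        exact h2.trans_eq (by ring)
      exact (mul_le_mul (abs_sin_le_one θ) h3 (by positivity) zero_le_one).trans_eq (one_mul _)
  refine (h.const_mul (1 / 2 * (m / 2) ^ 3)).congr' ?_ |>.trans_eq (by congr 1; ring)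
  refine Eventually.of_forall fun ε => ?_
  have e : ∀ θ, sin θ * (frRP (A ε) (m / 2) θ / ε) = sin θ * frRP (A ε) (m / 2) θ / ε :=
    fun θ => by ring
  change 1 / 2 * (m / 2) ^ 3 * avg (fun θ => sin θ * (frRP (A ε) (m / 2) θ / ε)) = _
  rw [funext e, avg_div_const]
  ring

theorem IsLinearData.rotation_flux_const (hm : 0 < m) (hB : IsLinearData m B b) {r : ℝ}
    (hr : m / 2 ≤ r) : r ^ 3 * avg (fun θ => sin θ * frRP B r θ)
      = 2 * (1 / 2 * ((m / 2) ^ 3 * avg fun θ => sin θ * frRP B (m / 2) θ)) := by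
  rw [hB.toIsAxialTT.rotation_flux_const hm (fun r hr θ => ?_) hr]
  · ring
  · rw [hB.momentum _ (smul_eR_mem hm hr.le θ)]
    have := hB.smooth_b.sin_mul_partialD_one hm hB.axial_b hr.le θ
    linear_combination 2 / 3 * psi0 m ‖r • eR θ‖ ^ 6 * this

/-- Factor out ψ₀ - 1 = m/(2r); the cofactor is at most 1 + 2 + ... + 2⁵ = 63. -/
theorem psi0_pow_six_sub_one_le (hm : 0 < m) {r : ℝ} (hr : m / 2 ≤ r) :
    |psi0 m r ^ 6 - 1| ≤ 63 * (m / (2 * r)) := by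
  have hr0 : 0 < r := by linarith
  have h1 := one_le_psi0 hm hr
  have h2 := psi0_le_two hm hr
  have e : m / (2 * r) = psi0 m r - 1 := by rw [psi0]; ring
  rw [e]
  set p := psi0 m r
  have e2 : p ^ 6 - 1 = (p - 1) * (p ^ 5 + p ^ 4 + p ^ 3 + p ^ 2 + p + 1) := by ring
  have hp : ∀ k : ℕ, p ^ k ≤ 2 ^ k := fun k => pow_le_pow_left₀ (by linarith) h2 k
  have a2 := hp 2; have a3 := hp 3; have a4 := hp 4; have a5 := hp 5
  have h3 : 0 ≤ p ^ 5 + p ^ 4 + p ^ 3 + p ^ 2 + p + 1 := by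
    have : 0 ≤ p := by linarith
    positivity
  rw [e2, abs_of_nonneg (mul_nonneg (by linarith) h3), mul_comm]
  exact mul_le_mul_of_nonneg_right (by linarith) (by linarith)

theorem IsDecayingData.exists_tendsto_axisFlux (hm : 0 < m) (hB : IsDecayingData m C B b)
    (hb : ∃ D, ∀ x ∈ surface m, |partialD 2 b x| ≤ D / ‖x‖ ^ 3) :
    ∃ P, Tendsto (axisFlux B b) atTop (𝓝 P) := by
  obtain ⟨D, hD⟩ := hb
  have hcont : ContinuousOn (fun p : ℝ × ℝ => (psi0 m p.1 ^ 6 - 1)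
      * partialD 2 b (p.1 • eR p.2)) (Set.Ici (m / 2) ×ˢ Set.univ) :=
    (((continuousOn_psi0_fst hm).pow 6).sub continuousOn_const).mul
      ((hB.smooth_b.partialD 2).continuousOn_mer hm)
  have hd : ∀ r, m / 2 < r → HasDerivAt (axisFlux B b) (2 / 3 * (r ^ 2 * avg fun θ =>
      (psi0 m r ^ 6 - 1) * partialD 2 b (r • eR θ))) r := by
    intro r hr
    refine (hB.toIsAxialTT.hasDerivAt_axisFlux hm hB.smooth_b hr).congr_deriv ?_
    rw [mul_left_comm, ← avg_const_mul (2 / 3)]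
    congr 2
    funext θ
    rw [hB.momentum _ (smul_eR_mem hm hr.le θ) 2, norm_smul_eR (by linarith)]
    ring
  refine exists_tendsto_of_deriv_integrable hd (Decays.integrableOn (Decays.const_mul _
    (Decays.of_succ_pow (k := 2) 2 (decays_avg (D := 63 * (m / 2) * D)
      (F := fun r θ => (psi0 m r ^ 6 - 1) * partialD 2 b (r • eR θ)) hcont fun r hr θ => ?_)))
    (continuousOn_const.mul ((continuousOn_id.pow 2).mul (continuousOn_avg
      (F := fun r θ => (psi0 m r ^ 6 - 1) * partialD 2 b (r • eR θ)) hcont))))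
  have hr0 : 0 < r := by linarith
  have h1 := hD _ (smul_eR_mem hm hr θ)
  rw [norm_smul_eR hr0.le] at h1
  rw [abs_mul]
  refine (mul_le_mul (psi0_pow_six_sub_one_le hm hr) h1 (abs_nonneg _) (by positivity)).trans_eq ?_
  field_simp
  ring

/-- P₁ is the identity polynomial, so the axis flux is the dipole combination except that it carries
b in place of ψ₀⁶b; the difference decays like 1/r. -/
theorem IsDecayingData.tendsto_mom (hm : 0 < m) (hB : IsDecayingData m C B b) {P : ℝ}
    (hP : Tendsto (axisFlux B b) atTop (𝓝 P)) :
    Tendsto (fun r => 1 / 2 * (r ^ 2 * (momT m B b 1 r - momRT B 1 r))) atTop (𝓝 (P / 2)) := by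
  have h1 : Tendsto (fun r => (1 - psi0 m r ^ 6) * (r ^ 2 * momH b 1 r)) atTop (𝓝 0) := by
    have hd : Decays 0 fun r => r ^ 2 * momH b 1 r := (hB.decays_momH hm 1).of_succ_pow (k := 0) 2
    have hk : Decays 1 fun r => 1 - psi0 m r ^ 6 := by
      refine decays_of_bound (a := m / 2) (C := 63 * (m / 2)) fun r hr => ?_
      rw [abs_sub_comm]
      refine (psi0_pow_six_sub_one_le hm hr).trans_eq ?_
      have hr0 : 0 < r := by linarith
      field_simp
    exact (hk.mul hd).tendsto_zero (by norm_num)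
  have h2 := (hP.add (h1.const_mul (2 / 3))).const_mul (1 / 2)
  refine (h2.congr' ?_).trans_eq (by congr 1; ring)
  filter_upwards [eventually_ge_atTop (m / 2)] with r hr
  have hP1 : legendrePoly 1 = Polynomial.X := by
    simp [legendrePoly]
    rw [← mul_assoc, one_add_one_eq_two, ← map_ofNat Polynomial.C 2, ← Polynomial.C_mul]
    norm_num
  have cRR := continuous_slice (hB.frRR_continuousOn hm) hr
  have cRT := continuous_slice (hB.frRT_continuousOn hm) hr
  have cb := hB.smooth_b.continuous_mer hm hr
  have c1 : Continuous fun θ => cos θ * frRR B r θ := continuous_cos.mul cRR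
  have c2 : Continuous fun θ => sin θ * frRT B r θ := continuous_sin.mul cRT
  have c3 : Continuous fun θ => 2 / 3 * (b (r • eR θ) * cos θ) :=
    continuous_const.mul (cb.mul continuous_cos)
  have c12 : Continuous fun θ => cos θ * frRR B r θ - sin θ * frRT B r θ := c1.sub c2
  have e : axisFlux B b r = r ^ 2 * (avg (fun θ => frRR B r θ * cos θ)
      - avg (fun θ => frRT B r θ * sin θ) - 2 / 3 * avg fun θ => b (r • eR θ) * cos θ) := by
    rw [axisFlux, ← avg_const_mul (2 / 3), funext fun θ => mul_comm (frRR B r θ) (cos θ),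
      funext fun θ => mul_comm (frRT B r θ) (sin θ), ← avg_sub c1 c2, ← avg_sub c12 c3]
    congr 2
    funext θ
    ring
  rw [e, momT, momRR, momH, momRT, legMoment, legMoment, hP1]
  simp only [Polynomial.eval_X, Polynomial.derivative_X, Polynomial.eval_one, mul_one]
  ring

/-- The r² weight makes the flux error at most δε uniformly in r, so the bound passes to the limit r
→ ∞ before ε → 0. -/
theorem HasExpansion.tendsto_momentum (hm : 0 < m)
    (hsol : ∀ᶠ ε in 𝓝[>] (0 : ℝ), IsSolution m (ψ ε) (A ε) (H ε))
    (hexp : HasExpansion m ψ A H ψ₁ ψ₂ B b) (hB : IsAxialTT m B) {P : ℝ → ℝ} {P₁ : ℝ}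
    (hP : ∀ᶠ ε in 𝓝[>] (0 : ℝ), Tendsto (axisFlux (A ε) (H ε)) atTop (𝓝 (P ε)))
    (hP₁ : Tendsto (axisFlux B b) atTop (𝓝 P₁)) :
    Tendsto (fun ε => P ε / ε) (𝓝[>] 0) (𝓝 P₁) := by
  refine tendsto_div_of_abs_sub_le one_pos fun δ hδ => ?_
  filter_upwards [hsol, hP, hexp.A_expansion (δ / 3) (by positivity),
    hexp.H_expansion (δ / 3) (by positivity)] with ε hS h hA hH
  rw [one_mul]
  refine le_of_tendsto (h.sub (hP₁.const_mul ε)).abs ?_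
  filter_upwards [eventually_ge_atTop (m / 2)] with r hr
  have hr0 : 0 < r := by linarith
  have c1 := continuous_slice (F := fun r θ => cos θ * frRR (A ε) r θ - sin θ * frRT (A ε) r θ
    - 2 / 3 * H ε (r • eR θ) * cos θ)
    (hS.isAxialTT.continuousOn_axisFlux_integrand hm hS.smooth_H) hr
  have c2 := continuous_slice (F := fun r θ => cos θ * frRR B r θ - sin θ * frRT B r θ
    - 2 / 3 * b (r • eR θ) * cos θ)
    (hB.continuousOn_axisFlux_integrand hm hexp.smooth_b) hr
  have c3 : Continuous fun θ => ε * (cos θ * frRR B r θ - sin θ * frRT B r θ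
    - 2 / 3 * b (r • eR θ) * cos θ) := continuous_const.mul c2
  have e : axisFlux (A ε) (H ε) r - ε * axisFlux B b r = avg fun θ => r ^ 2
      * (cos θ * frRR (A ε) r θ - sin θ * frRT (A ε) r θ - 2 / 3 * H ε (r • eR θ) * cos θ
        - ε * (cos θ * frRR B r θ - sin θ * frRT B r θ - 2 / 3 * b (r • eR θ) * cos θ)) := by
    rw [avg_const_mul, avg_sub c1 c3, avg_const_mul ε, axisFlux, axisFlux]
    ring
  rw [e]
  refine abs_avg_le (continuous_const.mul (c1.sub c3)) fun θ _ => ?_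
  have hmem := smul_eR_mem hm hr θ
  have hA' := fun i j => (hA _ hmem i j).1
  have hH' := (hH _ hmem).1
  rw [norm_smul_eR hr0.le] at hA' hH'
  have e2 : r ^ 2 * (cos θ * frRR (A ε) r θ - sin θ * frRT (A ε) r θ
        - 2 / 3 * H ε (r • eR θ) * cos θ
        - ε * (cos θ * frRR B r θ - sin θ * frRT B r θ - 2 / 3 * b (r • eR θ) * cos θ))
      = sin θ * (r ^ 2 * (A ε (r • eR θ) 0 2 - ε * B (r • eR θ) 0 2))
        + cos θ * (r ^ 2 * (A ε (r • eR θ) 2 2 - ε * B (r • eR θ) 2 2))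
        - 2 / 3 * (cos θ * (r ^ 2 * (H ε (r • eR θ) - ε * b (r • eR θ)))) := by
    simp only [frRR, frRT]
    linear_combination r ^ 2 * (sin θ * (A ε (r • eR θ) 0 2 - ε * B (r • eR θ) 0 2)
      + cos θ * (A ε (r • eR θ) 2 2 - ε * B (r • eR θ) 2 2)) * sin_sq_add_cos_sq θ
  have hk : ∀ s u : ℝ, |s| ≤ 1 → r ^ 2 * |u| ≤ δ / 3 * ε → |s * (r ^ 2 * u)| ≤ δ / 3 * ε := by
    intro s u hs hu
    rw [abs_mul, abs_mul, abs_of_nonneg (sq_nonneg r)]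
    exact (mul_le_mul hs hu (by positivity) zero_le_one).trans_eq (one_mul _)
  have a1 := abs_le.mp (hk _ _ (abs_sin_le_one θ) (hA' 0 2))
  have a2 := abs_le.mp (hk _ _ (abs_cos_le_one θ) (hA' 2 2))
  have a3 := abs_le.mp (hk _ _ (abs_cos_le_one θ) hH')
  rw [e2, abs_le]
  constructor <;> linarith

/-- A bound for the Laplacian of the conformal factor. -/
theorem IsSolution.abs_laplacian_le {ψ : E3 → ℝ} {A : E3 → Tensor2} {H : E3 → ℝ} {κ : ℝ}
    (hm : 0 < m) (hS : IsSolution m ψ A H)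
    (hb : ∀ x ∈ surface m, (1 / 2 ≤ ψ x ∧ ψ x ≤ 3) ∧ (∀ i j, |A x i j| ≤ κ / ‖x‖ ^ 2) ∧
      |H x| ≤ κ / ‖x‖ ^ 2) {r : ℝ} (hr : m / 2 ≤ r) (θ : ℝ) :
    |∑ i, partialD i (partialD i ψ) (r • eR θ)| ≤ 165 * κ ^ 2 / r ^ 4 := by
  have hr0 : 0 < r := by linarith
  obtain ⟨⟨hp, hp2⟩, bA, bH⟩ := hb _ (smul_eR_mem hm hr θ)
  rw [norm_smul_eR hr0.le] at bA bH
  rw [hS.laplacian_apply hm hr]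
  set p := ψ (r • eR θ)
  have hp0 : 0 < p := by linarith
  have hsum : ∑ i, ∑ j, A (r • eR θ) i j ^ 2 ≤ 9 * (κ ^ 2 / r ^ 4) := by
    have : ∀ i j, A (r • eR θ) i j ^ 2 ≤ κ ^ 2 / r ^ 4 := fun i j => sq_le_of_abs_le_div (bA i j)
    simp only [Fin.sum_univ_three]
    linarith [this 0 0, this 0 1, this 0 2, this 1 0, this 1 1, this 1 2, this 2 0, this 2 1,
      this 2 2]
  have hsum0 : 0 ≤ ∑ i, ∑ j, A (r • eR θ) i j ^ 2 :=
    Finset.sum_nonneg fun i _ => Finset.sum_nonneg fun j _ => sq_nonneg _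
  have h7 : (1 / 2 : ℝ) ^ 7 ≤ p ^ 7 := pow_le_pow_left₀ (by norm_num) hp 7
  have h5 : p ^ 5 ≤ (3 : ℝ) ^ 5 := pow_le_pow_left₀ hp0.le hp2 5
  have e1 : (∑ i, ∑ j, A (r • eR θ) i j ^ 2) / p ^ 7 ≤ 9 * (κ ^ 2 / r ^ 4) / (1 / 2) ^ 7 :=
    div_le_div₀ (by positivity) hsum (by norm_num) h7
  have e2 : H (r • eR θ) ^ 2 * p ^ 5 ≤ κ ^ 2 / r ^ 4 * 3 ^ 5 :=
    mul_le_mul (sq_le_of_abs_le_div bH) h5 (by positivity) (by positivity)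
  have e3 : 0 ≤ (∑ i, ∑ j, A (r • eR θ) i j ^ 2) / p ^ 7 := by positivity
  have e4 : 0 ≤ H (r • eR θ) ^ 2 * p ^ 5 := by positivity
  have e5 : 0 ≤ κ ^ 2 / r ^ 4 := by positivity
  rw [mul_div_assoc, mul_assoc, mul_div_assoc, abs_le]
  norm_num at e1 e2
  constructor <;> linarith

theorem HasExpansion.eventually_laplacian_le (hm : 0 < m)
    (hsol : ∀ᶠ ε in 𝓝[>] (0 : ℝ), IsSolution m (ψ ε) (A ε) (H ε))
    (hexp : HasExpansion m ψ A H ψ₁ ψ₂ B b) : ∃ L, 0 < L ∧ ∀ᶠ ε in 𝓝[>] (0 : ℝ),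
      ∀ r, m / 2 ≤ r → ∀ θ,
        |∑ i, partialD i (partialD i (ψ ε)) (r • eR θ)| ≤ L * ε ^ 2 / r ^ 4 := by
  obtain ⟨K, hK, hbd⟩ := hexp.eventually_bound hm hsol
  refine ⟨165 * K ^ 2, by positivity, ?_⟩
  filter_upwards [hsol, hbd] with ε hS h r hr θ
  refine (hS.abs_laplacian_le hm (κ := K * ε) (fun x hx => (h x hx).2) hr θ).trans_eq ?_
  ring

/-- Dominated convergence is used twice, over the sphere and then over the radius, with majorant
L/r² furnished by the uniform bound Δψ = O(ε²r⁻⁴). -/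
theorem HasExpansion.tendsto_source (hm : 0 < m)
    (hsol : ∀ᶠ ε in 𝓝[>] (0 : ℝ), IsSolution m (ψ ε) (A ε) (H ε))
    (hexp : HasExpansion m ψ A H ψ₁ ψ₂ B b) :
    Tendsto (fun ε => (∫ r in Set.Ioi (m / 2), alphaFn m r * (r ^ 2 * avg fun θ =>
        ∑ i, partialD i (partialD i (ψ ε)) (r • eR θ))) / ε ^ 2) (𝓝[>] 0)
      (𝓝 (-(1 / 8) * ∫ r in Set.Ioi (m / 2), energyDensity m B b r)) := by
  obtain ⟨L, hL, hlap⟩ := hexp.eventually_laplacian_le hm hsol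
  have havg : ∀ r, m / 2 ≤ r → Tendsto (fun ε => avg fun θ =>
      (∑ i, partialD i (partialD i (ψ ε)) (r • eR θ)) / ε ^ 2) (𝓝[>] 0)
      (𝓝 (avg fun θ => -(1 / 8) * ((∑ i, ∑ j, B (r • eR θ) i j ^ 2) / psi0 m r ^ 7
        - 2 / 3 * b (r • eR θ) ^ 2 * psi0 m r ^ 5))) := by
    intro r hr
    have hr0 : 0 < r := by linarith
    refine tendsto_avg_of_bound (M := L / r ^ 4) ?_ ?_ fun θ => ?_
    · filter_upwards [hsol] with ε hS
      exact (continuous_slice (F := fun r θ => ∑ i, partialD i (partialD i (ψ ε)) (r • eR θ))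
        (hS.smooth_psi.laplacian_continuousOn hm) hr).div_const _
    · filter_upwards [hlap, self_mem_nhdsWithin] with ε h hpos θ
      have hε0 : 0 < ε := hpos
      rw [abs_div, abs_of_pos (by positivity : 0 < ε ^ 2), div_le_iff₀ (by positivity)]
      exact (h r hr θ).trans_eq (by ring)
    · have hmem := smul_eR_mem hm hr θ
      have hψ := hexp.tendsto_psi hmem
      rw [norm_smul_eR hr0.le] at hψ
      have hp := (psi0_pos hm hr).ne'
      have h1 : Tendsto (fun ε => ∑ i, ∑ j, (A ε (r • eR θ) i j / ε) ^ 2) (𝓝[>] 0)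
          (𝓝 (∑ i, ∑ j, B (r • eR θ) i j ^ 2)) :=
        tendsto_finsetSum _ fun i _ => tendsto_finsetSum _ fun j _ =>
          (hexp.tendsto_A_div hm hmem i j).pow 2
      have h2 := ((h1.div (hψ.pow 7) (pow_ne_zero 7 hp)).const_mul (-(1 / 8))).add
        (((hexp.tendsto_H_div hm hmem).pow 2).const_mul (1 / 12) |>.mul (hψ.pow 5))
      refine (h2.congr' ?_).trans_eq (by congr 1; ring)
      filter_upwards [hsol] with ε hS
      rw [hS.laplacian_apply hm hr, Pi.div_apply]
      simp only [div_pow, ← Finset.sum_div]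
      ring
  have hmain : Tendsto (fun ε => ∫ r in Set.Ioi (m / 2), alphaFn m r * (r ^ 2 * avg fun θ =>
        (∑ i, partialD i (partialD i (ψ ε)) (r • eR θ)) / ε ^ 2)) (𝓝[>] 0)
      (𝓝 (∫ r in Set.Ioi (m / 2), alphaFn m r * (r ^ 2 * avg fun θ =>
        -(1 / 8) * ((∑ i, ∑ j, B (r • eR θ) i j ^ 2) / psi0 m r ^ 7
        - 2 / 3 * b (r • eR θ) ^ 2 * psi0 m r ^ 5)))) := by
    refine tendsto_integral_filter_of_dominated_convergence (fun r => L * (r ^ 2)⁻¹) ?_ ?_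
      ((integrableOn_inv_sq (by positivity)).const_mul L) ?_
    · filter_upwards [hsol] with ε hS
      have := (hS.integrableOn_source hm).aestronglyMeasurable.mul_const (1 / ε ^ 2)
      refine this.congr (Eventually.of_forall fun r => ?_)
      simp only [avg_div_const]
      ring
    · filter_upwards [hsol, hlap, self_mem_nhdsWithin] with ε hS h hpos
      have hε0 : 0 < ε := hpos
      refine (ae_restrict_mem measurableSet_Ioi).mono fun r hr => ?_
      have hr' : m / 2 ≤ r := le_of_lt hr
      have hr0 : 0 < r := by linarith
      have h1 : |avg fun θ => (∑ i, partialD i (partialD i (ψ ε)) (r • eR θ)) / ε ^ 2|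
          ≤ L / r ^ 4 := by
        refine abs_avg_le ((continuous_slice
          (F := fun r θ => ∑ i, partialD i (partialD i (ψ ε)) (r • eR θ))
          (hS.smooth_psi.laplacian_continuousOn hm) hr').div_const _) fun θ _ => ?_
        rw [abs_div, abs_of_pos (by positivity : 0 < ε ^ 2), div_le_iff₀ (by positivity)]
        exact (h r hr' θ).trans_eq (by ring)
      rw [norm_eq_abs, abs_mul, abs_mul, abs_of_nonneg (alphaFn_nonneg hm hr'),
        abs_of_pos (by positivity : 0 < r ^ 2)]
      calc alphaFn m r * (r ^ 2 * _) ≤ 1 * (r ^ 2 * (L / r ^ 4)) :=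
            mul_le_mul (alphaFn_le_one hm hr') (mul_le_mul_of_nonneg_left h1 (by positivity))
              (by positivity) zero_le_one
        _ = L * (r ^ 2)⁻¹ := by field_simp
    · refine (ae_restrict_mem measurableSet_Ioi).mono fun r hr => ?_
      exact ((havg r (le_of_lt hr)).const_mul _).const_mul _
  refine (hmain.congr fun ε => ?_).trans_eq ?_
  · rw [← integral_div]
    refine integral_congr_ae (Eventually.of_forall fun r => ?_)
    simp only [avg_div_const]
    ring
  · rw [← integral_const_mul]
    congr 1
    refine integral_congr_ae (Eventually.of_forall fun r => ?_)
    simp only [avg_const_mul, energyDensity]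
    ring

end Limits

/-! ### The first variation of the conformal factor on the horizon -/

section Horizon

/-- A value of w on the boundary above L/a could not be undone by the drift of w, which is at most
L/a in total. Then w would stay above a positive constant and u would contain the growing solution,
contrary to u → 0. -/
theorem le_div_of_mode_ode {u w w' : ℝ → ℝ} {a L : ℝ} {n : ℕ} (ha : 0 < a) (hL : 0 ≤ L)
    (hc : ContinuousOn w (Set.Ici a)) (dw : ∀ r, a < r → HasDerivAt w (w' r) r)
    (hw' : ∀ r, a < r → -(L / r ^ 2) ≤ w' r)
    (du : ∀ r, a < r → HasDerivAt (fun r => r ^ (n + 1) * u r) (r ^ (2 * n) * w r) r)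
    (hu : Tendsto u atTop (𝓝 0)) : w a ≤ L / a := by
  have hmono : MonotoneOn (fun r => w r - L / r) (Set.Ici a) := by
    refine monotoneOn_of_hasDerivWithinAt_nonneg (convex_Ici _)
      (f' := fun r => w' r - -(L / r ^ 2)) (hc.sub (continuousOn_const.div continuousOn_id
        fun r hr => (ha.trans_le hr).ne')) (fun r hr => ?_) fun r hr => ?_
    · rw [interior_Ici] at hr ⊢
      exact ((dw r hr).sub (hasDerivAt_div_id L (ha.trans hr).ne')).hasDerivWithinAt
    · rw [interior_Ici] at hr
      linarith [hw' r hr]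
  have h := nonpos_of_le_of_tendsto_zero (c := w a - L / a) ha du hu fun r hr => by
    have h1 := hmono Set.self_mem_Ici (le_of_lt hr : a ≤ r) (le_of_lt hr)
    have h2 : 0 ≤ L / r := div_nonneg hL (ha.trans hr).le
    simp only at h1
    linarith
  linarith

theorem abs_le_div_of_mode_ode {u w w' : ℝ → ℝ} {a L : ℝ} {n : ℕ} (ha : 0 < a) (hL : 0 ≤ L)
    (hc : ContinuousOn w (Set.Ici a)) (dw : ∀ r, a < r → HasDerivAt w (w' r) r)
    (hw' : ∀ r, a < r → |w' r| ≤ L / r ^ 2)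
    (du : ∀ r, a < r → HasDerivAt (fun r => r ^ (n + 1) * u r) (r ^ (2 * n) * w r) r)
    (hu : Tendsto u atTop (𝓝 0)) : |w a| ≤ L / a := by
  rw [abs_le]
  constructor
  · have h := le_div_of_mode_ode (n := n) (u := fun r => -u r) (w := fun r => -w r) ha hL hc.neg
      (fun r hr => (dw r hr).neg) (fun r hr => neg_le_neg (abs_le.mp (hw' r hr)).2)
      (fun r hr => ?_) (by simpa using hu.neg)
    · linarith
    · refine ((du r hr).neg.congr_deriv (by ring)).congr_of_eventuallyEq
        (Eventually.of_forall fun s => ?_)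
      simp
  · exact le_div_of_mode_ode ha hL hc dw (fun r hr => (abs_le.mp (hw' r hr)).1) du hu

theorem avg_legendre (n : ℕ) :
    avg (fun θ => (legendrePoly n).eval (cos θ)) = if n = 0 then 1 else 0 := by
  have h0 : legendrePoly 0 = 1 := by simp [legendrePoly]
  have h := avg_legendre_mul n 0
  simp only [h0, Polynomial.eval_one, mul_one] at h
  rw [h]
  split_ifs with h1
  · simp [h1]
  · rfl

/-- Subtracting the asymptotic value 1 from ψ affects only the mode n = 0, in which the eigenvalue
vanishes. -/
theorem capN_mul_avg_legendre (n : ℕ) :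
    capN n * avg (fun θ => (legendrePoly n).eval (cos θ)) = 0 := by
  rw [avg_legendre]
  split_ifs with h
  · simp [h, capN_zero]
  · simp

theorem exists_legendre_bound (n : ℕ) :
    ∃ c, 0 < c ∧ ∀ θ, |(legendrePoly n).eval (cos θ)| ≤ c := by
  obtain ⟨c, hc⟩ := (isCompact_Icc (a := -1) (b := (1 : ℝ))).exists_bound_of_continuousOn
    (legendrePoly n).continuous.continuousOn
  refine ⟨|c| + 1, by positivity, fun θ => ?_⟩
  have := hc (cos θ) ⟨neg_one_le_cos θ, cos_le_one θ⟩
  rw [norm_eq_abs] at this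
  linarith [le_abs_self c]

variable {m : ℝ}

/-- Integration by parts in the polar angle. -/
theorem SmoothOnSurface.avg_polComp (hm : 0 < m) {f : E3 → ℝ} (hf : SmoothOnSurface m f) (n : ℕ)
    {r : ℝ} (hr : m / 2 ≤ r) :
    r * avg (fun θ => -(sin θ * (legendrePoly n).derivative.eval (cos θ))
      * polComp (fun i => PenrosePerturbation.partialD i f) r θ)
      = 2 * capN n * avg fun θ => (legendrePoly n).eval (cos θ) * f (r • eR θ) := by
  have cP := continuous_eval_cos
  have c0 := (hf.partialD 0).continuous_mer hm hr
  have c2 := (hf.partialD 2).continuous_mer hm hr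
  have du : ∀ θ : ℝ, HasDerivAt (fun θ => -(sin θ ^ 2 * (legendrePoly n).derivative.eval (cos θ)))
      (-(2 * capN n * (legendrePoly n).eval (cos θ) * sin θ)) θ := by
    intro θ
    refine ((((hasDerivAt_sin θ).pow 2).mul
      (hasDerivAt_eval_cos (legendrePoly n).derivative θ)).neg).congr_deriv ?_
    have h := legendre_eval_ode n (cos θ)
    have h2 : sin θ ^ 2 = 1 - cos θ ^ 2 := sin_sq θ
    simp only [Pi.pow_apply]
    rw [← h, ← h2]
    push_cast
    ring
  have h := intervalIntegral.integral_mul_deriv_eq_deriv_mul (a := 0) (b := π)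
    (fun θ _ => du θ) (fun θ _ => hf.hasDerivAt_polar hm hr θ)
    (((((cP (legendrePoly n)).const_mul (2 * capN n)).mul continuous_sin).neg).intervalIntegrable
      _ _)
    ((continuous_const.mul ((continuous_cos.mul c0).sub
      (continuous_sin.mul c2))).intervalIntegrable _ _)
  simp only [sin_pi, sin_zero] at h
  rw [avg, avg, mul_left_comm, ← intervalIntegral.integral_const_mul r, mul_left_comm (2 * capN n),
    ← intervalIntegral.integral_const_mul (2 * capN n)]
  congr 1
  have e1 : ∀ θ, r * (-(sin θ * (legendrePoly n).derivative.eval (cos θ))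
      * polComp (fun i => PenrosePerturbation.partialD i f) r θ * sin θ)
      = -(sin θ ^ 2 * (legendrePoly n).derivative.eval (cos θ))
        * (r * (cos θ * PenrosePerturbation.partialD 0 f (r • eR θ)
          - sin θ * PenrosePerturbation.partialD 2 f (r • eR θ))) := by
    intro θ
    rw [polComp]
    ring
  rw [funext e1, h]
  simp only [ne_eq, OfNat.ofNat_ne_zero, not_false_eq_true, zero_pow, zero_mul, neg_zero, sub_zero,
    zero_sub, ← intervalIntegral.integral_neg]
  congr 1
  funext θ
  ring

variable {ψ : E3 → ℝ} {A : E3 → Tensor2} {H : E3 → ℝ}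

theorem IsSolution.tendsto_moment (hm : 0 < m) (hS : IsSolution m ψ A H) (n : ℕ) :
    Tendsto (fun r : ℝ => avg (fun θ => (legendrePoly n).eval (cos θ) * ψ (r • eR θ))
      - avg (fun θ => (legendrePoly n).eval (cos θ))) atTop (𝓝 0) := by
  have cP := continuous_eval_cos (legendrePoly n)
  obtain ⟨c, hc, hcθ⟩ := exists_legendre_bound n
  have h : Tendsto (fun r : ℝ => avg fun θ => (legendrePoly n).eval (cos θ) * (ψ (r • eR θ) - 1))
      atTop (𝓝 0) := by
    refine tendsto_avg_zero (F := fun r θ => (legendrePoly n).eval (cos θ) * (ψ (r • eR θ) - 1))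
      (a := m / 2) (fun r hr => cP.mul ((hS.smooth_psi.continuous_mer hm hr).sub
        continuous_const)) fun δ hδ => ?_
    obtain ⟨R, -, -, h⟩ := hS.eventually_psi (δ := δ / c) (by positivity)
    filter_upwards [eventually_gt_atTop R] with r hr θ
    rw [abs_mul]
    refine (mul_le_mul (hcθ θ) (h r hr θ) (abs_nonneg _) (by positivity)).trans_eq ?_
    field_simp
  refine h.congr' ?_
  filter_upwards [eventually_ge_atTop (m / 2)] with r hr
  have c1 : Continuous fun θ => (legendrePoly n).eval (cos θ) * ψ (r • eR θ) :=
    cP.mul (hS.smooth_psi.continuous_mer hm hr)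
  rw [← avg_sub c1 cP]
  congr 1
  funext θ
  ring

/-- On the horizon the moments of the conformal factor are almost those of a harmonic function. -/
theorem IsSolution.abs_horizon_moment_le (hm : 0 < m) (hS : IsSolution m ψ A H) {n : ℕ} {c L : ℝ}
    (hL : 0 ≤ L) (hc : ∀ θ, |(legendrePoly n).eval (cos θ)| ≤ c)
    (hlap : ∀ r, m / 2 ≤ r → ∀ θ, |∑ i, partialD i (partialD i ψ) (r • eR θ)| ≤ L / r ^ 4) :
    |(m / 2) ^ 2 * avg (fun θ => (legendrePoly n).eval (cos θ)
        * radComp (fun i => partialD i ψ) (m / 2) θ)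
      + (n + 1) * (m / 2 * (avg (fun θ => (legendrePoly n).eval (cos θ) * ψ ((m / 2) • eR θ))
        - avg (fun θ => (legendrePoly n).eval (cos θ))))| ≤ c * L / (m / 2) := by
  have ha : 0 < m / 2 := by positivity
  have hc0 : 0 ≤ c := (abs_nonneg _).trans (hc 0)
  have cP := continuous_eval_cos (legendrePoly n)
  have cP2 : ContinuousOn (fun p : ℝ × ℝ => (legendrePoly n).eval (cos p.2))
      (Set.Ici (m / 2) ×ˢ Set.univ) := (cP.comp continuous_snd).continuousOn
  have c1 := continuousOn_avg (F := fun r θ => (legendrePoly n).eval (cos θ)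
    * radComp (fun i => partialD i ψ) r θ) (cP2.mul (hS.smooth_psi.radComp_continuousOn hm))
  have c2 := continuousOn_avg (F := fun r θ => (legendrePoly n).eval (cos θ)
    * ψ (r • eR θ)) (cP2.mul (hS.smooth_psi.continuousOn_mer hm))
  -- r²u' + (n+1)ru annihilates the decaying harmonic mode r^(-n-1). Divided by r^(n+1) it is driven
  -- only by the Laplacian, and it measures the growing mode, which is excluded at infinity.
  set G : ℝ → ℝ := fun r => r ^ 2 * avg (fun θ => (legendrePoly n).eval (cos θ)
        * radComp (fun i => partialD i ψ) r θ)
      + (n + 1) * (r * (avg (fun θ => (legendrePoly n).eval (cos θ) * ψ (r • eR θ))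
        - avg (fun θ => (legendrePoly n).eval (cos θ)))) with hG
  have cG : ContinuousOn G (Set.Ici (m / 2)) :=
    ((continuousOn_id.pow 2).mul c1).add (continuousOn_const.mul
      (continuousOn_id.mul (c2.sub continuousOn_const)))
  have du : ∀ r, m / 2 < r → HasDerivAt (fun r => avg (fun θ => (legendrePoly n).eval (cos θ)
      * ψ (r • eR θ)) - avg (fun θ => (legendrePoly n).eval (cos θ)))
      (avg fun θ => (legendrePoly n).eval (cos θ) * radComp (fun i => partialD i ψ) r θ) r :=
    fun r hr => (hS.smooth_psi.hasDerivAt_avg_mul hm cP hr).sub_const _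
  have dG : ∀ r, m / 2 < r → HasDerivAt (fun r => G r / r ^ (n + 1)) (r ^ 2 * avg (fun θ =>
      (legendrePoly n).eval (cos θ) * ∑ i, partialD i (partialD i ψ) (r • eR θ)) / r ^ (n + 1))
      r := by
    intro r hr
    have hr0 : 0 < r := ha.trans hr
    have h1 := hS.smooth_psi.hasDerivAt_flux_gradient hm hS.axial_psi
      (fun θ => hasDerivAt_eval_cos (legendrePoly n) θ)
      (continuous_sin.mul (continuous_eval_cos _)).neg hr
    rw [hS.smooth_psi.avg_polComp hm n hr.le] at h1
    have h2 := (h1.add (((hasDerivAt_id r).mul (du r hr)).const_mul ((n : ℝ) + 1))).div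
      (hasDerivAt_pow (n + 1) r) (pow_pos hr0 _).ne'
    refine h2.congr_deriv ?_
    have h3 := capN_mul_avg_legendre n
    simp only [id_eq, Pi.add_apply, Pi.mul_apply, Nat.add_sub_cancel]
    generalize avg (fun θ => (legendrePoly n).eval (cos θ)
      * ∑ i, partialD i (partialD i ψ) (r • eR θ)) = D at *
    generalize avg (fun θ => (legendrePoly n).eval (cos θ)
      * radComp (fun i => partialD i ψ) r θ) = F at *
    generalize avg (fun θ => (legendrePoly n).eval (cos θ) * ψ (r • eR θ)) = U at *
    generalize avg (fun θ => (legendrePoly n).eval (cos θ)) = V at *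
    rw [capN] at *
    push_cast
    rw [pow_succ r n]
    field_simp
    linear_combination 2 * h3
  have h := abs_le_div_of_mode_ode (n := n) (w := fun r => G r / r ^ (n + 1))
    (L := c * L / (m / 2) ^ (n + 1)) ha (by positivity)
    (cG.div (continuousOn_id.pow (n + 1)) fun r hr => (pow_pos (ha.trans_le hr) _).ne') dG
    (fun r hr => ?_) (fun r hr => ?_) (hS.tendsto_moment hm n)
  · rw [abs_div, abs_of_pos (pow_pos ha _), div_div, mul_comm (_ ^ (n + 1)), ← div_div] at h
    exact (div_le_div_iff_of_pos_right (pow_pos ha _)).mp h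
  · have hr0 : 0 < r := ha.trans hr
    have cΔ := continuous_slice (F := fun r θ => ∑ i, partialD i (partialD i ψ) (r • eR θ))
      (hS.smooth_psi.laplacian_continuousOn hm) hr.le
    have h1 : |avg fun θ => (legendrePoly n).eval (cos θ)
        * ∑ i, partialD i (partialD i ψ) (r • eR θ)| ≤ c * (L / r ^ 4) :=
      abs_avg_le (cP.mul cΔ) fun θ _ => by
        rw [abs_mul]
        exact mul_le_mul (hc θ) (hlap r hr.le θ) (abs_nonneg _) hc0
    rw [abs_div, abs_mul, abs_of_pos (pow_pos hr0 2), abs_of_pos (pow_pos hr0 (n + 1))]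
    calc r ^ 2 * |_| / r ^ (n + 1) ≤ r ^ 2 * (c * (L / r ^ 4)) / (m / 2) ^ (n + 1) := by
          gcongr
      _ = c * L / (m / 2) ^ (n + 1) / r ^ 2 := by field_simp
  · have hr0 : 0 < r := ha.trans hr
    refine ((hasDerivAt_pow (n + 1) r).mul (du r hr)).congr_deriv ?_
    simp only [hG, Nat.add_sub_cancel]
    generalize avg (fun θ => (legendrePoly n).eval (cos θ)
      * radComp (fun i => partialD i ψ) r θ) = F
    generalize avg (fun θ => (legendrePoly n).eval (cos θ) * ψ (r • eR θ)) = U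
    generalize avg (fun θ => (legendrePoly n).eval (cos θ)) = V
    push_cast
    rw [two_mul, pow_add, pow_succ]
    field_simp
    ring

theorem IsSolution.radComp_horizon (hm : 0 < m) (hS : IsSolution m ψ A H) (θ : ℝ) :
    radComp (fun i => partialD i ψ) (m / 2) θ = -(ψ ((m / 2) • eR θ) / m)
      + 1 / 4 * frRR A (m / 2) θ / ψ ((m / 2) • eR θ) ^ 3
      - 1 / 6 * H ((m / 2) • eR θ) * ψ ((m / 2) • eR θ) ^ 3 := by
  have ha : 0 < m / 2 := by positivity
  have hmem := smul_eR_mem hm le_rfl θ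
  have hn := norm_smul_eR ha.le θ
  have h := hS.mots ((m / 2) • eR θ) hn
  have hsymm := hS.isAxialTT.symm_apply hmem 2 0
  have e1 : fderiv ℝ ψ ((m / 2) • eR θ) (‖(m / 2) • eR θ‖⁻¹ • (m / 2) • eR θ)
      = radComp (fun i => partialD i ψ) (m / 2) θ := by
    rw [hn, smul_smul, inv_mul_cancel₀ ha.ne', one_smul, fderiv_apply_eq_sum, Fin.sum_univ_three,
      eR_zero, eR_one, eR_two, radComp]
    ring
  have e2 : (fun i => ((m / 2) • eR θ) i / ‖(m / 2) • eR θ‖) = ![sin θ, 0, cos θ] := by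
    funext i
    rw [hn]
    fin_cases i
    · simp [eR_zero, hm.ne']
    · simp [eR_one]
    · simp [eR_two, hm.ne']
  have e3 : contract (A ((m / 2) • eR θ)) ![sin θ, 0, cos θ] ![sin θ, 0, cos θ]
      = frRR A (m / 2) θ := by
    simp only [contract, frRR, dotProduct, Matrix.mulVec, Fin.sum_univ_three, Matrix.cons_val]
    rw [hsymm]
    ring
  rw [e1, e2, e3] at h
  have e4 : 1 / 4 * (4 / m) * ψ ((m / 2) • eR θ) = ψ ((m / 2) • eR θ) / m := by ring
  rw [e4] at h
  linear_combination h

end Horizon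

/-! ### The second variation of the Penrose deficit -/

section Deficit
variable {m : ℝ} {ψ : ℝ → E3 → ℝ} {A : ℝ → E3 → Tensor2} {H : ℝ → E3 → ℝ}
  {ψ₁ ψ₂ : E3 → ℝ} {B : E3 → Tensor2} {b : E3 → ℝ} {C : ℝ}

/-- The difference quotient of the conformal factor on the horizon. -/
def horizonQuotient (m : ℝ) (ψ : ℝ → E3 → ℝ) (ε θ : ℝ) : ℝ := (ψ ε ((m / 2) • eR θ) - 2) / ε

theorem HasExpansion.tendsto_horizonQuotient (hm : 0 < m)
    (hexp : HasExpansion m ψ A H ψ₁ ψ₂ B b) (θ : ℝ) :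
    Tendsto (fun ε => horizonQuotient m ψ ε θ) (𝓝[>] 0) (𝓝 (ψ₁ ((m / 2) • eR θ))) := by
  have h := hexp.tendsto_psi_div (smul_eR_mem hm le_rfl θ)
  rwa [norm_smul_eR (by positivity), psi0_horizon hm] at h

theorem HasExpansion.eventually_horizonQuotient_le (hm : 0 < m)
    (hsol : ∀ᶠ ε in 𝓝[>] (0 : ℝ), IsSolution m (ψ ε) (A ε) (H ε))
    (hexp : HasExpansion m ψ A H ψ₁ ψ₂ B b) :
    ∃ K, 0 < K ∧ ∀ᶠ ε in 𝓝[>] (0 : ℝ), ∀ θ, |horizonQuotient m ψ ε θ| ≤ K := by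
  obtain ⟨K, hK, hbd⟩ := hexp.eventually_bound hm hsol
  refine ⟨K, hK, ?_⟩
  filter_upwards [hbd, self_mem_nhdsWithin] with ε h hpos θ
  have hε : 0 < ε := hpos
  have h1 := (h _ (smul_eR_mem hm le_rfl θ)).1
  rw [norm_smul_eR (by positivity), psi0_horizon hm] at h1
  rwa [horizonQuotient, abs_div, abs_of_pos hε, div_le_iff₀ hε]

theorem IsSolution.continuous_horizonQuotient (hm : 0 < m) {ε : ℝ}
    (hS : IsSolution m (ψ ε) (A ε) (H ε)) : Continuous (horizonQuotient m ψ ε) :=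
  ((hS.smooth_psi.continuous_mer hm le_rfl).sub continuous_const).div_const _

theorem HasExpansion.tendsto_avg_horizonQuotient_pow (hm : 0 < m)
    (hsol : ∀ᶠ ε in 𝓝[>] (0 : ℝ), IsSolution m (ψ ε) (A ε) (H ε))
    (hexp : HasExpansion m ψ A H ψ₁ ψ₂ B b) (k : ℕ) :
    Tendsto (fun ε => avg fun θ => horizonQuotient m ψ ε θ ^ k) (𝓝[>] 0)
      (𝓝 (avg fun θ => ψ₁ ((m / 2) • eR θ) ^ k)) := by
  obtain ⟨K, hK, hbd⟩ := hexp.eventually_horizonQuotient_le hm hsol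
  refine tendsto_avg_of_bound (M := K ^ k) ?_ ?_ fun θ =>
    (hexp.tendsto_horizonQuotient hm θ).pow k
  · filter_upwards [hsol] with ε hS using (hS.continuous_horizonQuotient hm).pow k
  · filter_upwards [hbd] with ε h θ
    rw [abs_pow]
    exact pow_le_pow_left₀ (abs_nonneg _) (h θ) k

/-- The boundary term whose moments vanish to leading order. -/
def horizonTerm (m : ℝ) (ψ : ℝ → E3 → ℝ) (A : ℝ → E3 → Tensor2) (H : ℝ → E3 → ℝ) (n : ℕ)
    (ε θ : ℝ) : ℝ :=
  (legendrePoly n).eval (cos θ) * (m / 2 * ((n : ℝ) + 1 / 2) * horizonQuotient m ψ ε θ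
    + (m / 2) ^ 2 * (1 / 4 * (frRR (A ε) (m / 2) θ / ε) / ψ ε ((m / 2) • eR θ) ^ 3
      - 1 / 6 * (H ε ((m / 2) • eR θ) / ε) * ψ ε ((m / 2) • eR θ) ^ 3))

theorem IsSolution.continuous_horizonTerm (hm : 0 < m) {ε : ℝ}
    (hS : IsSolution m (ψ ε) (A ε) (H ε)) (n : ℕ) : Continuous (horizonTerm m ψ A H n ε) := by
  have cψ := hS.smooth_psi.continuous_mer hm le_rfl
  have cR := continuous_slice (hS.isAxialTT.frRR_continuousOn hm) le_rfl
  have cH := hS.smooth_H.continuous_mer hm le_rfl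
  have hne : ∀ θ, ψ ε ((m / 2) • eR θ) ^ 3 ≠ 0 := fun θ =>
    pow_ne_zero 3 (hS.psi_pos _ (smul_eR_mem hm le_rfl θ)).ne'
  exact (continuous_eval_cos _).mul ((continuous_const.mul (hS.continuous_horizonQuotient hm)).add
    (continuous_const.mul (((continuous_const.mul (cR.div_const ε)).div (cψ.pow 3) hne).sub
      ((continuous_const.mul (cH.div_const ε)).mul (cψ.pow 3)))))

/-- The trapped-surface condition replaces the normal derivative; its linear part -ψ/m changes n + 1
into n + 1/2. -/
theorem IsSolution.avg_horizonTerm (hm : 0 < m) {ε : ℝ} (hε : ε ≠ 0)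
    (hS : IsSolution m (ψ ε) (A ε) (H ε)) (n : ℕ) :
    ε * avg (horizonTerm m ψ A H n ε)
      = (m / 2) ^ 2 * avg (fun θ => (legendrePoly n).eval (cos θ)
        * radComp (fun i => partialD i (ψ ε)) (m / 2) θ)
      + (n + 1) * (m / 2 * (avg (fun θ => (legendrePoly n).eval (cos θ) * ψ ε ((m / 2) • eR θ))
        - avg (fun θ => (legendrePoly n).eval (cos θ)))) := by
  have cP := continuous_eval_cos (legendrePoly n)
  have cψ := hS.smooth_psi.continuous_mer hm le_rfl
  have cρ := continuous_slice (hS.smooth_psi.radComp_continuousOn hm) le_rfl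
  have c1 : Continuous fun θ => (m / 2) ^ 2 * ((legendrePoly n).eval (cos θ)
      * radComp (fun i => partialD i (ψ ε)) (m / 2) θ) := continuous_const.mul (cP.mul cρ)
  have c2 : Continuous fun θ => (legendrePoly n).eval (cos θ) * ψ ε ((m / 2) • eR θ) := cP.mul cψ
  have c3 : Continuous fun θ => ((n : ℝ) + 1) * (m / 2)
      * ((legendrePoly n).eval (cos θ) * ψ ε ((m / 2) • eR θ)
        - (legendrePoly n).eval (cos θ)) := continuous_const.mul (c2.sub cP)
  have c4 : Continuous fun θ => m / 2 * n * (legendrePoly n).eval (cos θ) :=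
    continuous_const.mul cP
  have c13 : Continuous fun θ => (m / 2) ^ 2 * ((legendrePoly n).eval (cos θ)
      * radComp (fun i => partialD i (ψ ε)) (m / 2) θ)
      + ((n : ℝ) + 1) * (m / 2) * ((legendrePoly n).eval (cos θ) * ψ ε ((m / 2) • eR θ)
        - (legendrePoly n).eval (cos θ)) := c1.add c3
  have hpt : ∀ θ, ε * horizonTerm m ψ A H n ε θ = (m / 2) ^ 2 * ((legendrePoly n).eval (cos θ)
      * radComp (fun i => partialD i (ψ ε)) (m / 2) θ)
      + ((n : ℝ) + 1) * (m / 2) * ((legendrePoly n).eval (cos θ) * ψ ε ((m / 2) • eR θ)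
        - (legendrePoly n).eval (cos θ)) - m / 2 * n * (legendrePoly n).eval (cos θ) := by
    intro θ
    rw [hS.radComp_horizon hm, horizonTerm, horizonQuotient]
    have := (hS.psi_pos _ (smul_eR_mem hm le_rfl θ)).ne'
    field_simp
    ring
  -- The background value is subtracted with different weights on the two sides. The discrepancy is
  -- n times the mean of Pₙ, which is zero for every n.
  have hn : (n : ℝ) * avg (fun θ => (legendrePoly n).eval (cos θ)) = 0 := by
    rw [avg_legendre]
    split_ifs with h
    · simp [h]
    · simp
  rw [← avg_const_mul, funext hpt, avg_sub c13 c4, avg_add c1 c3, avg_const_mul,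
    avg_const_mul, avg_const_mul, avg_sub c2 cP]
  linear_combination -(m / 2) * hn

theorem HasExpansion.tendsto_avg_horizonTerm (hm : 0 < m)
    (hsol : ∀ᶠ ε in 𝓝[>] (0 : ℝ), IsSolution m (ψ ε) (A ε) (H ε))
    (hexp : HasExpansion m ψ A H ψ₁ ψ₂ B b) (n : ℕ) :
    Tendsto (fun ε => avg (horizonTerm m ψ A H n ε)) (𝓝[>] 0)
      (𝓝 (avg fun θ => (legendrePoly n).eval (cos θ)
        * (m / 2 * ((n : ℝ) + 1 / 2) * ψ₁ ((m / 2) • eR θ)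
          + (m / 2) ^ 2 / 32 * frT m B b (m / 2) θ))) := by
  obtain ⟨K, hK, hbd⟩ := hexp.eventually_bound hm hsol
  obtain ⟨M, hM, hq⟩ := hexp.eventually_horizonQuotient_le hm hsol
  obtain ⟨c, hc, hP⟩ := exists_legendre_bound n
  refine tendsto_avg_of_bound (M := c * (m / 2 * ((n : ℝ) + 1 / 2) * M
    + (m / 2) ^ 2 * (8 * (K / (m / 2) ^ 2) + 5 * (K / (m / 2) ^ 2)))) ?_ ?_ fun θ => ?_
  · filter_upwards [hsol] with ε hS using hS.continuous_horizonTerm hm n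
  · filter_upwards [hsol, hbd, hq, self_mem_nhdsWithin] with ε hS h1 h2 hpos θ
    have hε : 0 < ε := hpos
    obtain ⟨-, ⟨p1, p2⟩, bA, bH⟩ := h1 _ (smul_eR_mem hm le_rfl θ)
    rw [norm_smul_eR (by positivity)] at bA bH
    have bA' : ∀ i j, |A ε ((m / 2) • eR θ) i j / ε| ≤ K / (m / 2) ^ 2 := fun i j => by
      rw [abs_div, abs_of_pos hε, div_le_iff₀ hε]
      exact (bA i j).trans_eq (by ring)
    have bH' : |H ε ((m / 2) • eR θ) / ε| ≤ K / (m / 2) ^ 2 := by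
      rw [abs_div, abs_of_pos hε, div_le_iff₀ hε]
      exact bH.trans_eq (by ring)
    have bR : |frRR (A ε) (m / 2) θ / ε| ≤ 4 * (K / (m / 2) ^ 2) := by
      have e : frRR (A ε) (m / 2) θ / ε = sin θ ^ 2 * (A ε ((m / 2) • eR θ) 0 0 / ε)
          + 2 * sin θ * cos θ * (A ε ((m / 2) • eR θ) 0 2 / ε)
          + cos θ ^ 2 * (A ε ((m / 2) • eR θ) 2 2 / ε) := by
        rw [frRR]; ring
      rw [e]
      exact abs_lin_comb_le (abs_sin_sq_le θ) (abs_two_sin_cos_le θ) (abs_cos_sq_le θ)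
        (bA' 0 0) (bA' 0 2) (bA' 2 2)
    have hq' := h2 θ
    rw [horizonTerm, abs_mul]
    generalize ψ ε ((m / 2) • eR θ) = p at *
    have hp0 : 0 < p := by linarith
    have hp3 : (1 / 2 : ℝ) ^ 3 ≤ p ^ 3 := pow_le_pow_left₀ (by norm_num) p1 3
    have hp3' : p ^ 3 ≤ 3 ^ 3 := pow_le_pow_left₀ hp0.le p2 3
    refine mul_le_mul (hP θ) ?_ (abs_nonneg _) hc.le
    refine (abs_add_le _ _).trans (add_le_add ?_ ?_)
    · rw [abs_mul, abs_of_pos (by positivity : 0 < m / 2 * ((n : ℝ) + 1 / 2))]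
      exact mul_le_mul_of_nonneg_left hq' (by positivity)
    · rw [abs_mul, abs_of_pos (by positivity : 0 < (m / 2) ^ 2)]
      refine mul_le_mul_of_nonneg_left ((abs_sub _ _).trans (add_le_add ?_ ?_)) (by positivity)
      · rw [abs_div, abs_mul, abs_of_pos (by positivity : 0 < p ^ 3),
          abs_of_pos (by norm_num : (0 : ℝ) < 1 / 4), div_le_iff₀ (by positivity)]
        have : 0 ≤ K / (m / 2) ^ 2 := by positivity
        norm_num at hp3
        nlinarith
      · rw [abs_mul, abs_mul, abs_of_pos (by positivity : 0 < p ^ 3),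
          abs_of_pos (by norm_num : (0 : ℝ) < 1 / 6)]
        have : 0 ≤ K / (m / 2) ^ 2 := by positivity
        have a1 := mul_le_mul bH' hp3' (by positivity) this
        norm_num at a1
        linarith
  · have hmem := smul_eR_mem hm le_rfl θ
    have hψ := hexp.tendsto_psi hmem
    rw [norm_smul_eR (by positivity), psi0_horizon hm] at hψ
    have h := (((hexp.tendsto_horizonQuotient hm θ).const_mul (m / 2 * ((n : ℝ) + 1 / 2))).add
      (((((hexp.tendsto_frRR_div hm le_rfl θ).const_mul (1 / 4)).div (hψ.pow 3)
        (by norm_num)).sub (((hexp.tendsto_H_div hm hmem).const_mul (1 / 6)).mul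
          (hψ.pow 3))).const_mul ((m / 2) ^ 2))).const_mul ((legendrePoly n).eval (cos θ))
    refine h.trans_eq ?_
    congr 1
    rw [frT, psi0_horizon hm]
    ring

/-- The moments of the first variation of the conformal factor on the horizon. -/
theorem HasExpansion.legMoment_psi (hm : 0 < m)
    (hsol : ∀ᶠ ε in 𝓝[>] (0 : ℝ), IsSolution m (ψ ε) (A ε) (H ε))
    (hexp : HasExpansion m ψ A H ψ₁ ψ₂ B b) (hB : IsDecayingData m C B b) (n : ℕ) :
    legMoment (fun θ => ψ₁ ((m / 2) • eR θ)) n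
      = -dataX m B b n (m / 2) / (m * (2 * (n : ℝ) + 1)) := by
  obtain ⟨L, hL, hlap⟩ := hexp.eventually_laplacian_le hm hsol
  obtain ⟨c, hc, hP⟩ := exists_legendre_bound n
  -- The almost-harmonic estimate is O(ε²); after division by ε the limit is zero, and comparison
  -- with the pointwise limit of the boundary term gives the linear relation between the moments of
  -- ψ₁ and T.
  have hlim : Tendsto (fun ε => avg (horizonTerm m ψ A H n ε)) (𝓝[>] 0) (𝓝 0) := by
    have h0 : Tendsto (fun ε : ℝ => c * L / (m / 2) * ε) (𝓝[>] 0) (𝓝 0) := by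
      have := (tendsto_id (α := ℝ) (x := 𝓝 0)).const_mul (c * L / (m / 2))
      rw [mul_zero] at this
      exact this.mono_left nhdsWithin_le_nhds
    refine squeeze_zero_norm' ?_ h0
    filter_upwards [hsol, hlap, self_mem_nhdsWithin] with ε hS h hpos
    have hε : 0 < ε := hpos
    have h1 := hS.abs_horizon_moment_le hm (L := L * ε ^ 2) (by positivity) hP h
    rw [← hS.avg_horizonTerm hm hε.ne' n, abs_mul, abs_of_pos hε] at h1
    rw [norm_eq_abs]
    refine le_of_mul_le_mul_left (h1.trans_eq ?_) hε
    ring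
  have h := tendsto_nhds_unique (hexp.tendsto_avg_horizonTerm hm hsol n) hlim
  have cP := continuous_eval_cos (legendrePoly n)
  have c1 : Continuous fun θ => m / 2 * ((n : ℝ) + 1 / 2)
      * (ψ₁ ((m / 2) • eR θ) * (legendrePoly n).eval (cos θ)) :=
    continuous_const.mul ((hexp.smooth_psi₁.continuous_mer hm le_rfl).mul cP)
  have c2 : Continuous fun θ => (m / 2) ^ 2 / 32
      * (frT m B b (m / 2) θ * (legendrePoly n).eval (cos θ)) :=
    continuous_const.mul ((continuous_slice (hB.continuousOn_frT hm) le_rfl).mul cP)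
  have e : ∀ θ, (legendrePoly n).eval (cos θ)
        * (m / 2 * ((n : ℝ) + 1 / 2) * ψ₁ ((m / 2) • eR θ)
          + (m / 2) ^ 2 / 32 * frT m B b (m / 2) θ)
      = m / 2 * ((n : ℝ) + 1 / 2) * (ψ₁ ((m / 2) • eR θ) * (legendrePoly n).eval (cos θ))
        + (m / 2) ^ 2 / 32 * (frT m B b (m / 2) θ * (legendrePoly n).eval (cos θ)) :=
    fun θ => by ring
  rw [funext e, avg_add c1 c2, avg_const_mul, avg_const_mul] at h
  rw [dataX, modeX, alphaFn_horizon hm, psi0_horizon hm, hB.momT_eq hm n le_rfl]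
  change m / 2 * ((n : ℝ) + 1 / 2) * legMoment (fun θ => ψ₁ ((m / 2) • eR θ)) n
    + (m / 2) ^ 2 / 32 * legMoment (frT m B b (m / 2)) n = 0 at h
  have hn : (2 * (n : ℝ) + 1) ≠ 0 := by positivity
  field_simp
  linear_combination 128 * h

theorem IsSolution.avg_psi_horizon (hm : 0 < m) {ε : ℝ} (hε : ε ≠ 0)
    (hS : IsSolution m (ψ ε) (A ε) (H ε)) : avg (fun θ => ψ ε ((m / 2) • eR θ))
      = 2 + ε * avg (fun θ => horizonQuotient m ψ ε θ ^ 1) := by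
  have c1 : Continuous fun θ => ε * horizonQuotient m ψ ε θ ^ 1 :=
    continuous_const.mul ((hS.continuous_horizonQuotient hm).pow 1)
  rw [← avg_const_mul]
  nth_rewrite 2 [← avg_const 2]
  rw [← avg_add continuous_const c1]
  congr 1
  funext θ
  rw [horizonQuotient]
  field_simp
  ring

theorem IsSolution.avg_psi_pow_four_horizon (hm : 0 < m) {ε : ℝ} (hε : ε ≠ 0)
    (hS : IsSolution m (ψ ε) (A ε) (H ε)) : avg (fun θ => ψ ε ((m / 2) • eR θ) ^ 4)
      = 16 + 32 * ε * avg (fun θ => horizonQuotient m ψ ε θ ^ 1)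
        + 24 * ε ^ 2 * avg (fun θ => horizonQuotient m ψ ε θ ^ 2)
        + 8 * ε ^ 3 * avg (fun θ => horizonQuotient m ψ ε θ ^ 3)
        + ε ^ 4 * avg (fun θ => horizonQuotient m ψ ε θ ^ 4) := by
  have c : ∀ (s : ℝ) (k : ℕ), Continuous fun θ => s * horizonQuotient m ψ ε θ ^ k := fun s k =>
    continuous_const.mul ((hS.continuous_horizonQuotient hm).pow k)
  have c0 : Continuous fun _ : ℝ => (16 : ℝ) := continuous_const
  have h1 := avg_add c0 (c (32 * ε) 1)
  have h2 := avg_add (c0.add (c (32 * ε) 1)) (c (24 * ε ^ 2) 2)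
  have h3 := avg_add ((c0.add (c (32 * ε) 1)).add (c (24 * ε ^ 2) 2)) (c (8 * ε ^ 3) 3)
  have h4 := avg_add (((c0.add (c (32 * ε) 1)).add (c (24 * ε ^ 2) 2)).add (c (8 * ε ^ 3) 3))
    (c (ε ^ 4) 4)
  simp only [Pi.add_apply] at h2 h3 h4
  simp only [avg_const_mul, avg_const] at h1 h2 h3 h4
  have e : ∀ θ, ψ ε ((m / 2) • eR θ) ^ 4 = 16 + 32 * ε * horizonQuotient m ψ ε θ ^ 1
      + 24 * ε ^ 2 * horizonQuotient m ψ ε θ ^ 2 + 8 * ε ^ 3 * horizonQuotient m ψ ε θ ^ 3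
      + ε ^ 4 * horizonQuotient m ψ ε θ ^ 4 := fun θ => by
    rw [horizonQuotient]
    field_simp
    ring
  rw [funext e, h4]
  have f3 : avg ((((fun _ => 16) + fun θ => 32 * ε * horizonQuotient m ψ ε θ ^ 1)
    + fun θ => 24 * ε ^ 2 * horizonQuotient m ψ ε θ ^ 2)
    + fun θ => 8 * ε ^ 3 * horizonQuotient m ψ ε θ ^ 3) = _ := h3
  have f2 : avg (((fun _ => 16) + fun θ => 32 * ε * horizonQuotient m ψ ε θ ^ 1)
    + fun θ => 24 * ε ^ 2 * horizonQuotient m ψ ε θ ^ 2) = _ := h2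
  have f1 : avg ((fun _ => 16) + fun θ => 32 * ε * horizonQuotient m ψ ε θ ^ 1) = _ := h1
  rw [f3, f2, f1]

theorem IsSolution.sphereArea_pos {ψ : E3 → ℝ} {A : E3 → Tensor2} {H : E3 → ℝ} (hm : 0 < m)
    (hS : IsSolution m ψ A H) : 0 < sphereArea (physMetric ψ) (m / 2) := by
  have cψ := hS.smooth_psi.continuous_mer hm le_rfl
  have hpos : ∀ θ, 0 < ψ ((m / 2) • eR θ) := fun θ => hS.psi_pos _ (smul_eR_mem hm le_rfl θ)
  rw [hS.sphereArea_eq hm le_rfl]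
  have h : 0 < avg fun θ => ψ ((m / 2) • eR θ) ^ 4 := by
    refine lt_of_le_of_ne (avg_nonneg (cψ.pow 4) fun θ _ => by have := hpos θ; positivity)
      fun h0 => ?_
    have h1 : avg (fun θ => (ψ ((m / 2) • eR θ) ^ 2) ^ 2) = 0 := by
      rw [h0]
      congr 1
      funext θ
      ring
    have h2 := eq_zero_of_avg_sq_eq_zero (cψ.pow 2) h1 0 ⟨le_rfl, pi_pos.le⟩
    have := hpos 0
    simp only [Pi.pow_apply] at h2
    exact absurd h2 (by positivity)
  positivity

/-- The Penrose deficit to second order. -/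
theorem HasExpansion.deficit_isLittleO (hm : 0 < m)
    (hsol : ∀ᶠ ε in 𝓝[>] (0 : ℝ), IsSolution m (ψ ε) (A ε) (H ε))
    (hexp : HasExpansion m ψ A H ψ₁ ψ₂ B b) (hB : IsDecayingData m C B b) {P : ℝ → ℝ} {P₁ : ℝ}
    (hP : ∀ᶠ ε in 𝓝[>] (0 : ℝ), Tendsto (axisFlux (A ε) (H ε)) atTop (𝓝 (P ε)))
    (hP₁ : Tendsto (axisFlux B b) atTop (𝓝 P₁)) :
    (fun ε : ℝ => ((m * (avg (fun θ => ψ ε ((m / 2) • eR θ)) - 1)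
        - 2 * ∫ r in Set.Ioi (m / 2), alphaFn m r * (r ^ 2 * avg fun θ =>
          ∑ i, partialD i (partialD i (ψ ε)) (r • eR θ))) ^ 2
        - ∑ i, (![0, 0, P ε / 2] : Fin 3 → ℝ) i ^ 2)
      - (sphereArea (physMetric (ψ ε)) (m / 2) / (16 * π)
        + 4 * π / sphereArea (physMetric (ψ ε)) (m / 2)
          * (1 / 2 * ((m / 2) ^ 3 * avg fun θ => sin θ * frRP (A ε) (m / 2) θ)) ^ 2)
      - secondVariation m (P₁ / 2) (1 / 2 * ((m / 2) ^ 3 * avg fun θ => sin θ * frRP B (m / 2) θ))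
          (fun θ => ψ₁ ((m / 2) • eR θ)) B b * ε ^ 2) =o[𝓝[>] (0 : ℝ)] (fun ε : ℝ => ε ^ 2) := by
  have hid : Tendsto (fun ε : ℝ => ε) (𝓝[>] 0) (𝓝 0) := tendsto_id.mono_left nhdsWithin_le_nhds
  have hI := hexp.tendsto_source hm hsol
  have hJ := hexp.tendsto_angularMomentum hm hsol
  have hPd := hexp.tendsto_momentum hm hsol hB.toIsAxialTT hP hP₁
  have hF := fun k => hexp.tendsto_avg_horizonQuotient_pow hm hsol k
  set I : ℝ → ℝ := fun ε => ∫ r in Set.Ioi (m / 2), alphaFn m r * (r ^ 2 * avg fun θ =>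
    ∑ i, partialD i (partialD i (ψ ε)) (r • eR θ))
  set J : ℝ → ℝ := fun ε => 1 / 2 * ((m / 2) ^ 3 * avg fun θ => sin θ * frRP (A ε) (m / 2) θ)
  set J₁ : ℝ := 1 / 2 * ((m / 2) ^ 3 * avg fun θ => sin θ * frRP B (m / 2) θ)
  set F : ℕ → ℝ → ℝ := fun k ε => avg fun θ => horizonQuotient m ψ ε θ ^ k
  set f : ℕ → ℝ := fun k => avg fun θ => ψ₁ ((m / 2) • eR θ) ^ k
  set a : ℝ → ℝ := fun ε => 16 + 32 * ε * F 1 ε + 24 * ε ^ 2 * F 2 ε + 8 * ε ^ 3 * F 3 ε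
    + ε ^ 4 * F 4 ε
  have ha : Tendsto a (𝓝[>] 0) (𝓝 16) := by
    have h := (((((hid.const_mul 32).mul (hF 1)).const_add 16).add
      (((hid.pow 2).const_mul 24).mul (hF 2))).add (((hid.pow 3).const_mul 8).mul (hF 3))).add
      ((hid.pow 4).mul (hF 4))
    refine h.trans_eq (by congr 1; ring)
  -- This function equals the deficit divided by ε² for every small ε > 0. The mean F₁ is never
  -- expanded: its linear contribution 2m²εF₁ occurs in both E² and |S_h|/16π and cancels, so ψ₂
  -- does not enter.
  have hlim : Tendsto (fun ε => m ^ 2 * (F 1 ε ^ 2 - 3 / 2 * F 2 ε) - 4 * m * (I ε / ε ^ 2)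
      - (P ε / ε / 2) ^ 2 - (J ε / ε) ^ 2 * (4 / (m ^ 2 * a ε))
      + ε * (-(4 * m * (F 1 ε * (I ε / ε ^ 2))) + 4 * ε * (I ε / ε ^ 2) ^ 2
        - m ^ 2 * (1 / 2 * F 3 ε + ε * F 4 ε / 16))) (𝓝[>] 0)
      (𝓝 (secondVariation m (P₁ / 2) J₁ (fun θ => ψ₁ ((m / 2) • eR θ)) B b)) := by
    have h := (((((((hF 1).pow 2).sub ((hF 2).const_mul (3 / 2))).const_mul (m ^ 2)).sub
      (hI.const_mul (4 * m))).sub ((hPd.div_const 2).pow 2)).sub ((hJ.pow 2).mul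
        ((tendsto_const_nhds (x := (4 : ℝ))).div (ha.const_mul (m ^ 2)) (by positivity)))).add
      (hid.mul (((((hF 1).mul hI).const_mul (4 * m)).neg.add
        ((hid.const_mul 4).mul (hI.pow 2))).sub ((((hF 3).const_mul (1 / 2)).add
          ((hid.mul (hF 4)).div_const 16)).const_mul (m ^ 2))))
    refine h.trans_eq ?_
    congr 1
    have e : avg (fun θ => ψ₁ ((m / 2) • eR θ) ^ 1) = avg fun θ => ψ₁ ((m / 2) • eR θ) := by
      simp only [pow_one]
    rw [secondVariation, e]
    field_simp
    ring
  rw [isLittleO_iff_tendsto' (by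
    filter_upwards [self_mem_nhdsWithin] with ε hε h0
    have hε0 : (0 : ℝ) < ε := hε
    exact absurd h0 (by positivity))]
  have h0 := hlim.sub_const (secondVariation m (P₁ / 2) J₁ (fun θ => ψ₁ ((m / 2) • eR θ)) B b)
  rw [sub_self] at h0
  refine h0.congr' ?_
  filter_upwards [hsol, self_mem_nhdsWithin] with ε hS hε
  have hε0 : 0 < ε := hε
  have harea : sphereArea (physMetric (ψ ε)) (m / 2) = π * m ^ 2 * a ε := by
    rw [hS.sphereArea_eq hm le_rfl, hS.avg_psi_pow_four_horizon hm hε0.ne']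
    ring
  have ha0 : a ε ≠ 0 := by
    have h := hS.sphereArea_pos hm
    rw [harea] at h
    intro h1
    rw [h1, mul_zero] at h
    exact lt_irrefl _ h
  have hae : a ε = 16 + 32 * ε * F 1 ε + 24 * ε ^ 2 * F 2 ε + 8 * ε ^ 3 * F 3 ε
    + ε ^ 4 * F 4 ε := rfl
  have hsph : sphereArea (physMetric (ψ ε)) (m / 2) / (16 * π) = m ^ 2 / 16 * a ε := by
    rw [harea]
    field_simp
  have hJa : 4 * π / sphereArea (physMetric (ψ ε)) (m / 2) * J ε ^ 2
      = J ε ^ 2 * (4 / (m ^ 2 * a ε)) := by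
    rw [harea]
    field_simp
  rw [hsph, hJa, hS.avg_psi_horizon hm hε0.ne']
  change _ = ((m * (2 + ε * F 1 ε - 1) - 2 * I ε) ^ 2
    - ∑ i, (![0, 0, P ε / 2] : Fin 3 → ℝ) i ^ 2 - _ - _) / _
  simp only [Fin.sum_univ_three, Matrix.cons_val]
  rw [div_pow (J ε)]
  generalize 4 / (m ^ 2 * a ε) = k
  rw [hae]
  field_simp
  ring

end Deficit

end PenrosePerturbation

end

/-! ### Assembly of the theorem. -/

open PenrosePerturbation

theorem mainTheorem1 (m : ℝ) (hm : 0 < m)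
    (ψ : ℝ → E3 → ℝ) (A : ℝ → E3 → Tensor2) (H : ℝ → E3 → ℝ)
    (ψ₁ ψ₂ : E3 → ℝ) (B : E3 → Tensor2) (b : E3 → ℝ)
    (hsol : ∀ᶠ ε in 𝓝[>] (0 : ℝ), IsSolution m (ψ ε) (A ε) (H ε))
    (hexp : HasExpansion m ψ A H ψ₁ ψ₂ B b) :
    ∃ (E J : ℝ → ℝ) (p : ℝ → Fin 3 → ℝ),
      (∀ᶠ ε in 𝓝[>] (0 : ℝ),
        IsADMEnergy (physMetric (ψ ε)) (E ε) ∧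
        IsADMMomentum (ψ ε) (A ε) (H ε) (p ε) ∧
        IsAngularMomentum (ψ ε) (A ε) (H ε) (J ε) ∧
        0 < sphereArea (physMetric (ψ ε)) (m / 2)) ∧
      ∃ D : ℝ,
        ((fun ε : ℝ =>
            (E ε ^ 2 - ∑ i, p ε i ^ 2)
              - (sphereArea (physMetric (ψ ε)) (m / 2) / (16 * π)
                + 4 * π / sphereArea (physMetric (ψ ε)) (m / 2) * J ε ^ 2)
              - D * ε ^ 2) =o[𝓝[>] (0 : ℝ)] (fun ε : ℝ => ε ^ 2)) ∧
        Summable (fun n : ℕ => excessTerm m B b (n + 2)) ∧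
        ∑' n : ℕ, excessTerm m B b (n + 2) ≤ D ∧
        (Generic m B b →
          0 < D ∧
          ∀ᶠ ε in 𝓝[>] (0 : ℝ),
            sphereArea (physMetric (ψ ε)) (m / 2) / (16 * π)
                + 4 * π / sphereArea (physMetric (ψ ε)) (m / 2) * J ε ^ 2
              ≤ E ε ^ 2 - ∑ i, p ε i ^ 2) := by
  obtain ⟨C, hB⟩ := hexp.exists_isDecayingData hm hsol
  obtain ⟨D₀, -, hD₀⟩ := hexp.exists_bound hm hsol
  obtain ⟨P₁, hP₁⟩ := hB.exists_tendsto_axisFlux hm ⟨D₀, fun x hx => (hD₀ x hx).2.2 2⟩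
  -- For ε at which the data are not a solution this is a junk value, which is harmless because
  -- every claim is for small ε only.
  set P : ℝ → ℝ := fun ε => limUnder atTop (axisFlux (A ε) (H ε))
  have hP : ∀ᶠ ε in 𝓝[>] (0 : ℝ), Tendsto (axisFlux (A ε) (H ε)) atTop (𝓝 (P ε)) := by
    filter_upwards [hsol] with ε hS using tendsto_nhds_limUnder (hS.exists_tendsto_axisFlux hm)
  set J₁ : ℝ := 1 / 2 * ((m / 2) ^ 3 * avg fun θ => sin θ * frRP B (m / 2) θ)
  obtain ⟨hsum, hle⟩ := hB.tsum_modeExcess_le hm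
    (hexp.smooth_psi₁.continuous_mer hm le_rfl)
    (fun r hr => hB.toIsLinearData.rotation_flux_const hm hr) (hB.tendsto_mom hm hP₁)
    (hexp.legMoment_psi hm hsol hB)
  have hdeficit := hexp.deficit_isLittleO hm hsol hB hP hP₁
  have hexcess := hB.tsum_excessTerm_le hm hsum hle
  refine ⟨_, fun ε => 1 / 2 * ((m / 2) ^ 3 * avg fun θ => sin θ * frRP (A ε) (m / 2) θ),
    fun ε => ![0, 0, P ε / 2], ?_, _, hdeficit, hexcess.1, hexcess.2, fun hg => ?_⟩
  · filter_upwards [hsol, hP] with ε hS hPε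
    exact ⟨hS.isADMEnergy hm, hS.isADMMomentum hm hPε, hS.isAngularMomentum hm,
      hS.sphereArea_pos hm⟩
  · have hpos := hB.secondVariation_pos hm hsum hle hg
    refine ⟨hpos, ?_⟩
    -- With the error at most half the leading term, the deficit is at least Dε²/2.
    filter_upwards [hdeficit.bound (half_pos hpos)] with ε h
    rw [norm_eq_abs, norm_eq_abs, abs_of_nonneg (sq_nonneg ε)] at h
    have h1 := (abs_le.mp h).1
    have h2 : 0 ≤ secondVariation m (P₁ / 2) J₁ (fun θ => ψ₁ ((m / 2) • eR θ)) B b * ε ^ 2 := by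
      positivity
    linarith
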